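/- Let $d\ge 1$, $\kappa>0$, $\sigma=1/\kappa$. Consider the compressible Euler equations with physical vacuum in the variables $r\ge 0$ and $v\in\mathbb R^d$, $$ r_t+v\cdot\nabla r+\kappa r\,\nabla\cdot v=0,\qquad v_t+(v\cdot\nabla)v+\nabla r=0 \qquad\text{in } \Omega_t=\{x\in\mathbb R^d: r(t,x)>0\},\quad t\in[0,T]. $$ A solution on $[0,T]$ is a pair $(r,v)$ such that $r$, extended by zero outside $\Omega_t$, is continuous on $[0,T]\times\mathbb R^d$, the functions $r,v$ are locally Lipschitz in $\{(t,x): t\in[0,T],\ x\in\Omega_t\}$, and the equations hold almost everywhere there. Put $$ \|\nabla r\|_{\tilde C^{0,1/2}}=\sup_{x,y\in\Omega_t}\frac{|\nabla r(x)-\nabla r(y)|}{r(x)^{1/2}+r(y)^{1/2}+|x-y|^{1/2}},\qquad B(t)=\|\nabla r(t)\|_{\tilde C^{0,1/2}}+\|\nabla v(t)\|_{L^\infty(\Omega_t)}, $$ where the first supremum is over the points at which $r(t)$ is differentiable. For two solutions $(r_1,v_1)$, $(r_2,v_2)$ with gas domains $\Omega_1,\Omega_2$ (depending on $t$) define $$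 D_{\mathcal H}(t)=\int_{\Omega_1\cap\Omega_2}(r_1+r_2)^{\sigma-1}\Big((r_1-r_2)^2+\kappa\,(r_1+r_2)\,|v_1-v_2|^2\Big)\,dx\in[0,\infty]. $$ **Theorem.** For all $c>0$ and $L,M\ge 0$ there is $\varepsilon>0$, depending only on $d,\kappa,c,L,M$, and for every $T>0$ there is a finite constant $C$, depending only on $d,\kappa,c,L,M,T$, with the following property. Let $(r_1,v_1)$ and $(r_2,v_2)$ be two solutions on $[0,T]$ such that for $j=1,2$ and all $t\in[0,T]$: * $r_j(t)$ (extended by zero) is Lipschitz with constant $L$, $v_j(t)\in C^1(\Omega_{j})$, and $B_j(t)\le M$; * $r_j$ is uniformly nondegenerate near the boundary: $|\nabla r_j(t,x)|\ge c$ at every point $x$ with $0<r_j(t,x)<c$ at which $r_j(t)$ is differentiable; * $r_1$ and $r_2$ are close in the Lipschitz topology: $|r_1(t,x)-r_2(t,x)|\le\varepsilon$ for all $x\in\mathbb R^d$ (with the extensions by zero), and $|\nabla r_1(t,x)-\nabla r_2(t,x)|\le\varepsilon$ at every $x\in\Omega_1\cap\Omega_2$ at which both are differentiable. Then $$ \sup_{t\in[0,T]}D_{\mathcal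 H}(t)\le C\,D_{\mathcal H}(0). $$ -/

import Mathlib

open MeasureTheory Set
open scoped ENNReal NNReal Gradient

noncomputable section

/-- The physical space `ℝ^d` with its Euclidean structure. -/
abbrev Space (d : ℕ) : Type := EuclideanSpace ℝ (Fin d)

/-- The gas domain `Ω = {x : r x > 0}` of a state `r` (which is extended by zero to the vacuum). -/
def gasDomain {d : ℕ} (r : Space d → ℝ) : Set (Space d) := {x | 0 < r x}

/-- The space-time gas region `{(t, x) : t ∈ [0, T], x ∈ Ω_t}`. -/
def gasRegion {d : ℕ} (T : ℝ) (r : ℝ → Space d → ℝ) : Set (ℝ × Space d) :=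
  {p | p.1 ∈ Icc 0 T ∧ p.2 ∈ gasDomain (r p.1)}

/-- The divergence `∑ᵢ ∂ᵢ wᵢ` of a vector field. -/
def divergence {d : ℕ} (w : Space d → Space d) (x : Space d) : ℝ :=
  ∑ i, (fderiv ℝ w x (EuclideanSpace.single i 1)) i

/-- `(r, v)` solves the free boundary compressible Euler equations on `[0, T]`
`r_t + v · ∇r + κ r (∇ · v) = 0`, `v_t + (v · ∇) v + ∇r = 0` in `Ω_t = {r(t) > 0}`.
The function `r`, extended by zero to the vacuum, is continuous up to and across the free boundary;
`r` and `v` are locally Lipschitz in the space-time gas region, and the equations hold almost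
everywhere there (for locally Lipschitz functions this is the same as in the sense of
distributions). The values of `v` outside of the gas are irrelevant. -/
structure IsEulerSolution {d : ℕ} (κ T : ℝ) (r : ℝ → Space d → ℝ) (v : ℝ → Space d → Space d) :
    Prop where
  nonneg : ∀ t ∈ Icc 0 T, ∀ x, 0 ≤ r t x
  continuousOn : ContinuousOn (fun p : ℝ × Space d => r p.1 p.2) (Icc 0 T ×ˢ univ)
  locallyLipschitz_r : LocallyLipschitzOn (gasRegion T r) (fun p : ℝ × Space d => r p.1 p.2)
  locallyLipschitz_v : LocallyLipschitzOn (gasRegion T r) (fun p : ℝ × Space d => v p.1 p.2)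
  eq_r : ∀ᵐ p : ℝ × Space d ∂volume, p ∈ gasRegion T r →
    deriv (fun s => r s p.2) p.1 + inner ℝ (v p.1 p.2) (∇ (r p.1) p.2)
      + κ * r p.1 p.2 * divergence (v p.1) p.2 = 0
  eq_v : ∀ᵐ p : ℝ × Space d ∂volume, p ∈ gasRegion T r →
    deriv (fun s => v s p.2) p.1 + fderiv ℝ (v p.1) p.2 (v p.1 p.2) + ∇ (r p.1) p.2 = 0

/-- The points of the gas domain at which `r` has a classical gradient. When `r` is locally
Lipschitz these are almost all points of the gas domain. -/
def diffPoints {d : ℕ} (r : Space d → ℝ) : Set (Space d) :=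
  {x | x ∈ gasDomain r ∧ DifferentiableAt ℝ r x}

/-- The norm `‖∇r‖` in `C̃^{0,1/2}`, that is, the supremum of
`|∇r(x) - ∇r(y)| / (r(x)^{1/2} + r(y)^{1/2} + |x - y|^{1/2})` over `x, y ∈ Ω`. Nothing forces
`∇r` to be continuous inside of `Ω`, so `x` and `y` range over the points where it is defined;
for a locally Lipschitz `r` this is the essential supremum for the weak gradient. -/
def gradTildeHolderNorm {d : ℕ} (r : Space d → ℝ) : ℝ≥0∞ :=
  ⨆ x ∈ diffPoints r, ⨆ y ∈ diffPoints r,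
    ENNReal.ofReal (‖∇ r x - ∇ r y‖ / (√(r x) + √(r y) + √‖x - y‖))

/-- The control norm `B = ‖∇r‖_{C̃^{0,1/2}} + ‖∇v‖_{L^∞}` over the gas domain. -/
def controlNorm {d : ℕ} (r : Space d → ℝ) (v : Space d → Space d) : ℝ≥0∞ :=
  gradTildeHolderNorm r + ⨆ x ∈ gasDomain r, ENNReal.ofReal ‖fderiv ℝ v x‖

/-- `r` is nondegenerate near the free boundary `{r = 0}`, with constant `c`: it satisfies
`|∇r| ≥ c` in the part `{0 < r < c}` of the gas domain. -/
def NondegenerateNearBoundary {d : ℕ} (c : ℝ) (r : Space d → ℝ) : Prop :=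
  ∀ x ∈ diffPoints r, r x < c → c ≤ ‖∇ r x‖

/-- The states `r₁`, `r₂` (extended by zero to the vacuum) are `ε`-close in the Lipschitz topology:
`|r₁ - r₂| ≤ ε` everywhere, which makes the two domains close, and `|∇r₁ - ∇r₂| ≤ ε` in the
common domain. -/
def LipschitzClose {d : ℕ} (ε : ℝ) (r₁ r₂ : Space d → ℝ) : Prop :=
  (∀ x, |r₁ x - r₂ x| ≤ ε) ∧
    ∀ x ∈ diffPoints r₁ ∩ diffPoints r₂, ‖∇ r₁ x - ∇ r₂ x‖ ≤ ε

/-- The distance functional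
`∫_{Ω₁ ∩ Ω₂} (r₁ + r₂)^{σ-1} ((r₁ - r₂)² + κ (r₁ + r₂) |v₁ - v₂|²) dx` with `σ = 1 / κ`,
with values in `[0, ∞]`. -/
def distH {d : ℕ} (κ : ℝ) (r₁ : Space d → ℝ) (v₁ : Space d → Space d)
    (r₂ : Space d → ℝ) (v₂ : Space d → Space d) : ℝ≥0∞ :=
  ∫⁻ x in gasDomain r₁ ∩ gasDomain r₂,
    ENNReal.ofReal ((r₁ x + r₂ x) ^ (1 / κ - 1) *
      ((r₁ x - r₂ x) ^ 2 + κ * (r₁ x + r₂ x) * ‖v₁ x - v₂ x‖ ^ 2))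

/-- A solution on `[0, T]` in the regularity class of the difference estimate, with quantitative
bounds: `r(t)` is Lipschitz with constant `L`, `v(t)` is of class `C¹` in `Ω_t`, the control norm
`B(t)` is at most `M`, and `r(t)` is nondegenerate near the boundary with constant `c`. -/
structure IsRegularSolution {d : ℕ} (κ T c : ℝ) (L M : ℝ≥0)
    (r : ℝ → Space d → ℝ) (v : ℝ → Space d → Space d) : Prop where
  solution : IsEulerSolution κ T r v
  lipschitz : ∀ t ∈ Icc 0 T, LipschitzWith L (r t)
  contDiffOn : ∀ t ∈ Icc 0 T, ContDiffOn ℝ 1 (v t) (gasDomain (r t))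
  control : ∀ t ∈ Icc 0 T, controlNorm (r t) (v t) ≤ M
  nondegenerate : ∀ t ∈ Icc 0 T, NondegenerateNearBoundary c (r t)

end

/-! Write μ = r₁ + r₂, s = r₁ - r₂, w = v₁ - v₂, n = |w|, σ = 1/κ and z = s/μ. Up to constants the
distance density is μ^(σ-1) s² + μ^σ n². It cannot be differentiated along the flow as it stands: it
does not vanish on the boundary of the common domain, and its transport produces terms linear in α =
w·∇s and β = w·∇μ.

It is replaced by μ^(σ+1) g(z) + μ^σ b(z) n², transported by the mean velocity (v₁ + v₂)/2, with the
additional flux μ^(σ+1) f(z) w. The profiles f, g, b vanish for |z| > 1/2, so that after a cutoff to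
μ ≥ h nothing reaches the boundary. The two differential relations in `EnergyProfile` make all terms
linear in α and β cancel (`energy_identity`). What is left is quadratic and harmless, except for a
cubic term μ^(σ-1) n³ with one power of μ too few. All relations are solved by one generating
function (`exists_energyProfile`).

Two defects remain: the cubic term, and the lack of coercivity in the thin layers where μ is small
compared with |s| or with min(n, 1). Both are repaired by the Hardy inequality
`exists_hardy_constant`: the divergence theorem for ω μ^(β+1) η(m/μ) X, with X transversal to the
free boundary and η a logarithmic cutoff, bounds the integral of ω μ^β over {μ < m} by a small
multiple of the integral over the complement, provided that m is small and m and ω vary slowly. The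
field X comes from nondegeneracy and the Hölder type bound of ∇r₁ (`exists_transversal_field`); it
is also transversal for r₂ because the gradients are ε-close. The inequality is used in
`exists_gasPair_layer_sub`, `exists_gasPair_layer_velocity` and `exists_gasPair_cubic_le`, and gives
the coercivity `exists_gasPair_coercive`.

Since n need not be small, the energy above is cut off at n² ≤ 2 and complemented by a multiple of
r₁^σ n², cut off to n² ≥ 1/2 and r₁ ≥ δ and transported by v₁. No cancellation is needed there,
because n ≤ 2n² where its velocity cutoff is active.

Nothing is known about integrability, and the velocities and the domains may be unbounded. All
functionals therefore carry the weight Λ^(-N) with Λ = 1 + (|x|² + |v₁|² + |v₂|²)/A², whose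
logarithmic derivative along the flow is bounded uniformly in A. The energy estimate is proved with
cutoffs in Λ and μ, the cutoffs are removed, and a Gronwall argument (`le_of_forall_integral_bound`)
gives an estimate with a constant independent of A. Letting A → ∞ with Fatou's lemma removes the
weight. -/

open scoped Topology
set_option linter.unusedSectionVars false

/-! ### Calculus of locally Lipschitz functions. -/

section Generalities

variable {E F : Type*} [NormedAddCommGroup E] [NormedSpace ℝ E] [NormedAddCommGroup F]
  [NormedSpace ℝ F]

/-- A locally Lipschitz function on a closed set which vanishes far away is Lipschitz. -/
theorem exists_lipschitzOnWith_of_vanishing [ProperSpace E] {s : Set E} (hs : IsClosed s)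
    {f : E → F} (hf : LocallyLipschitzOn s f) {R : ℝ} (hR : ∀ x ∈ s, R < ‖x‖ → f x = 0) :
    ∃ K : ℝ≥0, LipschitzOnWith K f s := by
  have hcomp : IsCompact (s ∩ Metric.closedBall 0 (R + 1)) :=
    (isCompact_closedBall _ _).inter_left hs
  obtain ⟨K, hK⟩ := (hf.mono inter_subset_left).exists_lipschitzOnWith_of_compact hcomp
  obtain ⟨B, hB⟩ := hcomp.exists_bound_of_continuousOn hK.continuousOn
  -- The gap of length one between the radii R and R + 1 turns the bound B of the values into a
  -- bound of the slope: either both values vanish or the points are at distance at least 1.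
  have key : ∀ x ∈ s, ∀ y ∈ s, R + 1 < ‖y‖ → ‖f x - f y‖ ≤ (K + B.toNNReal : ℝ≥0) * ‖x - y‖ := by
    intro x hx y hy hy'
    rw [hR y hy (by linarith), sub_zero]
    by_cases hx' : R < ‖x‖
    · rw [hR x hx hx', norm_zero]; positivity
    · have h1 := hB x ⟨hx, by simpa using by linarith⟩
      have h2 : 1 ≤ ‖x - y‖ := by
        have := norm_sub_norm_le y x
        rw [norm_sub_rev] at this
        linarith
      have h3 : B ≤ B.toNNReal := Real.le_coe_toNNReal B
      push_cast
      nlinarith [K.coe_nonneg, B.toNNReal.coe_nonneg]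
  refine ⟨K + B.toNNReal, LipschitzOnWith.of_dist_le_mul fun x hx y hy => ?_⟩
  rw [dist_eq_norm, dist_eq_norm]
  by_cases hy' : R + 1 < ‖y‖
  · exact key x hx y hy hy'
  by_cases hx' : R + 1 < ‖x‖
  · rw [norm_sub_rev, norm_sub_rev x]
    exact key y hy x hx hx'
  have := hK.dist_le_mul x ⟨hx, by simpa using hx'⟩ y ⟨hy, by simpa using hy'⟩
  rw [dist_eq_norm, dist_eq_norm] at this
  push_cast
  nlinarith [norm_nonneg (x - y), B.toNNReal.coe_nonneg]

/-- Rademacher's theorem for locally Lipschitz functions on open sets. -/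
theorem ae_differentiableAt_of_locallyLipschitzOn [FiniteDimensional ℝ E] [FiniteDimensional ℝ F]
    [MeasurableSpace E] [BorelSpace E] {μ : Measure E} [μ.IsAddHaarMeasure] {U : Set E}
    (hU : IsOpen U) {f : E → F} (hf : LocallyLipschitzOn U f) :
    ∀ᵐ x ∂μ, x ∈ U → DifferentiableAt ℝ f x := by
  refine measure_null_of_locally_null _ fun x hx => ?_
  have hx : x ∈ U := by
    by_contra h
    exact hx fun h' => absurd h' h
  obtain ⟨K, t, ht, hK⟩ := hf hx
  rw [hU.nhdsWithin_eq hx] at ht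
  obtain ⟨o, hot, ho, hxo⟩ := mem_nhds_iff.1 ht
  refine ⟨{x | ¬ (x ∈ U → DifferentiableAt ℝ f x)} ∩ o,
    inter_mem_nhdsWithin _ (ho.mem_nhds hxo), ?_⟩
  refine measure_mono_null ?_ ((hK.mono hot).ae_differentiableWithinAt_of_mem (μ := μ))
  rintro y ⟨hy, hyo⟩ hy'
  exact hy fun _ => (hy' hyo).differentiableAt (ho.mem_nhds hyo)

/-- If the increments of `f` are controlled by those of a differentiable function, then so is the
derivative. -/
theorem norm_fderiv_le_of_norm_sub_le {G : Type*} [NormedAddCommGroup G] [NormedSpace ℝ G]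
    {f : E → F} {g : E → G} {x : E} {K : ℝ} (hK : 0 ≤ K)
    (hg : DifferentiableAt ℝ g x) (h : ∀ᶠ y in 𝓝 x, ‖f y - f x‖ ≤ K * ‖g y - g x‖) :
    ‖fderiv ℝ f x‖ ≤ K * ‖fderiv ℝ g x‖ := by
  -- Where f is not differentiable `fderiv` is zero by convention, so the bound holds without
  -- excluding the kinks of functions such as |s| and min(n, 1).
  by_cases hf : DifferentiableAt ℝ f x
  swap
  · rw [fderiv_zero_of_not_differentiableAt hf, norm_zero]
    positivity
  refine ContinuousLinearMap.opNorm_le_bound _ (by positivity) fun v => ?_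
  have h1 := (hf.hasFDerivAt.hasLineDerivAt v).tendsto_slope_zero.norm
  have h2 := ((hg.hasFDerivAt.hasLineDerivAt v).tendsto_slope_zero.norm).const_mul K
  have hc : Filter.Tendsto (fun t : ℝ => x + t • v) (𝓝[≠] 0) (𝓝 x) := by
    have : Continuous fun t : ℝ => x + t • v := by fun_prop
    simpa using (this.tendsto 0).mono_left nhdsWithin_le_nhds
  have h3 : ‖fderiv ℝ f x v‖ ≤ K * ‖fderiv ℝ g x v‖ := by
    refine le_of_tendsto_of_tendsto h1 h2 ?_
    filter_upwards [hc.eventually h] with t ht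
    rw [norm_smul, norm_smul]
    calc ‖t⁻¹‖ * ‖f (x + t • v) - f x‖ ≤ ‖t⁻¹‖ * (K * ‖g (x + t • v) - g x‖) := by gcongr
      _ = _ := by ring
  calc _ ≤ K * ‖fderiv ℝ g x v‖ := h3
    _ ≤ K * (‖fderiv ℝ g x‖ * ‖v‖) := by gcongr; exact ContinuousLinearMap.le_opNorm _ _
    _ = _ := by ring

/-- A composition of a locally Lipschitz function with a function of class `C¹` near its values. -/
theorem exists_lipschitzOnWith_comp {G : Type*} [PseudoEMetricSpace G] {s : Set G} {u : G → E}
    {p : G} {H : E → F} (hp : p ∈ s) (hu : ∃ K, ∃ t ∈ 𝓝[s] p, LipschitzOnWith K u t)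
    (hH : ContDiffAt ℝ 1 H (u p)) : ∃ K, ∃ t ∈ 𝓝[s] p, LipschitzOnWith K (fun q => H (u q)) t := by
  obtain ⟨K, t, ht, hK⟩ := hu
  obtain ⟨K', t', ht', hK'⟩ := hH.exists_lipschitzOnWith
  have hcont : ContinuousWithinAt u s p := by
    have := hK.continuousOn p (mem_of_mem_nhdsWithin hp ht)
    exact this.mono_of_mem_nhdsWithin ht
  exact ⟨K' * K, t ∩ u ⁻¹' t', Filter.inter_mem ht (hcont ht'),
    hK'.comp (hK.mono inter_subset_left) (fun x hx => hx.2)⟩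

theorem LocallyLipschitzOn.prodMk' {G : Type*} [PseudoEMetricSpace G] {s : Set G} {u : G → E}
    {v : G → F} (hu : LocallyLipschitzOn s u) (hv : LocallyLipschitzOn s v) :
    LocallyLipschitzOn s (fun p => (u p, v p)) := by
  intro p hp
  obtain ⟨K, t, ht, hK⟩ := hu hp
  obtain ⟨K', t', ht', hK'⟩ := hv hp
  exact ⟨max K K', t ∩ t', Filter.inter_mem ht ht',
    (hK.mono inter_subset_left).prodMk (hK'.mono inter_subset_right)⟩

theorem ContDiffOn.comp_locallyLipschitzOn {G : Type*} [PseudoEMetricSpace G] {s : Set G}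
    {u : G → E} {H : E → F} (hu : LocallyLipschitzOn s u)
    (hH : ∀ p ∈ s, ContDiffAt ℝ 1 H (u p)) : LocallyLipschitzOn s (fun q => H (u q)) :=
  fun p hp => exists_lipschitzOnWith_comp hp (hu hp) (hH p hp)

theorem LocallyLipschitzOn.comp_contDiffAt {G : Type*} [PseudoEMetricSpace G] {s : Set G}
    {u : G → ℝ} {H : ℝ → ℝ} (hu : LocallyLipschitzOn s u)
    (hH : ∀ p ∈ s, ContDiffAt ℝ 1 H (u p)) : LocallyLipschitzOn s (fun q => H (u q)) :=
  ContDiffOn.comp_locallyLipschitzOn hu hH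

theorem LocallyLipschitzOn.real_smul {G : Type*} [PseudoEMetricSpace G] {s : Set G}
    {u : G → ℝ} {v : G → F} (hu : LocallyLipschitzOn s u) (hv : LocallyLipschitzOn s v) :
    LocallyLipschitzOn s (fun q => u q • v q) :=
  ContDiffOn.comp_locallyLipschitzOn (u := fun q => (u q, v q))
    (H := fun p : ℝ × F => p.1 • p.2) (hu.prodMk' hv)
    fun _ _ => (contDiff_fst.smul contDiff_snd).contDiffAt

theorem LocallyLipschitzOn.real_mul {G : Type*} [PseudoEMetricSpace G] {s : Set G}
    {u v : G → ℝ} (hu : LocallyLipschitzOn s u) (hv : LocallyLipschitzOn s v) :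
    LocallyLipschitzOn s (fun q => u q * v q) :=
  hu.real_smul hv

theorem LocallyLipschitzOn.vec_add {G : Type*} [PseudoEMetricSpace G] {s : Set G}
    {u v : G → F} (hu : LocallyLipschitzOn s u) (hv : LocallyLipschitzOn s v) :
    LocallyLipschitzOn s (fun q => u q + v q) :=
  ContDiffOn.comp_locallyLipschitzOn (u := fun q => (u q, v q))
    (H := fun p : F × F => p.1 + p.2) (hu.prodMk' hv)
    fun _ _ => (contDiff_fst.add contDiff_snd).contDiffAt

theorem LocallyLipschitzOn.vec_sub {G : Type*} [PseudoEMetricSpace G] {s : Set G}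
    {u v : G → F} (hu : LocallyLipschitzOn s u) (hv : LocallyLipschitzOn s v) :
    LocallyLipschitzOn s (fun q => u q - v q) :=
  ContDiffOn.comp_locallyLipschitzOn (u := fun q => (u q, v q))
    (H := fun p : F × F => p.1 - p.2) (hu.prodMk' hv)
    fun _ _ => (contDiff_fst.sub contDiff_snd).contDiffAt

theorem LocallyLipschitzOn.real_div {G : Type*} [PseudoEMetricSpace G] {s : Set G}
    {u v : G → ℝ} (hu : LocallyLipschitzOn s u) (hv : LocallyLipschitzOn s v)
    (h0 : ∀ p ∈ s, v p ≠ 0) : LocallyLipschitzOn s (fun q => u q / v q) := by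
  simpa only [div_eq_mul_inv] using
    hu.real_mul (hv.comp_contDiffAt (H := fun y => y⁻¹) fun p hp => contDiffAt_inv ℝ (h0 p hp))

theorem LocallyLipschitzOn.norm_sq {G V : Type*} [NormedAddCommGroup V] [InnerProductSpace ℝ V]
    [PseudoEMetricSpace G] {s : Set G} {u : G → V} (hu : LocallyLipschitzOn s u) :
    LocallyLipschitzOn s (fun q => ‖u q‖ ^ 2) :=
  ContDiffOn.comp_locallyLipschitzOn (H := fun y : V => ‖y‖ ^ 2) hu
    fun _ _ => (contDiff_norm_sq ℝ).contDiffAt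

theorem locallyLipschitzOn_const {G : Type*} [PseudoEMetricSpace G] {s : Set G} (c : F) :
    LocallyLipschitzOn s (fun _ : G => c) :=
  (LipschitzWith.const c).locallyLipschitz.locallyLipschitzOn

end Generalities

/-! ### Product rules and the divergence theorem for compactly supported Lipschitz fields. -/

section Divergence

variable {d : ℕ}

theorem divergence_smul {a : Space d → ℝ} {b : Space d → Space d} {x : Space d}
    (ha : DifferentiableAt ℝ a x) (hb : DifferentiableAt ℝ b x) :
    divergence (fun y => a y • b y) x = fderiv ℝ a x (b x) + a x * divergence b x := by
  have h := (ha.hasFDerivAt.smul hb.hasFDerivAt).fderiv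
  have hsum : fderiv ℝ a x (b x) = ∑ i, (b x) i * fderiv ℝ a x (EuclideanSpace.single i 1) := by
    conv_lhs => rw [← (EuclideanSpace.basisFun (Fin d) ℝ).sum_repr (b x)]
    simp [map_sum]
  unfold divergence
  rw [show (fun y => a y • b y) = a • b from rfl, h, hsum, Finset.mul_sum, ← Finset.sum_add_distrib]
  refine Finset.sum_congr rfl fun i _ => ?_
  simp
  ring

theorem divergence_add {a b : Space d → Space d} {x : Space d}
    (ha : DifferentiableAt ℝ a x) (hb : DifferentiableAt ℝ b x) :
    divergence (fun y => a y + b y) x = divergence a x + divergence b x := by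
  unfold divergence
  rw [fderiv_fun_add ha hb, ← Finset.sum_add_distrib]
  simp

theorem divergence_const_smul {a : Space d → Space d} {x : Space d} (k : ℝ)
    (ha : DifferentiableAt ℝ a x) :
    divergence (fun y => k • a y) x = k * divergence a x := by
  unfold divergence
  rw [fderiv_fun_const_smul ha, Finset.mul_sum]
  simp

theorem abs_divergence_le (b : Space d → Space d) (x : Space d) :
    |divergence b x| ≤ d * ‖fderiv ℝ b x‖ := by
  unfold divergence
  refine (Finset.abs_sum_le_sum_abs _ _).trans ?_
  have : ∀ i ∈ Finset.univ, |(fderiv ℝ b x (EuclideanSpace.single i (1 : ℝ))) i| ≤ ‖fderiv ℝ b x‖ := by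
    intro i _
    refine (PiLp.norm_apply_le (fderiv ℝ b x (EuclideanSpace.single i (1 : ℝ))) i).trans ?_
    refine (ContinuousLinearMap.le_opNorm _ _).trans ?_
    simp
  simpa using Finset.sum_le_card_nsmul _ _ _ this

/-- The divergence theorem for compactly supported Lipschitz vector fields. -/
theorem integral_divergence_eq_zero {Y : Space d → Space d} {K : ℝ≥0} (hY : LipschitzWith K Y)
    (hc : HasCompactSupport Y) :
    Integrable (divergence Y) ∧ ∫ x, divergence Y x = 0 := by
  set e : Fin d → Space d := fun i => EuclideanSpace.single i 1
  have hYi : ∀ i, LipschitzWith K (fun x => Y x i) := fun i =>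
    LipschitzWith.of_dist_le_mul fun x y => by
      refine le_trans ?_ (hY.dist_le_mul x y)
      simpa [dist_eq_norm] using PiLp.norm_apply_le (Y x - Y y) i
  have hci : ∀ i, HasCompactSupport (fun x => Y x i) := fun i =>
    hc.comp_left (g := fun x : Space d => x i) (by simp)
  have hae : ∀ᵐ x : Space d, divergence Y x = ∑ i, lineDeriv ℝ (fun x => Y x i) x (e i) := by
    filter_upwards [hY.ae_differentiableAt (μ := volume)] with x hx
    refine Finset.sum_congr rfl fun i _ => ?_
    have h2 : HasFDerivAt (fun x => Y x i)
        ((EuclideanSpace.proj i : Space d →L[ℝ] ℝ).comp (fderiv ℝ Y x)) x :=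
      (EuclideanSpace.proj i : Space d →L[ℝ] ℝ).hasFDerivAt.comp x hx.hasFDerivAt
    rw [(h2.hasLineDerivAt (e i)).lineDeriv]
    simp [e]
  have hint : ∀ i, Integrable (fun x => lineDeriv ℝ (fun x => Y x i) x (e i)) := fun i =>
    (integrableOn_iff_integrable_of_support_subset fun x hx => by
      by_contra hx'
      have : (fun x => Y x i) =ᶠ[𝓝 x] fun _ => 0 := notMem_tsupport_iff_eventuallyEq.1 hx'
      refine hx ?_
      show lineDeriv ℝ (fun x => Y x i) x (e i) = 0
      rw [this.lineDeriv_eq]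
      simp [lineDeriv]).1
      (((hYi i).locallyIntegrable_lineDeriv (e i)).integrableOn_isCompact (hci i))
  have hzero : ∀ i, ∫ x, lineDeriv ℝ (fun x => Y x i) x (e i) = 0 := fun i => by
    -- The integral of a directional derivative is the limit of the integrals of the difference
    -- quotients, tested against the constant 1; each of these is zero by translation invariance.
    have h1 := (hYi i).integral_inv_smul_sub_mul_tendsto_integral_lineDeriv_mul' (μ := volume)
      (hci i) (g := fun _ => 1) continuous_const (e i)
    refine (tendsto_nhds_unique (by simpa using h1) (?_ : Filter.Tendsto _ _ (𝓝 (0 : ℝ))))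
    refine tendsto_const_nhds.congr fun t => ?_
    have hi : Integrable (fun x => Y x i) := (hYi i).continuous.integrable_of_hasCompactSupport (hci i)
    rw [integral_const_mul, integral_sub (hi.comp_add_right _) hi,
      integral_add_right_eq_self (fun x => Y x i), sub_self, mul_zero]
  have hsum : Integrable (fun x => ∑ i, lineDeriv ℝ (fun x => Y x i) x (e i)) :=
    integrable_finsetSum _ fun i _ => hint i
  refine ⟨hsum.congr (hae.mono fun x hx => hx.symm), ?_⟩
  rw [integral_congr_ae hae, integral_finsetSum _ fun i _ => hint i]
  simp [hzero]

end Divergence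

/-! ### A Lipschitz field transversal to the free boundary. -/

section Transversal

variable {d : ℕ}

/-- A Lipschitz function whose directional derivative is bounded below almost everywhere near a
segment grows along this segment. -/
theorem mul_le_sub_of_ae_fderiv_ge {f : Space d → ℝ} {K : ℝ≥0} (hf : LipschitzWith K f)
    {O : Set (Space d)} (hO : IsOpen O) {n : Space d} {a : ℝ}
    (h : ∀ᵐ y, y ∈ O → a ≤ fderiv ℝ f y n) {x : Space d} {τ : ℝ} (hτ : 0 ≤ τ)
    (hseg : ∀ u ∈ Icc 0 τ, x + u • n ∈ O) : a * τ ≤ f (x + τ • n) - f x := by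
  have hcomp : IsCompact ((fun u : ℝ => x + u • n) '' Icc 0 τ) :=
    isCompact_Icc.image (by fun_prop)
  obtain ⟨ρ₀, hρ₀, hthick⟩ := hcomp.exists_thickening_subset_open hO
    (by rintro _ ⟨u, hu, rfl⟩; exact hseg u hu)
  have hmem : ∀ u ∈ Icc 0 τ, ∀ y ∈ Metric.ball (0 : Space d) ρ₀, x + y + u • n ∈ O := by
    intro u hu y hy
    refine hthick (Metric.mem_thickening_iff.2 ⟨x + u • n, ⟨u, hu, rfl⟩, ?_⟩)
    rw [dist_eq_norm]
    simpa [add_sub_add_right_eq_sub] using hy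
  -- A bound valid almost everywhere says nothing on a single segment, which is a null set when d ≥
  -- 2. It is averaged over the translates of the segment by a ball of radius ρ; the average is
  -- differentiable in the parameter, and replacing it by the value at the centre costs 2Kρ.
  have key : ∀ ρ ∈ Ioo 0 ρ₀, a * τ ≤ f (x + τ • n) - f x + 2 * K * ρ := by
    intro ρ hρ
    set B := Metric.ball (0 : Space d) ρ
    have hBfin : volume B < ∞ := measure_ball_lt_top
    have hBpos : 0 < (volume B).toReal :=
      ENNReal.toReal_pos (Metric.measure_ball_pos _ _ hρ.1).ne' hBfin.ne
    have hB : ∀ u ∈ Icc 0 τ, ∀ y ∈ B, x + y + u • n ∈ O := fun u hu y hy =>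
      hmem u hu y (Metric.ball_subset_ball hρ.2.le hy)
    have : IsFiniteMeasure (volume.restrict B) := ⟨by simpa using hBfin⟩
    have hcont : ∀ u : ℝ, Continuous fun y => f (x + y + u • n) := fun u =>
      hf.continuous.comp (by fun_prop)
    have hint : ∀ u : ℝ, Integrable (fun y => f (x + y + u • n)) (volume.restrict B) := fun u =>
      ((hcont u).continuousOn.integrableOn_compact
        (isCompact_closedBall (0 : Space d) ρ)).mono_set Metric.ball_subset_closedBall
    have hdiff : ∀ u : ℝ, ∀ᵐ y : Space d, DifferentiableAt ℝ f (x + y + u • n) := fun u => by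
      have h1 := (measurePreserving_add_left volume (x + u • n)).quasiMeasurePreserving.ae
        (hf.ae_differentiableAt (μ := volume))
      filter_upwards [h1] with y hy
      have e : x + y + u • n = x + u • n + y := by abel
      rw [e]
      exact hy
    have hderiv : ∀ u : ℝ, Integrable (fun y => fderiv ℝ f (x + y + u • n) n) (volume.restrict B) ∧
        HasDerivAt (fun u : ℝ => ∫ y in B, f (x + y + u • n))
          (∫ y in B, fderiv ℝ f (x + y + u • n) n) u := by
      intro u
      refine hasDerivAt_integral_of_dominated_loc_of_lip (s := univ) (bound := fun _ => K * ‖n‖)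
        Filter.univ_mem (Filter.Eventually.of_forall fun u => (hcont u).aestronglyMeasurable)
        (hint u) ?_ ?_ (integrable_const _) ?_
      · refine Measurable.aestronglyMeasurable ?_
        exact (measurable_fderiv_apply_const ℝ f n).comp (by fun_prop)
      · refine Filter.Eventually.of_forall fun y => ?_
        refine (LipschitzWith.of_dist_le_mul fun p q => ?_).lipschitzOnWith
        refine (hf.dist_le_mul _ _).trans ?_
        rw [dist_add_left, dist_eq_norm, ← sub_smul, norm_smul, Real.coe_nnabs,
          abs_of_nonneg (by positivity), dist_eq_norm]
        exact le_of_eq (by ring)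
      · filter_upwards [ae_restrict_of_ae (hdiff u)] with y hy
        have := hy.hasFDerivAt.comp_hasDerivAt u
          (((hasDerivAt_id u).smul_const n).const_add (x + y))
        simpa [Function.comp_def] using this
    have hge : ∀ u ∈ Icc 0 τ, a * (volume B).toReal ≤ ∫ y in B, fderiv ℝ f (x + y + u • n) n := by
      intro u hu
      have h1 : ∫ y in B, a ≤ ∫ y in B, fderiv ℝ f (x + y + u • n) n := by
        refine integral_mono_ae (integrable_const _) (hderiv u).1 ?_
        have h2 := (measurePreserving_add_left volume (x + u • n)).quasiMeasurePreserving.ae h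
        filter_upwards [ae_restrict_of_ae h2, ae_restrict_mem Metric.isOpen_ball.measurableSet]
          with y hy hyB
        have e : x + y + u • n = x + u • n + y := by abel
        rw [e]
        exact hy (e ▸ hB u hu y hyB)
      simpa [Measure.real, mul_comm] using h1
    have hmono := (convex_Icc (0 : ℝ) τ).mul_sub_le_image_sub_of_le_deriv
      (f := fun u : ℝ => ∫ y in B, f (x + y + u • n)) (C := a * (volume B).toReal)
      (fun u _ => (hderiv u).2.continuousAt.continuousWithinAt)
      (fun u _ => (hderiv u).2.differentiableAt.differentiableWithinAt)
      (fun u hu => by rw [(hderiv u).2.deriv]; exact hge u (interior_subset hu))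
      0 ⟨le_rfl, hτ⟩ τ ⟨hτ, le_rfl⟩ hτ
    have hup : ∫ y in B, (f (x + y + τ • n) - f (x + y + (0 : ℝ) • n)) ≤
        ∫ y in B, (f (x + τ • n) - f x + 2 * K * ρ) := by
      refine setIntegral_mono_on ((hint τ).sub (hint 0)) (integrable_const _)
        Metric.isOpen_ball.measurableSet fun y hy => ?_
      have hy' : ‖y‖ ≤ ρ := by
        have := Metric.mem_ball.1 hy
        rw [dist_zero_right] at this
        exact this.le
      have h1 := (abs_le.1 ((hf.dist_le_mul (x + y + τ • n) (x + τ • n)))).2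
      have h2 := (abs_le.1 ((hf.dist_le_mul (x + y + (0 : ℝ) • n) x))).1
      have e1 : dist (x + y + τ • n) (x + τ • n) = ‖y‖ := by
        rw [dist_add_right, dist_eq_norm]; simp
      have e2 : dist (x + y + (0 : ℝ) • n) x = ‖y‖ := by rw [dist_eq_norm]; simp
      rw [e1] at h1
      rw [e2] at h2
      have : (K : ℝ) * ‖y‖ ≤ K * ρ := by gcongr
      linarith
    rw [integral_sub (hint τ) (hint 0)] at hup
    simp only [setIntegral_const, smul_eq_mul, Measure.real] at hup
    have : a * τ * (volume B).toReal ≤ (f (x + τ • n) - f x + 2 * K * ρ) * (volume B).toReal := by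
      rw [sub_zero] at hmono
      linarith
    exact le_of_mul_le_mul_right this hBpos
  have hlim : Filter.Tendsto (fun ρ : ℝ => f (x + τ • n) - f x + 2 * K * ρ) (𝓝[>] 0)
      (𝓝 (f (x + τ • n) - f x + 2 * K * 0)) :=
    ((by fun_prop : Continuous fun ρ : ℝ => f (x + τ • n) - f x + 2 * K * ρ).tendsto 0).mono_left
      nhdsWithin_le_nhds
  rw [mul_zero, add_zero] at hlim
  refine ge_of_tendsto hlim ?_
  filter_upwards [Ioo_mem_nhdsGT hρ₀] with ρ hρ using key ρ hρ

theorem norm_gradient_sub_le {r : Space d → ℝ} {M : ℝ≥0} (hM : gradTildeHolderNorm r ≤ M)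
    {x y : Space d} (hx : x ∈ diffPoints r) (hy : y ∈ diffPoints r) :
    ‖∇ r x - ∇ r y‖ ≤ M * (√(r x) + √(r y) + √‖x - y‖) := by
  have h1 : ENNReal.ofReal (‖∇ r x - ∇ r y‖ / (√(r x) + √(r y) + √‖x - y‖)) ≤ M :=
    le_trans (le_trans (le_iSup₂ (f := fun y (_ : y ∈ diffPoints r) =>
        ENNReal.ofReal (‖∇ r x - ∇ r y‖ / (√(r x) + √(r y) + √‖x - y‖))) y hy)
      (le_iSup₂ (f := fun x (_ : x ∈ diffPoints r) => ⨆ y ∈ diffPoints r,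
        ENNReal.ofReal (‖∇ r x - ∇ r y‖ / (√(r x) + √(r y) + √‖x - y‖))) x hx)) hM
  have hpos : 0 < √(r x) + √(r y) + √‖x - y‖ := by
    have : 0 < √(r x) := Real.sqrt_pos.2 hx.1
    positivity
  rw [← ENNReal.ofReal_coe_nnreal, ENNReal.ofReal_le_ofReal_iff M.coe_nonneg] at h1
  exact (div_le_iff₀ hpos).1 h1

theorem norm_gradient_eq (r : Space d → ℝ) (x : Space d) : ‖∇ r x‖ = ‖fderiv ℝ r x‖ := by
  simp [gradient]

theorem norm_gradient_le {r : Space d → ℝ} {L : ℝ≥0} (hL : LipschitzWith L r) (x : Space d) :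
    ‖∇ r x‖ ≤ L := by
  rw [norm_gradient_eq]
  exact norm_fderiv_le_of_lipschitz ℝ hL

/-- A vacuum point is a global minimum. As a consequence, averages of ∇r over the whole space only
see the gas, including points of the boundary where r is differentiable. -/
theorem gradient_eq_zero_of_nonneg {r : Space d → ℝ} (h0 : ∀ x, 0 ≤ r x) {x : Space d}
    (hx : x ∉ gasDomain r) : ∇ r x = 0 := by
  have hx0 : r x = 0 := le_antisymm (not_lt.1 hx) (h0 x)
  have : IsLocalMin r x := Filter.Eventually.of_forall fun y => by rw [hx0]; exact h0 y
  simp [gradient, this.fderiv_eq_zero]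

theorem isOpen_gasDomain {r : Space d → ℝ} (hr : Continuous r) : IsOpen (gasDomain r) :=
  isOpen_lt continuous_const hr

theorem measurable_gradient (r : Space d → ℝ) : Measurable (∇ r) :=
  (InnerProductSpace.toDual ℝ (Space d)).symm.continuous.measurable.comp (measurable_fderiv ℝ r)

/-- Near the free boundary `r` grows at a definite rate along the direction of its gradient. -/
theorem add_le_of_nondegenerate {c : ℝ} {L M : ℝ≥0} {ρ : ℝ} (hρ : 0 < ρ)
    (hρ' : M * (√ρ + √(ρ + L * ρ) + √ρ) ≤ c / 2) {r : Space d → ℝ}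
    (hL : LipschitzWith L r) (hM : gradTildeHolderNorm r ≤ M)
    {x : Space d} (hx : x ∈ diffPoints r) (hxρ : r x < ρ) (hcx : c ≤ ‖∇ r x‖)
    {τ : ℝ} (hτ : τ ∈ Ico 0 ρ) {u : Space d} (hu : u = ‖∇ r x‖⁻¹ • ∇ r x) (hx0 : ∇ r x ≠ 0) :
    r x + c / 2 * τ ≤ r (x + τ • u) := by
  have hc : 0 ≤ c := by
    have : 0 ≤ M * (√ρ + √(ρ + L * ρ) + √ρ) := by positivity
    linarith
  have hun : ‖u‖ = 1 := by
    rw [hu, norm_smul, norm_inv, norm_norm, inv_mul_cancel₀ (norm_ne_zero_iff.2 hx0)]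
  have hO : IsOpen (gasDomain r ∩ Metric.ball x ρ) :=
    (isOpen_gasDomain hL.continuous).inter Metric.isOpen_ball
  have hae : ∀ᵐ y, y ∈ gasDomain r ∩ Metric.ball x ρ → c / 2 ≤ fderiv ℝ r y u := by
    filter_upwards [hL.ae_differentiableAt (μ := volume)] with y hyd hy
    have h1 := norm_gradient_sub_le hM hx ⟨hy.1, hyd⟩
    have hxy : ‖x - y‖ ≤ ρ := by
      have := Metric.mem_ball'.1 hy.2
      rw [dist_eq_norm] at this
      exact this.le
    have hry : r y ≤ ρ + L * ρ := by
      have h2 := (abs_le.1 (hL.dist_le_mul x y)).1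
      rw [dist_eq_norm] at h2
      have : (L : ℝ) * ‖x - y‖ ≤ L * ρ := by gcongr
      linarith
    have h2 : ‖∇ r x - ∇ r y‖ ≤ c / 2 := by
      refine h1.trans (le_trans ?_ hρ')
      gcongr
    have h3 : inner ℝ (∇ r x) u = ‖∇ r x‖ := by
      rw [hu, real_inner_smul_right, real_inner_self_eq_norm_sq]
      field_simp [norm_ne_zero_iff.2 hx0]
    have h4 : inner ℝ (∇ r x - ∇ r y) u ≤ c / 2 := by
      refine (real_inner_le_norm _ _).trans ?_
      rw [hun, mul_one]
      exact h2
    rw [inner_sub_left, h3, inner_gradient_left] at h4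
    linarith
  have hgrow : ∀ t ∈ Ico 0 ρ, (∀ s ∈ Icc 0 t, 0 < r (x + s • u)) →
      r x + c / 2 * t ≤ r (x + t • u) := by
    intro t ht hpos
    have := mul_le_sub_of_ae_fderiv_ge hL hO hae ht.1 fun s hs => ⟨hpos s hs, by
      rw [Metric.mem_ball, dist_eq_norm, add_sub_cancel_left, norm_smul, hun, mul_one,
        Real.norm_of_nonneg hs.1]
      exact hs.2.trans_lt ht.2⟩
    linarith
  refine hgrow τ hτ ?_
  -- The ray might leave the gas before time τ. At its first zero s₀ the function r would still be
  -- at least r x by continuity from the left, since growth holds at all earlier times.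
  by_contra! hcon
  set Z := {s : ℝ | s ∈ Icc 0 τ ∧ r (x + s • u) ≤ 0}
  have hcontZ : Continuous fun s : ℝ => r (x + s • u) := hL.continuous.comp (by fun_prop)
  have hZc : IsCompact Z := by
    have : Z = Icc 0 τ ∩ {s | r (x + s • u) ≤ 0} := rfl
    rw [this]
    exact isCompact_Icc.inter_right (isClosed_le hcontZ continuous_const)
  obtain ⟨s₀, hs₀, hmin⟩ := hZc.exists_isLeast (by
    obtain ⟨s, hs, hs'⟩ := hcon
    exact ⟨s, hs, hs'⟩)
  have hbelow : ∀ t ∈ Ico 0 s₀, r x ≤ r (x + t • u) := by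
    intro t ht
    have := hgrow t ⟨ht.1, ht.2.trans_le (hs₀.1.2.trans hτ.2.le)⟩ fun s hs => by
      by_contra! h
      exact absurd (hmin ⟨⟨hs.1, hs.2.trans (ht.2.le.trans hs₀.1.2)⟩, h⟩)
        (not_le.2 (hs.2.trans_lt ht.2))
    nlinarith [ht.1]
  have hs₀pos : 0 < s₀ := by
    refine lt_of_le_of_ne hs₀.1.1 fun h => ?_
    have h1 := hs₀.2
    rw [← h, zero_smul, add_zero] at h1
    exact absurd hx.1 (not_lt.2 h1)
  have hlim : r x ≤ r (x + s₀ • u) := by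
    refine ge_of_tendsto ((hcontZ.tendsto s₀).mono_left nhdsWithin_le_nhds :
      Filter.Tendsto _ (𝓝[<] s₀) _) ?_
    filter_upwards [Ioo_mem_nhdsLT hs₀pos] with t ht using hbelow t ⟨ht.1.le, ht.2⟩
  exact absurd hx.1 (not_lt.2 (hlim.trans hs₀.2))

/-- A Lipschitz vector field which is uniformly transversal to the free boundary. -/
theorem exists_transversal_field (d : ℕ) {c : ℝ} (hc : 0 < c) (L M : ℝ≥0) :
    ∃ δ > 0, ∃ a > 0, ∃ B K : ℝ≥0, ∀ r : Space d → ℝ, (∀ x, 0 ≤ r x) → LipschitzWith L r →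
      gradTildeHolderNorm r ≤ M → NondegenerateNearBoundary c r →
      ∃ X : Space d → Space d, LipschitzWith K X ∧ (∀ x, ‖X x‖ ≤ B) ∧
        ∀ x ∈ diffPoints r, r x < δ → a ≤ inner ℝ (X x) (∇ r x) := by
  -- For r(x) < ρ and |x - y| ≤ ρ the Hölder type bound of ∇r is at most the left side of the last
  -- condition, so ∇r oscillates by at most c/2 at this scale, half of the nondegeneracy constant.
  obtain ⟨ρ, hρ, hρc, hρ'⟩ : ∃ ρ : ℝ, 0 < ρ ∧ ρ ≤ c ∧ M * (√ρ + √(ρ + L * ρ) + √ρ) ≤ c / 2 := by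
    have hcont : Continuous fun ρ : ℝ => (M : ℝ) * (√ρ + √(ρ + L * ρ) + √ρ) := by fun_prop
    have h0 : ∀ᶠ ρ in 𝓝 (0 : ℝ), (M : ℝ) * (√ρ + √(ρ + L * ρ) + √ρ) < c / 2 :=
      (hcont.tendsto 0).eventually (gt_mem_nhds (by simpa using hc))
    have h1 := (h0.filter_mono nhdsWithin_le_nhds : ∀ᶠ ρ in 𝓝[>] (0 : ℝ), _)
    obtain ⟨ρ, h2, h3⟩ := (h1.and (Ioo_mem_nhdsGT hc)).exists
    exact ⟨ρ, h3.1, h3.2.le, h2.le⟩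
  -- The field is the convolution of ∇r with a tent function of radius ρ. The Lipschitz constant
  -- falls on the kernel, so no continuity of ∇r is required.
  set k : Space d → ℝ := fun z => max (ρ - ‖z‖) 0
  have hk0 : ∀ z, 0 ≤ k z := fun z => le_max_right _ _
  have hkc : Continuous k := by fun_prop
  have hks : HasCompactSupport k := by
    refine HasCompactSupport.intro (isCompact_closedBall 0 ρ) fun z hz => ?_
    have : ρ < ‖z‖ := by simpa using hz
    exact max_eq_right (by linarith)
  have hkint : Integrable k := hkc.integrable_of_hasCompactSupport hks
  have hkx : ∀ x, Integrable fun y => k (x - y) := fun x => hkint.comp_sub_left x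
  -- Moving from x by ρ/2 along the gradient reaches a point x₁ with r x₁ ≥ r x + cρ/4. The second
  -- bound on s₀ keeps r positive on the ball of radius s₀ about x₁, and the first keeps the kernel
  -- at least ρ/4 there; this ball provides the lower bound for the convolution.
  set s₀ : ℝ := min (ρ / 4) (c * ρ / (4 * (L + 1)))
  have hs₀ : 0 < s₀ := by positivity
  set vol₀ : ℝ := (volume (Metric.ball (0 : Space d) s₀)).toReal
  have hvol₀ : 0 < vol₀ :=
    ENNReal.toReal_pos (Metric.measure_ball_pos _ _ hs₀).ne' measure_ball_lt_top.ne
  have hI : 0 ≤ ∫ z, k z := integral_nonneg hk0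
  refine ⟨ρ, hρ, c ^ 2 / 2 * (ρ / 4 * vol₀), by positivity, L * ⟨∫ z, k z, hI⟩,
    L * (2 * (volume (Metric.ball (0 : Space d) ρ)).toNNReal), fun r h0 hL hM hnd => ?_⟩
  have hgb : ∀ y, ‖∇ r y‖ ≤ L := norm_gradient_le hL
  have hgm : AEStronglyMeasurable (∇ r) volume := (measurable_gradient r).aestronglyMeasurable
  have hXint : ∀ x, Integrable fun y => k (x - y) • ∇ r y := fun x =>
    (hkx x).smul_bdd (L : ℝ) hgm (Filter.Eventually.of_forall hgb)
  refine ⟨fun x => ∫ y, k (x - y) • ∇ r y, ?_, ?_, ?_⟩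
  · refine LipschitzWith.of_dist_le_mul fun x x' => ?_
    rw [dist_eq_norm, ← integral_sub (hXint x) (hXint x')]
    have hbd : ∀ y, ‖k (x - y) • ∇ r y - k (x' - y) • ∇ r y‖ ≤
        (Metric.ball x ρ).indicator (fun _ => L * ‖x - x'‖) y +
        (Metric.ball x' ρ).indicator (fun _ => L * ‖x - x'‖) y := by
      intro y
      have hn1 : 0 ≤ (Metric.ball x ρ).indicator (fun _ => L * ‖x - x'‖) y :=
        indicator_nonneg (fun _ _ => by positivity) _
      have hn2 : 0 ≤ (Metric.ball x' ρ).indicator (fun _ => L * ‖x - x'‖) y :=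
        indicator_nonneg (fun _ _ => by positivity) _
      have hle : ‖k (x - y) • ∇ r y - k (x' - y) • ∇ r y‖ ≤ L * ‖x - x'‖ := by
        rw [← sub_smul, norm_smul, mul_comm]
        gcongr
        · exact hgb y
        · refine (abs_max_sub_max_le_abs _ _ _).trans ?_
          rw [sub_sub_sub_cancel_left]
          refine (abs_norm_sub_norm_le _ _).trans (le_of_eq ?_)
          rw [sub_sub_sub_cancel_right, norm_sub_rev]
      by_cases hx : y ∈ Metric.ball x ρ
      · rw [indicator_of_mem hx]; linarith
      by_cases hx' : y ∈ Metric.ball x' ρ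
      · rw [indicator_of_mem hx' ]; linarith
      have hz : ∀ x : Space d, y ∉ Metric.ball x ρ → k (x - y) = 0 := fun x hx => by
        rw [Metric.mem_ball', dist_eq_norm, not_lt] at hx
        exact max_eq_right (by linarith)
      rw [hz x hx, hz x' hx']
      simpa using add_nonneg hn1 hn2
    have hind : ∀ x₀ : Space d,
        Integrable ((Metric.ball x₀ ρ).indicator (fun _ => (L : ℝ) * ‖x - x'‖)) := fun x₀ =>
      (integrable_indicator_iff Metric.isOpen_ball.measurableSet).2
        (integrableOn_const measure_ball_lt_top.ne)
    refine (norm_integral_le_of_norm_le ((hind x).add (hind x'))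
      (Filter.Eventually.of_forall hbd)).trans (le_of_eq ?_)
    simp only [Pi.add_apply]
    rw [integral_add (hind x) (hind x'), integral_indicator_const _ Metric.isOpen_ball.measurableSet,
      integral_indicator_const _ Metric.isOpen_ball.measurableSet, dist_eq_norm]
    simp only [Measure.real, smul_eq_mul, NNReal.coe_mul, NNReal.coe_ofNat,
      Measure.addHaar_ball_center]
    rw [ENNReal.coe_toNNReal_eq_toReal]
    ring
  · intro x
    have h1 : ∀ y, ‖k (x - y) • ∇ r y‖ ≤ L * k (x - y) := fun y => by
      rw [norm_smul, Real.norm_of_nonneg (hk0 _), mul_comm]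
      gcongr
      · exact hgb y
    refine (norm_integral_le_of_norm_le ((hkx x).const_mul _)
      (Filter.Eventually.of_forall h1)).trans (le_of_eq ?_)
    rw [integral_const_mul, integral_sub_left_eq_self k]
    rfl
  · intro x hx hxρ
    have hcx : c ≤ ‖∇ r x‖ := hnd x hx (hxρ.trans_le hρc)
    have hx0 : ∇ r x ≠ 0 := norm_pos_iff.1 (hc.trans_le hcx)
    set u : Space d := ‖∇ r x‖⁻¹ • ∇ r x with hu
    have hun : ‖u‖ = 1 := by
      rw [hu, norm_smul, norm_inv, norm_norm, inv_mul_cancel₀ (norm_ne_zero_iff.2 hx0)]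
    have hgrow := add_le_of_nondegenerate hρ hρ' hL hM hx hxρ hcx (τ := ρ / 2)
      ⟨by positivity, by linarith⟩ hu hx0
    set x₁ := x + (ρ / 2) • u
    have hx₁ : ‖x - x₁‖ = ρ / 2 := by
      simp only [x₁]
      rw [sub_add_cancel_left, norm_neg, norm_smul, hun, mul_one, Real.norm_of_nonneg (by positivity)]
    have hball : ∀ y ∈ Metric.ball x₁ s₀, 0 < r y ∧ ρ / 4 ≤ k (x - y) := by
      intro y hy
      rw [Metric.mem_ball, dist_comm, dist_eq_norm] at hy
      constructor
      · have h2 := (abs_le.1 (hL.dist_le_mul x₁ y)).2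
        rw [dist_eq_norm] at h2
        have h3 : (L : ℝ) * ‖x₁ - y‖ ≤ L * (c * ρ / (4 * (L + 1))) := by
          gcongr
          exact hy.le.trans (min_le_right _ _)
        have h4 : (L : ℝ) * (c * ρ / (4 * (L + 1))) ≤ c * ρ / 4 := by
          rw [mul_div_assoc', div_le_div_iff₀ (by positivity) (by positivity)]
          have : 0 < c * ρ := by positivity
          nlinarith
        have := hx.1
        simp only [gasDomain, mem_ofPred_eq] at this
        linarith
      · have h3 : ‖x - y‖ ≤ ρ / 2 + ρ / 4 := by
          calc ‖x - y‖ = ‖(x - x₁) + (x₁ - y)‖ := by congr 1; abel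
            _ ≤ ‖x - x₁‖ + ‖x₁ - y‖ := norm_add_le _ _
            _ ≤ _ := by
              rw [hx₁]
              gcongr
              exact hy.le.trans (min_le_left _ _)
        exact le_max_of_le_left (by linarith)
    have hinner : inner ℝ (∫ y, k (x - y) • ∇ r y) (∇ r x) =
        ∫ y, k (x - y) * inner ℝ (∇ r x) (∇ r y) := by
      rw [real_inner_comm, ← integral_inner (hXint x)]
      simp only [real_inner_smul_right]
    have hint2 : Integrable fun y => k (x - y) * inner ℝ (∇ r x) (∇ r y) := by
      have := (hXint x).const_inner (𝕜 := ℝ) (∇ r x)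
      simpa only [real_inner_smul_right] using this
    rw [hinner]
    calc c ^ 2 / 2 * (ρ / 4 * vol₀)
        = ∫ y in Metric.ball x₁ s₀, c ^ 2 / 2 * (ρ / 4) := by
          rw [setIntegral_const, Measure.real, Measure.addHaar_ball_center]
          simp only [smul_eq_mul, vol₀]
          ring
      _ = ∫ y, (Metric.ball x₁ s₀).indicator (fun _ => c ^ 2 / 2 * (ρ / 4)) y :=
          (integral_indicator Metric.isOpen_ball.measurableSet).symm
      _ ≤ _ := by
          refine integral_mono_ae ((integrable_indicator_iff Metric.isOpen_ball.measurableSet).2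
            (integrableOn_const measure_ball_lt_top.ne)) hint2 ?_
          filter_upwards [hL.ae_differentiableAt (μ := volume)] with y hyd
          -- With |∇r x| ≥ c and oscillation at most c/2 the inner product is at least |∇r x| (|∇r
          -- x| - c/2) ≥ c²/2. Hence the gas contributes positively wherever the kernel does not
          -- vanish, and the vacuum contributes zero.
          have hlow : r y > 0 → k (x - y) ≠ 0 → c ^ 2 / 2 ≤ inner ℝ (∇ r x) (∇ r y) := by
            intro hry hk
            have hxy : ‖x - y‖ ≤ ρ := by
              by_contra! h
              exact hk (max_eq_right (by linarith))
            have hry' : r y ≤ ρ + L * ρ := by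
              have h2 := (abs_le.1 (hL.dist_le_mul x y)).1
              rw [dist_eq_norm] at h2
              have : (L : ℝ) * ‖x - y‖ ≤ L * ρ := by gcongr
              linarith
            have h2 : ‖∇ r x - ∇ r y‖ ≤ c / 2 := by
              refine (norm_gradient_sub_le hM hx ⟨hry, hyd⟩).trans (le_trans ?_ hρ')
              gcongr
            have h3 : inner ℝ (∇ r x) (∇ r x - ∇ r y) ≤ ‖∇ r x‖ * (c / 2) :=
              (real_inner_le_norm _ _).trans (by gcongr)
            rw [inner_sub_right, real_inner_self_eq_norm_sq] at h3
            nlinarith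
          by_cases hy : y ∈ Metric.ball x₁ s₀
          · obtain ⟨h1, h2⟩ := hball y hy
            rw [indicator_of_mem hy]
            have h3 := hlow h1 (by intro h; rw [h] at h2; linarith)
            nlinarith [sq_nonneg c]
          · rw [indicator_of_notMem hy]
            by_cases hry : 0 < r y
            · by_cases hk : k (x - y) = 0
              · simp [hk]
              · exact mul_nonneg (hk0 _) (le_trans (by positivity) (hlow hry hk))
            · simp [gradient_eq_zero_of_nonneg h0 (x := y) hry]

end Transversal

/-! ### The logarithmic cutoff and the pointwise form of the Hardy inequality. -/

section Hardy

theorem contDiff_smoothTransition : ContDiff ℝ 1 Real.smoothTransition :=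
  Real.smoothTransition.contDiff (n := 1)

theorem deriv_smoothTransition_nonneg (x : ℝ) : 0 ≤ deriv Real.smoothTransition x :=
  Real.smoothTransition.monotone.deriv_nonneg

theorem deriv_smoothTransition_of_nonpos {x : ℝ} (hx : x < 0) :
    deriv Real.smoothTransition x = 0 := by
  have : Real.smoothTransition =ᶠ[𝓝 x] fun _ => 0 := by
    filter_upwards [gt_mem_nhds hx] with y hy using Real.smoothTransition.zero_of_nonpos hy.le
  rw [this.deriv_eq, deriv_const]

theorem deriv_smoothTransition_of_one_lt {x : ℝ} (hx : 1 < x) :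
    deriv Real.smoothTransition x = 0 := by
  have : Real.smoothTransition =ᶠ[𝓝 x] fun _ => 1 := by
    filter_upwards [lt_mem_nhds hx] with y hy using Real.smoothTransition.one_of_one_le hy.le
  rw [this.deriv_eq, deriv_const]

theorem hasDerivAt_smoothTransition (x : ℝ) :
    HasDerivAt Real.smoothTransition (deriv Real.smoothTransition x) x :=
  (contDiff_smoothTransition.differentiable one_ne_zero x).hasDerivAt

theorem exists_deriv_smoothTransition_le :
    ∃ C > 0, ∀ x, deriv Real.smoothTransition x ≤ C := by
  have hc : Continuous (deriv Real.smoothTransition) :=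
    contDiff_smoothTransition.continuous_deriv le_rfl
  obtain ⟨C, hC⟩ := isCompact_Icc.exists_bound_of_continuousOn (s := Icc (0 : ℝ) 1) hc.continuousOn
  have hC0 : 0 ≤ C := (norm_nonneg _).trans (hC 0 (by simp))
  refine ⟨C + 1, by positivity, fun x => ?_⟩
  by_cases h0 : x < 0
  · rw [deriv_smoothTransition_of_nonpos h0]; positivity
  by_cases h1 : 1 < x
  · rw [deriv_smoothTransition_of_one_lt h1]; positivity
  · have := (abs_le.1 (hC x ⟨not_lt.1 h0, not_lt.1 h1⟩)).2
    linarith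

/-- A logarithmic cutoff: a transition from `0` to `1` with small `t η'(t)`. -/
theorem exists_log_cutoff {τ : ℝ} (hτ : 0 < τ) :
    ∃ (η : ℝ → ℝ) (t₀ C : ℝ), 0 < t₀ ∧ t₀ ≤ 1 ∧ 0 ≤ C ∧ (∀ t, 0 ≤ η t ∧ η t ≤ 1) ∧
      (∀ t, 1 ≤ t → η t = 1) ∧ (∀ t, 0 ≤ t → t < t₀ → η t = 0 ∧ deriv η t = 0) ∧
      (∀ t, 1 < t → deriv η t = 0) ∧
      ∀ t, 0 ≤ t → ContDiffAt ℝ 1 η t ∧ |deriv η t| ≤ C ∧ |t * deriv η t| ≤ τ := by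
  obtain ⟨C, hC, hS⟩ := exists_deriv_smoothTransition_le
  -- The cutoff is S(1 + log(t + e)/l) with the smooth transition S, so that |t η'(t)| ≤ C/l = τ.
  -- The shift e = exp(-2l) keeps η smooth at t = 0 and is small enough for η to vanish below
  -- exp(-l) - e > 0.
  set l : ℝ := C / τ
  have hl : 0 < l := by positivity
  set e : ℝ := Real.exp (-(2 * l))
  have he : 0 < e := Real.exp_pos _
  have he' : e < Real.exp (-l) := Real.exp_lt_exp.2 (by linarith)
  have he1 : Real.exp (-l) ≤ 1 := Real.exp_le_one_iff.2 (by linarith)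
  have hder : ∀ t, 0 ≤ t → HasDerivAt (fun t => Real.smoothTransition (1 + Real.log (t + e) / l))
      (deriv Real.smoothTransition (1 + Real.log (t + e) / l) * ((1 / (t + e)) / l)) t := by
    intro t ht
    have h1 : HasDerivAt (fun t => 1 + Real.log (t + e) / l) ((1 / (t + e)) / l) t :=
      ((((hasDerivAt_id t).add_const e).log (by simp; positivity)).div_const l).const_add 1
    exact (hasDerivAt_smoothTransition _).comp t h1
  have harg : ∀ t, 0 ≤ t → t < Real.exp (-l) - e → 1 + Real.log (t + e) / l < 0 := by
    intro t ht ht'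
    have h1 : Real.log (t + e) < -l := by
      rw [Real.log_lt_iff_lt_exp (by positivity)]
      linarith
    have : Real.log (t + e) / l < -1 := by rw [div_lt_iff₀ hl]; linarith
    linarith
  refine ⟨fun t => Real.smoothTransition (1 + Real.log (t + e) / l), Real.exp (-l) - e, C / (e * l),
    by linarith, by linarith, by positivity, fun t => ⟨Real.smoothTransition.nonneg _,
    Real.smoothTransition.le_one _⟩, fun t ht => ?_, fun t ht ht' => ⟨?_, ?_⟩, fun t ht => ?_,
    fun t ht => ⟨?_, ?_, ?_⟩⟩
  · refine Real.smoothTransition.one_of_one_le ?_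
    have : 0 ≤ Real.log (t + e) := Real.log_nonneg (by linarith)
    have : 0 ≤ Real.log (t + e) / l := by positivity
    linarith
  · exact Real.smoothTransition.zero_of_nonpos (harg t ht ht').le
  · rw [(hder t ht).deriv, deriv_smoothTransition_of_nonpos (harg t ht ht'), zero_mul]
  · rw [(hder t (by linarith)).deriv, deriv_smoothTransition_of_one_lt, zero_mul]
    have : 0 < Real.log (t + e) := Real.log_pos (by linarith)
    have : 0 < Real.log (t + e) / l := by positivity
    linarith
  · have h1 : ContDiffAt ℝ 1 (fun t => 1 + Real.log (t + e) / l) t :=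
      contDiffAt_const.add (((contDiffAt_id.add contDiffAt_const).log
        (by simp; positivity)).div_const l)
    exact contDiff_smoothTransition.contDiffAt.comp t h1
  · rw [(hder t ht).deriv, abs_mul, abs_of_nonneg (deriv_smoothTransition_nonneg _),
      abs_of_nonneg (by positivity), div_div, mul_one_div]
    gcongr
    · exact hS _
    · linarith
  · rw [(hder t ht).deriv, abs_of_nonneg (mul_nonneg ht (mul_nonneg
      (deriv_smoothTransition_nonneg _) (by positivity)))]
    have h2 : t * (1 / (t + e)) ≤ 1 := by
      rw [mul_one_div, div_le_one (by positivity)]; linarith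
    calc _ = deriv Real.smoothTransition (1 + Real.log (t + e) / l) * (t * (1 / (t + e))) / l := by
          ring
      _ ≤ C * 1 / l := by
          gcongr
          exact hS _
      _ = τ := by simp only [l]; field_simp

/-- The pointwise inequality behind the Hardy inequality: the divergence of `ω μ^(β+1) η(m/μ) X`. -/
theorem hardy_pointwise {β ω μ m b D η₀ η₁ m' ω' lam a B CD L t₀ C τ₁ τ₂ δ : ℝ}
    (hβ : -1 < β) (hω : 0 ≤ ω) (hμ : 0 < μ) (hm : 0 ≤ m) (hml : m ≤ lam) (hlam : 0 < lam)
    (ha : 0 < a) (hB : 0 ≤ B) (hCD : 0 ≤ CD) (hC : 0 ≤ C) (hL : 0 ≤ L) (ht₀ : 0 < t₀)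
    (hb : μ < δ → 2 * a ≤ b) (hbL : |b| ≤ 2 * L * B) (hD : |D| ≤ CD)
    (hm' : |m'| ≤ lam * B) (hω' : m * |ω'| ≤ lam * B * ω) (ht₀1 : t₀ ≤ 1)
    (hη : 0 ≤ η₀ ∧ η₀ ≤ 1) (hη1 : 1 < m / μ → η₀ = 1 ∧ η₁ = 0)
    (hη0 : m / μ < t₀ → η₀ = 0 ∧ η₁ = 0) (hη₁ : |η₁| ≤ C) (hτ₁ : |m / μ * η₁| ≤ τ₁)
    (h1 : lam * (B + CD) ≤ a * (β + 1))
    (h2 : lam / t₀ < δ)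
    (h3 : lam * (B / t₀ + C * B + CD / t₀) + τ₁ * (2 * L * B) ≤ τ₂) :
    (if μ < m then a * (β + 1) * (ω * μ ^ β) else -(τ₂ * (ω * μ ^ β))) ≤
      ω' * μ ^ (β + 1) * η₀ + ω * ((β + 1) * μ ^ β * b) * η₀
        + ω * μ ^ (β + 1) * (η₁ * ((m' - m / μ * b) / μ)) + ω * μ ^ (β + 1) * η₀ * D := by
  have hμβ : 0 < μ ^ β := Real.rpow_pos_of_pos hμ _
  have hpow : μ ^ (β + 1) = μ ^ β * μ := by rw [Real.rpow_add hμ, Real.rpow_one]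
  have e : ω' * μ ^ (β + 1) * η₀ + ω * ((β + 1) * μ ^ β * b) * η₀
        + ω * μ ^ (β + 1) * (η₁ * ((m' - m / μ * b) / μ)) + ω * μ ^ (β + 1) * η₀ * D =
      μ ^ β * (μ * ω' * η₀ + ω * ((β + 1) * b * η₀) + ω * (η₁ * m') - ω * ((m / μ * η₁) * b)
        + ω * (μ * D * η₀)) := by
    rw [hpow]; field_simp; ring
  rw [e]
  have hτ₂ : 0 ≤ τ₂ := by
    have : 0 ≤ τ₁ := (abs_nonneg _).trans hτ₁
    refine le_trans ?_ h3
    positivity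
  -- In the layer η = 1 and the main term is (β+1) ω μ^β b with b ≥ 2a. One half of it pays for ω'
  -- and the divergence of X, both of size lam because μ < m ≤ lam.
  split_ifs with hlt
  · obtain ⟨e0, e1⟩ := hη1 ((one_lt_div hμ).2 hlt)
    rw [e0, e1]
    have hδ : μ < δ := by
      have : lam ≤ lam / t₀ := by rw [le_div_iff₀ ht₀]; nlinarith
      linarith
    have hb' := hb hδ
    have f1 : -(lam * B * ω) ≤ μ * ω' := by
      have : μ * |ω'| ≤ m * |ω'| := by gcongr
      have := neg_abs_le (μ * ω')
      rw [abs_mul, abs_of_pos hμ] at this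
      linarith
    have f2 : -(lam * CD) ≤ μ * D := by
      have : μ * |D| ≤ lam * CD := by gcongr; linarith
      have := neg_abs_le (μ * D)
      rw [abs_mul, abs_of_pos hμ] at this
      linarith
    have f3 : ω * ((β + 1) * (2 * a)) ≤ ω * ((β + 1) * b) := by
      have : 0 ≤ β + 1 := by linarith
      gcongr
    have f4 : ω * (-(lam * CD)) ≤ ω * (μ * D) := by gcongr
    have f5 : ω * (lam * (B + CD)) ≤ ω * (a * (β + 1)) := by gcongr
    have : a * (β + 1) * ω ≤ μ * ω' * 1 + ω * ((β + 1) * b * 1) + ω * (0 * m')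
        - ω * ((m / μ * 0) * b) + ω * (μ * D * 1) := by linarith
    calc _ = μ ^ β * (a * (β + 1) * ω) := by ring
      _ ≤ _ := by gcongr
  -- Outside the layer all terms vanish unless m/μ ≥ t₀. In that transition region μ ≤ lam/t₀ < δ,
  -- so the term with b is nonnegative; the other errors are of size lam, except for the one with
  -- (m/μ) η', which the logarithmic cutoff makes small.
  · by_cases ht : m / μ < t₀
    · obtain ⟨e0, e1⟩ := hη0 ht
      rw [e0, e1]
      simp
      positivity
    · have hμm : μ ≤ m / t₀ := by
        rw [not_lt, le_div_iff₀ hμ] at ht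
        rw [le_div_iff₀ ht₀]
        linarith
      have hμlam : μ ≤ lam / t₀ := hμm.trans (by gcongr)
      have hb' := hb (hμlam.trans_lt h2)
      have f1 : -(lam * (B / t₀) * ω) ≤ μ * ω' * η₀ := by
        have g1 : μ * |ω'| * η₀ ≤ m / t₀ * |ω'| * 1 := by
          gcongr
          · exact hη.1
          · exact hη.2
        have g2 : m / t₀ * |ω'| * 1 ≤ lam * (B / t₀) * ω := by
          calc _ = m * |ω'| / t₀ := by ring
            _ ≤ lam * B * ω / t₀ := by gcongr
            _ = _ := by ring
        have := neg_abs_le (μ * ω' * η₀)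
        rw [abs_mul, abs_mul, abs_of_pos hμ, abs_of_nonneg hη.1] at this
        linarith
      have f2 : -(lam * (CD / t₀)) ≤ μ * D * η₀ := by
        have g1 : μ * |D| * η₀ ≤ lam / t₀ * CD * 1 := by
          gcongr
          · exact hη.1
          · exact hη.2
        have := neg_abs_le (μ * D * η₀)
        rw [abs_mul, abs_mul, abs_of_pos hμ, abs_of_nonneg hη.1] at this
        have : lam / t₀ * CD * 1 = lam * (CD / t₀) := by ring
        linarith
      have f3 : 0 ≤ ω * ((β + 1) * b * η₀) := by
        have : 0 ≤ β + 1 := by linarith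
        have : 0 ≤ b := by linarith
        have := hη.1
        positivity
      have f4 : -(C * (lam * B)) ≤ η₁ * m' := by
        have : |η₁ * m'| ≤ C * (lam * B) := by rw [abs_mul]; gcongr
        exact (abs_le.1 this).1
      have f5 : (m / μ * η₁) * b ≤ τ₁ * (2 * L * B) := by
        refine (le_abs_self _).trans ?_
        rw [abs_mul]
        gcongr
        exact (abs_nonneg _).trans hτ₁
      have g2 : ω * (-(lam * (CD / t₀))) ≤ ω * (μ * D * η₀) := by gcongr
      have g4 : ω * (-(C * (lam * B))) ≤ ω * (η₁ * m') := by gcongr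
      have g5 : ω * ((m / μ * η₁) * b) ≤ ω * (τ₁ * (2 * L * B)) := by gcongr
      have g6 : ω * (lam * (B / t₀ + C * B + CD / t₀) + τ₁ * (2 * L * B)) ≤ ω * τ₂ := by gcongr
      have : -(τ₂ * ω) ≤ μ * ω' * η₀ + ω * ((β + 1) * b * η₀) + ω * (η₁ * m')
          - ω * ((m / μ * η₁) * b) + ω * (μ * D * η₀) := by linarith
      calc _ = μ ^ β * (-(τ₂ * ω)) := by ring
        _ ≤ _ := by gcongr

end Hardy

/-! ### The integrated Hardy inequality in the common gas domain. -/

section HardyInequality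

variable {d : ℕ}

theorem HasFDerivAt.hasDerivAt_line {E F : Type*} [NormedAddCommGroup E] [NormedSpace ℝ E]
    [NormedAddCommGroup F] [NormedSpace ℝ F] {f : E → F} {f' : E →L[ℝ] F} {x : E}
    (hf : HasFDerivAt f f' x) (v : E) : HasDerivAt (fun t : ℝ => f (x + t • v)) (f' v) 0 :=
  hf.hasLineDerivAt v

theorem hasDerivAt_hardy_density {β : ℝ} {μ m ω η : ℝ → ℝ} {b m' ω' : ℝ}
    (hμ : HasDerivAt μ b 0) (hm : HasDerivAt m m' 0) (hω : HasDerivAt ω ω' 0) (hpos : 0 < μ 0)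
    (hη : DifferentiableAt ℝ η (m 0 / μ 0)) :
    HasDerivAt (fun t => ω t * μ t ^ (β + 1) * η (m t / μ t))
      (ω' * μ 0 ^ (β + 1) * η (m 0 / μ 0) + ω 0 * ((β + 1) * μ 0 ^ β * b) * η (m 0 / μ 0)
        + ω 0 * μ 0 ^ (β + 1) * (deriv η (m 0 / μ 0) * ((m' - m 0 / μ 0 * b) / μ 0))) 0 := by
  have h1 := hμ.rpow_const (p := β + 1) (Or.inl hpos.ne')
  have h2 := HasDerivAt.comp (0 : ℝ) hη.hasDerivAt (hm.fun_div hμ hpos.ne')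
  refine ((hω.fun_mul h1).fun_mul h2).congr_deriv ?_
  rw [add_sub_cancel_right]
  simp only [Function.comp_apply]
  field_simp

/-- A cutoff to a compact part of `{r₁ > 0} ∩ {r₂ > 0}`. -/
noncomputable def interiorCutoff (r₁ r₂ : Space d → ℝ) (n : ℝ) (x : Space d) : ℝ :=
  Real.smoothTransition (n * r₁ x - 1) * Real.smoothTransition (n * r₂ x - 1) *
    Real.smoothTransition (2 - ‖x‖ ^ 2 / n ^ 2)

theorem interiorCutoff_mem_Icc (r₁ r₂ : Space d → ℝ) (n : ℝ) (x : Space d) :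
    interiorCutoff r₁ r₂ n x ∈ Icc 0 1 := by
  have h := Real.smoothTransition.nonneg
  have h' := Real.smoothTransition.le_one
  unfold interiorCutoff
  refine ⟨mul_nonneg (mul_nonneg (h _) (h _)) (h _), ?_⟩
  exact mul_le_one₀ (mul_le_one₀ (h' _) (h _) (h' _)) (h _) (h' _)

/-- The cutoff already vanishes where one of the densities is at most 1/n, and 1/n exceeds the value
zero at an outside point. Vanishing on a whole neighbourhood makes products with functions that are
Lipschitz only inside extend as locally Lipschitz functions. -/
theorem interiorCutoff_eventually_eq_zero {r₁ r₂ : Space d → ℝ} (h₁ : Continuous r₁)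
    (h₂ : Continuous r₂) {n : ℝ} (hn : 0 < n) {x : Space d}
    (hx : x ∉ gasDomain r₁ ∩ gasDomain r₂) : ∀ᶠ y in 𝓝 x, interiorCutoff r₁ r₂ n y = 0 := by
  have key : ∀ r : Space d → ℝ, Continuous r → x ∉ gasDomain r →
      ∀ᶠ y in 𝓝 x, Real.smoothTransition (n * r y - 1) = 0 := by
    intro r hr hx
    have : r x < 1 / n := lt_of_le_of_lt (not_lt.1 hx) (by positivity)
    filter_upwards [hr.continuousAt.eventually (gt_mem_nhds this)] with y hy
    refine Real.smoothTransition.zero_of_nonpos ?_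
    rw [lt_div_iff₀ hn] at hy
    linarith
  by_cases hx1 : x ∈ gasDomain r₁
  · filter_upwards [key r₂ h₂ fun h => hx ⟨hx1, h⟩] with y hy
    simp [interiorCutoff, hy]
  · filter_upwards [key r₁ h₁ hx1] with y hy
    simp [interiorCutoff, hy]

theorem interiorCutoff_eq_zero {r₁ r₂ : Space d → ℝ} {n : ℝ} (hn : 0 < n) {x : Space d}
    (hx : 2 * n < ‖x‖) : interiorCutoff r₁ r₂ n x = 0 := by
  have : Real.smoothTransition (2 - ‖x‖ ^ 2 / n ^ 2) = 0 := by
    refine Real.smoothTransition.zero_of_nonpos ?_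
    rw [sub_nonpos, le_div_iff₀ (by positivity)]
    nlinarith
  simp [interiorCutoff, this]

theorem locallyLipschitz_interiorCutoff {r₁ r₂ : Space d → ℝ} {K₁ K₂ : ℝ≥0}
    (h₁ : LipschitzWith K₁ r₁) (h₂ : LipschitzWith K₂ r₂) (n : ℝ) :
    LocallyLipschitz (interiorCutoff r₁ r₂ n) := by
  rw [← locallyLipschitzOn_univ]
  have key : ∀ {r : Space d → ℝ} {K : ℝ≥0}, LipschitzWith K r →
      LocallyLipschitzOn univ fun x => Real.smoothTransition (n * r x - 1) := fun hr =>
    hr.locallyLipschitz.locallyLipschitzOn.comp_contDiffAt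
      (H := fun y => Real.smoothTransition (n * y - 1)) fun p _ =>
        (contDiff_smoothTransition.comp ((contDiff_const.mul contDiff_id).sub
          contDiff_const)).contDiffAt
  exact ((key h₁).real_mul (key h₂)).real_mul
    (LipschitzWith.id.locallyLipschitz.locallyLipschitzOn.norm_sq.comp_contDiffAt
      (H := fun y => Real.smoothTransition (2 - y / n ^ 2)) fun p _ =>
        (contDiff_smoothTransition.comp (contDiff_const.sub (contDiff_id.div_const _))).contDiffAt)

/-- The derivative of the cutoff along a direction in which both `r₁` and `r₂` increase. -/
theorem interiorCutoff_fderiv_ge {r₁ r₂ : Space d → ℝ} {n : ℝ} (hn : 1 ≤ n) {x v : Space d}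
    {C B : ℝ} (hC : ∀ y, deriv Real.smoothTransition y ≤ C) (hB : ‖v‖ ≤ B)
    (h₁ : DifferentiableAt ℝ r₁ x) (h₂ : DifferentiableAt ℝ r₂ x) :
    ∃ D, HasDerivAt (fun t : ℝ => interiorCutoff r₁ r₂ n (x + t • v)) D 0 ∧
      (0 ≤ fderiv ℝ r₁ x v → 0 ≤ fderiv ℝ r₂ x v → -(4 * C * B / n) ≤ D) := by
  have hline : ∀ r : Space d → ℝ, DifferentiableAt ℝ r x →
      HasDerivAt (fun t : ℝ => Real.smoothTransition (n * r (x + t • v) - 1))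
        (deriv Real.smoothTransition (n * r x - 1) * (n * fderiv ℝ r x v)) 0 := by
    intro r hr
    have h := ((hr.hasFDerivAt.hasDerivAt_line v).const_mul n).sub_const 1
    have := HasDerivAt.comp (0 : ℝ) (hasDerivAt_smoothTransition _) h
    simpa using! this
  have h3 : HasDerivAt (fun t : ℝ => Real.smoothTransition (2 - ‖x + t • v‖ ^ 2 / n ^ 2))
      (deriv Real.smoothTransition (2 - ‖x‖ ^ 2 / n ^ 2) * -(2 * inner ℝ x v / n ^ 2)) 0 := by
    have h := ((((hasDerivAt_id (0 : ℝ)).smul_const v).const_add x).norm_sq.div_const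
      (n ^ 2)).const_sub 2
    have := HasDerivAt.comp (0 : ℝ) (hasDerivAt_smoothTransition _) h
    simpa using! this
  have hD := ((hline r₁ h₁).fun_mul (hline r₂ h₂)).fun_mul h3
  refine ⟨_, hD, fun hv₁ hv₂ => ?_⟩
  simp only [zero_smul, add_zero]
  have hS := Real.smoothTransition.nonneg
  have hS' := Real.smoothTransition.le_one
  have hdS := deriv_smoothTransition_nonneg
  have hC0 : 0 ≤ C := (hdS 0).trans (hC 0)
  have hB0 : 0 ≤ B := (norm_nonneg _).trans hB
  have hn0 : 0 < n := by linarith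
  set A := Real.smoothTransition (n * r₁ x - 1)
  set A' := Real.smoothTransition (n * r₂ x - 1)
  set A'' := Real.smoothTransition (2 - ‖x‖ ^ 2 / n ^ 2)
  -- The factors which cut off the boundary may have large derivatives of order n, but along a
  -- direction in which both densities increase these have the favourable sign.
  have f1 : 0 ≤ (deriv Real.smoothTransition (n * r₁ x - 1) * (n * fderiv ℝ r₁ x v) * A' +
      A * (deriv Real.smoothTransition (n * r₂ x - 1) * (n * fderiv ℝ r₂ x v))) * A'' :=
    mul_nonneg (add_nonneg (mul_nonneg (mul_nonneg (hdS _) (by positivity)) (hS _))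
      (mul_nonneg (hS _) (mul_nonneg (hdS _) (by positivity)))) (hS _)
  -- Only the cutoff at infinity has a derivative without a sign. Its support in |x| ≤ 2n and the
  -- factor 1/n² leave an error of order 1/n.
  have f2 : |A * A' * (deriv Real.smoothTransition (2 - ‖x‖ ^ 2 / n ^ 2) *
      -(2 * inner ℝ x v / n ^ 2))| ≤ 4 * C * B / n := by
    by_cases hx : 2 * n < ‖x‖
    · rw [deriv_smoothTransition_of_nonpos, zero_mul, mul_zero, abs_zero]
      · positivity
      · rw [sub_neg, lt_div_iff₀ (by positivity)]
        nlinarith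
    · rw [abs_mul, abs_mul, abs_mul, abs_of_nonneg (hS _), abs_of_nonneg (hS _),
        abs_of_nonneg (hdS _), abs_neg, abs_div, abs_mul, abs_two, abs_of_pos (pow_pos hn0 2)]
      have hin : |inner ℝ x v| ≤ 2 * n * B :=
        (abs_real_inner_le_norm _ _).trans (by gcongr; exact not_lt.1 hx)
      calc _ ≤ 1 * 1 * (C * (2 * (2 * n * B) / n ^ 2)) := by
            gcongr
            · exact mul_nonneg (hdS _) (by positivity)
            · exact hS _
            · exact hS' _
            · exact hS' _
            · exact hC _
        _ = _ := by field_simp; ring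
  have := (abs_le.1 f2).1
  linarith

theorem tendsto_interiorCutoff {r₁ r₂ : Space d → ℝ} {x : Space d}
    (hx : x ∈ gasDomain r₁ ∩ gasDomain r₂) :
    Filter.Tendsto (fun n : ℕ => interiorCutoff r₁ r₂ (n + 1) x) Filter.atTop (𝓝 1) := by
  refine tendsto_const_nhds.congr' ?_
  have key : ∀ a : ℝ, 0 < a → ∀ᶠ n : ℕ in Filter.atTop, 2 ≤ (n + 1 : ℝ) * a := by
    intro a ha
    filter_upwards [Filter.eventually_ge_atTop ⌈2 / a⌉₊] with n hn
    have := Nat.ceil_le.1 hn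
    rw [div_le_iff₀ ha] at this
    nlinarith
  filter_upwards [key _ hx.1, key _ hx.2, Filter.eventually_ge_atTop ⌈‖x‖⌉₊] with n h1 h2 h3
  have h3 := Nat.ceil_le.1 h3
  unfold interiorCutoff
  rw [Real.smoothTransition.one_of_one_le (by linarith),
    Real.smoothTransition.one_of_one_le (by linarith), Real.smoothTransition.one_of_one_le]
  · norm_num
  · have : ‖x‖ ^ 2 / (n + 1 : ℝ) ^ 2 ≤ 1 := by
      rw [div_le_one (by positivity)]
      gcongr
      linarith
    linarith

/-- The density `ω μ^(β+1) η(m/μ)` with `μ = r₁ + r₂`. -/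
noncomputable def hardyDensity (β : ℝ) (η : ℝ → ℝ) (r₁ r₂ m ω : Space d → ℝ) (x : Space d) : ℝ :=
  ω x * (r₁ x + r₂ x) ^ (β + 1) * η (m x / (r₁ x + r₂ x))

/-- The divergence of the density times a transversal vector with an additional cutoff. -/
theorem hardyDensity_cutoff_fderiv_ge {β a B CD L t₀ C τ₁ τ₂ δ lam n CS D : ℝ} {η : ℝ → ℝ}
    {r₁ r₂ m ω : Space d → ℝ} {x v : Space d} (hβ : -1 < β) (ha : 0 < a) (hlam : 0 < lam)
    (hC : 0 ≤ C) (hL : 0 ≤ L) (ht₀ : 0 < t₀) (ht₀1 : t₀ ≤ 1) (hCD : 0 ≤ CD)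
    (hη01 : ∀ t, 0 ≤ η t ∧ η t ≤ 1) (hη1 : ∀ t, 1 ≤ t → η t = 1)
    (hη0 : ∀ t, 0 ≤ t → t < t₀ → η t = 0 ∧ deriv η t = 0) (hη1' : ∀ t, 1 < t → deriv η t = 0)
    (hη : ∀ t, 0 ≤ t → ContDiffAt ℝ 1 η t ∧ |deriv η t| ≤ C ∧ |t * deriv η t| ≤ τ₁)
    (hl1 : lam * (B + CD) ≤ a * (β + 1)) (hl2 : lam / t₀ < δ)
    (hl3 : lam * (B / t₀ + C * B + CD / t₀) + τ₁ * (2 * L * B) ≤ τ₂)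
    (hd1 : DifferentiableAt ℝ r₁ x) (hd2 : DifferentiableAt ℝ r₂ x)
    (hdm : DifferentiableAt ℝ m x) (hdω : DifferentiableAt ℝ ω x)
    (hL1 : ‖fderiv ℝ r₁ x‖ ≤ L) (hL2 : ‖fderiv ℝ r₂ x‖ ≤ L) (hvB : ‖v‖ ≤ B)
    (hX : r₁ x + r₂ x < δ → a ≤ fderiv ℝ r₁ x v ∧ a ≤ fderiv ℝ r₂ x v) (hD : |D| ≤ CD)
    (hpos : 0 < r₁ x + r₂ x) (hm0 : 0 ≤ m x) (hml : m x ≤ lam) (hω0 : 0 ≤ ω x)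
    (hm' : ‖fderiv ℝ m x‖ ≤ lam) (hω' : m x * ‖fderiv ℝ ω x‖ ≤ lam * ω x) (hn : 1 ≤ n)
    (hCS : ∀ y, deriv Real.smoothTransition y ≤ CS)
    (hpω : 0 ≤ hardyDensity β η r₁ r₂ m ω x ∧ hardyDensity β η r₁ r₂ m ω x ≤ ω x)
    (hpsmall : hardyDensity β η r₁ r₂ m ω x ≠ 0 → r₁ x + r₂ x < δ)
    (hdQ : DifferentiableAt ℝ
      (fun x => interiorCutoff r₁ r₂ n x * hardyDensity β η r₁ r₂ m ω x) x) :
    (if r₁ x + r₂ x < m x then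
      a * (β + 1) * (interiorCutoff r₁ r₂ n x * (ω x * (r₁ x + r₂ x) ^ β)) else 0) ≤
      fderiv ℝ (fun x => interiorCutoff r₁ r₂ n x * hardyDensity β η r₁ r₂ m ω x) x v +
        interiorCutoff r₁ r₂ n x * hardyDensity β η r₁ r₂ m ω x * D +
        ((if r₁ x + r₂ x < m x then 0 else τ₂ * (ω x * (r₁ x + r₂ x) ^ β)) +
          4 * CS * B / n * ω x) := by
  have hB : 0 ≤ B := (norm_nonneg _).trans hvB
  have hCS0 : 0 ≤ CS := (deriv_smoothTransition_nonneg 0).trans (hCS 0)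
  have hbd : ∀ (A : Space d →L[ℝ] ℝ) (k : ℝ), ‖A‖ ≤ k → |A v| ≤ k * B := fun A k hA => by
    refine (ContinuousLinearMap.le_opNorm A v).trans ?_
    have : 0 ≤ k := (norm_nonneg _).trans hA
    gcongr
  have ht : 0 ≤ m x / (r₁ x + r₂ x) := div_nonneg hm0 hpos.le
  have hdp := hasDerivAt_hardy_density (β := β) (η := η)
    ((hd1.hasFDerivAt.hasDerivAt_line v).fun_add (hd2.hasFDerivAt.hasDerivAt_line v))
    (hdm.hasFDerivAt.hasDerivAt_line v) (hdω.hasFDerivAt.hasDerivAt_line v)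
    (by simpa using hpos)
    (by
      simp only [zero_smul, add_zero]
      exact (hη _ ht).1.differentiableAt one_ne_zero)
  simp only [zero_smul, add_zero] at hdp
  have hb1 := hbd _ _ hL1
  have hb2 := hbd _ _ hL2
  have hω'' : m x * |fderiv ℝ ω x v| ≤ lam * B * ω x := by
    calc m x * |fderiv ℝ ω x v| ≤ m x * (‖fderiv ℝ ω x‖ * B) := by
          gcongr
          exact hbd _ _ le_rfl
      _ = m x * ‖fderiv ℝ ω x‖ * B := by ring
      _ ≤ lam * ω x * B := by gcongr
      _ = _ := by ring
  have hpw := hardy_pointwise (D := D) (η₀ := η (m x / (r₁ x + r₂ x)))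
    (η₁ := deriv η (m x / (r₁ x + r₂ x))) (m' := fderiv ℝ m x v)
    (ω' := fderiv ℝ ω x v) (b := fderiv ℝ r₁ x v + fderiv ℝ r₂ x v)
    (B := B) (L := L) hβ hω0 hpos hm0 hml hlam ha hB hCD hC hL ht₀
    (fun h => by have := hX h; linarith) ((abs_add_le _ _).trans (by linarith)) hD
    (hbd _ _ hm') hω'' ht₀1 (hη01 _) (fun h => ⟨hη1 _ h.le, hη1' _ h⟩)
    (fun h => hη0 _ ht h) (hη _ ht).2.1 (hη _ ht).2.2 hl1 hl2 hl3
  generalize fderiv ℝ ω x v * (r₁ x + r₂ x) ^ (β + 1) * η (m x / (r₁ x + r₂ x)) +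
      ω x * ((β + 1) * (r₁ x + r₂ x) ^ β * (fderiv ℝ r₁ x v + fderiv ℝ r₂ x v)) *
        η (m x / (r₁ x + r₂ x)) +
      ω x * (r₁ x + r₂ x) ^ (β + 1) * (deriv η (m x / (r₁ x + r₂ x)) *
        ((fderiv ℝ m x v - m x / (r₁ x + r₂ x) * (fderiv ℝ r₁ x v + fderiv ℝ r₂ x v)) /
          (r₁ x + r₂ x))) = p' at hdp hpw
  obtain ⟨ϑ', hϑ', hϑge⟩ := interiorCutoff_fderiv_ge hn hCS hvB hd1 hd2
  obtain ⟨hϑ0, hϑ1⟩ := interiorCutoff_mem_Icc r₁ r₂ n x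
  have hQ' := (hdQ.hasFDerivAt.hasDerivAt_line v).unique (hϑ'.fun_mul hdp)
  simp only [zero_smul, add_zero] at hQ'
  rw [hQ']
  have hbase : 0 ≤ ω x * (r₁ x + r₂ x) ^ β :=
    mul_nonneg hω0 (Real.rpow_pos_of_pos hpos _).le
  have hτ₂ : 0 ≤ τ₂ := by
    have : 0 ≤ τ₁ := (abs_nonneg _).trans (hη _ ht).2.2
    refine le_trans ?_ hl3
    positivity
  change _ ≤ ϑ' * hardyDensity β η r₁ r₂ m ω x + _ + _ + _
  change _ ≤ p' + hardyDensity β η r₁ r₂ m ω x * D at hpw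
  -- The derivative of the cutoff is multiplied by the density, which is nonzero only for μ < δ.
  -- There the field is transversal for both states, so the one-sided bound of the cutoff derivative
  -- is available.
  have f1 : -(4 * CS * B / n * ω x) ≤ ϑ' * hardyDensity β η r₁ r₂ m ω x := by
    by_cases hp0 : hardyDensity β η r₁ r₂ m ω x = 0
    · rw [hp0, mul_zero, Left.neg_nonpos_iff]
      positivity
    · obtain ⟨h1, h2⟩ := hX (hpsmall hp0)
      have h3 := hϑge (ha.le.trans h1) (ha.le.trans h2)
      have h4 : 0 ≤ 4 * CS * B / n := by positivity
      linarith [mul_le_mul_of_nonneg_right h3 hpω.1, mul_le_mul_of_nonneg_left hpω.2 h4]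
  have f2 := mul_le_mul_of_nonneg_left hpw hϑ0
  have f3 : interiorCutoff r₁ r₂ n x * (τ₂ * (ω x * (r₁ x + r₂ x) ^ β)) ≤
      τ₂ * (ω x * (r₁ x + r₂ x) ^ β) := mul_le_of_le_one_left (by positivity) hϑ1
  have f4 : 0 ≤ τ₂ * (ω x * (r₁ x + r₂ x) ^ β) := by positivity
  split_ifs at f2 ⊢ <;> linarith

/-- A Hardy type inequality: for slowly varying `m` and `ω`, the mass of `ω μ^β` in the boundary
layer `{μ < m}`, where `μ = r₁ + r₂`, is a small part of the mass outside of it. -/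
theorem exists_hardy_constant (d : ℕ) {β : ℝ} (hβ : -1 < β) (L B K : ℝ≥0) {a δ τ : ℝ} (ha : 0 < a)
    (hδ : 0 < δ) (hτ : 0 < τ) :
    ∃ lam > 0, ∀ (r₁ r₂ : Space d → ℝ) (X : Space d → Space d) (m ω : Space d → ℝ),
      LipschitzWith L r₁ → LipschitzWith L r₂ → LipschitzWith K X → (∀ x, ‖X x‖ ≤ B) →
      (∀ᵐ x, x ∈ gasDomain r₁ ∩ gasDomain r₂ → r₁ x + r₂ x < δ →
        a ≤ fderiv ℝ r₁ x (X x) ∧ a ≤ fderiv ℝ r₂ x (X x)) →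
      LocallyLipschitzOn (gasDomain r₁ ∩ gasDomain r₂) m →
      LocallyLipschitzOn (gasDomain r₁ ∩ gasDomain r₂) ω →
      (∀ x ∈ gasDomain r₁ ∩ gasDomain r₂, 0 ≤ m x ∧ m x ≤ lam ∧ 0 ≤ ω x) →
      (∀ᵐ x, x ∈ gasDomain r₁ ∩ gasDomain r₂ →
        ‖fderiv ℝ m x‖ ≤ lam ∧ m x * ‖fderiv ℝ ω x‖ ≤ lam * ω x) →
      IntegrableOn ω (gasDomain r₁ ∩ gasDomain r₂) →
      ∫⁻ x in gasDomain r₁ ∩ gasDomain r₂ ∩ {x | r₁ x + r₂ x < m x},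
          ENNReal.ofReal (ω x * (r₁ x + r₂ x) ^ β) ≤
        ENNReal.ofReal τ * ∫⁻ x in gasDomain r₁ ∩ gasDomain r₂ ∩ {x | m x ≤ r₁ x + r₂ x},
          ENNReal.ofReal (ω x * (r₁ x + r₂ x) ^ β) := by
  have hγ : 0 < β + 1 := by linarith
  -- The layer appears below with the factor a(β+1) and its complement with τ₂; the quotient is the
  -- desired τ.
  set τ₂ : ℝ := τ * (a * (β + 1)) with hτ₂
  have hτ₂0 : 0 < τ₂ := by positivity
  -- With this slope the error from the logarithmic cutoff, bounded by τ₁ · 2LB, takes less than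
  -- half of τ₂; the remainder is left for the terms of size lam. As t₀ and C depend on τ₁, lam has
  -- to be chosen last.
  set τ₁ : ℝ := τ₂ / (2 * (2 * L * B + 1)) with hτ₁
  obtain ⟨η, t₀, C, ht₀, ht₀1, hC, hη01, hη1, hη0, hη1', hη⟩ :=
    exists_log_cutoff (τ := τ₁) (by positivity)
  obtain ⟨CS, hCS, hS⟩ := exists_deriv_smoothTransition_le
  set CD : ℝ := d * K
  obtain ⟨lam, hlam, hl1, hl2, hl3, hl4⟩ : ∃ lam : ℝ, 0 < lam ∧ lam * (B + CD) ≤ a * (β + 1) ∧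
      lam / t₀ < δ ∧ lam * (B / t₀ + C * B + CD / t₀) + τ₁ * (2 * L * B) ≤ τ₂ ∧ lam / t₀ ≤ 1 := by
    have hsmall : τ₁ * (2 * L * B) < τ₂ := by
      rw [hτ₁, div_mul_eq_mul_div, div_lt_iff₀ (by positivity)]
      have : (0 : ℝ) ≤ 2 * L * B := by positivity
      nlinarith
    have e : ∀ (f : ℝ → ℝ) (y : ℝ), Continuous f → f 0 < y → ∀ᶠ l in 𝓝[>] (0 : ℝ), f l < y :=
      fun f y hf h => ((hf.tendsto 0).eventually (gt_mem_nhds h)).filter_mono nhdsWithin_le_nhds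
    have e1 := e (fun l => l * (B + CD)) (a * (β + 1)) (by fun_prop) (by simp; positivity)
    have e2 := e (fun l => l / t₀) (min δ 1) (by fun_prop) (by simp [hδ])
    have e3 := e (fun l => l * (B / t₀ + C * B + CD / t₀) + τ₁ * (2 * L * B)) τ₂ (by fun_prop)
      (by simpa using hsmall)
    obtain ⟨l, h1, h2, h3, h4⟩ := (e1.and (e2.and (e3.and self_mem_nhdsWithin))).exists
    exact ⟨l, h4, h1.le, h2.trans_le (min_le_left _ _), h3.le, h2.le.trans (min_le_right _ _)⟩
  refine ⟨lam, hlam, fun r₁ r₂ X m ω h₁ h₂ hX hXB hXa hm hω hmω hder hint => ?_⟩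
  set U := gasDomain r₁ ∩ gasDomain r₂ with hU
  have hUo : IsOpen U := (isOpen_gasDomain h₁.continuous).inter (isOpen_gasDomain h₂.continuous)
  have hμpos : ∀ x ∈ U, 0 < r₁ x + r₂ x := fun x hx => add_pos hx.1 hx.2
  set p : Space d → ℝ := hardyDensity β η r₁ r₂ m ω with hp
  have hpω : ∀ x ∈ U, 0 ≤ p x ∧ p x ≤ ω x := by
    intro x hx
    have hpos := hμpos x hx
    have hω0 := (hmω x hx).2.2
    have hpw : 0 < (r₁ x + r₂ x) ^ (β + 1) := Real.rpow_pos_of_pos hpos _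
    refine ⟨mul_nonneg (by positivity) (hη01 _).1, ?_⟩
    -- Where η does not vanish, μ ≤ lam/t₀ ≤ 1, which is the purpose of the last condition on lam.
    -- The density is then bounded by ω, whose integrability disposes of the cutoff at infinity.
    by_cases ht : m x / (r₁ x + r₂ x) < t₀
    · simp only [hp, hardyDensity]
      rw [(hη0 _ (div_nonneg (hmω x hx).1 hpos.le) ht).1, mul_zero]
      exact hω0
    · have h1 : r₁ x + r₂ x ≤ 1 := by
        rw [not_lt, le_div_iff₀ hpos] at ht
        refine le_trans ?_ hl4
        rw [le_div_iff₀ ht₀]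
        linarith [(hmω x hx).2.1]
      have h2 : (r₁ x + r₂ x) ^ (β + 1) ≤ 1 := Real.rpow_le_one hpos.le h1 hγ.le
      calc p x ≤ ω x * 1 * 1 := by
            simp only [hp, hardyDensity]
            gcongr
            · exact (hη01 _).1
            · exact (hη01 _).2
        _ = ω x := by ring
  have hpsmall : ∀ x ∈ U, p x ≠ 0 → r₁ x + r₂ x < δ := by
    intro x hx hpx
    have hpos := hμpos x hx
    have ht : ¬ m x / (r₁ x + r₂ x) < t₀ := fun ht => hpx (by
      simp only [hp, hardyDensity]
      rw [(hη0 _ (div_nonneg (hmω x hx).1 hpos.le) ht).1, mul_zero])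
    rw [not_lt, le_div_iff₀ hpos] at ht
    refine lt_of_le_of_lt ?_ hl2
    rw [le_div_iff₀ ht₀]
    linarith [(hmω x hx).2.1]
  have hpL : LocallyLipschitzOn U p := by
    have hμ : LocallyLipschitzOn U fun x => r₁ x + r₂ x :=
      h₁.locallyLipschitz.locallyLipschitzOn.vec_add h₂.locallyLipschitz.locallyLipschitzOn
    refine (hω.real_mul (hμ.comp_contDiffAt (H := fun y => y ^ (β + 1)) fun x hx =>
      Real.contDiffAt_rpow_const_of_ne (hμpos x hx).ne')).real_mul
      ((hm.real_div hμ fun x hx => (hμpos x hx).ne').comp_contDiffAt fun x hx =>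
        (hη _ (div_nonneg (hmω x hx).1 (hμpos x hx).le)).1)
  -- the inequality with an additional cutoff
  have hn : ∀ n : ℝ, 1 ≤ n →
      ENNReal.ofReal (a * (β + 1)) * ∫⁻ x in U ∩ {x | r₁ x + r₂ x < m x},
        ENNReal.ofReal (interiorCutoff r₁ r₂ n x * (ω x * (r₁ x + r₂ x) ^ β)) ≤
      ENNReal.ofReal τ₂ * (∫⁻ x in U ∩ {x | m x ≤ r₁ x + r₂ x},
          ENNReal.ofReal (ω x * (r₁ x + r₂ x) ^ β)) +
        ENNReal.ofReal (4 * CS * B / n) * ∫⁻ x in U, ENNReal.ofReal (ω x) := by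
    intro n hn
    have hn0 : 0 < n := by linarith
    set Q : Space d → ℝ := fun x => interiorCutoff r₁ r₂ n x * p x with hQ
    have hϑL := locallyLipschitz_interiorCutoff h₁ h₂ n
    have hQ0 : ∀ x, x ∉ U → Q =ᶠ[𝓝 x] fun _ => 0 := fun x hx => by
      filter_upwards [interiorCutoff_eventually_eq_zero h₁.continuous h₂.continuous hn0 hx]
        with y hy
      simp [hQ, hy]
    have hQL : LocallyLipschitz Q := by
      intro x
      by_cases hx : x ∈ U
      · have hQU : LocallyLipschitzOn U Q := hϑL.locallyLipschitzOn.real_mul hpL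
        obtain ⟨K', t, ht, hK'⟩ := hQU hx
        exact ⟨K', t, by rwa [hUo.nhdsWithin_eq hx] at ht, hK'⟩
      · exact ⟨0, _, hQ0 x hx, fun y hy z hz => by simp [show Q y = 0 from hy, show Q z = 0 from hz]⟩
    have hYL : LocallyLipschitzOn univ fun x => Q x • X x :=
      hQL.locallyLipschitzOn.real_smul hX.locallyLipschitz.locallyLipschitzOn
    have hY0 : ∀ x : Space d, 2 * n < ‖x‖ → Q x • X x = 0 := fun x hx => by
      simp [hQ, interiorCutoff_eq_zero hn0 hx]
    obtain ⟨KY, hKY⟩ := exists_lipschitzOnWith_of_vanishing isClosed_univ hYL fun x _ => hY0 x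
    obtain ⟨hWint, hW0⟩ := integral_divergence_eq_zero (lipschitzOnWith_univ.1 hKY)
      (HasCompactSupport.intro (isCompact_closedBall 0 (2 * n)) fun x hx => hY0 x (by simpa using hx))
    set W := divergence fun x => Q x • X x with hW
    have hWU : ∫ x in U, W x = 0 := by
      rw [← hW0]
      refine setIntegral_eq_integral_of_forall_compl_eq_zero fun x hx => ?_
      have : (fun x => Q x • X x) =ᶠ[𝓝 x] fun _ => 0 := by
        filter_upwards [hQ0 x hx] with y hy
        simp [hy]
      simp [hW, divergence, this.fderiv_eq]
    set S : Set (Space d) := U ∩ {x | r₁ x + r₂ x < m x} with hS_def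
    have hSm : IsOpen S := by
      have : ContinuousOn (fun x => m x - (r₁ x + r₂ x)) U :=
        hm.continuousOn.sub (h₁.continuous.add h₂.continuous).continuousOn
      convert! this.isOpen_inter_preimage hUo isOpen_Ioi (t := Ioi 0) using 2
      ext x
      simp
    set R : Space d → ℝ := fun x => Sᶜ.indicator (fun x => τ₂ * (ω x * (r₁ x + r₂ x) ^ β)) x +
      4 * CS * B / n * ω x with hR
    have hRite : ∀ x ∈ U, R x = (if r₁ x + r₂ x < m x then 0 else τ₂ * (ω x * (r₁ x + r₂ x) ^ β)) +
        4 * CS * B / n * ω x := fun x hx => by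
      simp only [hR]
      by_cases hlt : r₁ x + r₂ x < m x
      · rw [indicator_of_notMem (by simp [hS_def, hx, hlt]), if_pos hlt]
      · rw [indicator_of_mem (show x ∈ Sᶜ from fun h => hlt h.2), if_neg hlt]
    have hbase0 : ∀ x ∈ U, 0 ≤ ω x * (r₁ x + r₂ x) ^ β := fun x hx =>
      mul_nonneg (hmω x hx).2.2 (Real.rpow_pos_of_pos (hμpos x hx) _).le
    have hae : ∀ᵐ x, x ∈ U → (if r₁ x + r₂ x < m x then a * (β + 1) *
        (interiorCutoff r₁ r₂ n x * (ω x * (r₁ x + r₂ x) ^ β)) else 0) ≤ W x + R x := by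
      filter_upwards [h₁.ae_differentiableAt (μ := volume), h₂.ae_differentiableAt (μ := volume),
        ae_differentiableAt_of_locallyLipschitzOn (μ := volume) hUo hm,
        ae_differentiableAt_of_locallyLipschitzOn (μ := volume) hUo hω,
        ae_differentiableAt_of_locallyLipschitzOn (μ := volume) isOpen_univ
          (hQL.locallyLipschitzOn (s := univ)),
        hX.ae_differentiableAt (μ := volume), hXa, hder] with x hd1 hd2 hdm hdω hdQ hdX hXa hder hx
      obtain ⟨hm0, hml, hω0⟩ := hmω x hx
      obtain ⟨hm', hω'⟩ := hder hx
      have hdX' : |divergence X x| ≤ CD := (abs_divergence_le X x).trans (by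
        simp only [CD]
        gcongr
        exact norm_fderiv_le_of_lipschitz ℝ hX)
      have hWx : W x = fderiv ℝ Q x (X x) + Q x * divergence X x :=
        divergence_smul (hdQ (mem_univ _)) hdX
      rw [hWx, hRite x hx]
      exact hardyDensity_cutoff_fderiv_ge hβ ha hlam hC L.coe_nonneg ht₀ ht₀1 (by positivity) hη01 hη1
        hη0 hη1' hη hl1 hl2 hl3 hd1 hd2 (hdm hx) (hdω hx) (norm_fderiv_le_of_lipschitz ℝ h₁)
        (norm_fderiv_le_of_lipschitz ℝ h₂) (hXB x) (hXa hx) hdX' (hμpos x hx) hm0 hml hω0 hm' hω' hn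
        hS (hpω x hx) (hpsmall x hx) (hdQ (mem_univ _))
    have hcω : ContinuousOn ω U := hω.continuousOn
    have hcb : ContinuousOn (fun x => ω x * (r₁ x + r₂ x) ^ β) U :=
      hcω.mul ((h₁.continuous.add h₂.continuous).continuousOn.rpow_const
        fun x hx => Or.inl (hμpos x hx).ne')
    have hRm : AEStronglyMeasurable R (volume.restrict U) :=
      (((continuousOn_const.mul hcb).aestronglyMeasurable hUo.measurableSet).indicator
        hSm.measurableSet.compl).add
        ((continuousOn_const.mul hcω).aestronglyMeasurable hUo.measurableSet)
    have hk0 : 0 ≤ 4 * CS * B / n := by positivity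
    have hR0 : ∀ x ∈ U, 0 ≤ R x := fun x hx => by
      have := hbase0 x hx
      have := (hmω x hx).2.2
      rw [hRite x hx]
      split_ifs <;> positivity
    have hUS : U ∩ {x | m x ≤ r₁ x + r₂ x} = Sᶜ ∩ U := by
      ext x
      simp only [hS_def, mem_inter_iff, mem_ofPred_eq, mem_compl_iff, not_and, not_lt]
      tauto
    have hlR : ∫⁻ x in U, ENNReal.ofReal (R x) =
        ENNReal.ofReal τ₂ * (∫⁻ x in U ∩ {x | m x ≤ r₁ x + r₂ x},
          ENNReal.ofReal (ω x * (r₁ x + r₂ x) ^ β)) +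
        ENNReal.ofReal (4 * CS * B / n) * ∫⁻ x in U, ENNReal.ofReal (ω x) := by
      rw [hUS, ← Measure.restrict_restrict hSm.measurableSet.compl,
        ← lintegral_indicator hSm.measurableSet.compl,
        ← lintegral_const_mul'' _
          ((hcb.aemeasurable hUo.measurableSet).ennreal_ofReal.indicator hSm.measurableSet.compl),
        ← lintegral_const_mul'' _ (hcω.aemeasurable hUo.measurableSet).ennreal_ofReal,
        ← lintegral_add_left' (((hcb.aemeasurable hUo.measurableSet).ennreal_ofReal.indicator
          hSm.measurableSet.compl).const_mul _)]
      refine setLIntegral_congr_fun hUo.measurableSet fun x hx => ?_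
      have h1 := hbase0 x hx
      have h2 := (hmω x hx).2.2
      simp only [hR]
      by_cases hxS : x ∈ Sᶜ
      · rw [indicator_of_mem hxS, indicator_of_mem hxS, ← ENNReal.ofReal_mul hτ₂0.le,
          ← ENNReal.ofReal_mul hk0, ← ENNReal.ofReal_add (by positivity) (by positivity)]
      · rw [indicator_of_notMem hxS, indicator_of_notMem hxS, ← ENNReal.ofReal_mul hk0]
        simp
    rw [← hlR, ← lintegral_const_mul' _ _ ENNReal.ofReal_ne_top]
    have hae' : ∀ᵐ x ∂volume.restrict U, 0 ≤ W x + R x := by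
      rw [ae_restrict_iff' hUo.measurableSet]
      filter_upwards [hae] with x hx hxU
      refine le_trans ?_ (hx hxU)
      have := hbase0 x hxU
      have := (interiorCutoff_mem_Icc r₁ r₂ n x).1
      split_ifs <;> positivity
    calc _ ≤ ∫⁻ x in U ∩ {x | r₁ x + r₂ x < m x}, ENNReal.ofReal (W x + R x) := by
          refine lintegral_mono_ae ?_
          rw [ae_restrict_iff' hSm.measurableSet]
          filter_upwards [hae] with x hx hxU
          rw [← ENNReal.ofReal_mul (by positivity)]
          have := hx hxU.1
          rw [if_pos (show r₁ x + r₂ x < m x from hxU.2)] at this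
          exact ENNReal.ofReal_le_ofReal this
      _ ≤ ∫⁻ x in U, ENNReal.ofReal (W x + R x) := lintegral_mono_set inter_subset_left
      _ ≤ ∫⁻ x in U, ENNReal.ofReal (R x) := by
          -- If the right side is infinite there is nothing to prove. Otherwise W and R are
          -- integrable, and W drops out because it is the divergence of a compactly supported
          -- Lipschitz field.
          by_cases hRtop : ∫⁻ x in U, ENNReal.ofReal (R x) = ∞
          · rw [hRtop]; exact le_top
          have hRae : ∀ᵐ x ∂volume.restrict U, 0 ≤ R x :=
            (ae_restrict_iff' hUo.measurableSet).2 (Filter.Eventually.of_forall hR0)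
          have hRint : Integrable R (volume.restrict U) :=
            (lintegral_ofReal_ne_top_iff_integrable hRm hRae).1 hRtop
          have hadd : Integrable (fun x => W x + R x) (volume.restrict U) :=
            hWint.integrableOn.add hRint
          rw [← ofReal_integral_eq_lintegral_ofReal hadd hae',
            ← ofReal_integral_eq_lintegral_ofReal hRint hRae]
          refine ENNReal.ofReal_le_ofReal (le_of_eq ?_)
          have := integral_add (μ := volume.restrict U) hWint.integrableOn hRint
          rw [this, hWU, zero_add]
  -- removing the cutoff
  set I := ∫⁻ x in U ∩ {x | m x ≤ r₁ x + r₂ x}, ENNReal.ofReal (ω x * (r₁ x + r₂ x) ^ β) with hI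
  set J := ∫⁻ x in U, ENNReal.ofReal (ω x) with hJ
  have hJtop : J ≠ ∞ := by
    refine ne_of_lt (lt_of_le_of_lt (lintegral_mono fun x => ?_) hint.2)
    exact Real.ofReal_le_enorm _
  have hcb : ContinuousOn (fun x => ω x * (r₁ x + r₂ x) ^ β) U :=
    hω.continuousOn.mul ((h₁.continuous.add h₂.continuous).continuousOn.rpow_const
      fun x hx => Or.inl (hμpos x hx).ne')
  have hSsub : U ∩ {x | r₁ x + r₂ x < m x} ⊆ U := inter_subset_left
  have hfatou : ∫⁻ x in U ∩ {x | r₁ x + r₂ x < m x}, ENNReal.ofReal (ω x * (r₁ x + r₂ x) ^ β) ≤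
      Filter.liminf (fun n : ℕ => ∫⁻ x in U ∩ {x | r₁ x + r₂ x < m x},
        ENNReal.ofReal (interiorCutoff r₁ r₂ (n + 1) x * (ω x * (r₁ x + r₂ x) ^ β)))
        Filter.atTop := by
    refine le_trans (lintegral_mono_ae ?_) (lintegral_liminf_le' fun n => ?_)
    · have hUae : ∀ᵐ x ∂volume.restrict (U ∩ {x | r₁ x + r₂ x < m x}), x ∈ U :=
        ae_mono (Measure.restrict_mono hSsub le_rfl) (ae_restrict_mem hUo.measurableSet)
      filter_upwards [hUae] with x hx
      have h1 : Filter.Tendsto (fun n : ℕ => ENNReal.ofReal (interiorCutoff r₁ r₂ (n + 1) x *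
          (ω x * (r₁ x + r₂ x) ^ β))) Filter.atTop
          (𝓝 (ENNReal.ofReal (1 * (ω x * (r₁ x + r₂ x) ^ β)))) :=
        ENNReal.tendsto_ofReal ((tendsto_interiorCutoff hx).mul_const _)
      rw [h1.liminf_eq, one_mul]
    · have : ContinuousOn (fun x => interiorCutoff r₁ r₂ (n + 1) x *
          (ω x * (r₁ x + r₂ x) ^ β)) U :=
        (locallyLipschitz_interiorCutoff h₁ h₂ _).continuous.continuousOn.mul hcb
      exact ((this.aemeasurable hUo.measurableSet).mono_measure
        (Measure.restrict_mono hSsub le_rfl)).ennreal_ofReal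
  -- The cutoff error is of order 1/n times J, the integral of ω. It disappears because J is finite,
  -- whether or not I is finite.
  have hlim : Filter.Tendsto (fun n : ℕ => ENNReal.ofReal τ₂ * I +
      ENNReal.ofReal (4 * CS * B / ((n : ℝ) + 1)) * J) Filter.atTop (𝓝 (ENNReal.ofReal τ₂ * I)) := by
    have h1 : Filter.Tendsto (fun n : ℕ => 4 * CS * B / ((n : ℝ) + 1)) Filter.atTop (𝓝 0) :=
      tendsto_const_nhds.div_atTop
        (Filter.tendsto_atTop_add_const_right _ _ tendsto_natCast_atTop_atTop)
    have h2 := ENNReal.Tendsto.mul_const (ENNReal.tendsto_ofReal h1) (Or.inr hJtop)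
    simpa using tendsto_const_nhds.add h2
  have hkey : ENNReal.ofReal (a * (β + 1)) * ∫⁻ x in U ∩ {x | r₁ x + r₂ x < m x},
      ENNReal.ofReal (ω x * (r₁ x + r₂ x) ^ β) ≤ ENNReal.ofReal τ₂ * I := by
    have hA : ENNReal.ofReal (a * (β + 1)) ≠ 0 := by simpa using by positivity
    rw [mul_comm, ← ENNReal.le_div_iff_mul_le (Or.inl hA) (Or.inl ENNReal.ofReal_ne_top)]
    refine hfatou.trans ?_
    rw [← (ENNReal.Tendsto.div_const hlim (Or.inr hA)).liminf_eq]
    refine Filter.liminf_le_liminf (Filter.Eventually.of_forall fun n => ?_)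
    rw [ENNReal.le_div_iff_mul_le (Or.inl hA) (Or.inl ENNReal.ofReal_ne_top), mul_comm]
    exact hn (n + 1) (by linarith [(Nat.cast_nonneg n : (0 : ℝ) ≤ n)])
  rw [hτ₂, ENNReal.ofReal_mul hτ.le, mul_comm (ENNReal.ofReal τ), mul_assoc] at hkey
  rwa [ENNReal.mul_le_mul_iff_right (by simpa using by positivity) ENNReal.ofReal_ne_top] at hkey

end HardyInequality

/-! ### From a pointwise balance law to an integral inequality in time. -/

section Transport

variable {d : ℕ}

/-- The integrated form of a differential inequality `∂ₜ f + ∇ · Y ≤ g`. -/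
theorem integral_le_of_transport {T : ℝ} {f : ℝ × Space d → ℝ} {Y : ℝ → Space d → Space d}
    {K : ℝ≥0} {R : ℝ} (hf : LipschitzOnWith K f (Icc 0 T ×ˢ univ))
    (hfR : ∀ t ∈ Icc 0 T, ∀ x, R < ‖x‖ → f (t, x) = 0)
    (hY : ∀ t ∈ Ioo 0 T, (∃ K', LipschitzWith K' (Y t)) ∧ HasCompactSupport (Y t))
    {G : ℝ → ℝ} (hG : Continuous G)
    (h : ∀ᵐ s, s ∈ Ioo 0 T → ∃ g : Space d → ℝ, Integrable g ∧
      (∀ᵐ x, deriv (fun t => f (t, x)) s + divergence (Y s) x ≤ g x) ∧ ∫ x, g x ≤ G s)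
    {t : ℝ} (ht : t ∈ Icc 0 T) :
    ∫ x, f (t, x) ≤ (∫ x, f (0, x)) + ∫ s in (0 : ℝ)..t, G s := by
  have hT : 0 ≤ T := ht.1.trans ht.2
  set B := Metric.closedBall (0 : Space d) R
  have hBfin : volume B < ∞ := (isCompact_closedBall _ _).measure_lt_top
  have hcont : ∀ s ∈ Icc 0 T, Continuous fun x => f (s, x) := fun s hs =>
    hf.continuousOn.comp_continuous (by fun_prop) fun x => ⟨hs, mem_univ _⟩
  have hsupp : ∀ s ∈ Icc 0 T, HasCompactSupport fun x => f (s, x) := fun s hs =>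
    HasCompactSupport.intro (isCompact_closedBall 0 R) fun x hx => hfR s hs x (by simpa using hx)
  have hint : ∀ s ∈ Icc 0 T, Integrable fun x => f (s, x) := fun s hs =>
    (hcont s hs).integrable_of_hasCompactSupport (hsupp s hs)
  have hbd : ∀ x, LipschitzOnWith (Real.nnabs (B.indicator (fun _ => (K : ℝ)) x))
      (fun s => f (s, x)) (Icc 0 T) := by
    intro x
    by_cases hx : x ∈ B
    · rw [indicator_of_mem hx, Real.nnabs_coe]
      refine LipschitzOnWith.of_dist_le_mul fun a ha b hb => ?_
      refine (hf.dist_le_mul _ ⟨ha, mem_univ x⟩ _ ⟨hb, mem_univ x⟩).trans (le_of_eq ?_)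
      rw [Prod.dist_eq, dist_self, max_eq_left dist_nonneg]
    · refine LipschitzOnWith.of_dist_le_mul fun a ha b hb => ?_
      have hx' : R < ‖x‖ := by simpa [B] using hx
      rw [hfR a ha x hx', hfR b hb x hx', dist_self]
      positivity
  have hBint : Integrable (B.indicator fun _ => (K : ℝ)) :=
    (integrable_indicator_iff Metric.isClosed_closedBall.measurableSet).2
      (integrableOn_const hBfin.ne)
  set y : ℝ → ℝ := fun s => ∫ x, f (s, x)
  have hyL : LipschitzOnWith (K * (volume B).toNNReal) y (Icc 0 T) := by
    refine LipschitzOnWith.of_dist_le_mul fun a ha b hb => ?_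
    rw [dist_eq_norm, ← integral_sub (hint a ha) (hint b hb)]
    have h1 : ∀ x, ‖f (a, x) - f (b, x)‖ ≤ B.indicator (fun _ => (K : ℝ)) x * dist a b := fun x => by
      have := (hbd x).dist_le_mul a ha b hb
      rw [dist_eq_norm, Real.coe_nnabs, abs_of_nonneg (indicator_nonneg (fun _ _ => K.coe_nonneg) _)]
        at this
      exact this
    refine (norm_integral_le_of_norm_le (hBint.mul_const _)
      (Filter.Eventually.of_forall h1)).trans (le_of_eq ?_)
    rw [integral_mul_const, integral_indicator_const _ Metric.isClosed_closedBall.measurableSet]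
    rw [NNReal.coe_mul, ENNReal.coe_toNNReal_eq_toReal, Measure.real, smul_eq_mul]
    ring
  have hae : ∀ᵐ s : ℝ, ∀ᵐ x : Space d, s ∈ Ioo 0 T → DifferentiableAt ℝ (fun t => f (t, x)) s := by
    refine Measure.ae_ae_of_ae_prod
      (p := fun p : ℝ × Space d => p.1 ∈ Ioo 0 T → DifferentiableAt ℝ (fun t => f (t, p.2)) p.1) ?_
    filter_upwards [hf.ae_differentiableWithinAt_of_mem (μ := volume.prod volume)] with p hp hpT
    have hd := (hp ⟨Ioo_subset_Icc_self hpT, mem_univ _⟩).differentiableAt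
      (prod_mem_nhds (Icc_mem_nhds hpT.1 hpT.2) Filter.univ_mem)
    have hc : DifferentiableAt ℝ (fun t : ℝ => (t, p.2)) p.1 := by fun_prop
    exact DifferentiableAt.comp (g := f) p.1 hd hc
  have hderiv : ∀ᵐ s : ℝ, s ∈ Icc 0 T → deriv y s ≤ G s := by
    have hne : ∀ᵐ s : ℝ, s ≠ 0 ∧ s ≠ T := by
      have h0 : ∀ a : ℝ, ∀ᵐ s : ℝ, s ≠ a := fun a => by simp [ae_iff]
      filter_upwards [h0 0, h0 T] with s hs hs' using ⟨hs, hs'⟩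
    filter_upwards [h, hae, hne] with s hs hsd hne hsT
    have hsT : s ∈ Ioo 0 T := ⟨lt_of_le_of_ne hsT.1 hne.1.symm, lt_of_le_of_ne hsT.2 hne.2⟩
    obtain ⟨g, hg, hgle, hgG⟩ := hs hsT
    obtain ⟨⟨K', hK'⟩, hYc⟩ := hY s hsT
    have hmeas : AEStronglyMeasurable (fun x => deriv (fun t => f (t, x)) s) := by
      -- The time variable is clamped to [0, T], where f is continuous. The clamped function is
      -- continuous everywhere and has the same time derivative at interior times, which gives
      -- measurability of that derivative in x.
      have hF : Continuous fun p : Space d × ℝ => f (max 0 (min T p.2), p.1) :=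
        hf.continuousOn.comp_continuous (by fun_prop) fun p =>
          ⟨⟨le_max_left _ _, max_le hT (min_le_left _ _)⟩, mem_univ _⟩
      have h1 : Measurable fun x : Space d => deriv (fun t => f (max 0 (min T t), x)) s :=
        (measurable_deriv_with_param (f := fun (x : Space d) (t : ℝ) => f (max 0 (min T t), x))
          hF).comp (measurable_id.prodMk measurable_const)
      refine h1.aestronglyMeasurable.congr (Filter.Eventually.of_forall fun x => ?_)
      refine Filter.EventuallyEq.deriv_eq ?_
      filter_upwards [Ioo_mem_nhds hsT.1 hsT.2] with t ht
      rw [min_eq_right ht.2.le, max_eq_right ht.1.le]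
    have hnhds : Icc 0 T ∈ 𝓝 s := Icc_mem_nhds hsT.1 hsT.2
    obtain ⟨hi, hd⟩ := hasDerivAt_integral_of_dominated_loc_of_lip (μ := volume)
      (F := fun s x => f (s, x)) hnhds
      (by filter_upwards [hnhds] with s hs using (hcont s hs).aestronglyMeasurable)
      (hint s (Ioo_subset_Icc_self hsT)) hmeas (Filter.Eventually.of_forall hbd) hBint
      (hsd.mono fun x hx => (hx hsT).hasDerivAt)
    obtain ⟨hdi, hd0⟩ := integral_divergence_eq_zero hK' hYc
    calc deriv y s = ∫ x, deriv (fun t => f (t, x)) s := hd.deriv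
      _ = ∫ x, (deriv (fun t => f (t, x)) s + divergence (Y s) x) := by
          rw [integral_add hi hdi, hd0, add_zero]
      _ ≤ ∫ x, g x := integral_mono_ae (hi.add hdi) hg hgle
      _ ≤ G s := hgG
  have hac : AbsolutelyContinuousOnInterval y 0 t := by
    refine (hyL.mono ?_).absolutelyContinuousOnInterval
    rw [uIcc_of_le ht.1]
    exact Icc_subset_Icc_right ht.2
  have hftc := hac.integral_deriv_eq_sub
  have hle : ∫ s in (0 : ℝ)..t, deriv y s ≤ ∫ s in (0 : ℝ)..t, G s := by
    refine intervalIntegral.integral_mono_ae_restrict ht.1 hac.intervalIntegrable_deriv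
      (hG.intervalIntegrable _ _) ?_
    filter_upwards [ae_restrict_of_ae hderiv, ae_restrict_mem measurableSet_Icc] with s hs hsI
    exact hs (Icc_subset_Icc_right ht.2 hsI)
  rw [hftc] at hle
  have : y t - y 0 ≤ ∫ s in (0 : ℝ)..t, G s := hle
  linarith

end Transport

/-! ### Construction of the angular profiles. -/

section Profile

/-- The angular profiles of the energy density `μ^(σ+1) g(z) + μ^σ b(z) |w|²` and of the flux
`μ^(σ+1) f(z) w`, where `σ = 1/κ`, `μ = r₁ + r₂`, `z = (r₁ - r₂) / μ` and `w = v₁ - v₂`. The two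
differential relations cancel all terms of the energy identity which lose derivatives. -/
structure EnergyProfile (κ : ℝ) where
  f : ℝ → ℝ
  g : ℝ → ℝ
  b : ℝ → ℝ
  z₀ : ℝ
  C : ℝ
  z₀_pos : 0 < z₀
  z₀_lt : z₀ < 1 / 4
  C_pos : 0 < C
  contDiff_f : ContDiff ℝ 1 f
  contDiff_g : ContDiff ℝ 1 g
  contDiff_b : ContDiff ℝ 1 b
  eq_zero : ∀ z, 1 / 2 < |z| → f z = 0 ∧ g z = 0 ∧ b z = 0
  rel_g : ∀ z, deriv g z = 2 * ((1 / κ + 1) * f z - z * deriv f z)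
  rel_b : ∀ z, (1 / κ + 1) * g z - z * deriv g z + 4 * b z = 2 * deriv f z
  f_le : ∀ z, |f z| ≤ C * |z|
  g_le : ∀ z, |g z| ≤ C * z ^ 2
  b_le : ∀ z, |b z| ≤ C
  deriv_b_le : ∀ z, |deriv b z| ≤ C
  defect_le : ∀ z, |f z - κ / 2 * (1 / κ + 1) * z * g z - κ / 2 * deriv g z * (1 - z ^ 2)| ≤ C * z ^ 2
  g_eq : ∀ z, |z| < 1 / 4 → g z = z ^ 2
  le_b : ∀ z, |z| ≤ z₀ → κ / 4 ≤ b z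

/-- The relations have a one-function family of solutions. With f = Φ' the first integrates to g =
2((σ+2)Φ - zΦ'), and the second then determines b = ((1 - z²)Φ'' + 2(σ+1) zΦ' - (σ+1)(σ+2)Φ)/2.
Taking Φ = κz²/2 near zero gives g = z², because κσ = 1, and b(0) = κ/2, the positivity behind
coercivity. Cutting Φ off gives the compact support. -/
theorem exists_energyProfile {κ : ℝ} (hκ : 0 < κ) : Nonempty (EnergyProfile κ) := by
  set σ := 1 / κ with hσ
  have hκσ : κ * σ = 1 := by rw [hσ]; field_simp
  have hσ0 : 0 < σ := by positivity
  -- The factor 16/3 makes the argument of the transition equal to 1 at |z| = 1/4 and 0 at |z| =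
  -- 1/2, so Φ is exactly quadratic for |z| ≤ 1/4 and vanishes for |z| ≥ 1/2.
  set Φ : ℝ → ℝ := fun z => κ / 2 * z ^ 2 * Real.smoothTransition ((1 / 4 - z ^ 2) * (16 / 3)) with hΦ
  have hΦ3 : ContDiff ℝ 3 Φ := by
    have : ContDiff ℝ 3 Real.smoothTransition := Real.smoothTransition.contDiff (n := 3)
    exact (contDiff_const.mul (contDiff_id.pow 2)).mul
      (this.comp ((contDiff_const.sub (contDiff_id.pow 2)).mul contDiff_const))
  have hΦd : ∀ z, HasDerivAt Φ (deriv Φ z) z := fun z =>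
    (hΦ3.differentiable (by norm_num) z).hasDerivAt
  have hf2 : ContDiff ℝ 2 (deriv Φ) := (contDiff_succ_iff_deriv (n := 2)).1 hΦ3 |>.2.2
  have hf1 : ContDiff ℝ 1 (deriv (deriv Φ)) := (contDiff_succ_iff_deriv (n := 1)).1 hf2 |>.2.2
  have hfd : ∀ z, HasDerivAt (deriv Φ) (deriv (deriv Φ) z) z := fun z =>
    (hf2.differentiable (by norm_num) z).hasDerivAt
  have hsupp : ∀ z, 1 / 2 < |z| → Φ =ᶠ[𝓝 z] fun _ => 0 := by
    intro z hz
    filter_upwards [continuous_abs.continuousAt.eventually (lt_mem_nhds hz)] with y hy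
    have : 1 / 4 < y ^ 2 := by rw [← sq_abs]; nlinarith
    simp only [hΦ]
    rw [Real.smoothTransition.zero_of_nonpos (by linarith), mul_zero]
  have hnear : ∀ z, |z| < 1 / 4 → Φ =ᶠ[𝓝 z] fun y => κ / 2 * y ^ 2 := by
    intro z hz
    filter_upwards [continuous_abs.continuousAt.eventually (gt_mem_nhds hz)] with y hy
    have : y ^ 2 ≤ 1 / 16 := by rw [← sq_abs]; nlinarith [abs_nonneg y]
    simp only [hΦ]
    rw [Real.smoothTransition.one_of_one_le (by linarith), mul_one]
  have hsq : ∀ z : ℝ, deriv (fun y : ℝ => κ / 2 * y ^ 2) z = κ * z := fun z => by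
    have := ((hasDerivAt_pow 2 z).const_mul (κ / 2)).deriv
    rw [this]; norm_num; ring
  have hnear1 : ∀ z, |z| < 1 / 4 → deriv Φ =ᶠ[𝓝 z] fun y => κ * y := fun z hz => by
    refine (hnear z hz).deriv.trans (Filter.Eventually.of_forall fun y => hsq y)
  have hnear2 : ∀ z, |z| < 1 / 4 → deriv (deriv Φ) z = κ := fun z hz => by
    rw [(hnear1 z hz).deriv_eq]
    simp
  set f := deriv Φ with hf
  set g : ℝ → ℝ := fun z => 2 * ((σ + 2) * Φ z - z * f z) with hg
  set b : ℝ → ℝ := fun z => 1 / 2 * ((1 - z ^ 2) * deriv f z + 2 * (σ + 1) * (z * f z) -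
    (σ + 1) * (σ + 2) * Φ z) with hb
  have hΦ1 : ContDiff ℝ 1 Φ := hΦ3.of_le (by norm_num)
  have hf1' : ContDiff ℝ 1 f := hf2.of_le (by norm_num)
  have hg1 : ContDiff ℝ 1 g :=
    contDiff_const.mul ((contDiff_const.mul hΦ1).sub (contDiff_id.mul hf1'))
  have hb1 : ContDiff ℝ 1 b :=
    contDiff_const.mul ((((contDiff_const.sub (contDiff_id.pow 2)).mul hf1).add
      (contDiff_const.mul (contDiff_id.mul hf1'))).sub (contDiff_const.mul hΦ1))
  have hgd : ∀ z, deriv g z = 2 * ((σ + 1) * f z - z * deriv f z) := fun z => by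
    have := ((((hΦd z).const_mul (σ + 2)).sub ((hasDerivAt_id z).mul (hfd z))).const_mul 2).deriv
    refine Eq.trans this ?_
    simp
    ring
  have hz : ∀ z, 1 / 2 < |z| → f =ᶠ[𝓝 z] fun _ => 0 := fun z hz =>
    (hsupp z hz).deriv.trans (Filter.Eventually.of_forall fun y => by simp)
  have hz' : ∀ z, 1 / 2 < |z| → Φ z = 0 ∧ f z = 0 ∧ deriv f z = 0 := fun z h =>
    ⟨(hsupp z h).self_of_nhds, (hz z h).self_of_nhds, by rw [(hz z h).deriv_eq]; simp⟩
  have hz0 : ∀ z, 1 / 2 < |z| → f z = 0 ∧ g z = 0 ∧ b z = 0 := fun z h => by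
    obtain ⟨h1, h2, h3⟩ := hz' z h
    simp [hg, hb, h1, h2, h3]
  have hbd0 : ∀ z, 1 / 2 < |z| → deriv b z = 0 := fun z h => by
    have : b =ᶠ[𝓝 z] fun _ => 0 := by
      filter_upwards [continuous_abs.continuousAt.eventually (lt_mem_nhds h)] with y hy
      exact (hz0 y hy).2.2
    rw [this.deriv_eq]; simp
  -- continuous functions which vanish for large `z` are bounded
  have hbdd : ∀ h : ℝ → ℝ, Continuous h → (∀ z, 1 / 2 < |z| → h z = 0) → ∃ C > 0, ∀ z, |h z| ≤ C := by
    intro h hc h0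
    obtain ⟨C, hC⟩ := isCompact_Icc.exists_bound_of_continuousOn (s := Icc (-(1 / 2) : ℝ) (1 / 2))
      hc.continuousOn
    have hC0 : 0 ≤ C := (norm_nonneg _).trans (hC 0 (by norm_num))
    refine ⟨C + 1, by positivity, fun z => ?_⟩
    by_cases hz : 1 / 2 < |z|
    · rw [h0 z hz, abs_zero]; positivity
    · have := hC z (abs_le.1 (not_lt.1 hz))
      rw [Real.norm_eq_abs] at this
      linarith
  have hc := hf1'.continuous
  have hc' : Continuous (deriv f) := hf1.continuous
  set e : ℝ → ℝ := fun z => f z - κ / 2 * (σ + 1) * z * g z - κ / 2 * deriv g z * (1 - z ^ 2) with he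
  have hec : Continuous e := by
    have : deriv g = fun z => 2 * ((σ + 1) * f z - z * deriv f z) := funext hgd
    have hgc := hg1.continuous
    simp only [he, this]
    fun_prop
  obtain ⟨Cf, hCf, hCf'⟩ := hbdd f hc fun z h => (hz0 z h).1
  obtain ⟨Cg, hCg, hCg'⟩ := hbdd g hg1.continuous fun z h => (hz0 z h).2.1
  obtain ⟨Cb, hCb, hCb'⟩ := hbdd b hb1.continuous fun z h => (hz0 z h).2.2
  obtain ⟨Cd, hCd, hCd'⟩ := hbdd (deriv b) (hb1.continuous_deriv le_rfl) hbd0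
  obtain ⟨Ce, hCe, hCe'⟩ := hbdd e hec fun z h => by
    obtain ⟨h1, h2, h3⟩ := hz' z h
    simp only [he]
    rw [hgd, h3, h2, (hz0 z h).2.1]
    ring
  have hg0 : ∀ z, |z| < 1 / 4 → g z = z ^ 2 := fun z h => by
    simp only [hg]
    rw [(hnear z h).self_of_nhds, (hnear1 z h).self_of_nhds]
    linear_combination z ^ 2 * hκσ
  -- The linear terms κz and (κ/2) g'(z) = κz of the defect cancel, so it is cubic near zero. This
  -- makes the term with the difference of the divergences quadratic in s.
  have he0 : ∀ z, |z| < 1 / 4 → e z = (κ - κ / 2 * (σ + 1)) * z ^ 3 := fun z h => by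
    simp only [he]
    rw [hgd, hg0 z h, (hnear1 z h).self_of_nhds, hnear2 z h]
    linear_combination (-z * (1 - z ^ 2) * κ) * hκσ
  obtain ⟨z₀, hz₀, hz₀', hbz⟩ : ∃ z₀ : ℝ, 0 < z₀ ∧ z₀ < 1 / 4 ∧ ∀ z, |z| ≤ z₀ → κ / 4 ≤ b z := by
    have hb0 : b 0 = κ / 2 := by
      simp only [hb]
      rw [(hnear 0 (by norm_num)).self_of_nhds, hnear2 0 (by norm_num)]
      norm_num
      ring
    have h1 : ∀ᶠ z in 𝓝 (0 : ℝ), κ / 4 < b z :=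
      hb1.continuous.continuousAt.eventually (lt_mem_nhds (by rw [hb0]; linarith))
    obtain ⟨ε, hε, h2⟩ := Metric.eventually_nhds_iff.1 h1
    refine ⟨min (ε / 2) (1 / 8), by positivity, (min_le_right _ _).trans_lt (by norm_num), fun z hz => (h2 ?_).le⟩
    rw [dist_zero_right, Real.norm_eq_abs]
    have := hz.trans (min_le_left _ _)
    linarith
  -- For |z| ≥ 1/4 the uniform bounds become multiples of |z| or z² at the price of the factors 4
  -- and 16; for |z| < 1/4 the explicit formulas apply.
  set C := 4 * Cf + κ + 16 * Cg + 1 + Cb + Cd + 16 * Ce + |κ - κ / 2 * (σ + 1)| with hC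
  have hCa : 0 ≤ |κ - κ / 2 * (σ + 1)| := abs_nonneg _
  refine ⟨⟨f, g, b, z₀, C, hz₀, hz₀', by positivity, hf1', hg1, hb1, hz0, hgd, fun z => ?_,
    fun z => ?_, fun z => ?_, fun z => (hCb' z).trans (by linarith),
    fun z => (hCd' z).trans (by linarith), fun z => ?_, hg0, hbz⟩⟩
  · simp only [hb, hgd]
    simp only [hg]
    ring
  · by_cases h : |z| < 1 / 4
    · rw [(hnear1 z h).self_of_nhds, abs_mul, abs_of_pos hκ]
      gcongr
      linarith
    · have := hCf' z
      have h2 : 4 * Cf * |z| ≤ C * |z| := by gcongr; linarith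
      nlinarith
  · by_cases h : |z| < 1 / 4
    · rw [hg0 z h, abs_of_nonneg (sq_nonneg z)]
      nlinarith [sq_nonneg z]
    · have := hCg' z
      have h1 : 1 / 16 ≤ z ^ 2 := by rw [← sq_abs]; nlinarith
      have h2 : 16 * Cg * z ^ 2 ≤ C * z ^ 2 := by gcongr; linarith
      nlinarith
  · by_cases h : |z| < 1 / 4
    · have h3 : |e z| ≤ C * z ^ 2 := by
        rw [he0 z h, abs_mul, abs_pow, pow_succ, sq_abs, ← mul_assoc]
        have : |κ - κ / 2 * (σ + 1)| * z ^ 2 * |z| ≤ |κ - κ / 2 * (σ + 1)| * z ^ 2 * 1 := by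
          gcongr; linarith
        have : |κ - κ / 2 * (σ + 1)| * z ^ 2 ≤ C * z ^ 2 := by gcongr; linarith
        linarith
      exact h3
    · have h3 : |e z| ≤ C * z ^ 2 := by
        have := hCe' z
        have h1 : 1 / 16 ≤ z ^ 2 := by rw [← sq_abs]; nlinarith
        have h2 : 16 * Ce * z ^ 2 ≤ C * z ^ 2 := by gcongr; linarith
        nlinarith
      exact h3

end Profile

/-! ### Algebra of the energy identity and bounds for its error terms. -/

section PointwiseEnergy

/-- The cancellation in the energy identity: all terms which are linear in `α = w · ∇s` and in
`β = w · ∇μ` drop out. Here `D` and `δ` are the sum and the difference of the divergences. -/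
theorem energy_identity {κ σ P μ s z α β δ D p W g g' f f' b b' s' μ' z' : ℝ}
    (hμ : μ ≠ 0) (hs : s = z * μ)
    (hs' : s' = -(β / 2) - κ / 2 * (μ * δ + s * D)) (hμ' : μ' = -(α / 2) - κ / 2 * (μ * D + s * δ))
    (hz' : z' = (s' - z * μ') / μ)
    (hg : g' = 2 * ((σ + 1) * f - z * f')) (hb : (σ + 1) * g - z * g' + 4 * b = 2 * f') :
    ((σ + 1) * (P * μ) * μ' * g + P * μ ^ 2 * (g' * z') +
        ((σ * P * μ' * b + P * μ * (b' * z')) * W + P * μ * b * (-(2 * α) - p))) +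
      ((σ + 1) * (P * μ) * β * f + P * μ ^ 2 * (f' * ((α - z * β) / μ))) + P * μ ^ 2 * f * δ =
    P * μ ^ 2 * (-(κ / 2 * (σ + 1) * g * D) +
        δ * (f - κ / 2 * (σ + 1) * z * g - κ / 2 * g' * (1 - z ^ 2))) +
      W * (σ * P * μ' * b + P * μ * (b' * z')) - P * μ * b * p := by
  have e1 : μ * z' = -(β / 2) + z * α / 2 - κ / 2 * μ * δ * (1 - z ^ 2) := by
    rw [hz', hs', hμ', hs]; field_simp; ring
  have e2 : P * μ ^ 2 * (f' * ((α - z * β) / μ)) = P * μ * f' * (α - z * β) := by field_simp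
  have e3 : P * μ ^ 2 * (g' * z') = P * μ * g' * (μ * z') := by ring
  rw [e2, e3, e1, hμ', hs]
  have hf' : f' = ((σ + 1) * g - z * g' + 4 * b) / 2 := by linarith
  have hβ : (σ + 1) * f = g' / 2 + z * f' := by rw [hg]; ring
  -- The first relation between the profiles cancels the coefficient of β, the second that of α.
  linear_combination (P * μ * β) * hβ + (-(P * μ * α) / 2) * hb

/-- Along the mean flow μ changes by compression, at a rate proportional to μ, and by the drift of
the two states relative to the mean flow, at a rate proportional to n. The second part carries no
factor μ and is the origin of the cubic terms. -/
theorem abs_transport_le {κ μ s μ' α δ D n B : ℝ} (hκ : 0 < κ) (hκB : κ ≤ B) (hB0 : 0 ≤ B)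
    (hμ : 0 < μ) (h1 : |s| ≤ μ) (hμ' : μ' = -(α / 2) - κ / 2 * (μ * D + s * δ))
    (hα : |α| ≤ B * n) (hδ : |δ| ≤ B) (hD : |D| ≤ B) : |μ'| ≤ B * n + B ^ 2 * μ := by
  have h2 : |κ / 2 * (μ * D + s * δ)| ≤ B / 2 * (μ * B + μ * B) := by
    rw [abs_mul, abs_of_pos (by positivity : 0 < κ / 2)]
    gcongr
    refine (abs_add_le _ _).trans ?_
    rw [abs_mul, abs_mul, abs_of_pos hμ]
    gcongr
  have h3 : |-(α / 2)| ≤ B * n / 2 := by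
    rw [abs_neg, abs_div, abs_of_pos (by norm_num : (0 : ℝ) < 2)]
    linarith
  rw [hμ']
  refine (abs_sub _ _).trans ?_
  have := (abs_nonneg _).trans hα
  linarith

set_option maxHeartbeats 1000000 in
/-- The error terms of the energy identity are controlled by the energy and a cubic term. -/
theorem energy_error_le {κ σ P μ s z α β δ D p n g g' f b b' s' μ' z' B : ℝ}
    (hB : 1 ≤ B) (hκ : 0 < κ) (hκB : κ ≤ B) (hσ0 : 0 ≤ σ) (hσ : σ + 1 ≤ B) (hP : 0 ≤ P)
    (hμ : 0 < μ) (hn : 0 ≤ n) (hs : s = z * μ) (hz : |z| ≤ 1)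
    (hs' : s' = -(β / 2) - κ / 2 * (μ * δ + s * D)) (hμ' : μ' = -(α / 2) - κ / 2 * (μ * D + s * δ))
    (hz' : z' = (s' - z * μ') / μ)
    (hα : |α| ≤ B * n) (hβ : |β| ≤ B * n) (hδ : |δ| ≤ B) (hD : |D| ≤ B) (hp : |p| ≤ B * n ^ 2)
    (hg : |g| ≤ B * z ^ 2) (hb : |b| ≤ B) (hb' : |b'| ≤ B)
    (he : |f - κ / 2 * (σ + 1) * z * g - κ / 2 * g' * (1 - z ^ 2)| ≤ B * z ^ 2) :
    |P * μ ^ 2 * (-(κ / 2 * (σ + 1) * g * D) +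
        δ * (f - κ / 2 * (σ + 1) * z * g - κ / 2 * g' * (1 - z ^ 2))) +
      n ^ 2 * (σ * P * μ' * b + P * μ * (b' * z')) - P * μ * b * p| ≤
    8 * B ^ 4 * (P * s ^ 2 + P * μ * n ^ 2 + P * n ^ 3) := by
  have hB0 : 0 ≤ B := by linarith
  have hB2 : B ≤ B ^ 2 := le_self_pow₀ hB two_ne_zero
  have hB24 : B ^ 2 ≤ B ^ 4 := pow_le_pow_right₀ hB (by norm_num)
  have hB34 : B ^ 3 ≤ B ^ 4 := pow_le_pow_right₀ hB (by norm_num)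
  have hμ'le : |μ'| ≤ B * n + B ^ 2 * μ :=
    abs_transport_le hκ hκB hB0 hμ (by rw [hs, abs_mul, abs_of_pos hμ]; exact mul_le_of_le_one_left hμ.le hz) hμ' hα hδ hD
  have hz2 : |1 - z ^ 2| ≤ 1 := by
    rw [abs_le]
    have := sq_le_one_iff_abs_le_one z |>.2 hz
    constructor <;> linarith [sq_nonneg z]
  have hzle : μ * |z'| ≤ B * n + B ^ 2 * μ := by
    have e1 : μ * z' = (-(β / 2) + z * (α / 2)) - κ / 2 * μ * (δ * (1 - z ^ 2)) := by
      rw [hz', hs', hμ', hs]; field_simp; ring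
    rw [← abs_of_pos hμ, ← abs_mul, e1, abs_of_pos hμ]
    refine (abs_sub _ _).trans ?_
    have h1 : |-(β / 2) + z * (α / 2)| ≤ B * n := by
      refine (abs_add_le _ _).trans ?_
      rw [abs_neg, abs_mul, abs_div, abs_div, abs_of_pos (by norm_num : (0 : ℝ) < 2)]
      have : |z| * (|α| / 2) ≤ 1 * (|α| / 2) := by gcongr
      linarith
    have h2 : |κ / 2 * μ * (δ * (1 - z ^ 2))| ≤ B / 2 * μ * (B * 1) := by
      rw [abs_mul, abs_mul δ, abs_of_pos (by positivity : 0 < κ / 2 * μ)]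
      gcongr
    have : 0 ≤ B ^ 2 * μ := by positivity
    linarith
  -- Both g and the defect of the profiles are O(z²), and μ²z² = s².
  have t1 : |P * μ ^ 2 * (-(κ / 2 * (σ + 1) * g * D) +
        δ * (f - κ / 2 * (σ + 1) * z * g - κ / 2 * g' * (1 - z ^ 2)))| ≤ 2 * B ^ 4 * (P * s ^ 2) := by
    rw [abs_mul, abs_of_nonneg (by positivity : 0 ≤ P * μ ^ 2)]
    have h1 : |-(κ / 2 * (σ + 1) * g * D)| ≤ B / 2 * B * (B * z ^ 2) * B := by
      rw [abs_neg, abs_mul, abs_mul, abs_of_nonneg (by positivity : 0 ≤ κ / 2 * (σ + 1))]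
      gcongr
    have h2 : |δ * (f - κ / 2 * (σ + 1) * z * g - κ / 2 * g' * (1 - z ^ 2))| ≤ B * (B * z ^ 2) := by
      rw [abs_mul]
      gcongr
    have h3 : B * (B * z ^ 2) ≤ B ^ 4 * z ^ 2 := by
      calc _ = B ^ 2 * z ^ 2 := by ring
        _ ≤ _ := by gcongr
    calc _ ≤ P * μ ^ 2 * (B / 2 * B * (B * z ^ 2) * B + B ^ 4 * z ^ 2) := by
          gcongr
          exact (abs_add_le _ _).trans (add_le_add h1 (h2.trans h3))
      _ = 3 / 2 * B ^ 4 * (P * s ^ 2) := by rw [hs]; ring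
      _ ≤ _ := by gcongr; norm_num
  -- Here μ' and μz' may be as large as n, without a factor μ. Multiplied by n² this gives P n³,
  -- which is not controlled pointwise by the distance density near the vacuum.
  have t2 : |n ^ 2 * (σ * P * μ' * b + P * μ * (b' * z'))| ≤
      2 * B ^ 4 * (P * μ * n ^ 2 + P * n ^ 3) := by
    rw [abs_mul, abs_of_nonneg (by positivity : 0 ≤ n ^ 2)]
    have h1 : |σ * P * μ' * b| ≤ B * P * (B * n + B ^ 2 * μ) * B := by
      rw [abs_mul, abs_mul, abs_of_nonneg (by positivity : 0 ≤ σ * P)]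
      gcongr
      linarith
    have h2 : |P * μ * (b' * z')| ≤ P * (B * (B * n + B ^ 2 * μ)) := by
      rw [abs_mul, abs_of_nonneg (by positivity : 0 ≤ P * μ), abs_mul]
      calc P * μ * (|b'| * |z'|) = P * (|b'| * (μ * |z'|)) := by ring
        _ ≤ _ := by gcongr
    calc _ ≤ n ^ 2 * (B * P * (B * n + B ^ 2 * μ) * B + P * (B * (B * n + B ^ 2 * μ))) := by
          gcongr
          exact (abs_add_le _ _).trans (add_le_add h1 h2)
      _ = (B ^ 3 + B ^ 2) * (P * n ^ 3) + (B ^ 4 + B ^ 3) * (P * μ * n ^ 2) := by ring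
      _ ≤ (B ^ 4 + B ^ 4) * (P * n ^ 3) + (B ^ 4 + B ^ 4) * (P * μ * n ^ 2) := by gcongr
      _ = _ := by ring
  have t3 : |P * μ * b * p| ≤ B ^ 4 * (P * μ * n ^ 2) := by
    rw [abs_mul, abs_mul, abs_of_nonneg (by positivity : 0 ≤ P * μ)]
    calc _ ≤ P * μ * B * (B * n ^ 2) := by gcongr
      _ = B ^ 2 * (P * μ * n ^ 2) := by ring
      _ ≤ _ := by gcongr
  have a1 : 0 ≤ B ^ 4 * (P * s ^ 2) := by positivity
  have a2 : 0 ≤ B ^ 4 * (P * μ * n ^ 2) := by positivity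
  have a3 : 0 ≤ B ^ 4 * (P * n ^ 3) := by positivity
  refine (abs_sub _ _).trans ((add_le_add (abs_add_le _ _) le_rfl).trans ?_)
  linarith

set_option maxHeartbeats 1000000 in
/-- The error terms which come from the cutoff functions. The numbers `J₁`, `J₂`, `J₃` are the
derivatives of the cutoff `J` with respect to the weight, to `|w|²` and to `μ`. -/
theorem cutoff_error_le {P μ s z n φ Λ H h g f b J J₁ J₂ J₃ Λ' Λw W' Ww μ' β D B core : ℝ}
    (hB : 1 ≤ B) (hP : 0 ≤ P) (hφ : 0 ≤ φ) (hΛ : 0 < Λ) (hH : 0 ≤ H)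
    (hμ : 0 < μ) (hn : 0 ≤ n) (hn2 : n ≤ 2) (hs : s = z * μ) (hz : |z| ≤ 1) (hs1 : |s| ≤ 1)
    (hJ : |J| ≤ φ) (hJ₁ : |J₁| * Λ ≤ B * φ) (hJ₂ : |J₂| ≤ B * φ) (hJ₃ : |J₃| * h ≤ B * φ)
    (hJ₃0 : J₃ ≠ 0 → μ ≤ 2 * h ∧ P * μ ≤ H)
    (hΛ' : |Λ'| ≤ B * Λ) (hΛw : √μ * |Λw| ≤ B * Λ * n) (hW' : |W'| ≤ 2 * B * n + B * n ^ 2)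
    (hWw : |Ww| ≤ B * n ^ 2) (hμ' : |μ'| ≤ B * n + B ^ 2 * μ) (hβ : |β| ≤ B * n) (hD : |D| ≤ B)
    (hg : |g| ≤ B * z ^ 2) (hf : |f| ≤ B * |z|) (hb : |b| ≤ B)
    (hcore : |core| ≤ 8 * B ^ 4 * (P * s ^ 2 + P * μ * n ^ 2 + P * n ^ 3)) :
    |(J₁ * Λ' + J₂ * W' + J₃ * μ') * (P * μ ^ 2 * g + P * μ * b * n ^ 2) +
        (J₁ * Λw + J₂ * Ww + J₃ * β) * (P * μ ^ 2 * f) +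
        J * (P * μ ^ 2 * g + P * μ * b * n ^ 2) * (D / 2) + J * core| ≤
      40 * B ^ 4 * (φ * (P * s ^ 2 + P * μ * n ^ 2 + P * n ^ 3 + H)) := by
  have hB0 : 0 ≤ B := by linarith
  have hB24 : B ^ 2 ≤ B ^ 4 := pow_le_pow_right₀ hB (by norm_num)
  have hB34 : B ^ 3 ≤ B ^ 4 := pow_le_pow_right₀ hB (by norm_num)
  have hsμ : |s| ≤ μ := by rw [hs, abs_mul, abs_of_pos hμ]; exact mul_le_of_le_one_left hμ.le hz
  have hss : s ^ 2 = |s| * |s| := by rw [← abs_mul, ← sq, abs_of_nonneg (sq_nonneg s)]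
  set Q := P * s ^ 2 + P * μ * n ^ 2 with hQ
  have hQ0 : 0 ≤ Q := by positivity
  have hn3 : 0 ≤ P * n ^ 3 := by positivity
  set e := P * μ ^ 2 * g + P * μ * b * n ^ 2 with he
  set F := P * μ ^ 2 * f with hF
  have hele : |e| ≤ B * Q := by
    refine (abs_add_le _ _).trans ?_
    rw [abs_mul _ g, abs_mul _ (n ^ 2), abs_mul _ b, abs_of_nonneg (by positivity : 0 ≤ P * μ ^ 2),
      abs_of_nonneg (by positivity : 0 ≤ n ^ 2), abs_of_nonneg (by positivity : 0 ≤ P * μ)]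
    calc _ ≤ P * μ ^ 2 * (B * z ^ 2) + P * μ * B * n ^ 2 := by gcongr
      _ = _ := by rw [hQ, hs]; ring
  have hFle : |F| ≤ B * (P * μ * |s|) := by
    rw [hF, abs_mul, abs_of_nonneg (by positivity : 0 ≤ P * μ ^ 2), hs, abs_mul, abs_of_pos hμ]
    calc _ ≤ P * μ ^ 2 * (B * |z|) := by gcongr
      _ = _ := by ring
  set X := φ * (Q + P * n ^ 3 + H) with hX
  have hφQ : φ * Q ≤ X := by rw [hX]; gcongr; linarith
  have hφH : φ * H ≤ X := by rw [hX]; gcongr; linarith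
  have hφn : φ * (P * n ^ 3) ≤ X := by rw [hX]; gcongr; linarith
  have hX0 : 0 ≤ X := by positivity
  have a1 : |J₁ * Λ' * e| ≤ B ^ 4 * X := by
    rw [abs_mul, abs_mul]
    calc _ ≤ |J₁| * (B * Λ) * (B * Q) := by gcongr
      _ = |J₁| * Λ * (B * (B * Q)) := by ring
      _ ≤ B * φ * (B * (B * Q)) := by gcongr
      _ = B ^ 3 * (φ * Q) := by ring
      _ ≤ _ := by gcongr
  have a2 : |J₂ * W' * e| ≤ 8 * B ^ 4 * X := by
    have : |W'| ≤ 8 * B := by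
      calc _ ≤ 2 * B * 2 + B * 2 ^ 2 := hW'.trans (by gcongr)
        _ = _ := by ring
    rw [abs_mul, abs_mul]
    calc _ ≤ B * φ * (8 * B) * (B * Q) := by gcongr
      _ = 8 * B ^ 3 * (φ * Q) := by ring
      _ ≤ _ := by gcongr
  -- The derivative of the cutoff in μ costs 1/h but lives where μ ≤ 2h, so a factor μ compensates
  -- for it. The remaining Pμ is at most H, which in the application is (2h)^σ and disappears with
  -- h.
  have hJ₃' : J₃ ≠ 0 → |J₃| * μ ≤ 2 * B * φ := fun h0 => by
    have := mul_le_mul_of_nonneg_left (hJ₃0 h0).1 (abs_nonneg J₃)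
    linarith
  have a3 : |J₃ * μ' * e| ≤ 8 * B ^ 4 * X := by
    by_cases h0 : J₃ = 0
    · rw [h0]; simp; positivity
    have h1 := hJ₃' h0
    have h2 : |μ'| * |e| ≤ μ * (B ^ 2 * (2 * (P * μ) + P * n ^ 3) + B ^ 3 * Q) := by
      calc _ ≤ (B * n + B ^ 2 * μ) * (B * Q) := by gcongr
        _ = B ^ 2 * (P * (|s| * |s|) * n + P * μ * n ^ 3) + μ * (B ^ 3 * Q) := by
            rw [hQ, hss]; ring
        _ ≤ B ^ 2 * (P * (μ * μ) * 2 + P * μ * n ^ 3) + μ * (B ^ 3 * Q) := by gcongr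
        _ = _ := by ring
    rw [abs_mul, abs_mul]
    calc |J₃| * |μ'| * |e| = |J₃| * (|μ'| * |e|) := by ring
      _ ≤ |J₃| * (μ * (B ^ 2 * (2 * (P * μ) + P * n ^ 3) + B ^ 3 * Q)) := by gcongr
      _ = |J₃| * μ * (B ^ 2 * (2 * (P * μ) + P * n ^ 3) + B ^ 3 * Q) := by ring
      _ ≤ 2 * B * φ * (B ^ 2 * (2 * H + P * n ^ 3) + B ^ 3 * Q) := by
          gcongr
          exact (hJ₃0 h0).2
      _ = 4 * B ^ 3 * (φ * H) + 2 * B ^ 3 * (φ * (P * n ^ 3)) + 2 * B ^ 4 * (φ * Q) := by ring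
      _ ≤ 4 * B ^ 4 * X + 2 * B ^ 4 * X + 2 * B ^ 4 * X := by gcongr
      _ = _ := by ring
  -- The flux has the factor μ|s|. One √μ controls the derivative of the weight in the direction w,
  -- the other is combined with n|s| by the arithmetic-geometric inequality into s² + μn².
  have a4 : |J₁ * Λw * F| ≤ B ^ 4 * X := by
    have hsq : √μ * √μ = μ := Real.mul_self_sqrt hμ.le
    have h1 : √μ * n * |s| ≤ s ^ 2 + μ * n ^ 2 := by
      rw [← sq_abs s]
      have h2 := two_mul_le_add_sq (√μ * n) |s|
      have h3 : 0 ≤ √μ * n * |s| := by positivity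
      have h4 : (√μ * n) ^ 2 = μ * n ^ 2 := by rw [mul_pow, Real.sq_sqrt hμ.le]
      linarith
    rw [abs_mul, abs_mul]
    calc _ ≤ |J₁| * |Λw| * (B * (P * μ * |s|)) := by gcongr
      _ = |J₁| * (√μ * |Λw|) * (B * (P * √μ * |s|)) := by
          conv_lhs => rw [← hsq]
          ring
      _ ≤ |J₁| * (B * Λ * n) * (B * (P * √μ * |s|)) := by gcongr
      _ = |J₁| * Λ * (B * (B * (P * (√μ * n * |s|)))) := by ring
      _ ≤ B * φ * (B * (B * (P * (s ^ 2 + μ * n ^ 2)))) := by gcongr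
      _ = B ^ 3 * (φ * Q) := by rw [hQ]; ring
      _ ≤ _ := by gcongr
  have a5 : |J₂ * Ww * F| ≤ B ^ 4 * X := by
    rw [abs_mul, abs_mul]
    calc _ ≤ B * φ * (B * n ^ 2) * (B * (P * μ * 1)) := by gcongr; exact hFle.trans (by gcongr)
      _ = B ^ 3 * (φ * (P * μ * n ^ 2)) := by ring
      _ ≤ B ^ 4 * X := by
          gcongr
          refine le_trans ?_ hφQ
          gcongr
          rw [hQ]
          have : 0 ≤ P * s ^ 2 := by positivity
          linarith
  have a6 : |J₃ * β * F| ≤ 4 * B ^ 4 * X := by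
    by_cases h0 : J₃ = 0
    · rw [h0]; simp; positivity
    have h1 := hJ₃' h0
    rw [abs_mul, abs_mul]
    calc _ ≤ |J₃| * (B * 2) * (B * (P * μ * μ)) := by
          gcongr
          · exact hβ.trans (by gcongr)
          · exact hFle.trans (by gcongr)
      _ = |J₃| * μ * (2 * B ^ 2 * (P * μ)) := by ring
      _ ≤ 2 * B * φ * (2 * B ^ 2 * H) := by gcongr; exact (hJ₃0 h0).2
      _ = 4 * B ^ 3 * (φ * H) := by ring
      _ ≤ _ := by gcongr
  have a7 : |J * e * (D / 2)| ≤ B ^ 4 * X := by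
    rw [abs_mul, abs_mul, abs_div, abs_of_pos (by norm_num : (0 : ℝ) < 2)]
    calc _ ≤ φ * (B * Q) * (B / 2) := by gcongr
      _ = B ^ 2 * (φ * Q) / 2 := by ring
      _ ≤ B ^ 2 * (φ * Q) := by
          have : 0 ≤ B ^ 2 * (φ * Q) := by positivity
          linarith
      _ ≤ _ := by gcongr
  have a8 : |J * core| ≤ 8 * B ^ 4 * X := by
    rw [abs_mul]
    calc _ ≤ φ * (8 * B ^ 4 * (Q + P * n ^ 3)) := by gcongr
      _ ≤ φ * (8 * B ^ 4 * (Q + P * n ^ 3 + H)) := by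
          have : Q + P * n ^ 3 ≤ Q + P * n ^ 3 + H := by linarith
          gcongr
      _ = _ := by rw [hX]; ring
  have hsum : (J₁ * Λ' + J₂ * W' + J₃ * μ') * e + (J₁ * Λw + J₂ * Ww + J₃ * β) * F +
      J * e * (D / 2) + J * core = J₁ * Λ' * e + J₂ * W' * e + J₃ * μ' * e + J₁ * Λw * F +
      J₂ * Ww * F + J₃ * β * F + J * e * (D / 2) + J * core := by ring
  rw [hsum]
  have : 0 ≤ B ^ 4 * X := by positivity
  have b2 := (abs_add_le _ _).trans (add_le_add a1 a2)
  have b3 := (abs_add_le _ _).trans (add_le_add b2 a3)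
  have b4 := (abs_add_le _ _).trans (add_le_add b3 a4)
  have b5 := (abs_add_le _ _).trans (add_le_add b4 a5)
  have b6 := (abs_add_le _ _).trans (add_le_add b5 a6)
  have b7 := (abs_add_le _ _).trans (add_le_add b6 a7)
  refine (abs_add_le _ _).trans ((add_le_add b7 a8).trans ?_)
  linarith

end PointwiseEnergy

/-! ### The Euler equations in terms of space-time derivatives. -/

section EulerSolution

variable {d : ℕ} {κ T : ℝ} {r : ℝ → Space d → ℝ} {v : ℝ → Space d → Space d}

/-- `R` and `A` are the space-time derivatives at `(t, x)` of a density and of a velocity which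
satisfy the Euler equations there. -/
structure IsEulerDerivAt (κ : ℝ) (r : ℝ → Space d → ℝ) (v : ℝ → Space d → Space d) (t : ℝ)
    (x : Space d) (R : ℝ × Space d →L[ℝ] ℝ) (A : ℝ × Space d →L[ℝ] Space d) : Prop where
  hasFDerivAt_r : HasFDerivAt (fun p : ℝ × Space d => r p.1 p.2) R (t, x)
  hasFDerivAt_v : HasFDerivAt (fun p : ℝ × Space d => v p.1 p.2) A (t, x)
  apply_r : ∀ a y, R (a, y) = fderiv ℝ (r t) x (y - a • v t x) - a * (κ * r t x * divergence (v t) x)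
  apply_v : ∀ a y, A (a, y) = fderiv ℝ (v t) x (y - a • v t x) - a • ∇ (r t) x

theorem HasFDerivAt.comp_prodMk_right {F : Type*} [NormedAddCommGroup F] [NormedSpace ℝ F]
    {u : ℝ → Space d → F} {A : ℝ × Space d →L[ℝ] F} {t : ℝ} {x : Space d}
    (h : HasFDerivAt (fun p : ℝ × Space d => u p.1 p.2) A (t, x)) :
    HasFDerivAt (u t) (A.comp (ContinuousLinearMap.inr ℝ ℝ (Space d))) x :=
  h.comp (f := fun y => (t, y)) x (hasFDerivAt_prodMk_right t x)

theorem HasFDerivAt.comp_prodMk_left {F : Type*} [NormedAddCommGroup F] [NormedSpace ℝ F]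
    {u : ℝ → Space d → F} {A : ℝ × Space d →L[ℝ] F} {t : ℝ} {x : Space d}
    (h : HasFDerivAt (fun p : ℝ × Space d => u p.1 p.2) A (t, x)) :
    HasDerivAt (fun s => u s x) (A (1, 0)) t := by
  have := (h.comp (f := fun s => (s, x)) t (hasFDerivAt_prodMk_left t x)).hasDerivAt
  simp only [ContinuousLinearMap.comp_apply, ContinuousLinearMap.inl_apply] at this
  exact this

theorem fderiv_eq_inner_gradient {f : Space d → ℝ} {x : Space d} (hf : DifferentiableAt ℝ f x)
    (y : Space d) : fderiv ℝ f x y = inner ℝ y (∇ f x) := by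
  rw [hf.hasGradientAt.hasFDerivAt.fderiv, real_inner_comm]
  simp

theorem isOpen_interior_gasRegion
    (hr : ContinuousOn (fun p : ℝ × Space d => r p.1 p.2) (Icc 0 T ×ˢ univ)) :
    IsOpen {p : ℝ × Space d | p.1 ∈ Ioo 0 T ∧ p.2 ∈ gasDomain (r p.1)} := by
  have h := (hr.mono (prod_mono Ioo_subset_Icc_self subset_rfl)).isOpen_inter_preimage
    (isOpen_Ioo.prod isOpen_univ) isOpen_Ioi (t := Ioi 0)
  convert! h using 1
  ext p
  simp [gasDomain]

/-- Rademacher's theorem applies in space-time, on the open set of interior times, and Fubini passes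
to almost every time slice. The equations eliminate the time derivatives, so derivatives in all
directions (a, y) are expressed through spatial ones. -/
theorem IsEulerSolution.ae_isEulerDerivAt (h : IsEulerSolution κ T r v) :
    ∀ᵐ t, t ∈ Ioo 0 T → ∀ᵐ x, x ∈ gasDomain (r t) → ∃ R A, IsEulerDerivAt κ r v t x R A := by
  set O : Set (ℝ × Space d) := {p | p.1 ∈ Ioo 0 T ∧ p.2 ∈ gasDomain (r p.1)} with hO
  have hOo : IsOpen O := isOpen_interior_gasRegion h.continuousOn
  have hsub : O ⊆ gasRegion T r := fun p hp => ⟨Ioo_subset_Icc_self hp.1, hp.2⟩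
  have hp : ∀ᵐ p : ℝ × Space d ∂(volume.prod volume), p ∈ O →
      ∃ R A, IsEulerDerivAt κ r v p.1 p.2 R A := by
    filter_upwards [ae_differentiableAt_of_locallyLipschitzOn (μ := volume.prod volume) hOo
        (h.locallyLipschitz_r.mono hsub),
      ae_differentiableAt_of_locallyLipschitzOn (μ := volume.prod volume) hOo
        (h.locallyLipschitz_v.mono hsub), h.eq_r, h.eq_v] with p h1 h2 h3 h4 hpO
    obtain ⟨t, x⟩ := p
    have h1 := (h1 hpO).hasFDerivAt
    have h2 := (h2 hpO).hasFDerivAt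
    have h3 := h3 (hsub hpO)
    have h4 := h4 (hsub hpO)
    dsimp only at h1 h2 h3 h4 ⊢
    set R := fderiv ℝ (fun p : ℝ × Space d => r p.1 p.2) (t, x)
    set A := fderiv ℝ (fun p : ℝ × Space d => v p.1 p.2) (t, x)
    have hr := HasFDerivAt.comp_prodMk_right h1
    have hv := HasFDerivAt.comp_prodMk_right h2
    have e : ∀ (a : ℝ) (y : Space d), ((a, y) : ℝ × Space d) = a • (1, 0) + (0, y) := by simp
    rw [(HasFDerivAt.comp_prodMk_left h1).deriv] at h3
    rw [(HasFDerivAt.comp_prodMk_left h2).deriv] at h4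
    refine ⟨R, A, h1, h2, fun a y => ?_, fun a y => ?_⟩
    · rw [← fderiv_eq_inner_gradient hr.differentiableAt] at h3
      rw [e a y, map_add, map_smul, map_sub, map_smul]
      have : R (0, y) = fderiv ℝ (r t) x y := by rw [hr.fderiv]; simp
      rw [this]
      simp only [smul_eq_mul]
      linear_combination a * h3
    · rw [e a y, map_add, map_smul, map_sub, map_smul]
      have : A (0, y) = fderiv ℝ (v t) x y := by rw [hv.fderiv]; simp
      rw [this]
      have h5 : A (1, 0) = -(fderiv ℝ (v t) x (v t x)) - ∇ (r t) x := by
        rw [add_assoc] at h4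
        rw [eq_neg_of_add_eq_zero_left h4, neg_add, sub_eq_add_neg]
      rw [h5, smul_sub, smul_neg]
      abel
  filter_upwards [Measure.ae_ae_of_ae_prod hp] with t ht htI
  filter_upwards [ht] with x hx hxt
  exact hx ⟨htI, hxt⟩

end EulerSolution

/-! ### Bounds contained in the regularity class. -/

section RegularSolution

variable {d : ℕ} {κ T c : ℝ} {L M : ℝ≥0} {r : ℝ → Space d → ℝ} {v : ℝ → Space d → Space d} {t : ℝ}

theorem IsRegularSolution.gradTildeHolderNorm_le (h : IsRegularSolution κ T c L M r v)
    (ht : t ∈ Icc 0 T) : gradTildeHolderNorm (r t) ≤ M :=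
  le_trans le_self_add (h.control t ht)

theorem IsRegularSolution.norm_fderiv_le (h : IsRegularSolution κ T c L M r v) (ht : t ∈ Icc 0 T)
    {x : Space d} (hx : x ∈ gasDomain (r t)) : ‖fderiv ℝ (v t) x‖ ≤ M := by
  have h1 : (⨆ x ∈ gasDomain (r t), ENNReal.ofReal ‖fderiv ℝ (v t) x‖) ≤ M :=
    le_trans le_add_self (h.control t ht)
  have h2 := (le_iSup₂ (f := fun x (_ : x ∈ gasDomain (r t)) =>
    ENNReal.ofReal ‖fderiv ℝ (v t) x‖) x hx).trans h1
  have h3 := ENNReal.toReal_mono ENNReal.coe_ne_top h2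
  rwa [ENNReal.toReal_ofReal (norm_nonneg _), ENNReal.coe_toReal] at h3

theorem IsRegularSolution.differentiableAt (h : IsRegularSolution κ T c L M r v)
    (ht : t ∈ Icc 0 T) {x : Space d} (hx : x ∈ gasDomain (r t)) : DifferentiableAt ℝ (v t) x :=
  ((h.contDiffOn t ht).differentiableOn one_ne_zero).differentiableAt
    ((isOpen_gasDomain (h.lipschitz t ht).continuous).mem_nhds hx)

end RegularSolution

/-! ### Smooth steps and truncated polynomial weights. -/

section Cutoff

/-- A smooth step which increases from `0` on `(-∞, 1]` to `1` on `[2, ∞)`. -/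
noncomputable def smoothStep (y : ℝ) : ℝ := Real.smoothTransition (y - 1)

theorem contDiff_smoothStep : ContDiff ℝ 1 smoothStep :=
  Real.smoothTransition.contDiff.comp (contDiff_id.sub contDiff_const)

theorem hasDerivAt_smoothStep (y : ℝ) : HasDerivAt smoothStep (deriv smoothStep y) y :=
  (contDiff_smoothStep.differentiable one_ne_zero y).hasDerivAt

theorem smoothStep_nonneg (y : ℝ) : 0 ≤ smoothStep y := Real.smoothTransition.nonneg _

theorem smoothStep_le_one (y : ℝ) : smoothStep y ≤ 1 := Real.smoothTransition.le_one _

theorem smoothStep_of_le_one {y : ℝ} (hy : y ≤ 1) : smoothStep y = 0 :=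
  Real.smoothTransition.zero_of_nonpos (by linarith)

theorem smoothStep_of_two_le {y : ℝ} (hy : 2 ≤ y) : smoothStep y = 1 :=
  Real.smoothTransition.one_of_one_le (by linarith)

theorem deriv_smoothStep_of_lt {y : ℝ} (hy : y < 1) : deriv smoothStep y = 0 := by
  have : smoothStep =ᶠ[𝓝 y] fun _ => 0 := by
    filter_upwards [gt_mem_nhds hy] with z hz
    exact smoothStep_of_le_one hz.le
  rw [this.deriv_eq, deriv_const]

theorem deriv_smoothStep_of_gt {y : ℝ} (hy : 2 < y) : deriv smoothStep y = 0 := by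
  have : smoothStep =ᶠ[𝓝 y] fun _ => 1 := by
    filter_upwards [lt_mem_nhds hy] with z hz
    exact smoothStep_of_two_le hz.le
  rw [this.deriv_eq, deriv_const]

theorem exists_abs_deriv_smoothStep_le : ∃ C : ℝ, 0 ≤ C ∧ ∀ y, |deriv smoothStep y| ≤ C := by
  obtain ⟨C, hC⟩ := isCompact_Icc.exists_bound_of_continuousOn (s := Icc (1 : ℝ) 2)
    (contDiff_smoothStep.continuous_deriv le_rfl).continuousOn
  refine ⟨C, (norm_nonneg _).trans (hC 1 (by norm_num)), fun y => ?_⟩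
  by_cases h1 : y < 1
  · rw [deriv_smoothStep_of_lt h1, abs_zero]
    exact (norm_nonneg _).trans (hC 1 (by norm_num))
  by_cases h2 : 2 < y
  · rw [deriv_smoothStep_of_gt h2, abs_zero]
    exact (norm_nonneg _).trans (hC 1 (by norm_num))
  exact hC y ⟨not_lt.1 h1, not_lt.1 h2⟩

/-- The polynomial weight `Λ⁻ᴺ`, cut off at `Λ ~ R`. -/
noncomputable def cutoffWeight (N : ℕ) (R Λ : ℝ) : ℝ := (Λ ^ N)⁻¹ * (1 - smoothStep (Λ / R))

theorem cutoffWeight_nonneg {N : ℕ} {R Λ : ℝ} (hΛ : 0 ≤ Λ) : 0 ≤ cutoffWeight N R Λ :=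
  mul_nonneg (by positivity) (by linarith [smoothStep_le_one (Λ / R)])

theorem cutoffWeight_le {N : ℕ} {R Λ : ℝ} (hΛ : 0 ≤ Λ) : cutoffWeight N R Λ ≤ (Λ ^ N)⁻¹ :=
  mul_le_of_le_one_right (by positivity) (by linarith [smoothStep_nonneg (Λ / R)])

/-- The step varies only where Λ ≤ 2R, so the factor 1/R from its derivative is compensated by Λ.
The bound on the logarithmic scale is therefore independent of R. -/
theorem exists_hasDerivAt_cutoffWeight {N : ℕ} {R Λ C : ℝ} (hR : 0 < R) (hΛ : 0 < Λ)
    (hC : ∀ y, |deriv smoothStep y| ≤ C) :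
    ∃ γ', HasDerivAt (cutoffWeight N R) γ' Λ ∧ |γ'| * Λ ≤ (N + 2 * C) * (Λ ^ N)⁻¹ := by
  have h1 := (hasDerivAt_pow N Λ).inv (by positivity)
  have h2 := ((hasDerivAt_smoothStep (Λ / R)).comp Λ ((hasDerivAt_id Λ).div_const R)).const_sub 1
  refine ⟨_, h1.mul h2, ?_⟩
  have e1 : |-(N * Λ ^ (N - 1)) / (Λ ^ N) ^ 2| * Λ = N * (Λ ^ N)⁻¹ := by
    rw [abs_div, abs_neg, abs_of_nonneg (by positivity), abs_of_pos (by positivity)]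
    rcases N with _ | N
    · simp
    · field_simp
      simp
      ring
  have e2 : |deriv smoothStep (Λ / R) * (1 / R)| * Λ ≤ 2 * C := by
    rw [abs_mul, abs_of_pos (by positivity : 0 < 1 / R)]
    by_cases h : 2 < Λ / R
    · rw [deriv_smoothStep_of_gt h]
      simp
      exact (abs_nonneg _).trans (hC 0)
    · calc _ = |deriv smoothStep (Λ / R)| * (Λ / R) := by ring
        _ ≤ C * 2 := by
          gcongr
          · exact (abs_nonneg _).trans (hC 0)
          · exact hC _
          · exact not_lt.1 h
        _ = _ := by ring
  have e3 : |1 - smoothStep (Λ / R)| ≤ 1 :=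
    abs_le.2 ⟨by linarith [smoothStep_le_one (Λ / R)], by linarith [smoothStep_nonneg (Λ / R)]⟩
  refine (mul_le_mul_of_nonneg_right (abs_add_le _ _) hΛ.le).trans ?_
  simp only [Pi.inv_apply, abs_mul, abs_neg, abs_inv] at e2 ⊢
  rw [abs_of_pos (by positivity : 0 < Λ ^ N)]
  calc _ = |-(N * Λ ^ (N - 1)) / (Λ ^ N) ^ 2| * Λ * |1 - smoothStep (Λ / R)| +
        (Λ ^ N)⁻¹ * (|deriv smoothStep (Λ / R)| * |1 / R| * Λ) := by ring
    _ ≤ N * (Λ ^ N)⁻¹ * 1 + (Λ ^ N)⁻¹ * (2 * C) := by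
        rw [e1]
        gcongr
    _ = _ := by ring

end Cutoff

/-! ### The localized energy density and its transport. -/

section EnergyDensity

variable {κ : ℝ} (p : EnergyProfile κ) (N : ℕ) (R h : ℝ)

/-- The cutoff of the energy density to `|w|² ≤ 2`, `μ ≥ h` and `Λ ≤ 2R`. -/
noncomputable def energyCutoff (Λ W μ : ℝ) : ℝ :=
  cutoffWeight N R Λ * (1 - smoothStep W) * smoothStep (μ / h)

/-- The localized energy density. -/
noncomputable def energyDensity (Λ W μ s : ℝ) : ℝ :=
  energyCutoff N R h Λ W μ * (μ ^ (1 / κ + 1) * p.g (s / μ) + μ ^ (1 / κ) * p.b (s / μ) * W)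

/-- The coefficient of `w = v₁ - v₂` in the localized energy flux. -/
noncomputable def energyFlux (Λ W μ s : ℝ) : ℝ :=
  energyCutoff N R h Λ W μ * (μ ^ (1 / κ + 1) * p.f (s / μ))

variable {N R h}

/-- Each partial derivative, multiplied by the scale of its variable (Λ, 1 and h respectively), is
bounded by the weight without truncation, uniformly in R and h. The bound uses Λ^(-N) because the
truncation itself does not control its derivative. The additional information on J₃ records that the
step in μ is constant above 2h. -/
theorem exists_hasDerivAt_energyCutoff {C B Λ W μ H : ℝ} (hR : 0 < R) (hh : 0 < h) (hΛ : 0 < Λ)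
    (hμ : 0 < μ) (hC : ∀ y, |deriv smoothStep y| ≤ C) (hB : 1 ≤ B) (hCB : N + 2 * C ≤ B) {P : ℝ}
    (hH : μ ≤ 2 * h → P * μ ≤ H) :
    ∃ J₁ J₂ J₃, (∀ (Λ₁ W₁ μ₁ : ℝ → ℝ) (Λ' W' μ' : ℝ), HasDerivAt Λ₁ Λ' 0 → HasDerivAt W₁ W' 0 →
        HasDerivAt μ₁ μ' 0 → Λ₁ 0 = Λ → W₁ 0 = W → μ₁ 0 = μ →
        HasDerivAt (fun τ => energyCutoff N R h (Λ₁ τ) (W₁ τ) (μ₁ τ))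
          (J₁ * Λ' + J₂ * W' + J₃ * μ') 0) ∧
      |energyCutoff N R h Λ W μ| ≤ (Λ ^ N)⁻¹ ∧
      |J₁| * Λ ≤ B * (Λ ^ N)⁻¹ ∧ |J₂| ≤ B * (Λ ^ N)⁻¹ ∧ |J₃| * h ≤ B * (Λ ^ N)⁻¹ ∧
      (J₃ ≠ 0 → μ ≤ 2 * h ∧ P * μ ≤ H) ∧
      (2 < W → energyCutoff N R h Λ W μ = 0 ∧ J₁ = 0 ∧ J₂ = 0 ∧ J₃ = 0) := by
  obtain ⟨γ', hγ', hγle⟩ := exists_hasDerivAt_cutoffWeight (N := N) hR hΛ hC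
  have hC0 : 0 ≤ C := (abs_nonneg _).trans (hC 0)
  have hCB' : C ≤ B := by linarith [(Nat.cast_nonneg N : (0 : ℝ) ≤ N)]
  have e1 : |1 - smoothStep W| ≤ 1 :=
    abs_le.2 ⟨by linarith [smoothStep_le_one W], by linarith [smoothStep_nonneg W]⟩
  have e2 : |smoothStep (μ / h)| ≤ 1 := by
    rw [abs_of_nonneg (smoothStep_nonneg _)]
    exact smoothStep_le_one _
  have e3 : |cutoffWeight N R Λ| ≤ (Λ ^ N)⁻¹ := by
    rw [abs_of_nonneg (cutoffWeight_nonneg hΛ.le)]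
    exact cutoffWeight_le hΛ.le
  refine ⟨γ' * (1 - smoothStep W) * smoothStep (μ / h),
    cutoffWeight N R Λ * -deriv smoothStep W * smoothStep (μ / h),
    cutoffWeight N R Λ * (1 - smoothStep W) * (deriv smoothStep (μ / h) / h), ?_, ?_, ?_, ?_, ?_, ?_,
    ?_⟩
  · rintro Λ₁ W₁ μ₁ Λ' W' μ' h1 h2 h3 rfl rfl rfl
    have := ((hγ'.comp (0 : ℝ) h1).mul (((hasDerivAt_smoothStep _).comp (0 : ℝ) h2).const_sub 1)).mul
      ((hasDerivAt_smoothStep _).comp (0 : ℝ) (h3.div_const h))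
    refine this.congr_deriv ?_
    simp only [Function.comp_apply, Pi.mul_apply]
    ring
  · rw [energyCutoff, abs_mul, abs_mul]
    calc _ ≤ (Λ ^ N)⁻¹ * 1 * 1 := by gcongr
      _ = _ := by ring
  · rw [abs_mul, abs_mul]
    calc _ = |γ'| * Λ * (|1 - smoothStep W| * |smoothStep (μ / h)|) := by ring
      _ ≤ (N + 2 * C) * (Λ ^ N)⁻¹ * (1 * 1) := by gcongr
      _ ≤ _ := by rw [one_mul, mul_one]; gcongr
  · rw [abs_mul, abs_mul, abs_neg]
    calc _ ≤ (Λ ^ N)⁻¹ * B * 1 := by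
          gcongr
          exact (hC _).trans hCB'
      _ = _ := by ring
  · rw [abs_mul, abs_mul, abs_div, abs_of_pos hh]
    calc _ = |cutoffWeight N R Λ| * |1 - smoothStep W| * |deriv smoothStep (μ / h)| := by
          field_simp
      _ ≤ (Λ ^ N)⁻¹ * 1 * B := by
          gcongr
          exact (hC _).trans hCB'
      _ = _ := by ring
  · intro h0
    have : μ ≤ 2 * h := by
      by_contra hlt
      rw [not_le, ← lt_div_iff₀ hh] at hlt
      rw [deriv_smoothStep_of_gt hlt] at h0
      simp at h0
    exact ⟨this, hH this⟩
  · intro hW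
    simp [energyCutoff, smoothStep_of_two_le hW.le, deriv_smoothStep_of_gt hW]

/-- The multiplier in the Hardy inequality may not exceed 1, hence min(n, 1) in place of n. The
upper bound on n is supplied by the velocity cutoff of the energy. -/
theorem pow_three_le_mul_min {n : ℝ} (hn : 0 ≤ n) (hn2 : n ≤ 2) :
    n ^ 3 ≤ 2 * (n ^ 2 * min n 1) := by
  rcases le_total n 1 with h1 | h1
  · rw [min_eq_left h1]; nlinarith [pow_nonneg hn 3]
  · rw [min_eq_right h1]; nlinarith [pow_nonneg hn 2]

set_option maxHeartbeats 1000000 in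
/-- The localized energy identity with its error terms. -/
theorem energyDensity_transport (hκ : 0 < κ) {B C : ℝ} (hR : 0 < R) (hh : 0 < h)
    (hC : ∀ y, |deriv smoothStep y| ≤ C) (hB : 1 ≤ B) (hCB : N + 2 * C ≤ B)
    (hκB : κ ≤ B) (hσB : 1 / κ + 1 ≤ B) (hpB : p.C ≤ B)
    {Λ₁ W₁ μ₁ s₁ Λ₂ W₂ μ₂ s₂ : ℝ → ℝ} {Λ μ s n Λ' s' μ' α β δ D q Λw Ww : ℝ}
    (hΛ : 0 < Λ) (hμ : 0 < μ) (hn : 0 ≤ n) (hsμ : |s| ≤ μ) (hs1 : |s| ≤ 1)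
    (hΛ₁ : HasDerivAt Λ₁ Λ' 0) (hW₁ : HasDerivAt W₁ (-(2 * α) - q) 0) (hμ₁ : HasDerivAt μ₁ μ' 0)
    (hs₁ : HasDerivAt s₁ s' 0) (hΛ₂ : HasDerivAt Λ₂ Λw 0) (hW₂ : HasDerivAt W₂ Ww 0)
    (hμ₂ : HasDerivAt μ₂ β 0) (hs₂ : HasDerivAt s₂ α 0)
    (hΛ₁0 : Λ₁ 0 = Λ) (hW₁0 : W₁ 0 = n ^ 2) (hμ₁0 : μ₁ 0 = μ) (hs₁0 : s₁ 0 = s)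
    (hΛ₂0 : Λ₂ 0 = Λ) (hW₂0 : W₂ 0 = n ^ 2) (hμ₂0 : μ₂ 0 = μ) (hs₂0 : s₂ 0 = s)
    (hs' : s' = -(β / 2) - κ / 2 * (μ * δ + s * D)) (hμ' : μ' = -(α / 2) - κ / 2 * (μ * D + s * δ))
    (hα : |α| ≤ B * n) (hβ : |β| ≤ B * n) (hδ : |δ| ≤ B) (hD : |D| ≤ B) (hq : |q| ≤ B * n ^ 2)
    (hΛ' : |Λ'| ≤ B * Λ) (hΛw : √μ * |Λw| ≤ B * Λ * n) (hWw : |Ww| ≤ B * n ^ 2) :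
    ∃ e' F', HasDerivAt (fun τ => energyDensity p N R h (Λ₁ τ) (W₁ τ) (μ₁ τ) (s₁ τ)) e' 0 ∧
      HasDerivAt (fun τ => energyFlux p N R h (Λ₂ τ) (W₂ τ) (μ₂ τ) (s₂ τ)) F' 0 ∧
      |e' + energyDensity p N R h Λ (n ^ 2) μ s * (D / 2) + (F' + energyFlux p N R h Λ (n ^ 2) μ s * δ)|
        ≤ 80 * B ^ 4 * ((Λ ^ N)⁻¹ * (μ ^ (1 / κ - 1) * s ^ 2 + μ ^ (1 / κ) * n ^ 2 +
          μ ^ (1 / κ - 1) * (n ^ 2 * min n 1) + (2 * h) ^ (1 / κ))) := by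
  set σ := 1 / κ with hσ
  have hσ0 : 0 < σ := by positivity
  set P := μ ^ (σ - 1) with hP
  have hP0 : 0 < P := Real.rpow_pos_of_pos hμ _
  have hPμ : μ ^ σ = P * μ := by
    rw [hP, ← Real.rpow_add_one hμ.ne']; simp
  have hPμ2 : μ ^ (σ + 1) = P * μ ^ 2 := by
    rw [Real.rpow_add_one hμ.ne', hPμ]; ring
  set φ := (Λ ^ N)⁻¹ with hφ
  have hφ0 : 0 < φ := by positivity
  set H := (2 * h) ^ σ with hHdef
  have hH0 : 0 ≤ H := by positivity
  have hH : μ ≤ 2 * h → P * μ ≤ H := fun hle => by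
    rw [← hPμ]; exact Real.rpow_le_rpow hμ.le hle hσ0.le
  obtain ⟨J₁, J₂, J₃, hJd, hJ, hJ₁, hJ₂, hJ₃, hJ₃0, hJ0⟩ :=
    exists_hasDerivAt_energyCutoff (W := n ^ 2) hR hh hΛ hμ hC hB hCB hH
  set J := energyCutoff N R h Λ (n ^ 2) μ with hJdef
  set z := s / μ with hz
  have hszμ : s = z * μ := by rw [hz]; field_simp
  have hz1 : |z| ≤ 1 := by rw [hz, abs_div, abs_of_pos hμ]; exact (div_le_one hμ).2 hsμ
  set z' := (s' - z * μ') / μ with hz'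
  have hzd : HasDerivAt (fun τ => s₁ τ / μ₁ τ) z' 0 := by
    refine (hs₁.div hμ₁ (by rw [hμ₁0]; exact hμ.ne')).congr_deriv ?_
    rw [hs₁0, hμ₁0, hz', hz]; field_simp
  have hzd2 : HasDerivAt (fun τ => s₂ τ / μ₂ τ) ((α - z * β) / μ) 0 := by
    refine (hs₂.div hμ₂ (by rw [hμ₂0]; exact hμ.ne')).congr_deriv ?_
    rw [hs₂0, hμ₂0, hz]; field_simp
  have hd : ∀ {u : ℝ → ℝ} (hu : ContDiff ℝ 1 u) {k : ℝ → ℝ} {k' : ℝ}, HasDerivAt k k' 0 → k 0 = z →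
      HasDerivAt (fun τ => u (k τ)) (deriv u z * k') 0 := fun {u} hu {k k'} hk h0 => by
    have := (hu.differentiable one_ne_zero z).hasDerivAt
    rw [← h0] at this ⊢
    exact this.comp (0 : ℝ) hk
  have hz0 : s₁ 0 / μ₁ 0 = z := by rw [hs₁0, hμ₁0]
  have hz02 : s₂ 0 / μ₂ 0 = z := by rw [hs₂0, hμ₂0]
  have hpow : ∀ {k : ℝ → ℝ} {k' : ℝ}, HasDerivAt k k' 0 → k 0 = μ →
      HasDerivAt (fun τ => k τ ^ (σ + 1)) ((σ + 1) * (P * μ) * k') 0 := fun {k k'} hk h0 => by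
    refine (hk.rpow_const (p := σ + 1) (Or.inl (by rw [h0]; exact hμ.ne'))).congr_deriv ?_
    rw [h0, add_sub_cancel_right, hPμ]; ring
  have hpow1 : HasDerivAt (fun τ => μ₁ τ ^ σ) (σ * P * μ') 0 := by
    refine (hμ₁.rpow_const (p := σ) (Or.inl (by rw [hμ₁0]; exact hμ.ne'))).congr_deriv ?_
    rw [hμ₁0]; ring
  have hê := ((hpow hμ₁ hμ₁0).fun_mul (hd p.contDiff_g hzd hz0)).fun_add
    ((hpow1.fun_mul (hd p.contDiff_b hzd hz0)).fun_mul hW₁)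
  have hF := (hpow hμ₂ hμ₂0).fun_mul (hd p.contDiff_f hzd2 hz02)
  have hE' := (hJd Λ₁ W₁ μ₁ _ _ _ hΛ₁ hW₁ hμ₁ hΛ₁0 hW₁0 hμ₁0).fun_mul hê
  have hF' := (hJd Λ₂ W₂ μ₂ _ _ _ hΛ₂ hW₂ hμ₂ hΛ₂0 hW₂0 hμ₂0).fun_mul hF
  refine ⟨_, _, hE', hF', ?_⟩
  simp only [hΛ₁0, hW₁0, hμ₁0, hs₁0, hΛ₂0, hW₂0, hμ₂0, hs₂0, energyDensity, energyFlux]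
  rw [← hJdef, ← hσ, hPμ, hPμ2, ← hz]
  have hid := energy_identity (P := P) (D := D) (δ := δ) (W := n ^ 2) (p := q) (b' := deriv p.b z)
    hμ.ne' hszμ hs' hμ' hz' (p.rel_g z) (p.rel_b z)
  rw [← hσ] at hid
  -- Above the velocity cutoff the density, the flux and all derivatives of the cutoff vanish. Below
  -- it n ≤ 2, as required by the error estimates.
  by_cases hW : 2 < n ^ 2
  · obtain ⟨k0, k1, k2, k3⟩ := hJ0 hW
    rw [k0, k1, k2, k3]
    simp only [zero_mul, add_zero, abs_zero]
    have : 0 ≤ min n 1 := le_min hn zero_le_one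
    positivity
  have hn2 : n ≤ 2 := (pow_le_pow_iff_left₀ hn zero_le_two two_ne_zero).1
    ((not_lt.1 hW).trans (by norm_num))
  have herr := energy_error_le (f := p.f z) (g := p.g z) (b := p.b z) (b' := deriv p.b z)
    (g' := deriv p.g z) hB hκ hκB hσ0.le hσB
    hP0.le hμ hn hszμ hz1 hs' hμ' hz' hα hβ hδ hD hq ((p.g_le z).trans (by gcongr))
    ((p.b_le z).trans hpB) ((p.deriv_b_le z).trans hpB) ((p.defect_le z).trans (by gcongr))
  have hB0 : 0 ≤ B := by linarith
  have hcut := cutoff_error_le (W' := -(2 * α) - q) (f := p.f z) hB hP0.le hφ0.le hΛ hH0 hμ hn hn2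
    hszμ hz1 hs1 hJ hJ₁ hJ₂ hJ₃ hJ₃0 hΛ' hΛw
    ((abs_sub _ _).trans (by rw [abs_neg, abs_mul, abs_of_pos (by norm_num : (0 : ℝ) < 2)]; linarith))
    hWw (abs_transport_le hκ hκB hB0 hμ hsμ hμ' hα hδ hD)
    hβ hD ((p.g_le z).trans (by gcongr)) ((p.f_le z).trans (by gcongr)) ((p.b_le z).trans hpB) herr
  rw [← hid] at hcut
  have hn3 := pow_three_le_mul_min hn hn2
  calc _ = _ := by congr 1; ring
    _ ≤ _ := hcut
    _ ≤ 40 * B ^ 4 * (φ * (P * s ^ 2 + P * μ * n ^ 2 + P * (2 * (n ^ 2 * min n 1)) + H)) := by gcongr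
    _ ≤ 40 * B ^ 4 * (φ * (2 * (P * s ^ 2 + P * μ * n ^ 2 + P * (n ^ 2 * min n 1) + H))) := by
        have : 0 ≤ P * s ^ 2 + P * μ * n ^ 2 + H := by positivity
        have h3 : P * s ^ 2 + P * μ * n ^ 2 + P * (2 * (n ^ 2 * min n 1)) + H ≤
            2 * (P * s ^ 2 + P * μ * n ^ 2 + P * (n ^ 2 * min n 1) + H) := by linarith
        gcongr
    _ = _ := by ring

end EnergyDensity

/-! ### The complementary energy for large velocity differences. -/

section VelocityDensity

/-- The power `ρ^σ`, cut off to `ρ ≥ δ`. -/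
noncomputable def cutoffPower (σ δ ρ : ℝ) : ℝ := ρ ^ σ * smoothStep (ρ / δ)

/-- The identity, cut off to `W ≥ 1/2`. -/
noncomputable def cutoffSquare (W : ℝ) : ℝ := W * smoothStep (2 * W)

/-- The localized energy of large velocity differences. -/
noncomputable def velocityDensity (σ : ℝ) (N : ℕ) (R δ Λ W ρ : ℝ) : ℝ :=
  cutoffWeight N R Λ * cutoffPower σ δ ρ * cutoffSquare W

theorem cutoffPower_nonneg {σ δ ρ : ℝ} (hρ : 0 ≤ ρ) : 0 ≤ cutoffPower σ δ ρ :=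
  mul_nonneg (Real.rpow_nonneg hρ _) (smoothStep_nonneg _)

theorem cutoffPower_le {σ δ ρ : ℝ} (hρ : 0 ≤ ρ) : cutoffPower σ δ ρ ≤ ρ ^ σ :=
  mul_le_of_le_one_right (Real.rpow_nonneg hρ _) (smoothStep_le_one _)

theorem cutoffPower_of_le {σ δ ρ : ℝ} (hδ : 0 < δ) (h : ρ ≤ δ) : cutoffPower σ δ ρ = 0 := by
  rw [cutoffPower, smoothStep_of_le_one ((div_le_one hδ).2 h), mul_zero]

theorem cutoffPower_of_ge {σ δ ρ : ℝ} (hδ : 0 < δ) (h : 2 * δ ≤ ρ) :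
    cutoffPower σ δ ρ = ρ ^ σ := by
  rw [cutoffPower, smoothStep_of_two_le ((le_div_iff₀ hδ).2 h), mul_one]

theorem cutoffSquare_nonneg {W : ℝ} (hW : 0 ≤ W) : 0 ≤ cutoffSquare W :=
  mul_nonneg hW (smoothStep_nonneg _)

theorem cutoffSquare_le {W : ℝ} (hW : 0 ≤ W) : cutoffSquare W ≤ W :=
  mul_le_of_le_one_right hW (smoothStep_le_one _)

theorem cutoffSquare_of_ge {W : ℝ} (hW : 1 ≤ W) : cutoffSquare W = W := by
  rw [cutoffSquare, smoothStep_of_two_le (by linarith), mul_one]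

theorem abs_mul_deriv_smoothStep_le {C : ℝ} (hC : ∀ y, |deriv smoothStep y| ≤ C) {y : ℝ}
    (hy : 0 ≤ y) : |deriv smoothStep y| * y ≤ 2 * C := by
  have hC0 : 0 ≤ C := (abs_nonneg _).trans (hC 0)
  by_cases h : 2 < y
  · rw [deriv_smoothStep_of_gt h]
    simpa using hC0
  · calc _ ≤ C * 2 := by
          gcongr
          · exact hC _
          · exact not_lt.1 h
      _ = _ := by ring

theorem exists_hasDerivAt_cutoffPower {σ δ ρ C : ℝ} (hσ : 0 ≤ σ) (hδ : 0 < δ) (hρ : 0 < ρ)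
    (hC : ∀ y, |deriv smoothStep y| ≤ C) :
    ∃ ψ', HasDerivAt (cutoffPower σ δ) ψ' ρ ∧ |ψ'| * ρ ≤ (σ + 2 * C) * ρ ^ σ := by
  have h1 := (Real.hasDerivAt_rpow_const (p := σ) (Or.inl hρ.ne')).mul
    ((hasDerivAt_smoothStep (ρ / δ)).comp ρ ((hasDerivAt_id ρ).div_const δ))
  refine ⟨_, h1, ?_⟩
  have hp : 0 < ρ ^ σ := Real.rpow_pos_of_pos hρ _
  have hp' : ρ ^ (σ - 1) * ρ = ρ ^ σ := by rw [← Real.rpow_add_one hρ.ne']; simp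
  have hy := abs_mul_deriv_smoothStep_le hC (div_nonneg hρ.le hδ.le)
  refine (mul_le_mul_of_nonneg_right (abs_add_le _ _) hρ.le).trans ?_
  simp only [Function.comp_apply, id, abs_mul]
  rw [abs_of_nonneg hσ, abs_of_pos (Real.rpow_pos_of_pos hρ (σ - 1)), abs_of_pos hp,
    abs_of_nonneg (smoothStep_nonneg _), abs_of_pos (by positivity : 0 < 1 / δ)]
  calc _ = σ * (ρ ^ (σ - 1) * ρ) * smoothStep (ρ / δ) +
        ρ ^ σ * (|deriv smoothStep (ρ / δ)| * (ρ / δ)) := by ring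
    _ ≤ σ * ρ ^ σ * 1 + ρ ^ σ * (2 * C) := by
        rw [hp']
        gcongr
        exact smoothStep_le_one _
    _ = _ := by ring

/-- The lower bound on W at points where the derivative is nonzero is what later absorbs forcing
that is only linear in n. -/
theorem exists_hasDerivAt_cutoffSquare {W C : ℝ} (hW : 0 ≤ W)
    (hC : ∀ y, |deriv smoothStep y| ≤ C) :
    ∃ k', HasDerivAt cutoffSquare k' W ∧ |k'| ≤ 1 + 2 * C ∧ (k' ≠ 0 → 1 / 2 ≤ W) := by
  have h1 := (hasDerivAt_id W).mul
    ((hasDerivAt_smoothStep (2 * W)).comp W ((hasDerivAt_id W).const_mul 2))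
  refine ⟨_, h1, ?_, fun h0 => ?_⟩
  · have hy := abs_mul_deriv_smoothStep_le hC (mul_nonneg zero_le_two hW)
    refine (abs_add_le _ _).trans ?_
    simp only [Function.comp_apply, id, abs_mul, one_mul, mul_one, abs_of_nonneg hW]
    rw [abs_of_nonneg (smoothStep_nonneg _), abs_of_pos (by norm_num : (0 : ℝ) < 2)]
    linarith [smoothStep_le_one (2 * W)]
  · by_contra hlt
    have hlt : 2 * W < 1 := by linarith
    apply h0
    simp [deriv_smoothStep_of_lt hlt, smoothStep_of_le_one hlt.le]

/-- The transport of the energy of large velocity differences by the first velocity. -/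
theorem velocityDensity_transport {κ : ℝ} {N : ℕ} {R δ₀ : ℝ} (hκ : 0 < κ) {B C : ℝ} (hR : 0 < R)
    (hδ₀ : 0 < δ₀) (hC : ∀ y, |deriv smoothStep y| ≤ C) (hN : 1 ≤ N) (hNσ : 1 / κ ≤ N)
    (hB : 1 ≤ B) (hCB : N + 2 * C ≤ B) (hκB : κ ≤ B)
    {Λ₁ W₁ ρ₁ : ℝ → ℝ} {Λ ρ n Λ' W' D : ℝ}
    (hΛ : 0 < Λ) (hρ : 0 < ρ) (hn : 0 ≤ n)
    (hΛ₁ : HasDerivAt Λ₁ Λ' 0) (hW₁ : HasDerivAt W₁ W' 0)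
    (hρ₁ : HasDerivAt ρ₁ (-(κ * ρ * D)) 0)
    (hΛ₁0 : Λ₁ 0 = Λ) (hW₁0 : W₁ 0 = n ^ 2) (hρ₁0 : ρ₁ 0 = ρ)
    (hD : |D| ≤ B) (hΛ' : |Λ'| ≤ B * Λ) (hW' : |W'| ≤ 2 * B * n + B * n ^ 2) :
    ∃ e', HasDerivAt (fun τ => velocityDensity (1 / κ) N R δ₀ (Λ₁ τ) (W₁ τ) (ρ₁ τ)) e' 0 ∧
      |e' + velocityDensity (1 / κ) N R δ₀ Λ (n ^ 2) ρ * D| ≤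
        8 * B ^ 3 * ((Λ ^ N)⁻¹ * (ρ ^ (1 / κ) * n ^ 2)) := by
  set σ := 1 / κ with hσ
  have hσ0 : 0 < σ := by positivity
  have hB0 : 0 ≤ B := by linarith
  have hN1 : (1 : ℝ) ≤ N := by exact_mod_cast hN
  obtain ⟨γ', hγ', hγle⟩ := exists_hasDerivAt_cutoffWeight (N := N) hR hΛ hC
  obtain ⟨ψ', hψ', hψle⟩ := exists_hasDerivAt_cutoffPower hσ0.le hδ₀ hρ hC
  obtain ⟨k', hk', hkle, hk0⟩ := exists_hasDerivAt_cutoffSquare (sq_nonneg n) hC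
  have hd : ∀ {u k : ℝ → ℝ} {u' k' : ℝ} {y : ℝ}, HasDerivAt u u' y → HasDerivAt k k' 0 → k 0 = y →
      HasDerivAt (fun τ => u (k τ)) (u' * k') 0 := by
    rintro u k u' k' y hu hk rfl
    exact hu.comp (0 : ℝ) hk
  have h := ((hd hγ' hΛ₁ hΛ₁0).fun_mul (hd hψ' hρ₁ hρ₁0)).fun_mul (hd hk' hW₁ hW₁0)
  refine ⟨_, h, ?_⟩
  rw [hΛ₁0, hW₁0, hρ₁0, velocityDensity]
  set γ := cutoffWeight N R Λ
  set ψ := cutoffPower σ δ₀ ρ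
  set k := cutoffSquare (n ^ 2)
  set φ := (Λ ^ N)⁻¹ with hφ
  have hφ0 : 0 < φ := by positivity
  have hp : 0 < ρ ^ σ := Real.rpow_pos_of_pos hρ _
  have hγ1 : |γ| ≤ φ := by
    rw [abs_of_nonneg (cutoffWeight_nonneg hΛ.le)]; exact cutoffWeight_le hΛ.le
  have hψ1 : |ψ| ≤ ρ ^ σ := by
    rw [abs_of_nonneg (cutoffPower_nonneg hρ.le)]; exact cutoffPower_le hρ.le
  have hk1 : |k| ≤ n ^ 2 := by
    rw [abs_of_nonneg (cutoffSquare_nonneg (sq_nonneg n))]; exact cutoffSquare_le (sq_nonneg n)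
  set X := φ * (ρ ^ σ * n ^ 2) with hX
  have hX0 : 0 ≤ X := by positivity
  have a1 : |γ' * Λ' * ψ * k| ≤ B ^ 2 * X := by
    rw [abs_mul, abs_mul, abs_mul]
    calc _ ≤ |γ'| * (B * Λ) * ρ ^ σ * n ^ 2 := by gcongr
      _ = |γ'| * Λ * (B * (ρ ^ σ * n ^ 2)) := by ring
      _ ≤ (N + 2 * C) * φ * (B * (ρ ^ σ * n ^ 2)) := by gcongr
      _ ≤ B * φ * (B * (ρ ^ σ * n ^ 2)) := by gcongr
      _ = _ := by rw [hX]; ring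
  have hψle' : |ψ'| * ρ ≤ B * ρ ^ σ := hψle.trans (by gcongr; linarith)
  have a2 : |γ * (ψ' * -(κ * ρ * D)) * k| ≤ B ^ 3 * X := by
    rw [abs_mul, abs_mul, abs_mul, abs_neg, abs_mul, abs_of_pos (by positivity : 0 < κ * ρ)]
    calc _ ≤ φ * (|ψ'| * (B * ρ * B)) * n ^ 2 := by gcongr
      _ = φ * (|ψ'| * ρ * B ^ 2) * n ^ 2 := by ring
      _ ≤ φ * (B * ρ ^ σ * B ^ 2) * n ^ 2 := by
          gcongr
      _ = _ := by rw [hX]; ring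
  have a3 : |γ * ψ * (k' * W')| ≤ 5 * B ^ 2 * X := by
    -- The rate of change of n² contains a term linear in n, from the pressure gradients. Where k'
    -- does not vanish n ≥ 1/2, hence n ≤ 2n², and no cancellation is needed.
    have : |k' * W'| ≤ 5 * B ^ 2 * n ^ 2 := by
      by_cases h0 : k' = 0
      · rw [h0, zero_mul, abs_zero]; positivity
      have h1 : 1 / 2 ≤ n := by
        have := hk0 h0
        by_contra hlt
        have h3 := pow_lt_pow_left₀ (not_le.1 hlt) hn two_ne_zero
        norm_num at h3
        linarith
      have h2 : n ≤ 2 * n ^ 2 := by linarith [mul_le_mul_of_nonneg_left h1 hn]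
      rw [abs_mul]
      calc _ ≤ B * (2 * B * (2 * n ^ 2) + B * n ^ 2) := by
            gcongr
            · linarith
            · exact hW'.trans (by gcongr)
        _ = _ := by ring
    rw [abs_mul, abs_mul]
    calc _ ≤ φ * ρ ^ σ * (5 * B ^ 2 * n ^ 2) := by gcongr
      _ = _ := by rw [hX]; ring
  have a4 : |γ * ψ * k * D| ≤ B * X := by
    rw [abs_mul, abs_mul, abs_mul]
    calc _ ≤ φ * ρ ^ σ * n ^ 2 * B := by gcongr
      _ = _ := by rw [hX]; ring
  have hsum : (γ' * Λ' * ψ + γ * (ψ' * -(κ * ρ * D))) * k + γ * ψ * (k' * W') + γ * ψ * k * D =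
      γ' * Λ' * ψ * k + γ * (ψ' * -(κ * ρ * D)) * k + γ * ψ * (k' * W') + γ * ψ * k * D := by ring
  rw [hsum]
  have b2 := (abs_add_le _ _).trans (add_le_add a1 a2)
  have b3 := (abs_add_le _ _).trans (add_le_add b2 a3)
  refine (abs_add_le _ _).trans ((add_le_add b3 a4).trans ?_)
  have c1 : B ^ 2 * X ≤ B ^ 3 * X := by gcongr; norm_num
  have c2 : B * X ≤ B ^ 3 * X := by
    gcongr
    exact le_self_pow₀ hB (by norm_num)
  linarith

end VelocityDensity

/-! ### Pointwise coercivity up to thin layers. -/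

section Coercivity

set_option maxHeartbeats 1000000 in
/-- Pointwise coercivity of the energy up to terms in thin boundary layers. -/
theorem EnergyProfile.exists_le_energy_add_layer {κ : ℝ} (hκ : 0 < κ) (p : EnergyProfile κ) :
    ∃ CK > 0, ∃ C₁ > 0, ∃ C₂ > 0, ∀ a > 0, ∃ ε > 0, ∀ ρ₁ ρ₂ n μ s : ℝ, 0 < ρ₁ → 0 < ρ₂ → 0 ≤ n →
      μ = ρ₁ + ρ₂ → s = ρ₁ - ρ₂ → |s| ≤ ε →
      μ ^ (1 / κ - 1) * s ^ 2 + μ ^ (1 / κ) * n ^ 2 ≤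
        C₁ * ((1 - smoothStep (n ^ 2)) *
            (μ ^ (1 / κ + 1) * p.g (s / μ) + μ ^ (1 / κ) * p.b (s / μ) * n ^ 2) +
          CK * (cutoffPower (1 / κ) (a / 8) ρ₁ * cutoffSquare (n ^ 2))) +
        C₂ * ((if μ < |s| / p.z₀ then μ ^ (1 / κ - 1) * s ^ 2 else 0) +
          (if μ < a * min n 1 then μ ^ (1 / κ) * n ^ 2 else 0)) := by
  set σ := 1 / κ with hσ
  have hσ0 : 0 < σ := by positivity
  have hz₀ := p.z₀_pos
  have hpC := p.C_pos
  set c := min 1 (κ / 4) with hc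
  have hc0 : 0 < c := lt_min one_pos (by positivity)
  set C₁ := 1 / c with hC₁
  have hC₁0 : 0 < C₁ := by positivity
  have hC₁c : C₁ * c = 1 := by rw [hC₁]; field_simp
  set D := 1 + C₁ * p.C with hD
  have hD0 : 0 < D := by positivity
  -- For n > 1 the cut off energy may be as low as -C Q, where Q is the distance density and C the
  -- profile constant. With D = 1 + C₁C the complementary energy contributes at least DQ after
  -- multiplication by C₁, which leaves Q. The power of 8/3 compares μ with ρ₁.
  refine ⟨2 * D * (8 / 3) ^ σ / C₁, by positivity, C₁, hC₁0, 2 * D, by positivity, fun a ha => ?_⟩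
  -- In the layer μ < |s|/z₀ these conditions give μ < a and μ < z₀²a². The first excludes n > 1
  -- outside the velocity layer, the second bounds the velocity term there.
  refine ⟨min 1 (min (p.z₀ * a) (p.z₀ ^ 3 * a ^ 2)), by positivity, ?_⟩
  rintro ρ₁ ρ₂ n μ s h1 h2 hn hμs hss hε
  obtain ⟨hε1, hε2, hε3⟩ : |s| ≤ 1 ∧ |s| ≤ p.z₀ * a ∧ |s| ≤ p.z₀ ^ 3 * a ^ 2 :=
    ⟨hε.trans (min_le_left _ _), hε.trans ((min_le_right _ _).trans (min_le_left _ _)),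
      hε.trans ((min_le_right _ _).trans (min_le_right _ _))⟩
  have hμ : 0 < μ := by rw [hμs]; positivity
  have hsμ : |s| ≤ μ := by rw [hss, hμs, abs_le]; constructor <;> linarith
  set P := μ ^ (σ - 1) with hP
  have hP0 : 0 < P := Real.rpow_pos_of_pos hμ _
  have hPμ : μ ^ σ = P * μ := by rw [hP, ← Real.rpow_add_one hμ.ne']; simp
  have hPμ2 : μ ^ (σ + 1) = P * μ ^ 2 := by rw [Real.rpow_add_one hμ.ne', hPμ]; ring
  set z := s / μ with hz
  have hs : s = z * μ := by rw [hz]; field_simp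
  set Q := P * s ^ 2 + μ ^ σ * n ^ 2 with hQ
  set e := μ ^ (σ + 1) * p.g z + μ ^ σ * p.b z * n ^ 2 with he
  set k := 2 * D * (8 / 3) ^ σ / C₁ * (cutoffPower σ (a / 8) ρ₁ * cutoffSquare (n ^ 2)) with hk
  have hk0 : 0 ≤ k := mul_nonneg (by positivity)
    (mul_nonneg (cutoffPower_nonneg h1.le) (cutoffSquare_nonneg (sq_nonneg n)))
  have hQ0 : 0 ≤ Q := by positivity
  set ls := if μ < |s| / p.z₀ then P * s ^ 2 else 0 with hls
  set lw := if μ < a * min n 1 then μ ^ σ * n ^ 2 else 0 with hlw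
  have hls0 : 0 ≤ ls := by rw [hls]; split_ifs <;> positivity
  have hlw0 : 0 ≤ lw := by rw [hlw]; split_ifs <;> positivity
  have hele : |e| ≤ p.C * Q := by
    refine (abs_add_le _ _).trans ?_
    rw [abs_mul _ (p.g z), abs_mul _ (n ^ 2), abs_mul _ (p.b z), abs_of_nonneg (sq_nonneg n),
      abs_of_pos (Real.rpow_pos_of_pos hμ _), abs_of_pos (Real.rpow_pos_of_pos hμ _)]
    calc _ ≤ μ ^ (σ + 1) * (p.C * z ^ 2) + μ ^ σ * p.C * n ^ 2 := by
          gcongr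
          · exact p.g_le z
          · exact p.b_le z
      _ = _ := by rw [hPμ2, hQ, hs]; ring
  have hζe : -(p.C * Q) ≤ (1 - smoothStep (n ^ 2)) * e := by
    have h3 : |(1 - smoothStep (n ^ 2)) * e| ≤ 1 * (p.C * Q) := by
      rw [abs_mul]
      gcongr
      exact abs_le.2 ⟨by linarith [smoothStep_le_one (n ^ 2)], by
        linarith [smoothStep_nonneg (n ^ 2)]⟩
    linarith [(abs_le.1 h3).1]
  -- in the bad region the layers control everything
  have hbad : Q ≤ 2 * (ls + lw) → Q ≤ C₁ * ((1 - smoothStep (n ^ 2)) * e + k) +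
      2 * D * (ls + lw) := fun hb => by
    have h3 : C₁ * (-(p.C * Q)) ≤ C₁ * ((1 - smoothStep (n ^ 2)) * e + k) := by
      gcongr; linarith
    have h4 : D * Q ≤ D * (2 * (ls + lw)) := by gcongr
    have : D * Q = Q + C₁ * (p.C * Q) := by rw [hD]; ring
    linarith
  have hsn : 1 ≤ n → P * s ^ 2 ≤ μ ^ σ * n ^ 2 := fun hn1 => by
    rw [hPμ, mul_assoc, ← sq_abs s]
    have : |s| ^ 2 ≤ μ * n ^ 2 := by
      calc |s| ^ 2 = |s| * |s| := sq _
        _ ≤ μ * 1 := by gcongr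
        _ ≤ μ * n ^ 2 := by gcongr; exact one_le_pow₀ hn1
    gcongr
  by_cases hzlt : μ < |s| / p.z₀
  · refine hbad ?_
    rw [hls, if_pos hzlt]
    by_cases hwlt : μ < a * min n 1
    · rw [hlw, if_pos hwlt]
      have : 0 ≤ P * s ^ 2 := by positivity
      have : 0 ≤ μ ^ σ * n ^ 2 := by positivity
      linarith
    -- In the s-layer but outside the velocity layer n ≤ 1 and an ≤ μ. Then a²μn² ≤ μ³ ≤ z₀²a²μ² ≤
    -- a²s², so the velocity term is dominated by the s-term, which the layer already contains.
    · rw [lt_div_iff₀ hz₀] at hzlt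
      have hn1 : n ≤ 1 := by
        by_contra hn1
        rw [min_eq_right (not_le.1 hn1).le, mul_one, not_lt] at hwlt
        have : p.z₀ * a ≤ μ * p.z₀ := by rw [mul_comm]; gcongr
        linarith
      rw [min_eq_left hn1, not_lt] at hwlt
      have h3 : μ * n ^ 2 ≤ s ^ 2 := by
        have h4 : μ ≤ p.z₀ ^ 2 * a ^ 2 := by
          refine le_of_mul_le_mul_right ?_ hz₀
          calc _ ≤ p.z₀ ^ 3 * a ^ 2 := by linarith
            _ = _ := by ring
        have h5 : a ^ 2 * (μ * n ^ 2) ≤ a ^ 2 * s ^ 2 := by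
          calc _ = μ * (a * n) ^ 2 := by ring
            _ ≤ p.z₀ ^ 2 * a ^ 2 * μ ^ 2 := by gcongr
            _ = a ^ 2 * (μ * p.z₀) ^ 2 := by ring
            _ ≤ a ^ 2 * |s| ^ 2 := by gcongr
            _ = _ := by rw [sq_abs]
        exact le_of_mul_le_mul_left h5 (by positivity)
      have h6 : P * (μ * n ^ 2) ≤ P * s ^ 2 := by gcongr
      rw [hQ, hPμ]
      linarith
  · have hzz : |z| ≤ p.z₀ := by
      rw [hz, abs_div, abs_of_pos hμ, div_le_iff₀ hμ]
      rw [not_lt, div_le_iff₀ hz₀] at hzlt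
      linarith
    rcases le_or_gt n 1 with hn1 | hn1
    -- For n ≤ 1 and |z| ≤ z₀ no velocity cutoff is active, g = z² and b ≥ κ/4, so the energy itself
    -- is coercive.
    · have hn2 : n ^ 2 ≤ 1 := pow_le_one₀ hn hn1
      rw [smoothStep_of_le_one hn2, sub_zero, one_mul]
      have h3 : c * Q ≤ e := by
        rw [he, hQ]
        rw [p.g_eq z (hzz.trans_lt p.z₀_lt), hPμ2]
        have h4 : c * (P * s ^ 2) ≤ 1 * (P * s ^ 2) := by
          gcongr
          exact min_le_left _ _
        have h5 : μ ^ σ * c * n ^ 2 ≤ μ ^ σ * p.b z * n ^ 2 := by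
          gcongr
          exact (min_le_right _ _).trans (p.le_b z hzz)
        have : P * s ^ 2 = P * μ ^ 2 * z ^ 2 := by rw [hs]; ring
        linarith
      have h4 : C₁ * (c * Q) ≤ C₁ * (e + k) := by gcongr; linarith
      rw [← mul_assoc, hC₁c, one_mul] at h4
      have : 0 ≤ 2 * D * (ls + lw) := by positivity
      linarith
    · have hsn := hsn hn1.le
      by_cases hμa : μ < a
      · refine hbad ?_
        rw [hlw, min_eq_right hn1.le, mul_one, if_pos hμa, hQ]
        linarith
      -- From |z| ≤ z₀ < 1/4 follows ρ₁ = (μ + s)/2 ≥ 3μ/8. Since μ ≥ a this exceeds a/4, twice the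
      -- threshold a/8, so both cutoffs of the complementary energy are inactive.
      · have hρ : 3 / 8 * μ ≤ ρ₁ := by
          have h3 : |s| ≤ μ / 4 := by
            rw [hs, abs_mul, abs_of_pos hμ]
            calc |z| * μ ≤ 1 / 4 * μ := by gcongr; exact hzz.trans p.z₀_lt.le
              _ = _ := by ring
          have := (abs_le.1 h3).1
          rw [hss] at this
          linarith
        have hke : k = 2 * D * (8 / 3) ^ σ / C₁ * (ρ₁ ^ σ * n ^ 2) := by
          rw [hk, cutoffPower_of_ge (by positivity) (by linarith), cutoffSquare_of_ge (one_le_pow₀ hn1.le)]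
        have hk1 : 2 * D / C₁ * (μ ^ σ * n ^ 2) ≤ k := by
          rw [hke]
          have h3 : μ ^ σ ≤ (8 / 3) ^ σ * ρ₁ ^ σ := by
            rw [← Real.mul_rpow (by norm_num) h1.le]
            exact Real.rpow_le_rpow hμ.le (by linarith) hσ0.le
          calc _ ≤ 2 * D / C₁ * ((8 / 3) ^ σ * ρ₁ ^ σ * n ^ 2) := by gcongr
            _ = _ := by ring
        have h3 : C₁ * (-(p.C * Q) + 2 * D / C₁ * (μ ^ σ * n ^ 2)) ≤
            C₁ * ((1 - smoothStep (n ^ 2)) * e + k) := by gcongr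
        have h4 : C₁ * (-(p.C * Q) + 2 * D / C₁ * (μ ^ σ * n ^ 2)) =
            -(C₁ * p.C * Q) + D * (2 * (μ ^ σ * n ^ 2)) := by field_simp
        have h5 : D * Q ≤ D * (2 * (μ ^ σ * n ^ 2)) := by gcongr; linarith
        have : D * Q = Q + C₁ * p.C * Q := by rw [hD]; ring
        have : 0 ≤ 2 * D * (ls + lw) := by positivity
        linarith

end Coercivity

/-! ### Balance laws for densities supported inside the common gas region. -/

section GasTransport

variable {d : ℕ} {T : ℝ} {r₁ r₂ : ℝ → Space d → ℝ}

/-- A function which is locally Lipschitz in the common gas region and whose support stays away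
from its boundary is locally Lipschitz. -/
theorem locallyLipschitzOn_of_support {E F : Type*} [NormedAddCommGroup E] [NormedSpace ℝ E]
    [NormedAddCommGroup F] [NormedSpace ℝ F] {s : Set E} {ρ₁ ρ₂ : E → ℝ} {f : E → F} {η : ℝ}
    (hη : 0 < η) (h₁ : ContinuousOn ρ₁ s) (h₂ : ContinuousOn ρ₂ s)
    (hf : LocallyLipschitzOn (s ∩ {q | 0 < ρ₁ q ∧ 0 < ρ₂ q}) f)
    (h0 : ∀ q ∈ s, f q ≠ 0 → η ≤ ρ₁ q ∧ η ≤ ρ₂ q) : LocallyLipschitzOn s f := by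
  intro q hq
  by_cases hlt : η ≤ ρ₁ q ∧ η ≤ ρ₂ q
  · have hmem : {q | 0 < ρ₁ q ∧ 0 < ρ₂ q} ∈ 𝓝[s] q :=
      ((h₁ q hq).eventually (lt_mem_nhds (hη.trans_le hlt.1))).and
        ((h₂ q hq).eventually (lt_mem_nhds (hη.trans_le hlt.2)))
    obtain ⟨K, t, ht, hK⟩ := hf ⟨hq, hη.trans_le hlt.1, hη.trans_le hlt.2⟩
    refine ⟨K, t, ?_, hK⟩
    rwa [inter_comm, nhdsWithin_inter_of_mem hmem] at ht
  · have hev : ∀ᶠ y in 𝓝[s] q, ¬ (η ≤ ρ₁ y ∧ η ≤ ρ₂ y) := by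
      rw [not_and_or, not_le, not_le] at hlt
      rcases hlt with hlt | hlt
      · filter_upwards [(h₁ q hq).eventually (gt_mem_nhds hlt)] with y hy h using hy.not_ge h.1
      · filter_upwards [(h₂ q hq).eventually (gt_mem_nhds hlt)] with y hy h using hy.not_ge h.2
    refine ⟨0, _, Filter.inter_mem hev self_mem_nhdsWithin, LipschitzOnWith.of_dist_le_mul ?_⟩
    rintro y ⟨hy, hys⟩ z ⟨hz, hzs⟩
    have e1 : f y = 0 := by_contra fun h => hy (h0 y hys h)
    have e2 : f z = 0 := by_contra fun h => hz (h0 z hzs h)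
    simp [e1, e2]

/-- The integrated form of `∂ₜ f + ∇ · Y ≤ g` for densities and fluxes which are supported away from
the boundary of the common gas region. -/
theorem integral_le_of_gas_transport
    (h₁ : ContinuousOn (fun p : ℝ × Space d => r₁ p.1 p.2) (Icc 0 T ×ˢ univ))
    (h₂ : ContinuousOn (fun p : ℝ × Space d => r₂ p.1 p.2) (Icc 0 T ×ˢ univ))
    {f : ℝ × Space d → ℝ} {Y : ℝ × Space d → Space d} {η R : ℝ} (hη : 0 < η)
    (hf : LocallyLipschitzOn (gasRegion T r₁ ∩ gasRegion T r₂) f)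
    (hY : LocallyLipschitzOn (gasRegion T r₁ ∩ gasRegion T r₂) Y)
    (h0 : ∀ q ∈ Icc 0 T ×ˢ (univ : Set (Space d)), f q ≠ 0 ∨ Y q ≠ 0 →
      η ≤ r₁ q.1 q.2 ∧ η ≤ r₂ q.1 q.2)
    (hR : ∀ t x, R < ‖x‖ → f (t, x) = 0 ∧ Y (t, x) = 0)
    {G : ℝ → ℝ} (hG : Continuous G) {g : ℝ → Space d → ℝ}
    (hg : ∀ s ∈ Ioo 0 T, IntegrableOn (g s) (gasDomain (r₁ s) ∩ gasDomain (r₂ s)) ∧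
      ∫ x in gasDomain (r₁ s) ∩ gasDomain (r₂ s), g s x ≤ G s)
    (h : ∀ᵐ s, s ∈ Ioo 0 T → ∀ᵐ x, x ∈ gasDomain (r₁ s) ∩ gasDomain (r₂ s) →
      deriv (fun t => f (t, x)) s + divergence (fun y => Y (s, y)) x ≤ g s x)
    {t : ℝ} (ht : t ∈ Icc 0 T) :
    ∫ x, f (t, x) ≤ (∫ x, f (0, x)) + ∫ s in (0 : ℝ)..t, G s := by
  have hS : IsClosed (Icc 0 T ×ˢ (univ : Set (Space d))) := isClosed_Icc.prod isClosed_univ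
  have hsub : gasRegion T r₁ ∩ gasRegion T r₂ =
      Icc 0 T ×ˢ univ ∩ {q : ℝ × Space d | 0 < r₁ q.1 q.2 ∧ 0 < r₂ q.1 q.2} := by
    ext q
    simp only [gasRegion, gasDomain, mem_inter_iff, mem_ofPred_eq, mem_prod, mem_univ, and_true]
    tauto
  rw [hsub] at hf hY
  have hfL := locallyLipschitzOn_of_support hη h₁ h₂ hf fun q hq hq0 => h0 q hq (Or.inl hq0)
  have hYL := locallyLipschitzOn_of_support hη h₁ h₂ hY fun q hq hq0 => h0 q hq (Or.inr hq0)
  have hfar : ∀ q ∈ Icc 0 T ×ˢ (univ : Set (Space d)), max T R < ‖q‖ → R < ‖q.2‖ := by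
    rintro ⟨s, x⟩ ⟨hs, -⟩ hq
    rw [Prod.norm_def, lt_max_iff] at hq
    rcases hq with hq | hq
    · rw [Real.norm_of_nonneg hs.1] at hq
      exact absurd hs.2 (not_le.2 ((le_max_left _ _).trans_lt hq))
    · exact (le_max_right _ _).trans_lt hq
  obtain ⟨K, hK⟩ := exists_lipschitzOnWith_of_vanishing hS hfL
    fun q hq hq' => (hR q.1 q.2 (hfar q hq hq')).1
  obtain ⟨K', hK'⟩ := exists_lipschitzOnWith_of_vanishing hS hYL
    fun q hq hq' => (hR q.1 q.2 (hfar q hq hq')).2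
  have hlip : ∀ s ∈ Icc 0 T, LipschitzWith K' fun x => Y (s, x) := fun s hs =>
    LipschitzWith.of_dist_le_mul fun x y => by
      refine (hK'.dist_le_mul (s, x) ⟨hs, mem_univ _⟩ (s, y) ⟨hs, mem_univ _⟩).trans (le_of_eq ?_)
      rw [Prod.dist_eq, dist_self, max_eq_right dist_nonneg]
  refine integral_le_of_transport (Y := fun s x => Y (s, x)) hK (fun s _ x hx => (hR s x hx).1)
    (fun s hs => ⟨⟨K', hlip s (Ioo_subset_Icc_self hs)⟩, HasCompactSupport.intro
      (isCompact_closedBall 0 R) fun x hx => (hR s x (by simpa using hx)).2⟩) hG ?_ ht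
  filter_upwards [h] with s hs hsI
  have hsI' := Ioo_subset_Icc_self hsI
  have hc : ∀ {r : ℝ → Space d → ℝ}, ContinuousOn (fun p : ℝ × Space d => r p.1 p.2)
      (Icc 0 T ×ˢ univ) → Continuous (r s) := fun hr =>
    hr.comp_continuous (f := fun x => (s, x)) (by fun_prop) fun x => ⟨hsI', mem_univ _⟩
  have hU : IsOpen (gasDomain (r₁ s) ∩ gasDomain (r₂ s)) :=
    (isOpen_gasDomain (hc h₁)).inter (isOpen_gasDomain (hc h₂))
  obtain ⟨hgi, hgG⟩ := hg s hsI
  refine ⟨(gasDomain (r₁ s) ∩ gasDomain (r₂ s)).indicator (g s),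
    (integrable_indicator_iff hU.measurableSet).2 hgi, ?_, ?_⟩
  · filter_upwards [hs hsI] with x hx
    by_cases hxU : x ∈ gasDomain (r₁ s) ∩ gasDomain (r₂ s)
    · rw [indicator_of_mem hxU]
      exact hx hxU
    · rw [indicator_of_notMem hxU]
      -- At a point outside the common domain one density is below η on a space-time neighbourhood.
      -- There f and Y vanish, and with them the time derivative and the divergence.
      have hev : ∀ᶠ q in 𝓝 (s, x), f q = 0 ∧ Y q = 0 := by
        have hSn : Icc 0 T ×ˢ (univ : Set (Space d)) ∈ 𝓝 (s, x) :=
          prod_mem_nhds (Icc_mem_nhds hsI.1 hsI.2) Filter.univ_mem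
        have hlt : r₁ s x < η ∨ r₂ s x < η := by
          by_contra hcon
          rw [not_or, not_lt, not_lt] at hcon
          exact hxU ⟨hη.trans_le hcon.1, hη.trans_le hcon.2⟩
        have : ∀ᶠ q in 𝓝 (s, x), ¬ (η ≤ r₁ q.1 q.2 ∧ η ≤ r₂ q.1 q.2) := by
          rcases hlt with hlt | hlt
          · filter_upwards [(h₁.continuousAt hSn).eventually (gt_mem_nhds hlt)] with y hy h
              using hy.not_ge h.1
          · filter_upwards [(h₂.continuousAt hSn).eventually (gt_mem_nhds hlt)] with y hy h
              using hy.not_ge h.2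
        filter_upwards [this, hSn] with q hq hqS
        exact ⟨by_contra fun hne => hq (h0 q hqS (Or.inl hne)),
          by_contra fun hne => hq (h0 q hqS (Or.inr hne))⟩
      have e1 : (fun t => f (t, x)) =ᶠ[𝓝 s] fun _ => 0 := by
        have : Filter.Tendsto (fun t => (t, x)) (𝓝 s) (𝓝 (s, x)) :=
          (by fun_prop : Continuous fun t => (t, x)).tendsto s
        filter_upwards [this.eventually hev] with t ht using ht.1
      have e2 : (fun y => Y (s, y)) =ᶠ[𝓝 x] fun _ => 0 := by
        have : Filter.Tendsto (fun y => (s, y)) (𝓝 x) (𝓝 (s, x)) :=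
          (by fun_prop : Continuous fun y => (s, y)).tendsto x
        filter_upwards [this.eventually hev] with t ht using ht.2
      rw [e1.deriv_eq, divergence, e2.fderiv_eq]
      simp
  · rwa [integral_indicator hU.measurableSet]

end GasTransport

/-! ### Divergence form of the transport derivative. -/

section DivergenceForm

variable {d : ℕ}

/-- The divergence form of a transport derivative in terms of the space-time derivatives. -/
theorem deriv_add_divergence_eq {f F : ℝ × Space d → ℝ} {V w : ℝ → Space d → Space d} {t : ℝ}
    {x : Space d} {f' F' : ℝ × Space d →L[ℝ] ℝ} (hf : HasFDerivAt f f' (t, x))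
    (hF : HasFDerivAt F F' (t, x)) (hV : DifferentiableAt ℝ (V t) x)
    (hw : DifferentiableAt ℝ (w t) x) :
    deriv (fun s => f (s, x)) t + divergence (fun y => f (t, y) • V t y + F (t, y) • w t y) x =
      f' (1, V t x) + f (t, x) * divergence (V t) x +
        (F' (0, w t x) + F (t, x) * divergence (w t) x) := by
  have h1 := HasFDerivAt.comp_prodMk_right (u := fun t x => f (t, x)) hf
  have h2 := HasFDerivAt.comp_prodMk_right (u := fun t x => F (t, x)) hF
  have h3 := HasFDerivAt.comp_prodMk_left (u := fun t x => f (t, x)) hf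
  rw [h3.deriv, divergence_add (h1.differentiableAt.fun_smul hV)
      (h2.differentiableAt.fun_smul hw),
    divergence_smul h1.differentiableAt hV, divergence_smul h2.differentiableAt hw, h1.fderiv,
    h2.fderiv]
  have : f' (1, V t x) = f' (1, 0) + f' (0, V t x) := by rw [← map_add]; simp
  rw [this]
  simp only [ContinuousLinearMap.comp_apply, ContinuousLinearMap.inr_apply]
  ring

end DivergenceForm

/-! ### The argument Λ of the weights and its derivatives. -/

section Weight

/-- The argument of the polynomial weights: it controls position and velocities at the scale `A`. -/
noncomputable def weightArg {d : ℕ} (A : ℝ) (x u₁ u₂ : Space d) : ℝ :=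
  1 + (‖x‖ ^ 2 + ‖u₁‖ ^ 2 + ‖u₂‖ ^ 2) / A ^ 2

variable {d : ℕ} {A : ℝ} {x u₁ u₂ : Space d}

theorem one_le_weightArg : 1 ≤ weightArg A x u₁ u₂ := by
  rw [weightArg]
  have : 0 ≤ (‖x‖ ^ 2 + ‖u₁‖ ^ 2 + ‖u₂‖ ^ 2) / A ^ 2 := by positivity
  linarith

theorem weightArg_pos : 0 < weightArg A x u₁ u₂ := one_pos.trans_le one_le_weightArg

theorem sq_add_le_weightArg (hA : 1 ≤ A) :
    ‖x‖ ^ 2 + ‖u₁‖ ^ 2 + ‖u₂‖ ^ 2 ≤ A ^ 2 * weightArg A x u₁ u₂ := by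
  have : A ^ 2 * weightArg A x u₁ u₂ = A ^ 2 + (‖x‖ ^ 2 + ‖u₁‖ ^ 2 + ‖u₂‖ ^ 2) := by
    rw [weightArg]; field_simp
  rw [this]
  nlinarith

theorem norm_le_weightArg (hA : 1 ≤ A) : ‖x‖ ≤ A ^ 2 * weightArg A x u₁ u₂ := by
  have : A ^ 2 * weightArg A x u₁ u₂ = A ^ 2 + (‖x‖ ^ 2 + ‖u₁‖ ^ 2 + ‖u₂‖ ^ 2) := by
    rw [weightArg]; field_simp
  rw [this]
  nlinarith [sq_nonneg (‖x‖ - 1), sq_nonneg ‖u₁‖, sq_nonneg ‖u₂‖]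

/-- The derivative of the weight argument. -/
noncomputable def weightDeriv (A : ℝ) (x u₁ u₂ y a₁ a₂ : Space d) : ℝ :=
  (2 * inner ℝ x y + 2 * inner ℝ u₁ a₁ + 2 * inner ℝ u₂ a₂) / A ^ 2

theorem hasDerivAt_weightArg {x u₁ u₂ : ℝ → Space d} {y a₁ a₂ : Space d} {t : ℝ}
    (hx : HasDerivAt x y t) (h₁ : HasDerivAt u₁ a₁ t) (h₂ : HasDerivAt u₂ a₂ t) :
    HasDerivAt (fun τ => weightArg A (x τ) (u₁ τ) (u₂ τ))
      (weightDeriv A (x t) (u₁ t) (u₂ t) y a₁ a₂) t :=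
  (((hx.norm_sq.add h₁.norm_sq).add h₂.norm_sq).div_const (A ^ 2)).const_add 1

/-- Position moves at most with the sum of the speeds, and the accelerations are affine in the
speeds. Since Λ contains the squares of all three quantities, it grows at a relative rate that does
not depend on A ≥ 1. This is why the velocities enter the weight: no bound for them is available. -/
theorem abs_weightDeriv_le {L M : ℝ} {y a₁ a₂ : Space d} (hA : 1 ≤ A) (hL : 0 ≤ L) (hM : 0 ≤ M)
    (hy : ‖y‖ ≤ ‖u₁‖ + ‖u₂‖) (h₁ : ‖a₁‖ ≤ M * (‖u₁‖ + ‖u₂‖) + L)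
    (h₂ : ‖a₂‖ ≤ M * (‖u₁‖ + ‖u₂‖) + L) :
    |weightDeriv A x u₁ u₂ y a₁ a₂| ≤ (2 + 4 * M + 2 * L) * weightArg A x u₁ u₂ := by
  have e : ∀ u a : Space d, |2 * inner ℝ u a| ≤ 2 * (‖u‖ * ‖a‖) := fun u a => by
    rw [abs_mul, abs_of_pos (by norm_num : (0 : ℝ) < 2)]
    gcongr
    exact abs_real_inner_le_norm u a
  have hA2 : 1 ≤ A ^ 2 := one_le_pow₀ hA
  rw [weightDeriv, abs_div, abs_of_pos (by positivity : 0 < A ^ 2), div_le_iff₀ (by positivity)]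
  have hw : weightArg A x u₁ u₂ * A ^ 2 = A ^ 2 + (‖x‖ ^ 2 + ‖u₁‖ ^ 2 + ‖u₂‖ ^ 2) := by
    rw [weightArg]; field_simp
  rw [mul_assoc, hw]
  have h0 : |2 * inner ℝ x y + 2 * inner ℝ u₁ a₁ + 2 * inner ℝ u₂ a₂| ≤
      2 * (‖x‖ * ‖y‖) + 2 * (‖u₁‖ * ‖a₁‖) + 2 * (‖u₂‖ * ‖a₂‖) :=
    (abs_add_le _ _).trans (add_le_add ((abs_add_le _ _).trans (add_le_add (e _ _) (e _ _)))
      (e _ _))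
  have hx := norm_nonneg x
  have b1 := norm_nonneg u₁
  have b2 := norm_nonneg u₂
  generalize ‖x‖ = X at *
  generalize ‖u₁‖ = p at *
  generalize ‖u₂‖ = q at *
  have c1 : X * ‖y‖ ≤ X * (p + q) := by gcongr
  have c2 : p * ‖a₁‖ ≤ p * (M * (p + q) + L) := by gcongr
  have c3 : q * ‖a₂‖ ≤ q * (M * (p + q) + L) := by gcongr
  have c4 : 2 * (X * (p + q)) ≤ 2 * (X ^ 2 + p ^ 2 + q ^ 2) := by
    nlinarith [sq_nonneg (X - p), sq_nonneg (X - q), sq_nonneg p, sq_nonneg q]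
  have c5 : (p + q) * (p + q) ≤ 2 * (p ^ 2 + q ^ 2) := by nlinarith [sq_nonneg (p - q)]
  have c6 : 2 * (p + q) ≤ 2 + p ^ 2 + q ^ 2 := by nlinarith [sq_nonneg (p - 1), sq_nonneg (q - 1)]
  have c7 : M * ((p + q) * (p + q)) ≤ M * (2 * (p ^ 2 + q ^ 2)) := by gcongr
  have c8 : L * (2 * (p + q)) ≤ L * (2 + p ^ 2 + q ^ 2) := by gcongr
  have c9 : 0 ≤ M * X ^ 2 := by positivity
  have c10 : 0 ≤ L * X ^ 2 := by positivity
  have c11 : 0 ≤ L * (p ^ 2 + q ^ 2) := by positivity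
  have c12 : L ≤ L * A ^ 2 := le_mul_of_one_le_right hL hA2
  have c13 : 0 ≤ M * A ^ 2 := by positivity
  linarith

/-- In a purely spatial direction y the velocities change at most by M|y|, so the whole derivative
has a factor |y|. In the flux y = w, and this factor is essential. -/
theorem abs_weightDeriv_le_mul_norm {M : ℝ} {y a₁ a₂ : Space d} (hA : 1 ≤ A) (hM : 0 ≤ M)
    (h₁ : ‖a₁‖ ≤ M * ‖y‖) (h₂ : ‖a₂‖ ≤ M * ‖y‖) :
    |weightDeriv A x u₁ u₂ y a₁ a₂| ≤ 2 * (1 + M) * (‖x‖ + ‖u₁‖ + ‖u₂‖) * ‖y‖ / A ^ 2 := by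
  have e : ∀ u a : Space d, |2 * inner ℝ u a| ≤ 2 * (‖u‖ * ‖a‖) := fun u a => by
    rw [abs_mul, abs_of_pos (by norm_num : (0 : ℝ) < 2)]
    gcongr
    exact abs_real_inner_le_norm u a
  have hA2 : 0 < A ^ 2 := by positivity
  rw [weightDeriv, abs_div, abs_of_pos hA2]
  gcongr
  have h0 : |2 * inner ℝ x y + 2 * inner ℝ u₁ a₁ + 2 * inner ℝ u₂ a₂| ≤
      2 * (‖x‖ * ‖y‖) + 2 * (‖u₁‖ * ‖a₁‖) + 2 * (‖u₂‖ * ‖a₂‖) :=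
    (abs_add_le _ _).trans (add_le_add ((abs_add_le _ _).trans (add_le_add (e _ _) (e _ _)))
      (e _ _))
  have c2 : ‖u₁‖ * ‖a₁‖ ≤ ‖u₁‖ * (M * ‖y‖) := by gcongr
  have c3 : ‖u₂‖ * ‖a₂‖ ≤ ‖u₂‖ * (M * ‖y‖) := by gcongr
  have : 0 ≤ ‖u₁‖ * ‖y‖ := by positivity
  have : 0 ≤ ‖u₂‖ * ‖y‖ := by positivity
  have : 0 ≤ M * (‖x‖ * ‖y‖) := by positivity
  linarith

/-- By the linear growth of μ both √μ and |x| + |u₁| + |u₂| are at most a constant times A√Λ. Their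
product is of order A²Λ, which cancels the A² in the denominator and gives a bound uniform in A. -/
theorem sqrt_mul_abs_weightDeriv_le {L M μ : ℝ} {y a₁ a₂ : Space d} (hA : 1 ≤ A) (hL : 0 ≤ L)
    (hM : 0 ≤ M) (hμ : 0 ≤ μ) (hμA : μ ≤ A ^ 2 + 2 * L * ‖x‖) (h₁ : ‖a₁‖ ≤ M * ‖y‖)
    (h₂ : ‖a₂‖ ≤ M * ‖y‖) :
    √μ * |weightDeriv A x u₁ u₂ y a₁ a₂| ≤ 4 * (1 + M) * (1 + L) * weightArg A x u₁ u₂ * ‖y‖ := by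
  have hA2 : 0 < A ^ 2 := by positivity
  have hΛ := one_le_weightArg (A := A) (x := x) (u₁ := u₁) (u₂ := u₂)
  have h1 := abs_weightDeriv_le_mul_norm (x := x) (u₁ := u₁) (u₂ := u₂) hA hM h₁ h₂
  have h2 : √μ * (‖x‖ + ‖u₁‖ + ‖u₂‖) ≤ 2 * (1 + L) * (A ^ 2 * weightArg A x u₁ u₂) := by
    have h3 : μ ≤ (1 + 2 * L) * (A ^ 2 * weightArg A x u₁ u₂) := by
      have := norm_le_weightArg (x := x) (u₁ := u₁) (u₂ := u₂) hA
      have h4 : L * ‖x‖ ≤ L * (A ^ 2 * weightArg A x u₁ u₂) := by gcongr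
      have h5 : A ^ 2 ≤ A ^ 2 * weightArg A x u₁ u₂ := le_mul_of_one_le_right hA2.le hΛ
      linarith
    have h4 := sq_add_le_weightArg (x := x) (u₁ := u₁) (u₂ := u₂) hA
    have h5 := Real.sq_sqrt hμ
    have h6 : (‖x‖ + ‖u₁‖ + ‖u₂‖) ^ 2 ≤ 3 * (‖x‖ ^ 2 + ‖u₁‖ ^ 2 + ‖u₂‖ ^ 2) := by
      nlinarith [sq_nonneg (‖x‖ - ‖u₁‖), sq_nonneg (‖x‖ - ‖u₂‖), sq_nonneg (‖u₁‖ - ‖u₂‖)]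
    have h7 := sq_nonneg (√μ - (‖x‖ + ‖u₁‖ + ‖u₂‖))
    have h8 : 0 ≤ L * (A ^ 2 * weightArg A x u₁ u₂) := by positivity
    nlinarith
  calc _ ≤ √μ * (2 * (1 + M) * (‖x‖ + ‖u₁‖ + ‖u₂‖) * ‖y‖ / A ^ 2) := by gcongr
    _ = 2 * (1 + M) * (√μ * (‖x‖ + ‖u₁‖ + ‖u₂‖)) * ‖y‖ / A ^ 2 := by ring
    _ ≤ 2 * (1 + M) * (2 * (1 + L) * (A ^ 2 * weightArg A x u₁ u₂)) * ‖y‖ / A ^ 2 := by gcongr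
    _ = _ := by field_simp; ring

end Weight

/-! ### Smoothness of the densities in the state variables. -/

section PairDensity

variable {d : ℕ} {κ : ℝ}

theorem contDiffAt_cutoffWeight {N : ℕ} {R Λ : ℝ} (hΛ : 0 < Λ) :
    ContDiffAt ℝ 1 (cutoffWeight N R) Λ := by
  refine ContDiffAt.mul ((contDiffAt_id.pow N).inv (pow_pos hΛ N).ne') ?_
  exact contDiffAt_const.sub
    (contDiff_smoothStep.contDiffAt.comp Λ (contDiffAt_id.div_const R))

theorem contDiffAt_energyCutoff {N : ℕ} {R h : ℝ} {y : ℝ × ℝ × ℝ × ℝ} (hΛ : 0 < y.1) :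
    ContDiffAt ℝ 1 (fun y : ℝ × ℝ × ℝ × ℝ => energyCutoff N R h y.1 y.2.1 y.2.2.1) y := by
  refine ((ContDiffAt.comp (f := fun y : ℝ × ℝ × ℝ × ℝ => y.1) y (contDiffAt_cutoffWeight hΛ)
    contDiffAt_fst).mul
    (contDiffAt_const.sub (contDiff_smoothStep.contDiffAt.comp y (by fun_prop)))).mul
    (contDiff_smoothStep.contDiffAt.comp y (by fun_prop))

theorem contDiffAt_energyDensity (p : EnergyProfile κ) {N : ℕ} {R h : ℝ} {y : ℝ × ℝ × ℝ × ℝ}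
    (hΛ : 0 < y.1) (hμ : 0 < y.2.2.1) :
    ContDiffAt ℝ 1 (fun y : ℝ × ℝ × ℝ × ℝ => energyDensity p N R h y.1 y.2.1 y.2.2.1 y.2.2.2) y := by
  have hz : ContDiffAt ℝ 1 (fun y : ℝ × ℝ × ℝ × ℝ => y.2.2.2 / y.2.2.1) y :=
    ContDiffAt.div (by fun_prop) (by fun_prop) hμ.ne'
  have hm : ContDiffAt ℝ 1 (fun y : ℝ × ℝ × ℝ × ℝ => y.2.2.1) y := by fun_prop
  exact (contDiffAt_energyCutoff hΛ).mul
    (((hm.rpow_const_of_ne hμ.ne').mul (p.contDiff_g.contDiffAt.comp y hz)).add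
      (((hm.rpow_const_of_ne hμ.ne').mul (p.contDiff_b.contDiffAt.comp y hz)).mul (by fun_prop)))

theorem contDiffAt_energyFlux (p : EnergyProfile κ) {N : ℕ} {R h : ℝ} {y : ℝ × ℝ × ℝ × ℝ}
    (hΛ : 0 < y.1) (hμ : 0 < y.2.2.1) :
    ContDiffAt ℝ 1 (fun y : ℝ × ℝ × ℝ × ℝ => energyFlux p N R h y.1 y.2.1 y.2.2.1 y.2.2.2) y := by
  have hz : ContDiffAt ℝ 1 (fun y : ℝ × ℝ × ℝ × ℝ => y.2.2.2 / y.2.2.1) y :=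
    ContDiffAt.div (by fun_prop) (by fun_prop) hμ.ne'
  have hm : ContDiffAt ℝ 1 (fun y : ℝ × ℝ × ℝ × ℝ => y.2.2.1) y := by fun_prop
  exact (contDiffAt_energyCutoff hΛ).mul
    ((hm.rpow_const_of_ne hμ.ne').mul (p.contDiff_f.contDiffAt.comp y hz))

theorem contDiffAt_velocityDensity {σ : ℝ} {N : ℕ} {R δ : ℝ} {y : ℝ × ℝ × ℝ}
    (hΛ : 0 < y.1) (hρ : 0 < y.2.2) :
    ContDiffAt ℝ 1 (fun y : ℝ × ℝ × ℝ => velocityDensity σ N R δ y.1 y.2.1 y.2.2) y := by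
  have hm : ContDiffAt ℝ 1 (fun y : ℝ × ℝ × ℝ => y.2.2) y := by fun_prop
  have hW : ContDiffAt ℝ 1 (fun y : ℝ × ℝ × ℝ => y.2.1) y := by fun_prop
  refine ((ContDiffAt.comp (f := fun y : ℝ × ℝ × ℝ => y.1) y (contDiffAt_cutoffWeight hΛ)
    contDiffAt_fst).mul ?_).mul ?_
  · exact (hm.rpow_const_of_ne hρ.ne').mul
      (contDiff_smoothStep.contDiffAt.comp y (hm.div_const δ))
  · exact hW.mul (contDiff_smoothStep.contDiffAt.comp y (contDiffAt_const.mul hW))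

end PairDensity

/-! ### The energy identity for two solutions at a point of differentiability. -/

section PairTransport

variable {d : ℕ} {κ : ℝ}

/-- Conditions on a constant `B` which bounds all the factors in the error terms of the energy
identity. -/
structure IsTransportConstant (p : EnergyProfile κ) (d N : ℕ) (L M C B : ℝ) : Prop where
  abs_deriv_le : ∀ y, |deriv smoothStep y| ≤ C
  one_le : 1 ≤ B
  weight_le : N + 2 * C ≤ B
  kappa_le : κ ≤ B
  sigma_le : 1 / κ + 1 ≤ B
  profile_le : p.C ≤ B
  mul_le : 4 * (1 + M) * (1 + L) ≤ B
  dim_le : 2 * (d * M) ≤ B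

theorem exists_isTransportConstant (p : EnergyProfile κ) (hκ : 0 < κ) (d N : ℕ) (L M : ℝ≥0) :
    ∃ C B, IsTransportConstant p d N L M C B := by
  obtain ⟨C, hC0, hC⟩ := exists_abs_deriv_smoothStep_le
  have h1 := p.C_pos
  have h2 : 0 ≤ 4 * (1 + (M : ℝ)) * (1 + L) := by positivity
  have h3 : 0 ≤ 2 * (d * (M : ℝ)) := by positivity
  have h4 : 0 ≤ N + 2 * C := by positivity
  have h5 : 0 < 1 / κ := by positivity
  exact ⟨C, 1 + (N + 2 * C) + κ + (1 / κ + 1) + p.C + 4 * (1 + M) * (1 + L) + 2 * (d * M), hC,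
    by linarith, by linarith, by linarith, by linarith, by linarith, by linarith, by linarith⟩

/-- The variables on which the energy densities of two states depend. -/
noncomputable def pairState (A : ℝ) (r₁ : ℝ → Space d → ℝ) (v₁ : ℝ → Space d → Space d)
    (r₂ : ℝ → Space d → ℝ) (v₂ : ℝ → Space d → Space d) (q : ℝ × Space d) : ℝ × ℝ × ℝ × ℝ :=
  (weightArg A q.2 (v₁ q.1 q.2) (v₂ q.1 q.2), ‖v₁ q.1 q.2 - v₂ q.1 q.2‖ ^ 2,
    r₁ q.1 q.2 + r₂ q.1 q.2, r₁ q.1 q.2 - r₂ q.1 q.2)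

/-- The localized energy density of two solutions. -/
noncomputable def pairEnergy (p : EnergyProfile κ) (N : ℕ) (R h A : ℝ) (r₁ : ℝ → Space d → ℝ)
    (v₁ : ℝ → Space d → Space d) (r₂ : ℝ → Space d → ℝ) (v₂ : ℝ → Space d → Space d)
    (q : ℝ × Space d) : ℝ :=
  energyDensity p N R h (weightArg A q.2 (v₁ q.1 q.2) (v₂ q.1 q.2)) (‖v₁ q.1 q.2 - v₂ q.1 q.2‖ ^ 2)
    (r₁ q.1 q.2 + r₂ q.1 q.2) (r₁ q.1 q.2 - r₂ q.1 q.2)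

/-- The coefficient of `v₁ - v₂` in the localized energy flux of two solutions. -/
noncomputable def pairFlux (p : EnergyProfile κ) (N : ℕ) (R h A : ℝ) (r₁ : ℝ → Space d → ℝ)
    (v₁ : ℝ → Space d → Space d) (r₂ : ℝ → Space d → ℝ) (v₂ : ℝ → Space d → Space d)
    (q : ℝ × Space d) : ℝ :=
  energyFlux p N R h (weightArg A q.2 (v₁ q.1 q.2) (v₂ q.1 q.2)) (‖v₁ q.1 q.2 - v₂ q.1 q.2‖ ^ 2)
    (r₁ q.1 q.2 + r₂ q.1 q.2) (r₁ q.1 q.2 - r₂ q.1 q.2)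

/-- The localized energy of large velocity differences of two solutions. -/
noncomputable def pairVelocity (σ : ℝ) (N : ℕ) (R δ A : ℝ) (r₁ : ℝ → Space d → ℝ)
    (v₁ v₂ : ℝ → Space d → Space d) (q : ℝ × Space d) : ℝ :=
  velocityDensity σ N R δ (weightArg A q.2 (v₁ q.1 q.2) (v₂ q.1 q.2))
    (‖v₁ q.1 q.2 - v₂ q.1 q.2‖ ^ 2) (r₁ q.1 q.2)

variable {r₁ r₂ : ℝ → Space d → ℝ} {v₁ v₂ : ℝ → Space d → Space d} {A : ℝ}

section Lipschitz

variable {S : Set (ℝ × Space d)}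

theorem locallyLipschitzOn_weightArg
    (hv₁ : LocallyLipschitzOn S fun q : ℝ × Space d => v₁ q.1 q.2)
    (hv₂ : LocallyLipschitzOn S fun q : ℝ × Space d => v₂ q.1 q.2) :
    LocallyLipschitzOn S fun q : ℝ × Space d => weightArg A q.2 (v₁ q.1 q.2) (v₂ q.1 q.2) := by
  have hx : LocallyLipschitzOn S fun q : ℝ × Space d => q.2 :=
    LipschitzWith.prod_snd.locallyLipschitz.locallyLipschitzOn
  exact (locallyLipschitzOn_const 1).vec_add (((hx.norm_sq.vec_add hv₁.norm_sq).vec_add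
    hv₂.norm_sq).comp_contDiffAt (H := fun y => y / A ^ 2) fun _ _ => contDiffAt_id.div_const _)

theorem locallyLipschitzOn_pairState
    (hr₁ : LocallyLipschitzOn S fun q : ℝ × Space d => r₁ q.1 q.2)
    (hv₁ : LocallyLipschitzOn S fun q : ℝ × Space d => v₁ q.1 q.2)
    (hr₂ : LocallyLipschitzOn S fun q : ℝ × Space d => r₂ q.1 q.2)
    (hv₂ : LocallyLipschitzOn S fun q : ℝ × Space d => v₂ q.1 q.2) :
    LocallyLipschitzOn S (pairState A r₁ v₁ r₂ v₂) :=
  (locallyLipschitzOn_weightArg hv₁ hv₂).prodMk' ((hv₁.vec_sub hv₂).norm_sq.prodMk'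
    ((hr₁.vec_add hr₂).prodMk' (hr₁.vec_sub hr₂)))

end Lipschitz

theorem differentiableAt_pairState {t : ℝ} {x : Space d}
    (hr₁ : DifferentiableAt ℝ (fun q : ℝ × Space d => r₁ q.1 q.2) (t, x))
    (hv₁ : DifferentiableAt ℝ (fun q : ℝ × Space d => v₁ q.1 q.2) (t, x))
    (hr₂ : DifferentiableAt ℝ (fun q : ℝ × Space d => r₂ q.1 q.2) (t, x))
    (hv₂ : DifferentiableAt ℝ (fun q : ℝ × Space d => v₂ q.1 q.2) (t, x)) :
    DifferentiableAt ℝ (pairState A r₁ v₁ r₂ v₂) (t, x) := by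
  have hx : DifferentiableAt ℝ (fun q : ℝ × Space d => q.2) (t, x) := differentiableAt_snd
  refine DifferentiableAt.prodMk ?_ (DifferentiableAt.prodMk ?_ (DifferentiableAt.prodMk ?_ ?_))
  · simp only [weightArg, div_eq_mul_inv]
    exact ((((hx.norm_sq ℝ).fun_add (hv₁.norm_sq ℝ)).fun_add (hv₂.norm_sq ℝ)).mul_const _).const_add 1
  · exact (hv₁.sub hv₂).norm_sq ℝ
  · exact hr₁.add hr₂
  · exact hr₁.sub hr₂

variable {T c : ℝ} {L M : ℝ≥0} {N : ℕ} {R h C B : ℝ} {t : ℝ} {x : Space d}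

/-- The derivatives of the state variables of two solutions in the direction `(a, y)`. -/
theorem hasDerivAt_pairState_line {R₁ R₂ : ℝ × Space d →L[ℝ] ℝ} {A₁ A₂ : ℝ × Space d →L[ℝ] Space d}
    (hr₁ : HasFDerivAt (fun q : ℝ × Space d => r₁ q.1 q.2) R₁ (t, x))
    (hv₁ : HasFDerivAt (fun q : ℝ × Space d => v₁ q.1 q.2) A₁ (t, x))
    (hr₂ : HasFDerivAt (fun q : ℝ × Space d => r₂ q.1 q.2) R₂ (t, x))
    (hv₂ : HasFDerivAt (fun q : ℝ × Space d => v₂ q.1 q.2) A₂ (t, x)) (a : ℝ × Space d) :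
    HasDerivAt (fun τ : ℝ => (pairState A r₁ v₁ r₂ v₂ ((t, x) + τ • a)).1)
        (weightDeriv A x (v₁ t x) (v₂ t x) a.2 (A₁ a) (A₂ a)) 0 ∧
      HasDerivAt (fun τ : ℝ => (pairState A r₁ v₁ r₂ v₂ ((t, x) + τ • a)).2.1)
        (2 * inner ℝ (v₁ t x - v₂ t x) (A₁ a - A₂ a)) 0 ∧
      HasDerivAt (fun τ : ℝ => (pairState A r₁ v₁ r₂ v₂ ((t, x) + τ • a)).2.2.1) (R₁ a + R₂ a) 0 ∧
      HasDerivAt (fun τ : ℝ => (pairState A r₁ v₁ r₂ v₂ ((t, x) + τ • a)).2.2.2) (R₁ a - R₂ a) 0 := by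
  have h1 := hr₁.hasDerivAt_line a
  have h2 := hr₂.hasDerivAt_line a
  have h3 := hv₁.hasDerivAt_line a
  have h4 := hv₂.hasDerivAt_line a
  have h5 : HasDerivAt (fun τ : ℝ => ((t, x) + τ • a).2) a.2 0 :=
    (hasFDerivAt_snd (𝕜 := ℝ) (p := (t, x))).hasDerivAt_line a
  refine ⟨?_, ?_, h1.add h2, h1.sub h2⟩
  · simpa [pairState] using hasDerivAt_weightArg (A := A) h5 h3 h4
  · simpa [pairState] using (h3.sub h4).norm_sq

theorem hasFDerivAt_pairEnergy {F : ℝ × ℝ × ℝ × ℝ → ℝ}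
    (hS : DifferentiableAt ℝ (pairState A r₁ v₁ r₂ v₂) (t, x))
    (hF : ContDiffAt ℝ 1 F (pairState A r₁ v₁ r₂ v₂ (t, x))) :
    HasFDerivAt (fun q => F (pairState A r₁ v₁ r₂ v₂ q))
      (fderiv ℝ (fun q => F (pairState A r₁ v₁ r₂ v₂ q)) (t, x)) (t, x) :=
  ((hF.differentiableAt one_ne_zero).comp (t, x) hS).hasFDerivAt

set_option maxHeartbeats 1000000 in
/-- The localized energy identity of two solutions at a point at which they are differentiable. -/
theorem energy_transport_at {p : EnergyProfile κ} (hκ : 0 < κ)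
    (hB : IsTransportConstant p d N L M C B) (hR : 0 < R) (hh : 0 < h) (hA : 1 ≤ A)
    {R₁ R₂ : ℝ × Space d →L[ℝ] ℝ} {A₁ A₂ : ℝ × Space d →L[ℝ] Space d}
    (h₁ : IsEulerDerivAt κ r₁ v₁ t x R₁ A₁) (h₂ : IsEulerDerivAt κ r₂ v₂ t x R₂ A₂)
    (hd₁ : DifferentiableAt ℝ (v₁ t) x) (hd₂ : DifferentiableAt ℝ (v₂ t) x)
    (hx₁ : 0 < r₁ t x) (hx₂ : 0 < r₂ t x)
    (hL₁ : ‖∇ (r₁ t) x‖ ≤ L) (hL₂ : ‖∇ (r₂ t) x‖ ≤ L)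
    (hM₁ : ‖fderiv ℝ (v₁ t) x‖ ≤ M) (hM₂ : ‖fderiv ℝ (v₂ t) x‖ ≤ M)
    (hs : |r₁ t x - r₂ t x| ≤ 1) (hμA : r₁ t x + r₂ t x ≤ A ^ 2 + 2 * L * ‖x‖) :
    deriv (fun τ => pairEnergy p N R h A r₁ v₁ r₂ v₂ (τ, x)) t +
      divergence (fun y => pairEnergy p N R h A r₁ v₁ r₂ v₂ (t, y) • ((1 / 2 : ℝ) • (v₁ t y + v₂ t y)) +
        pairFlux p N R h A r₁ v₁ r₂ v₂ (t, y) • (v₁ t y - v₂ t y)) x ≤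
      80 * B ^ 4 * ((weightArg A x (v₁ t x) (v₂ t x) ^ N)⁻¹ *
        ((r₁ t x + r₂ t x) ^ (1 / κ - 1) * (r₁ t x - r₂ t x) ^ 2 +
          (r₁ t x + r₂ t x) ^ (1 / κ) * ‖v₁ t x - v₂ t x‖ ^ 2 +
          (r₁ t x + r₂ t x) ^ (1 / κ - 1) *
            (‖v₁ t x - v₂ t x‖ ^ 2 * min ‖v₁ t x - v₂ t x‖ 1) + (2 * h) ^ (1 / κ))) := by
  have hμ : 0 < r₁ t x + r₂ t x := by positivity
  have hS := differentiableAt_pairState (A := A) h₁.hasFDerivAt_r.differentiableAt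
    h₁.hasFDerivAt_v.differentiableAt h₂.hasFDerivAt_r.differentiableAt
    h₂.hasFDerivAt_v.differentiableAt
  have hf := hasFDerivAt_pairEnergy hS (contDiffAt_energyDensity p (N := N) (R := R) (h := h)
    (y := pairState A r₁ v₁ r₂ v₂ (t, x)) weightArg_pos hμ)
  have hF := hasFDerivAt_pairEnergy hS (contDiffAt_energyFlux p (N := N) (R := R) (h := h)
    (y := pairState A r₁ v₁ r₂ v₂ (t, x)) weightArg_pos hμ)
  -- The mean velocity differs from the two fluid velocities by -w/2 and w/2. The symmetry produces
  -- the rates of s, μ and n² in which the profile relations act.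
  set V : ℝ → Space d → Space d := fun t y => (1 / 2 : ℝ) • (v₁ t y + v₂ t y) with hV
  set w : ℝ → Space d → Space d := fun t y => v₁ t y - v₂ t y with hw
  refine le_trans (le_of_eq (deriv_add_divergence_eq (V := V) (w := w) hf hF
    ((hd₁.fun_add hd₂).fun_const_smul _) (hd₁.fun_sub hd₂))) ?_
  have hdV : divergence (V t) x = (divergence (v₁ t) x + divergence (v₂ t) x) / 2 := by
    rw [hV, divergence_const_smul _ (hd₁.fun_add hd₂), divergence_add hd₁ hd₂]; ring
  have hdw : divergence (w t) x = divergence (v₁ t) x - divergence (v₂ t) x := by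
    have e : w t = fun y => v₁ t y + (-1 : ℝ) • v₂ t y := by
      funext y; simp [hw, sub_eq_add_neg]
    rw [e, divergence_add hd₁ (hd₂.fun_const_smul _), divergence_const_smul _ hd₂]; ring
  have hD : ∀ {u : Space d → Space d}, ‖fderiv ℝ u x‖ ≤ M → |divergence u x| ≤ d * M := fun hu =>
    (abs_divergence_le _ _).trans (by gcongr)
  have hD₁ := hD hM₁
  have hD₂ := hD hM₂
  obtain ⟨l1, l2, l3, l4⟩ := hasDerivAt_pairState_line (A := A) h₁.hasFDerivAt_r h₁.hasFDerivAt_v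
    h₂.hasFDerivAt_r h₂.hasFDerivAt_v (1, V t x)
  obtain ⟨m1, m2, m3, m4⟩ := hasDerivAt_pairState_line (A := A) h₁.hasFDerivAt_r h₁.hasFDerivAt_v
    h₂.hasFDerivAt_r h₂.hasFDerivAt_v (0, w t x)
  have hr₁ : DifferentiableAt ℝ (r₁ t) x :=
    (HasFDerivAt.comp_prodMk_right h₁.hasFDerivAt_r).differentiableAt
  have hr₂ : DifferentiableAt ℝ (r₂ t) x :=
    (HasFDerivAt.comp_prodMk_right h₂.hasFDerivAt_r).differentiableAt
  have eV₁ : V t x - (1 : ℝ) • v₁ t x = -((1 / 2 : ℝ) • w t x) := by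
    simp only [hV, hw]; module
  have eV₂ : V t x - (1 : ℝ) • v₂ t x = (1 / 2 : ℝ) • w t x := by
    simp only [hV, hw]; module
  have ew : ∀ u : Space d, w t x - (0 : ℝ) • u = w t x := fun u => by simp
  have n₁ : ‖w t x‖ ≤ ‖v₁ t x‖ + ‖v₂ t x‖ := norm_sub_le _ _
  have hn := norm_nonneg (w t x)
  set n := ‖w t x‖ with hn_def
  set α := fderiv ℝ (r₁ t) x (w t x) - fderiv ℝ (r₂ t) x (w t x) with hα
  set β := fderiv ℝ (r₁ t) x (w t x) + fderiv ℝ (r₂ t) x (w t x) with hβ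
  set q := inner ℝ (w t x) (fderiv ℝ (v₁ t) x (w t x) + fderiv ℝ (v₂ t) x (w t x)) with hq
  have hrL : ∀ {ρ : Space d → ℝ}, ‖∇ ρ x‖ ≤ L → |fderiv ℝ ρ x (w t x)| ≤ L * n := fun {ρ} hρ => by
    rw [norm_gradient_eq] at hρ
    exact ((fderiv ℝ ρ x).le_opNorm _).trans (by gcongr)
  have hvM : ∀ {u : Space d → Space d}, ‖fderiv ℝ u x‖ ≤ M → ‖fderiv ℝ u x (w t x)‖ ≤ M * n :=
    fun {u} hu => ((fderiv ℝ u x).le_opNorm _).trans (by gcongr)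
  have hB0 : 0 ≤ B := zero_le_one.trans hB.one_le
  have hLM : 4 + 4 * (M : ℝ) + 4 * L + 4 * (L * M) ≤ B := by linarith [hB.mul_le]
  have hL0 := L.coe_nonneg
  have hM0 := M.coe_nonneg
  have hLM0 : 0 ≤ (L : ℝ) * M := by positivity
  have hrB : ∀ {k : ℝ}, k ≤ B → k * n ≤ B * n := fun hk => by gcongr
  have hA₁ : A₁ (1, V t x) = -((1 / 2 : ℝ) • fderiv ℝ (v₁ t) x (w t x)) - ∇ (r₁ t) x := by
    rw [h₁.apply_v, eV₁, map_neg, map_smul, one_smul]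
  have hA₂ : A₂ (1, V t x) = (1 / 2 : ℝ) • fderiv ℝ (v₂ t) x (w t x) - ∇ (r₂ t) x := by
    rw [h₂.apply_v, eV₂, map_smul, one_smul]
  have hA₁w : A₁ (0, w t x) = fderiv ℝ (v₁ t) x (w t x) := by
    rw [h₁.apply_v, ew, zero_smul, sub_zero]
  have hA₂w : A₂ (0, w t x) = fderiv ℝ (v₂ t) x (w t x) := by
    rw [h₂.apply_v, ew, zero_smul, sub_zero]
  have hhalf : ∀ {u : Space d}, ‖u‖ ≤ M * n → ‖(1 / 2 : ℝ) • u‖ ≤ M * (‖v₁ t x‖ + ‖v₂ t x‖) :=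
    fun {u} hu => by
      rw [norm_smul, Real.norm_of_nonneg (by norm_num)]
      have : (M : ℝ) * n ≤ M * (‖v₁ t x‖ + ‖v₂ t x‖) := by gcongr
      linarith [norm_nonneg u]
  refine Exists.elim (energyDensity_transport (N := N) (R := R) (h := h) p hκ
    (C := C) (n := n) (Λ := weightArg A x (v₁ t x) (v₂ t x)) (s := r₁ t x - r₂ t x)
    (δ := divergence (v₁ t) x - divergence (v₂ t) x) (D := divergence (v₁ t) x + divergence (v₂ t) x) (α := α) (β := β) (q := q)
    hR hh hB.abs_deriv_le hB.one_le hB.weight_le hB.kappa_le hB.sigma_le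
    hB.profile_le weightArg_pos hμ hn (abs_sub_le_iff.2 ⟨by linarith, by linarith⟩) hs l1
    (l2.congr_deriv ?_) l3 l4 m1 m2 (m3.congr_deriv ?_) (m4.congr_deriv ?_)
    (by simp [pairState]) (by simp [pairState, hn_def, hw]) (by simp [pairState])
    (by simp [pairState]) (by simp [pairState]) (by simp [pairState, hn_def, hw])
    (by simp [pairState]) (by simp [pairState]) ?_ ?_ ?_ ?_ ?_ ?_ ?_ ?_ ?_ ?_)
    fun e' he' => ?_
  · rw [hA₁, hA₂]
    have e1 : -((1 / 2 : ℝ) • fderiv ℝ (v₁ t) x (w t x)) - ∇ (r₁ t) x -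
        ((1 / 2 : ℝ) • fderiv ℝ (v₂ t) x (w t x) - ∇ (r₂ t) x) =
        -((1 / 2 : ℝ) • (fderiv ℝ (v₁ t) x (w t x) + fderiv ℝ (v₂ t) x (w t x))) -
          (∇ (r₁ t) x - ∇ (r₂ t) x) := by module
    rw [e1, hα, fderiv_eq_inner_gradient hr₁, fderiv_eq_inner_gradient hr₂, hq]
    change 2 * inner ℝ (w t x) _ = _
    rw [inner_sub_right, inner_neg_right, inner_smul_right, inner_sub_right]
    ring
  · rw [h₁.apply_r, h₂.apply_r, ew, ew]; ring
  · rw [h₁.apply_r, h₂.apply_r, ew, ew]; ring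
  · rw [h₁.apply_r, h₂.apply_r, eV₁, eV₂, map_neg, map_smul, map_smul, hβ]
    simp only [smul_eq_mul]
    ring
  · rw [h₁.apply_r, h₂.apply_r, eV₁, eV₂, map_neg, map_smul, map_smul, hα]
    simp only [smul_eq_mul]
    ring
  · refine (abs_sub _ _).trans ((add_le_add (hrL hL₁) (hrL hL₂)).trans ?_)
    rw [← add_mul]
    exact hrB (by linarith)
  · refine (abs_add_le _ _).trans ((add_le_add (hrL hL₁) (hrL hL₂)).trans ?_)
    rw [← add_mul]
    exact hrB (by linarith)
  · refine (abs_sub _ _).trans ((add_le_add hD₁ hD₂).trans ?_)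
    linarith [hB.dim_le]
  · refine (abs_add_le _ _).trans ((add_le_add hD₁ hD₂).trans ?_)
    linarith [hB.dim_le]
  · refine (abs_real_inner_le_norm _ _).trans ?_
    calc n * _ ≤ n * (M * n + M * n) := by
          gcongr
          exact (norm_add_le _ _).trans (add_le_add (hvM hM₁) (hvM hM₂))
      _ = 2 * M * n ^ 2 := by ring
      _ ≤ _ := by gcongr; linarith
  · refine (abs_weightDeriv_le hA L.coe_nonneg M.coe_nonneg ?_ ?_ ?_).trans ?_
    · simp only [hV]
      rw [norm_smul, Real.norm_of_nonneg (by norm_num)]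
      linarith [norm_add_le (v₁ t x) (v₂ t x), norm_nonneg (v₁ t x), norm_nonneg (v₂ t x)]
    · rw [hA₁]
      refine (norm_sub_le _ _).trans (add_le_add ?_ hL₁)
      rw [norm_neg]
      exact hhalf (hvM hM₁)
    · rw [hA₂]
      exact (norm_sub_le _ _).trans (add_le_add (hhalf (hvM hM₂)) hL₂)
    · gcongr
      · exact weightArg_pos.le
      · linarith
  · refine (sqrt_mul_abs_weightDeriv_le hA L.coe_nonneg M.coe_nonneg hμ.le hμA ?_ ?_).trans ?_
    · rw [hA₁w]; exact hvM hM₁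
    · rw [hA₂w]; exact hvM hM₂
    · gcongr
      · exact weightArg_pos.le
      · exact hB.mul_le
  · rw [hA₁w, hA₂w, abs_mul, abs_of_pos (by norm_num : (0 : ℝ) < 2)]
    calc 2 * |inner ℝ (w t x) (fderiv ℝ (v₁ t) x (w t x) - fderiv ℝ (v₂ t) x (w t x))| ≤
          2 * (n * (M * n + M * n)) := by
          gcongr
          refine (abs_real_inner_le_norm _ _).trans ?_
          gcongr
          exact (norm_sub_le _ _).trans (add_le_add (hvM hM₁) (hvM hM₂))
      _ = 4 * M * n ^ 2 := by ring
      _ ≤ _ := by gcongr; linarith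
  · obtain ⟨F', he, hF', hle⟩ := he'
    have e1 := (hf.hasDerivAt_line (1, V t x)).unique he
    have e2 := (hF.hasDerivAt_line (0, w t x)).unique hF'
    rw [e1, e2, hdV, hdw]
    exact (le_abs_self _).trans hle

end PairTransport

/-! ### Transport of the complementary energy along the first velocity. -/

section VelocityTransport

variable {d : ℕ} {κ : ℝ}

/-- The transport form of a conservation law in terms of the space-time derivatives. -/
theorem deriv_add_divergence_smul {f : ℝ × Space d → ℝ} {V : ℝ → Space d → Space d} {t : ℝ}
    {x : Space d} {f' : ℝ × Space d →L[ℝ] ℝ} (hf : HasFDerivAt f f' (t, x))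
    (hV : DifferentiableAt ℝ (V t) x) :
    deriv (fun s => f (s, x)) t + divergence (fun y => f (t, y) • V t y) x =
      f' (1, V t x) + f (t, x) * divergence (V t) x := by
  have h1 := HasFDerivAt.comp_prodMk_right (u := fun t x => f (t, x)) hf
  have h3 := HasFDerivAt.comp_prodMk_left (u := fun t x => f (t, x)) hf
  rw [h3.deriv, divergence_smul h1.differentiableAt hV, h1.fderiv]
  have : f' (1, V t x) = f' (1, 0) + f' (0, V t x) := by rw [← map_add]; simp
  rw [this]
  simp only [ContinuousLinearMap.comp_apply, ContinuousLinearMap.inr_apply]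
  ring

variable {r₁ r₂ : ℝ → Space d → ℝ} {v₁ v₂ : ℝ → Space d → Space d} {A : ℝ}
  {T c : ℝ} {L M : ℝ≥0} {N : ℕ} {R δ₀ C B : ℝ} {t : ℝ} {x : Space d}

/-- The transport of large velocity differences at a point at which two solutions are
differentiable. -/
theorem velocity_transport_at {p : EnergyProfile κ} (hκ : 0 < κ)
    (hB : IsTransportConstant p d N L M C B) (hR : 0 < R) (hδ₀ : 0 < δ₀) (hA : 1 ≤ A) (hN : 1 ≤ N)
    (hNσ : 1 / κ ≤ N)
    {R₁ R₂ : ℝ × Space d →L[ℝ] ℝ} {A₁ A₂ : ℝ × Space d →L[ℝ] Space d}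
    (h₁ : IsEulerDerivAt κ r₁ v₁ t x R₁ A₁) (h₂ : IsEulerDerivAt κ r₂ v₂ t x R₂ A₂)
    (hd₁ : DifferentiableAt ℝ (v₁ t) x) (hx₁ : 0 < r₁ t x) (hx₂ : 0 < r₂ t x)
    (hL₁ : ‖∇ (r₁ t) x‖ ≤ L) (hL₂ : ‖∇ (r₂ t) x‖ ≤ L)
    (hM₁ : ‖fderiv ℝ (v₁ t) x‖ ≤ M) (hM₂ : ‖fderiv ℝ (v₂ t) x‖ ≤ M) :
    deriv (fun τ => pairVelocity (1 / κ) N R δ₀ A r₁ v₁ v₂ (τ, x)) t +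
      divergence (fun y => pairVelocity (1 / κ) N R δ₀ A r₁ v₁ v₂ (t, y) • v₁ t y) x ≤
      8 * B ^ 3 * ((weightArg A x (v₁ t x) (v₂ t x) ^ N)⁻¹ *
          ((r₁ t x + r₂ t x) ^ (1 / κ) * ‖v₁ t x - v₂ t x‖ ^ 2)) := by
  have hS := differentiableAt_pairState (A := A) h₁.hasFDerivAt_r.differentiableAt
    h₁.hasFDerivAt_v.differentiableAt h₂.hasFDerivAt_r.differentiableAt
    h₂.hasFDerivAt_v.differentiableAt
  have hf : HasFDerivAt (pairVelocity (1 / κ) N R δ₀ A r₁ v₁ v₂)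
      (fderiv ℝ (pairVelocity (1 / κ) N R δ₀ A r₁ v₁ v₂) (t, x)) (t, x) := by
    have hF := contDiffAt_velocityDensity (σ := 1 / κ) (N := N) (R := R) (δ := δ₀)
      (y := (weightArg A x (v₁ t x) (v₂ t x), ‖v₁ t x - v₂ t x‖ ^ 2, r₁ t x)) weightArg_pos hx₁
    exact ((hF.differentiableAt one_ne_zero).comp (t, x) (hS.fst.prodMk
      (hS.snd.fst.prodMk h₁.hasFDerivAt_r.differentiableAt))).hasFDerivAt
  refine le_trans (le_of_eq (deriv_add_divergence_smul (V := v₁) hf hd₁)) ?_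
  have hD : |divergence (v₁ t) x| ≤ B := by
    refine (abs_divergence_le _ _).trans ?_
    have : (d : ℝ) * ‖fderiv ℝ (v₁ t) x‖ ≤ d * M := by gcongr
    have : 0 ≤ (d : ℝ) * M := by positivity
    linarith [hB.dim_le]
  obtain ⟨l1, l2, -, -⟩ := hasDerivAt_pairState_line (A := A) h₁.hasFDerivAt_r h₁.hasFDerivAt_v
    h₂.hasFDerivAt_r h₂.hasFDerivAt_v (1, v₁ t x)
  have l3 := h₁.hasFDerivAt_r.hasDerivAt_line (1, v₁ t x)
  set w := v₁ t x - v₂ t x with hw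
  have hn := norm_nonneg w
  have hLM : 4 + 4 * (M : ℝ) + 4 * L + 4 * (L * M) ≤ B := by linarith [hB.mul_le]
  have hL0 := L.coe_nonneg
  have hM0 := M.coe_nonneg
  have hLM0 : 0 ≤ (L : ℝ) * M := by positivity
  have hvM : ‖fderiv ℝ (v₂ t) x w‖ ≤ M * ‖w‖ :=
    ((fderiv ℝ (v₂ t) x).le_opNorm _).trans (by gcongr)
  have n₁ : ‖w‖ ≤ ‖v₁ t x‖ + ‖v₂ t x‖ := norm_sub_le _ _
  -- Along the first flow v₁ accelerates only by its own pressure. The difference w then feels both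
  -- pressure gradients, bounded by 2L without any smallness; this is the forcing linear in n.
  have hA₁ : A₁ (1, v₁ t x) = -∇ (r₁ t) x := by rw [h₁.apply_v]; simp
  have hA₂ : A₂ (1, v₁ t x) = fderiv ℝ (v₂ t) x w - ∇ (r₂ t) x := by
    rw [h₂.apply_v, one_smul, one_smul]
  refine Exists.elim (velocityDensity_transport (N := N) (R := R) (δ₀ := δ₀) hκ (n := ‖w‖)
    (Λ := weightArg A x (v₁ t x) (v₂ t x)) (ρ := r₁ t x) (D := divergence (v₁ t) x)
    hR hδ₀ hB.abs_deriv_le hN hNσ hB.one_le hB.weight_le hB.kappa_le weightArg_pos hx₁ hn l1 l2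
    (l3.congr_deriv ?_) (by simp [pairState]) (by simp [pairState, hw]) (by simp) hD ?_ ?_)
    fun e' he' => ?_
  · rw [h₁.apply_r]; simp
  · refine (abs_weightDeriv_le hA L.coe_nonneg M.coe_nonneg ?_ ?_ ?_).trans ?_
    · linarith [norm_nonneg (v₂ t x)]
    · rw [hA₁, norm_neg]
      have : 0 ≤ M * (‖v₁ t x‖ + ‖v₂ t x‖) := by positivity
      linarith
    · rw [hA₂]
      exact (norm_sub_le _ _).trans (add_le_add (hvM.trans (by gcongr)) hL₂)
    · gcongr
      · exact weightArg_pos.le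
      · linarith
  · rw [hA₁, hA₂, abs_mul, abs_of_pos (by norm_num : (0 : ℝ) < 2)]
    calc _ ≤ 2 * (‖w‖ * (L + (M * ‖w‖ + L))) := by
          gcongr
          refine (abs_real_inner_le_norm _ _).trans ?_
          gcongr
          refine (norm_sub_le _ _).trans (add_le_add ?_ ?_)
          · rwa [norm_neg]
          · exact (norm_sub_le _ _).trans (add_le_add hvM hL₂)
      _ = 2 * (2 * L) * ‖w‖ + 2 * M * ‖w‖ ^ 2 := by ring
      _ ≤ _ := by gcongr <;> linarith
  · obtain ⟨he, hle⟩ := he'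
    have e1 := (hf.hasDerivAt_line (1, v₁ t x)).unique he
    rw [e1]
    refine ((le_abs_self _).trans hle).trans ?_
    have hB0 : 0 ≤ B := zero_le_one.trans hB.one_le
    have hφ : 0 ≤ (weightArg A x (v₁ t x) (v₂ t x) ^ N)⁻¹ :=
      inv_nonneg.2 (pow_nonneg weightArg_pos.le _)
    gcongr
    linarith

end VelocityTransport

/-! ### Pairs of nearby states at a fixed time, their weights and the Hardy inequality. -/

section GasPair

variable {d : ℕ}

/-- Two states of the gas at a fixed time with uniform bounds, which are close in the Lipschitz
topology. -/
structure IsGasPair (c : ℝ) (L M : ℝ≥0) (ε : ℝ) (ρ₁ : Space d → ℝ) (u₁ : Space d → Space d)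
    (ρ₂ : Space d → ℝ) (u₂ : Space d → Space d) : Prop where
  nonneg₁ : ∀ x, 0 ≤ ρ₁ x
  nonneg₂ : ∀ x, 0 ≤ ρ₂ x
  lipschitz₁ : LipschitzWith L ρ₁
  lipschitz₂ : LipschitzWith L ρ₂
  holder₁ : gradTildeHolderNorm ρ₁ ≤ M
  nondegenerate₁ : NondegenerateNearBoundary c ρ₁
  contDiffOn₁ : ContDiffOn ℝ 1 u₁ (gasDomain ρ₁)
  contDiffOn₂ : ContDiffOn ℝ 1 u₂ (gasDomain ρ₂)
  norm_fderiv_le₁ : ∀ x ∈ gasDomain ρ₁, ‖fderiv ℝ u₁ x‖ ≤ M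
  norm_fderiv_le₂ : ∀ x ∈ gasDomain ρ₂, ‖fderiv ℝ u₂ x‖ ≤ M
  close : LipschitzClose ε ρ₁ ρ₂

theorem IsRegularSolution.isGasPair {κ T c ε : ℝ} {L M : ℝ≥0} {r₁ r₂ : ℝ → Space d → ℝ}
    {v₁ v₂ : ℝ → Space d → Space d} (h₁ : IsRegularSolution κ T c L M r₁ v₁)
    (h₂ : IsRegularSolution κ T c L M r₂ v₂) {t : ℝ} (ht : t ∈ Icc 0 T)
    (h : LipschitzClose ε (r₁ t) (r₂ t)) : IsGasPair c L M ε (r₁ t) (v₁ t) (r₂ t) (v₂ t) where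
  nonneg₁ := h₁.solution.nonneg t ht
  nonneg₂ := h₂.solution.nonneg t ht
  lipschitz₁ := h₁.lipschitz t ht
  lipschitz₂ := h₂.lipschitz t ht
  holder₁ := h₁.gradTildeHolderNorm_le ht
  nondegenerate₁ := h₁.nondegenerate t ht
  contDiffOn₁ := h₁.contDiffOn t ht
  contDiffOn₂ := h₂.contDiffOn t ht
  norm_fderiv_le₁ _ hx := h₁.norm_fderiv_le ht hx
  norm_fderiv_le₂ _ hx := h₂.norm_fderiv_le ht hx
  close := h

/-- The weight at a fixed time. -/
noncomputable def gasWeight (N : ℕ) (A : ℝ) (u₁ u₂ : Space d → Space d) (x : Space d) : ℝ :=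
  (weightArg A x (u₁ x) (u₂ x) ^ N)⁻¹

theorem gasWeight_pos {N : ℕ} {A : ℝ} {u₁ u₂ : Space d → Space d} {x : Space d} :
    0 < gasWeight N A u₁ u₂ x :=
  inv_pos.2 (pow_pos weightArg_pos _)

theorem gasWeight_le_one {N : ℕ} {A : ℝ} {u₁ u₂ : Space d → Space d} {x : Space d} :
    gasWeight N A u₁ u₂ x ≤ 1 :=
  inv_le_one_of_one_le₀ (one_le_pow₀ one_le_weightArg)

/-- An integrable majorant of the weights. -/
theorem pow_mul_gasWeight_le {N k : ℕ} {A : ℝ} (hA : 1 ≤ A) (hN : k + d + 1 ≤ N)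
    {u₁ u₂ : Space d → Space d} {x : Space d} :
    weightArg A x (u₁ x) (u₂ x) ^ k * gasWeight N A u₁ u₂ x ≤
      A ^ (2 * (d + 1)) * ((1 + ‖x‖ ^ 2) ^ (d + 1))⁻¹ := by
  have h1 := one_le_weightArg (A := A) (x := x) (u₁ := u₁ x) (u₂ := u₂ x)
  set Λ := weightArg A x (u₁ x) (u₂ x) with hΛ
  have h0 : 0 < Λ := by linarith
  have h2 : 1 + ‖x‖ ^ 2 ≤ A ^ 2 * Λ := by
    have : A ^ 2 * Λ = A ^ 2 + (‖x‖ ^ 2 + ‖u₁ x‖ ^ 2 + ‖u₂ x‖ ^ 2) := by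
      rw [hΛ, weightArg]; field_simp
    rw [this]
    have := one_le_pow₀ hA (n := 2)
    have := sq_nonneg ‖u₁ x‖
    have := sq_nonneg ‖u₂ x‖
    linarith
  have h3 : Λ ^ (k + (d + 1)) ≤ Λ ^ N := pow_le_pow_right₀ h1 (by omega)
  rw [gasWeight, ← hΛ, pow_mul]
  calc Λ ^ k * (Λ ^ N)⁻¹ ≤ Λ ^ k * (Λ ^ (k + (d + 1)))⁻¹ := by gcongr
    _ = (Λ ^ (d + 1))⁻¹ := by rw [pow_add]; field_simp
    _ = (A ^ 2) ^ (d + 1) * ((A ^ 2 * Λ) ^ (d + 1))⁻¹ := by rw [mul_pow]; field_simp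
    _ ≤ _ := by gcongr

theorem integrable_inv_one_add_norm_sq_pow :
    Integrable fun x : Space d => ((1 + ‖x‖ ^ 2) ^ (d + 1))⁻¹ := by
  have h := integrable_rpow_neg_one_add_norm_sq (E := Space d) (μ := volume)
    (r := 2 * ((d + 1 : ℕ) : ℝ)) (by rw [finrank_euclideanSpace_fin]; push_cast; linarith)
  refine h.congr (Filter.Eventually.of_forall fun x => ?_)
  have h0 : (0 : ℝ) ≤ 1 + ‖x‖ ^ 2 := by positivity
  simp only
  rw [show -(2 * ((d + 1 : ℕ) : ℝ)) / 2 = -((d + 1 : ℕ) : ℝ) by ring, Real.rpow_neg h0,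
    Real.rpow_natCast]

section Weight

variable {u₁ u₂ : Space d → Space d} {x : Space d} {A : ℝ} {N : ℕ}

theorem differentiableAt_gasWeight (h₁ : DifferentiableAt ℝ u₁ x) (h₂ : DifferentiableAt ℝ u₂ x) :
    DifferentiableAt ℝ (gasWeight N A u₁ u₂) x := by
  have hx : DifferentiableAt ℝ (fun y : Space d => y) x := differentiableAt_id
  have : DifferentiableAt ℝ (fun y => weightArg A y (u₁ y) (u₂ y)) x := by
    simp only [weightArg, div_eq_mul_inv]
    exact ((((hx.norm_sq ℝ).fun_add (h₁.norm_sq ℝ)).fun_add (h₂.norm_sq ℝ)).mul_const _).const_add 1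
  exact (this.pow N).inv (pow_ne_zero _ weightArg_pos.ne')

/-- The relative variation of the weight is bounded independently of A, because |x| + |u₁| + |u₂| is
at most a multiple of A²Λ. The Hardy inequality can thus take the weight as part of its slowly
varying factor. -/
theorem norm_fderiv_gasWeight_le {M : ℝ} (hA : 1 ≤ A) (h₁ : DifferentiableAt ℝ u₁ x)
    (h₂ : DifferentiableAt ℝ u₂ x) (hM₁ : ‖fderiv ℝ u₁ x‖ ≤ M) (hM₂ : ‖fderiv ℝ u₂ x‖ ≤ M) :
    ‖fderiv ℝ (gasWeight N A u₁ u₂) x‖ ≤ N * (3 * (1 + M)) * gasWeight N A u₁ u₂ x := by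
  have hM : 0 ≤ M := (norm_nonneg _).trans hM₁
  have hφ := (gasWeight_pos (N := N) (A := A) (u₁ := u₁) (u₂ := u₂) (x := x)).le
  refine ContinuousLinearMap.opNorm_le_bound _ (by positivity) fun y => ?_
  have hx : HasDerivAt (fun τ : ℝ => x + τ • y) y 0 := by
    simpa using ((hasDerivAt_id (0 : ℝ)).smul_const y).const_add x
  have hΛ := hasDerivAt_weightArg (A := A) hx (h₁.hasFDerivAt.hasDerivAt_line y)
    (h₂.hasFDerivAt.hasDerivAt_line y)
  have h1 := one_le_weightArg (A := A) (x := x) (u₁ := u₁ x) (u₂ := u₂ x)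
  have hφ' := (hΛ.pow N).inv (by simpa using (pow_pos weightArg_pos N).ne')
  rw [((differentiableAt_gasWeight (N := N) (A := A) h₁ h₂).hasFDerivAt.hasDerivAt_line y).unique hφ']
  have hb : ∀ {u : Space d → Space d}, ‖fderiv ℝ u x‖ ≤ M → ‖fderiv ℝ u x y‖ ≤ M * ‖y‖ :=
    fun {u} hu => ((fderiv ℝ u x).le_opNorm y).trans (by gcongr)
  have h2 := abs_weightDeriv_le_mul_norm (x := x) (u₁ := u₁ x) (u₂ := u₂ x) hA hM (hb hM₁) (hb hM₂)
  simp only [zero_smul, add_zero, Pi.pow_apply, gasWeight]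
  have h3 : 2 * (1 + M) * (‖x‖ + ‖u₁ x‖ + ‖u₂ x‖) * ‖y‖ / A ^ 2 ≤
      3 * (1 + M) * weightArg A x (u₁ x) (u₂ x) * ‖y‖ := by
    have h4 : A ^ 2 * weightArg A x (u₁ x) (u₂ x) =
        A ^ 2 + (‖x‖ ^ 2 + ‖u₁ x‖ ^ 2 + ‖u₂ x‖ ^ 2) := by rw [weightArg]; field_simp
    have h5 : 2 * (‖x‖ + ‖u₁ x‖ + ‖u₂ x‖) ≤ 3 * (A ^ 2 * weightArg A x (u₁ x) (u₂ x)) := by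
      rw [h4]
      have := one_le_pow₀ hA (n := 2)
      nlinarith [sq_nonneg (‖x‖ - 1), sq_nonneg (‖u₁ x‖ - 1), sq_nonneg (‖u₂ x‖ - 1),
        sq_nonneg ‖x‖, sq_nonneg ‖u₁ x‖, sq_nonneg ‖u₂ x‖]
    rw [div_le_iff₀ (by positivity)]
    calc _ = (1 + M) * (2 * (‖x‖ + ‖u₁ x‖ + ‖u₂ x‖)) * ‖y‖ := by ring
      _ ≤ (1 + M) * (3 * (A ^ 2 * weightArg A x (u₁ x) (u₂ x))) * ‖y‖ := by gcongr
      _ = _ := by ring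
  have h6 := h2.trans h3
  set Λ := weightArg A x (u₁ x) (u₂ x)
  have hΛ0 : 0 < Λ := by linarith
  rw [Real.norm_eq_abs, abs_div, abs_neg, abs_mul, abs_mul, abs_of_nonneg (Nat.cast_nonneg N),
    abs_of_pos (pow_pos hΛ0 _), abs_of_pos (by positivity : 0 < (Λ ^ N) ^ 2)]
  rw [div_le_iff₀ (by positivity)]
  rcases N with _ | N
  · simp
  · calc _ ≤ ((N + 1 : ℕ) : ℝ) * Λ ^ (N + 1 - 1) * (3 * (1 + M) * Λ * ‖y‖) := by gcongr
      _ = _ := by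
        simp only [add_tsub_cancel_right]
        field_simp
        ring

end Weight

section Hardy

variable {c : ℝ} {L M : ℝ≥0} {ε : ℝ} {ρ₁ ρ₂ : Space d → ℝ} {u₁ u₂ : Space d → Space d}

theorem IsGasPair.isOpen (H : IsGasPair c L M ε ρ₁ u₁ ρ₂ u₂) :
    IsOpen (gasDomain ρ₁ ∩ gasDomain ρ₂) :=
  (isOpen_gasDomain H.lipschitz₁.continuous).inter (isOpen_gasDomain H.lipschitz₂.continuous)

theorem IsGasPair.differentiableAt₁ (H : IsGasPair c L M ε ρ₁ u₁ ρ₂ u₂) {x : Space d}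
    (hx : x ∈ gasDomain ρ₁) : DifferentiableAt ℝ u₁ x :=
  (H.contDiffOn₁.differentiableOn one_ne_zero).differentiableAt
    ((isOpen_gasDomain H.lipschitz₁.continuous).mem_nhds hx)

theorem IsGasPair.differentiableAt₂ (H : IsGasPair c L M ε ρ₁ u₁ ρ₂ u₂) {x : Space d}
    (hx : x ∈ gasDomain ρ₂) : DifferentiableAt ℝ u₂ x :=
  (H.contDiffOn₂.differentiableOn one_ne_zero).differentiableAt
    ((isOpen_gasDomain H.lipschitz₂.continuous).mem_nhds hx)

theorem locallyLipschitzOn_of_contDiffOn {u : Space d → Space d} {s : Set (Space d)} (hs : IsOpen s)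
    (hu : ContDiffOn ℝ 1 u s) : LocallyLipschitzOn s u :=
  ContDiffOn.comp_locallyLipschitzOn (u := fun x => x)
    LipschitzWith.id.locallyLipschitz.locallyLipschitzOn
    fun _ hp => hu.contDiffAt (hs.mem_nhds hp)

theorem IsGasPair.locallyLipschitzOn₁ (H : IsGasPair c L M ε ρ₁ u₁ ρ₂ u₂) :
    LocallyLipschitzOn (gasDomain ρ₁ ∩ gasDomain ρ₂) u₁ :=
  (locallyLipschitzOn_of_contDiffOn (isOpen_gasDomain H.lipschitz₁.continuous) H.contDiffOn₁).mono
    inter_subset_left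

theorem IsGasPair.locallyLipschitzOn₂ (H : IsGasPair c L M ε ρ₁ u₁ ρ₂ u₂) :
    LocallyLipschitzOn (gasDomain ρ₁ ∩ gasDomain ρ₂) u₂ :=
  (locallyLipschitzOn_of_contDiffOn (isOpen_gasDomain H.lipschitz₂.continuous) H.contDiffOn₂).mono
    inter_subset_right

theorem IsGasPair.locallyLipschitzOn_gasWeight (H : IsGasPair c L M ε ρ₁ u₁ ρ₂ u₂) {N : ℕ} {A : ℝ} :
    LocallyLipschitzOn (gasDomain ρ₁ ∩ gasDomain ρ₂) (gasWeight N A u₁ u₂) := by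
  have hx : LocallyLipschitzOn (gasDomain ρ₁ ∩ gasDomain ρ₂) fun x : Space d => x :=
    LipschitzWith.id.locallyLipschitz.locallyLipschitzOn
  have hΛ : LocallyLipschitzOn (gasDomain ρ₁ ∩ gasDomain ρ₂) fun x => weightArg A x (u₁ x) (u₂ x) :=
    (locallyLipschitzOn_const 1).vec_add (((hx.norm_sq.vec_add H.locallyLipschitzOn₁.norm_sq).vec_add
      H.locallyLipschitzOn₂.norm_sq).comp_contDiffAt (H := fun y => y / A ^ 2)
      fun _ _ => contDiffAt_id.div_const _)
  exact hΛ.comp_contDiffAt (H := fun y => (y ^ N)⁻¹) fun x _ =>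
    (contDiffAt_id.pow N).inv (pow_pos weightArg_pos N).ne'

/-- The Hardy inequality for two nearby states of the gas, with the polynomial weights. -/
theorem exists_gasPair_hardy (d : ℕ) {c : ℝ} (hc : 0 < c) (L M : ℝ≥0) (N : ℕ) {β K τ : ℝ}
    (hβ : -1 < β) (hK : 0 ≤ K) (hτ : 0 < τ) :
    ∃ a₀ > 0, ∃ ε₀ > 0, ∀ ε ≤ ε₀, ∀ (ρ₁ ρ₂ : Space d → ℝ) (u₁ u₂ : Space d → Space d),
      IsGasPair c L M ε ρ₁ u₁ ρ₂ u₂ → ∀ A : ℝ, 1 ≤ A → ∀ a : ℝ, 0 ≤ a → a ≤ a₀ →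
      ∀ k f : Space d → ℝ, LocallyLipschitzOn (gasDomain ρ₁ ∩ gasDomain ρ₂) k →
      LocallyLipschitzOn (gasDomain ρ₁ ∩ gasDomain ρ₂) f →
      (∀ x ∈ gasDomain ρ₁ ∩ gasDomain ρ₂, 0 ≤ k x ∧ k x ≤ 1 ∧ 0 ≤ f x) →
      (∀ᵐ x, x ∈ gasDomain ρ₁ ∩ gasDomain ρ₂ →
        ‖fderiv ℝ k x‖ ≤ K ∧ k x * ‖fderiv ℝ f x‖ ≤ K * f x) →
      IntegrableOn (fun x => f x * gasWeight N A u₁ u₂ x) (gasDomain ρ₁ ∩ gasDomain ρ₂) →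
      ∫⁻ x in gasDomain ρ₁ ∩ gasDomain ρ₂ ∩ {x | ρ₁ x + ρ₂ x < a * k x},
          ENNReal.ofReal (f x * gasWeight N A u₁ u₂ x * (ρ₁ x + ρ₂ x) ^ β) ≤
        ENNReal.ofReal τ * ∫⁻ x in gasDomain ρ₁ ∩ gasDomain ρ₂ ∩ {x | a * k x ≤ ρ₁ x + ρ₂ x},
          ENNReal.ofReal (f x * gasWeight N A u₁ u₂ x * (ρ₁ x + ρ₂ x) ^ β) := by
  obtain ⟨δ, hδ, b, hb, B, KX, hfield⟩ := exists_transversal_field d hc L M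
  obtain ⟨lam, hlam, hH⟩ := exists_hardy_constant d hβ L B KX (half_pos hb) hδ hτ
  set Cφ : ℝ := N * (3 * (1 + M)) with hCφ
  have hCφ0 : 0 ≤ Cφ := by positivity
  -- The bound on a makes both ak and the relative variation of f times the weight small enough for
  -- the Hardy inequality. The bound on ε costs at most half of the transversality constant b, since
  -- |X| ≤ B.
  refine ⟨lam / (1 + K + Cφ), by positivity, b / (2 * (B + 1)), by positivity, ?_⟩
  intro ε hε ρ₁ ρ₂ u₁ u₂ H A hA a ha0 ha k f hk hf hkf hder hint
  obtain ⟨X, hXL, hXB, hXa⟩ := hfield ρ₁ H.nonneg₁ H.lipschitz₁ H.holder₁ H.nondegenerate₁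
  set φ := gasWeight N A u₁ u₂ with hφ
  have haK : a * (1 + K + Cφ) ≤ lam := (le_div_iff₀ (by positivity)).1 ha
  have haK0 : 0 ≤ a * K := by positivity
  have haC0 : 0 ≤ a * Cφ := by positivity
  have hUo := H.isOpen
  refine hH ρ₁ ρ₂ X (fun x => a * k x) (fun x => f x * φ x) H.lipschitz₁ H.lipschitz₂ hXL hXB ?_
    ((locallyLipschitzOn_const a).real_mul hk) (hf.real_mul H.locallyLipschitzOn_gasWeight)
    (fun x hx => ?_) ?_ hint
  · filter_upwards [H.lipschitz₁.ae_differentiableAt (μ := volume),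
      H.lipschitz₂.ae_differentiableAt (μ := volume)] with x hd₁ hd₂ hx hxδ
    have h1 : b ≤ fderiv ℝ ρ₁ x (X x) := by
      rw [fderiv_eq_inner_gradient hd₁]
      exact hXa x ⟨hx.1, hd₁⟩ (by have : 0 < ρ₂ x := hx.2; linarith)
    -- The field is built from ρ₁ alone; transversality for ρ₂ is inherited through the closeness of
    -- the gradients.
    have h2 : |fderiv ℝ ρ₁ x (X x) - fderiv ℝ ρ₂ x (X x)| ≤ b / 2 := by
      rw [fderiv_eq_inner_gradient hd₁, fderiv_eq_inner_gradient hd₂, ← inner_sub_right]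
      refine (abs_real_inner_le_norm _ _).trans ?_
      calc ‖X x‖ * ‖∇ ρ₁ x - ∇ ρ₂ x‖ ≤ B * (b / (2 * (B + 1))) := by
            gcongr
            · exact hXB x
            · exact (H.close.2 x ⟨⟨hx.1, hd₁⟩, ⟨hx.2, hd₂⟩⟩).trans hε
        _ ≤ b / 2 := by
            rw [mul_div_assoc', div_le_div_iff₀ (by positivity) two_pos]
            nlinarith [B.coe_nonneg]
    have := (abs_le.1 h2).2
    exact ⟨by linarith, by linarith⟩
  · obtain ⟨h1, h2, h3⟩ := hkf x hx
    refine ⟨by positivity, ?_, mul_nonneg h3 gasWeight_pos.le⟩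
    nlinarith
  · filter_upwards [hder, ae_differentiableAt_of_locallyLipschitzOn (μ := volume) hUo hk,
      ae_differentiableAt_of_locallyLipschitzOn (μ := volume) hUo hf] with x hx hdk hdf hxU
    obtain ⟨h1, h2, h3⟩ := hkf x hxU
    obtain ⟨h4, h5⟩ := hx hxU
    have hd1 := H.differentiableAt₁ hxU.1
    have hd2 := H.differentiableAt₂ hxU.2
    have hφd := differentiableAt_gasWeight (N := N) (A := A) hd1 hd2
    have hφ' := norm_fderiv_gasWeight_le (N := N) hA hd1 hd2 (H.norm_fderiv_le₁ x hxU.1)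
      (H.norm_fderiv_le₂ x hxU.2)
    have hφ0 : 0 < φ x := gasWeight_pos
    rw [fderiv_const_mul (hdk hxU), norm_smul, Real.norm_of_nonneg ha0]
    constructor
    · calc a * ‖fderiv ℝ k x‖ ≤ a * K := by gcongr
        _ ≤ lam := by linarith
    · rw [fderiv_fun_mul (hdf hxU) hφd]
      calc a * k x * ‖f x • fderiv ℝ φ x + φ x • fderiv ℝ f x‖ ≤
            a * k x * (f x * (Cφ * φ x) + φ x * ‖fderiv ℝ f x‖) := by
            gcongr
            refine (norm_add_le _ _).trans ?_
            rw [norm_smul, norm_smul, Real.norm_of_nonneg h3, Real.norm_of_nonneg hφ0.le]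
            gcongr
        _ = a * (k x * (f x * (Cφ * φ x)) + φ x * (k x * ‖fderiv ℝ f x‖)) := by ring
        _ ≤ a * (1 * (f x * (Cφ * φ x)) + φ x * (K * f x)) := by gcongr
        _ = (a * (Cφ + K)) * (f x * φ x) := by ring
        _ ≤ lam * (f x * φ x) := by
            have : a * (Cφ + K) ≤ lam := by linarith
            gcongr

end Hardy

end GasPair

/-! ### Distance and energy densities at a fixed time: integrability with weights. -/

section FixedTime

variable {d : ℕ} {c : ℝ} {L M : ℝ≥0} {ε : ℝ} {ρ₁ ρ₂ : Space d → ℝ} {u₁ u₂ : Space d → Space d}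

theorem LocallyLipschitzOn.comp_lipschitzWith {E F G : Type*} [PseudoEMetricSpace E]
    [PseudoEMetricSpace F] [PseudoEMetricSpace G] {s : Set E} {f : E → F} {g : F → G} {K : ℝ≥0}
    (hf : LocallyLipschitzOn s f) (hg : LipschitzWith K g) :
    LocallyLipschitzOn s fun x => g (f x) := by
  intro x hx
  obtain ⟨K', t, ht, hK'⟩ := hf hx
  exact ⟨K * K', t, ht, hg.comp_lipschitzOnWith hK'⟩

theorem lipschitzWith_min_one : LipschitzWith 1 fun y : ℝ => min y 1 :=
  LipschitzWith.id.min_const 1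

/-- The distance density, without the constant in front of the velocities. -/
noncomputable def gasDist (σ : ℝ) (ρ₁ : Space d → ℝ) (u₁ : Space d → Space d) (ρ₂ : Space d → ℝ)
    (u₂ : Space d → Space d) (x : Space d) : ℝ :=
  (ρ₁ x + ρ₂ x) ^ (σ - 1) * (ρ₁ x - ρ₂ x) ^ 2 + (ρ₁ x + ρ₂ x) ^ σ * ‖u₁ x - u₂ x‖ ^ 2

/-- The energy density at a fixed time, without the cutoffs. -/
noncomputable def gasEnergy {κ : ℝ} (p : EnergyProfile κ) (CK δ₀ : ℝ) (ρ₁ : Space d → ℝ)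
    (u₁ : Space d → Space d) (ρ₂ : Space d → ℝ) (u₂ : Space d → Space d) (x : Space d) : ℝ :=
  (1 - smoothStep (‖u₁ x - u₂ x‖ ^ 2)) *
      ((ρ₁ x + ρ₂ x) ^ (1 / κ + 1) * p.g ((ρ₁ x - ρ₂ x) / (ρ₁ x + ρ₂ x)) +
        (ρ₁ x + ρ₂ x) ^ (1 / κ) * p.b ((ρ₁ x - ρ₂ x) / (ρ₁ x + ρ₂ x)) * ‖u₁ x - u₂ x‖ ^ 2) +
    CK * (cutoffPower (1 / κ) δ₀ (ρ₁ x) * cutoffSquare (‖u₁ x - u₂ x‖ ^ 2))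

section Integrability

theorem IsGasPair.locallyLipschitzOn_sub (H : IsGasPair c L M ε ρ₁ u₁ ρ₂ u₂) :
    LocallyLipschitzOn (gasDomain ρ₁ ∩ gasDomain ρ₂) fun x => ρ₁ x - ρ₂ x :=
  H.lipschitz₁.locallyLipschitz.locallyLipschitzOn.vec_sub
    H.lipschitz₂.locallyLipschitz.locallyLipschitzOn

theorem IsGasPair.continuousOn_gasWeight (H : IsGasPair c L M ε ρ₁ u₁ ρ₂ u₂) {N : ℕ} {A : ℝ} :
    ContinuousOn (gasWeight N A u₁ u₂) (gasDomain ρ₁ ∩ gasDomain ρ₂) :=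
  H.locallyLipschitzOn_gasWeight.continuousOn

theorem IsGasPair.continuousOn_rpow (H : IsGasPair c L M ε ρ₁ u₁ ρ₂ u₂) (β : ℝ) :
    ContinuousOn (fun x => (ρ₁ x + ρ₂ x) ^ β) (gasDomain ρ₁ ∩ gasDomain ρ₂) :=
  (H.lipschitz₁.continuous.add H.lipschitz₂.continuous).continuousOn.rpow_const
    fun _ hx => Or.inl (add_pos hx.1 hx.2).ne'

theorem IsGasPair.continuousOn_norm_sub (H : IsGasPair c L M ε ρ₁ u₁ ρ₂ u₂) :
    ContinuousOn (fun x => ‖u₁ x - u₂ x‖) (gasDomain ρ₁ ∩ gasDomain ρ₂) :=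
  (H.locallyLipschitzOn₁.continuousOn.sub H.locallyLipschitzOn₂.continuousOn).norm

theorem IsGasPair.continuousOn_gasDist (H : IsGasPair c L M ε ρ₁ u₁ ρ₂ u₂) (σ : ℝ) :
    ContinuousOn (gasDist σ ρ₁ u₁ ρ₂ u₂) (gasDomain ρ₁ ∩ gasDomain ρ₂) :=
  ((H.continuousOn_rpow _).mul (H.locallyLipschitzOn_sub.continuousOn.pow 2)).add
    ((H.continuousOn_rpow _).mul (H.continuousOn_norm_sub.pow 2))

theorem IsGasPair.continuousOn_gasEnergy (H : IsGasPair c L M ε ρ₁ u₁ ρ₂ u₂) {κ : ℝ}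
    (p : EnergyProfile κ) (CK δ₀ : ℝ) :
    ContinuousOn (gasEnergy p CK δ₀ ρ₁ u₁ ρ₂ u₂) (gasDomain ρ₁ ∩ gasDomain ρ₂) := by
  have hn := H.continuousOn_norm_sub.pow 2
  have hS := contDiff_smoothStep.continuous
  have h1 := H.lipschitz₁.continuous
  have h2 := H.lipschitz₂.continuous
  have hz : ContinuousOn (fun x => (ρ₁ x - ρ₂ x) / (ρ₁ x + ρ₂ x)) (gasDomain ρ₁ ∩ gasDomain ρ₂) :=
    (h1.sub h2).continuousOn.div (h1.add h2).continuousOn fun _ hx => (add_pos hx.1 hx.2).ne'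
  refine ((continuousOn_const.sub (hS.comp_continuousOn hn)).mul
    (((H.continuousOn_rpow _).mul (p.contDiff_g.continuous.comp_continuousOn hz)).add
      (((H.continuousOn_rpow _).mul (p.contDiff_b.continuous.comp_continuousOn hz)).mul hn))).add
    (continuousOn_const.mul (ContinuousOn.mul ?_ (hn.mul (hS.comp_continuousOn
      (continuousOn_const.mul hn)))))
  exact (h1.continuousOn.rpow_const fun _ hx => Or.inl (ne_of_gt hx.1)).mul
    (hS.comp_continuousOn (h1.continuousOn.div_const δ₀))

theorem gasDist_nonneg {σ : ℝ} {x : Space d} (hx : x ∈ gasDomain ρ₁ ∩ gasDomain ρ₂) :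
    0 ≤ gasDist σ ρ₁ u₁ ρ₂ u₂ x := by
  have h : 0 < ρ₁ x + ρ₂ x := add_pos hx.1 hx.2
  have := Real.rpow_pos_of_pos h σ
  have := Real.rpow_pos_of_pos h (σ - 1)
  rw [gasDist]
  positivity

/-- The profiles satisfy g = O(z²) and b = O(1), and μ^(σ+1) z² = μ^(σ-1) s². This upper bound is
used for integrability and for the initial energy. -/
theorem abs_gasEnergy_le {κ : ℝ} (hκ : 0 < κ) (p : EnergyProfile κ) {CK δ₀ : ℝ} (hCK : 0 ≤ CK)
    {x : Space d} (hx : x ∈ gasDomain ρ₁ ∩ gasDomain ρ₂) :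
    |gasEnergy p CK δ₀ ρ₁ u₁ ρ₂ u₂ x| ≤ (p.C + CK) * gasDist (1 / κ) ρ₁ u₁ ρ₂ u₂ x := by
  have hμ : 0 < ρ₁ x + ρ₂ x := add_pos hx.1 hx.2
  have hx1 : 0 < ρ₁ x := hx.1
  have hx2 : 0 < ρ₂ x := hx.2
  have hσ : 0 < 1 / κ := by positivity
  rw [gasEnergy, gasDist]
  set σ := 1 / κ
  set μ := ρ₁ x + ρ₂ x with hμd
  set s := ρ₁ x - ρ₂ x
  set n := ‖u₁ x - u₂ x‖
  set z := s / μ with hz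
  have hs : s = z * μ := by rw [hz]; field_simp
  have hP := Real.rpow_pos_of_pos hμ (σ - 1)
  have hP1 := Real.rpow_pos_of_pos hμ σ
  have hP2 := Real.rpow_pos_of_pos hμ (σ + 1)
  have e2 : μ ^ (σ + 1) = μ ^ (σ - 1) * μ ^ 2 := by
    rw [← Real.rpow_natCast, ← Real.rpow_add hμ]; congr 1; push_cast; ring
  have hpC := p.C_pos
  have hS : |1 - smoothStep (n ^ 2)| ≤ 1 :=
    abs_le.2 ⟨by linarith [smoothStep_le_one (n ^ 2)], by linarith [smoothStep_nonneg (n ^ 2)]⟩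
  have h1 : |(1 - smoothStep (n ^ 2)) * (μ ^ (σ + 1) * p.g z + μ ^ σ * p.b z * n ^ 2)| ≤
      p.C * (μ ^ (σ - 1) * s ^ 2 + μ ^ σ * n ^ 2) := by
    rw [abs_mul]
    calc _ ≤ 1 * (μ ^ (σ + 1) * (p.C * z ^ 2) + μ ^ σ * p.C * n ^ 2) := by
          gcongr
          refine (abs_add_le _ _).trans ?_
          rw [abs_mul _ (p.g z), abs_mul _ (n ^ 2), abs_mul _ (p.b z), abs_of_nonneg (sq_nonneg n),
            abs_of_pos hP1, abs_of_pos hP2]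
          gcongr
          · exact p.g_le z
          · exact p.b_le z
      _ = _ := by rw [e2, hs]; ring
  have h2 : |CK * (cutoffPower σ δ₀ (ρ₁ x) * cutoffSquare (n ^ 2))| ≤ CK * (μ ^ σ * n ^ 2) := by
    rw [abs_of_nonneg (mul_nonneg hCK (mul_nonneg (cutoffPower_nonneg hx1.le)
      (cutoffSquare_nonneg (sq_nonneg n))))]
    gcongr
    · exact cutoffSquare_nonneg (sq_nonneg n)
    · exact (cutoffPower_le hx1.le).trans (Real.rpow_le_rpow hx1.le (by linarith) hσ.le)
    · exact cutoffSquare_le (sq_nonneg n)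
  have h3 : 0 ≤ CK * (μ ^ (σ - 1) * s ^ 2) := by positivity
  refine (abs_add_le _ _).trans ((add_le_add h1 h2).trans ?_)
  linarith

/-- An a priori bound of the weighted distance density by an integrable function. -/
theorem gasDist_mul_gasWeight_le {σ : ℝ} (hσ : 0 < σ) {A : ℝ} (hA : 1 ≤ A) {N : ℕ}
    (hN : ⌈σ⌉₊ + d + 2 ≤ N) {x : Space d} (hx : x ∈ gasDomain ρ₁ ∩ gasDomain ρ₂)
    (hs : |ρ₁ x - ρ₂ x| ≤ 1) (hμA : ρ₁ x + ρ₂ x ≤ A ^ 2 + 2 * L * ‖x‖) :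
    gasDist σ ρ₁ u₁ ρ₂ u₂ x * gasWeight N A u₁ u₂ x ≤
      (A ^ 2 * (1 + 2 * L)) ^ σ * (3 * A ^ 2) *
        (A ^ (2 * (d + 1)) * ((1 + ‖x‖ ^ 2) ^ (d + 1))⁻¹) := by
  have hμ : 0 < ρ₁ x + ρ₂ x := add_pos hx.1 hx.2
  have hx1 : 0 < ρ₁ x := hx.1
  have hx2 : 0 < ρ₂ x := hx.2
  have h1 := one_le_weightArg (A := A) (x := x) (u₁ := u₁ x) (u₂ := u₂ x)
  have hφ := gasWeight_pos (N := N) (A := A) (u₁ := u₁) (u₂ := u₂) (x := x)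
  have hpow := pow_mul_gasWeight_le (d := d) (N := N) (k := ⌈σ⌉₊ + 1) (u₁ := u₁) (u₂ := u₂) (x := x) hA
    (by omega)
  have hsq := sq_add_le_weightArg (x := x) (u₁ := u₁ x) (u₂ := u₂ x) hA
  have hnx := norm_le_weightArg (x := x) (u₁ := u₁ x) (u₂ := u₂ x) hA
  set Λ := weightArg A x (u₁ x) (u₂ x)
  have hA2 : 1 ≤ A ^ 2 := one_le_pow₀ hA
  have hAΛ : 1 ≤ A ^ 2 * Λ := one_le_mul_of_one_le_of_one_le hA2 h1
  have hL := L.coe_nonneg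
  have hμΛ : ρ₁ x + ρ₂ x ≤ A ^ 2 * (1 + 2 * L) * Λ := by
    have h4 : (L : ℝ) * ‖x‖ ≤ L * (A ^ 2 * Λ) := by gcongr
    have h5 : A ^ 2 ≤ A ^ 2 * Λ := le_mul_of_one_le_right (by positivity) h1
    linarith
  have hΛσ : (ρ₁ x + ρ₂ x) ^ σ ≤ (A ^ 2 * (1 + 2 * L)) ^ σ * Λ ^ ⌈σ⌉₊ := by
    refine (Real.rpow_le_rpow hμ.le hμΛ hσ.le).trans ?_
    rw [Real.mul_rpow (by positivity) (by positivity)]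
    gcongr
    rw [← Real.rpow_natCast]
    exact Real.rpow_le_rpow_of_exponent_le h1 (Nat.le_ceil σ)
  have hd : gasDist σ ρ₁ u₁ ρ₂ u₂ x ≤ (A ^ 2 * (1 + 2 * L)) ^ σ * (3 * A ^ 2) * Λ ^ (⌈σ⌉₊ + 1) := by
    have e1 : (ρ₁ x + ρ₂ x) ^ (σ - 1) * (ρ₁ x - ρ₂ x) ^ 2 ≤ (ρ₁ x + ρ₂ x) ^ σ := by
      have h6 : (ρ₁ x - ρ₂ x) ^ 2 ≤ ρ₁ x + ρ₂ x := by
        rw [← sq_abs, sq]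
        have h7 : |ρ₁ x - ρ₂ x| ≤ ρ₁ x + ρ₂ x := abs_le.2 ⟨by linarith, by linarith⟩
        calc _ ≤ (ρ₁ x + ρ₂ x) * 1 := by gcongr
          _ = _ := mul_one _
      have h8 : (ρ₁ x + ρ₂ x) ^ σ = (ρ₁ x + ρ₂ x) ^ (σ - 1) * (ρ₁ x + ρ₂ x) := by
        rw [← Real.rpow_add_one hμ.ne']; simp
      rw [h8]
      have := (Real.rpow_pos_of_pos hμ (σ - 1)).le
      gcongr
    have e2 : ‖u₁ x - u₂ x‖ ^ 2 ≤ 2 * (A ^ 2 * Λ) := by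
      have h6 : ‖u₁ x - u₂ x‖ ^ 2 ≤ (‖u₁ x‖ + ‖u₂ x‖) ^ 2 := by
        gcongr
        exact norm_sub_le _ _
      nlinarith [sq_nonneg (‖u₁ x‖ - ‖u₂ x‖), sq_nonneg ‖x‖]
    have h9 := (Real.rpow_pos_of_pos hμ σ).le
    calc gasDist σ ρ₁ u₁ ρ₂ u₂ x ≤ (ρ₁ x + ρ₂ x) ^ σ +
          (ρ₁ x + ρ₂ x) ^ σ * (2 * (A ^ 2 * Λ)) := by
          rw [gasDist]
          gcongr
      _ = (ρ₁ x + ρ₂ x) ^ σ * (1 + 2 * (A ^ 2 * Λ)) := by ring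
      _ ≤ (A ^ 2 * (1 + 2 * L)) ^ σ * Λ ^ ⌈σ⌉₊ * (3 * (A ^ 2 * Λ)) := by
          gcongr
          linarith
      _ = _ := by rw [pow_succ]; ring
  calc _ ≤ (A ^ 2 * (1 + 2 * L)) ^ σ * (3 * A ^ 2) * Λ ^ (⌈σ⌉₊ + 1) * gasWeight N A u₁ u₂ x := by
        gcongr
    _ = (A ^ 2 * (1 + 2 * L)) ^ σ * (3 * A ^ 2) * (Λ ^ (⌈σ⌉₊ + 1) * gasWeight N A u₁ u₂ x) := by
        ring
    _ ≤ _ := by gcongr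

/-- The conditions on the scale `A` of the weights. -/
def IsGasScale (L : ℝ≥0) (A : ℝ) (ρ₁ ρ₂ : Space d → ℝ) : Prop :=
  1 ≤ A ∧ ∀ x, ρ₁ x + ρ₂ x ≤ A ^ 2 + 2 * L * ‖x‖

theorem IsGasPair.integrableOn_gasDist (H : IsGasPair c L M ε ρ₁ u₁ ρ₂ u₂) (hε : ε ≤ 1) {σ : ℝ}
    (hσ : 0 < σ) {A : ℝ} (hA : IsGasScale L A ρ₁ ρ₂) {N : ℕ} (hN : ⌈σ⌉₊ + d + 2 ≤ N) :
    IntegrableOn (fun x => gasDist σ ρ₁ u₁ ρ₂ u₂ x * gasWeight N A u₁ u₂ x)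
      (gasDomain ρ₁ ∩ gasDomain ρ₂) := by
  refine (((integrable_inv_one_add_norm_sq_pow (d := d)).const_mul
    (A ^ (2 * (d + 1)))).const_mul ((A ^ 2 * (1 + 2 * L)) ^ σ * (3 * A ^ 2))).integrableOn.mono'
    (((H.continuousOn_gasDist σ).mul H.continuousOn_gasWeight).aestronglyMeasurable
      H.isOpen.measurableSet) ?_
  rw [ae_restrict_iff' H.isOpen.measurableSet]
  refine Filter.Eventually.of_forall fun x hx => ?_
  rw [Real.norm_of_nonneg (mul_nonneg (gasDist_nonneg hx) gasWeight_pos.le)]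
  exact gasDist_mul_gasWeight_le hσ hA.1 hN hx ((H.close.1 x).trans hε) (hA.2 x)

theorem IsGasPair.integrableOn_gasWeight (H : IsGasPair c L M ε ρ₁ u₁ ρ₂ u₂) {A : ℝ} (hA : 1 ≤ A)
    {N : ℕ} (hN : d + 1 ≤ N) :
    IntegrableOn (gasWeight N A u₁ u₂) (gasDomain ρ₁ ∩ gasDomain ρ₂) := by
  refine ((integrable_inv_one_add_norm_sq_pow (d := d)).const_mul
    (A ^ (2 * (d + 1)))).integrableOn.mono'
    (H.continuousOn_gasWeight.aestronglyMeasurable H.isOpen.measurableSet) ?_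
  refine Filter.Eventually.of_forall fun x => ?_
  rw [Real.norm_of_nonneg gasWeight_pos.le]
  simpa using pow_mul_gasWeight_le (d := d) (N := N) (k := 0) (u₁ := u₁) (u₂ := u₂) (x := x) hA
    (by omega)

theorem norm_sub_sq_mul_gasWeight_le {A : ℝ} (hA : 1 ≤ A) {N : ℕ} (hN : d + 2 ≤ N) {x : Space d} :
    ‖u₁ x - u₂ x‖ ^ 2 * gasWeight N A u₁ u₂ x ≤
      2 * A ^ 2 * (A ^ (2 * (d + 1)) * ((1 + ‖x‖ ^ 2) ^ (d + 1))⁻¹) := by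
  have hφ := gasWeight_pos (N := N) (A := A) (u₁ := u₁) (u₂ := u₂) (x := x)
  have hpow := pow_mul_gasWeight_le (d := d) (N := N) (k := 1) (u₁ := u₁) (u₂ := u₂) (x := x) hA
    (by omega)
  have hsq := sq_add_le_weightArg (x := x) (u₁ := u₁ x) (u₂ := u₂ x) hA
  have e2 : ‖u₁ x - u₂ x‖ ^ 2 ≤ 2 * (A ^ 2 * weightArg A x (u₁ x) (u₂ x)) := by
    have h6 : ‖u₁ x - u₂ x‖ ^ 2 ≤ (‖u₁ x‖ + ‖u₂ x‖) ^ 2 := by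
      gcongr
      exact norm_sub_le _ _
    nlinarith [sq_nonneg (‖u₁ x‖ - ‖u₂ x‖), sq_nonneg ‖x‖]
  calc _ ≤ 2 * (A ^ 2 * weightArg A x (u₁ x) (u₂ x)) * gasWeight N A u₁ u₂ x := by gcongr
    _ = 2 * A ^ 2 * (weightArg A x (u₁ x) (u₂ x) ^ 1 * gasWeight N A u₁ u₂ x) := by ring
    _ ≤ _ := by gcongr

/-- Continuous functions which are bounded by `1 + |u₁ - u₂|²` are integrable with the weights. -/
theorem IsGasPair.integrableOn_mul_gasWeight (H : IsGasPair c L M ε ρ₁ u₁ ρ₂ u₂) {A : ℝ}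
    (hA : 1 ≤ A) {N : ℕ} (hN : d + 2 ≤ N) {f : Space d → ℝ}
    (hf : ContinuousOn f (gasDomain ρ₁ ∩ gasDomain ρ₂))
    (hfn : ∀ x ∈ gasDomain ρ₁ ∩ gasDomain ρ₂, |f x| ≤ 1 + ‖u₁ x - u₂ x‖ ^ 2) :
    IntegrableOn (fun x => f x * gasWeight N A u₁ u₂ x) (gasDomain ρ₁ ∩ gasDomain ρ₂) := by
  have hi := (((integrable_inv_one_add_norm_sq_pow (d := d)).const_mul
    (A ^ (2 * (d + 1)))).const_mul (2 * A ^ 2)).integrableOn (s := gasDomain ρ₁ ∩ gasDomain ρ₂)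
  refine ((H.integrableOn_gasWeight (N := N) hA (by omega)).add hi).mono'
    ((hf.mul H.continuousOn_gasWeight).aestronglyMeasurable H.isOpen.measurableSet) ?_
  rw [ae_restrict_iff' H.isOpen.measurableSet]
  refine Filter.Eventually.of_forall fun x hx => ?_
  have hφ := gasWeight_pos (N := N) (A := A) (u₁ := u₁) (u₂ := u₂) (x := x)
  rw [norm_mul, Real.norm_eq_abs, Real.norm_of_nonneg hφ.le]
  calc _ ≤ (1 + ‖u₁ x - u₂ x‖ ^ 2) * gasWeight N A u₁ u₂ x := by gcongr; exact hfn x hx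
    _ = gasWeight N A u₁ u₂ x + ‖u₁ x - u₂ x‖ ^ 2 * gasWeight N A u₁ u₂ x := by ring
    _ ≤ _ := add_le_add le_rfl (norm_sub_sq_mul_gasWeight_le hA hN)

end Integrability

end FixedTime

/-- Passage from the extended integrals of the Hardy inequality to Bochner integrals. Finiteness of
the left side is part of the gain, which matters for the cubic term, whose integrability is not
known beforehand. -/
theorem integrableOn_and_setIntegral_le {α : Type*} [MeasurableSpace α] {m : Measure α} {S U : Set α}
    {F G : α → ℝ} {τ : ℝ} (hS : MeasurableSet S) (hU : MeasurableSet U)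
    (hF : AEStronglyMeasurable F (m.restrict S)) (hF0 : ∀ x ∈ S, 0 ≤ F x)
    (hG : IntegrableOn G U m) (hG0 : ∀ x ∈ U, 0 ≤ G x) (hτ : 0 ≤ τ)
    (h : ∫⁻ x in S, ENNReal.ofReal (F x) ∂m ≤
      ENNReal.ofReal τ * ∫⁻ x in U, ENNReal.ofReal (G x) ∂m) :
    IntegrableOn F S m ∧ ∫ x in S, F x ∂m ≤ τ * ∫ x in U, G x ∂m := by
  have hF' : 0 ≤ᵐ[m.restrict S] F := (ae_restrict_iff' hS).2 (.of_forall hF0)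
  have hG' : 0 ≤ᵐ[m.restrict U] G := (ae_restrict_iff' hU).2 (.of_forall hG0)
  rw [← ofReal_integral_eq_lintegral_ofReal hG hG', ← ENNReal.ofReal_mul hτ] at h
  have hi : IntegrableOn F S m :=
    ⟨hF, (hasFiniteIntegral_iff_ofReal hF').2 (h.trans_lt ENNReal.ofReal_lt_top)⟩
  refine ⟨hi, ?_⟩
  rw [← ofReal_integral_eq_lintegral_ofReal hi hF'] at h
  exact (ENNReal.ofReal_le_ofReal_iff (mul_nonneg hτ (setIntegral_nonneg hU hG0))).1 h

section FixedTime

variable {d : ℕ} {c : ℝ} {L M : ℝ≥0} {ε : ℝ} {ρ₁ ρ₂ : Space d → ℝ} {u₁ u₂ : Space d → Space d}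

theorem IsGasPair.measurableSet_layer (H : IsGasPair c L M ε ρ₁ u₁ ρ₂ u₂) {k : Space d → ℝ}
    (hk : ContinuousOn k (gasDomain ρ₁ ∩ gasDomain ρ₂)) :
    MeasurableSet (gasDomain ρ₁ ∩ gasDomain ρ₂ ∩ {x | ρ₁ x + ρ₂ x < k x}) := by
  have h := (hk.sub (H.lipschitz₁.continuous.add H.lipschitz₂.continuous).continuousOn
    ).isOpen_inter_preimage H.isOpen (isOpen_Ioi (a := (0 : ℝ)))
  convert h.measurableSet using 2
  ext x
  simp

/-- The differences of the velocities satisfy the hypotheses of the Hardy inequality. -/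
theorem IsGasPair.norm_fderiv_min_le (H : IsGasPair c L M ε ρ₁ u₁ ρ₂ u₂) {x : Space d}
    (hx : x ∈ gasDomain ρ₁ ∩ gasDomain ρ₂) :
    ‖fderiv ℝ (fun y => min ‖u₁ y - u₂ y‖ 1) x‖ ≤ 2 * M ∧
      ‖fderiv ℝ (fun y => ‖u₁ y - u₂ y‖ ^ 2) x‖ ≤ 4 * M * ‖u₁ x - u₂ x‖ := by
  have h1 := H.differentiableAt₁ hx.1
  have h2 := H.differentiableAt₂ hx.2
  have hw : DifferentiableAt ℝ (fun y => u₁ y - u₂ y) x := h1.fun_sub h2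
  have hwM : ‖fderiv ℝ (fun y => u₁ y - u₂ y) x‖ ≤ 2 * M := by
    rw [fderiv_fun_sub h1 h2]
    linarith [norm_sub_le (fderiv ℝ u₁ x) (fderiv ℝ u₂ x), H.norm_fderiv_le₁ x hx.1,
      H.norm_fderiv_le₂ x hx.2]
  constructor
  · refine (norm_fderiv_le_of_norm_sub_le zero_le_one hw (.of_forall fun y => ?_)).trans
      (by rwa [one_mul])
    rw [Real.norm_eq_abs, one_mul]
    have := lipschitzWith_min_one.dist_le_mul ‖u₁ y - u₂ y‖ ‖u₁ x - u₂ x‖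
    rw [Real.dist_eq, Real.dist_eq] at this
    simp only [NNReal.coe_one, one_mul] at this
    exact this.trans (abs_norm_sub_norm_le _ _)
  · rw [(hw.hasFDerivAt.norm_sq).fderiv]
    refine ContinuousLinearMap.opNorm_le_bound _ (by positivity) fun y => ?_
    simp only [smul_apply, ContinuousLinearMap.comp_apply, innerSL_apply_apply]
    have e1 := norm_inner_le_norm (𝕜 := ℝ) (u₁ x - u₂ x)
      ((fderiv ℝ (fun y => u₁ y - u₂ y) x) y)
    have e2 := ((fderiv ℝ (fun y => u₁ y - u₂ y) x).le_opNorm y).trans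
      (mul_le_mul_of_nonneg_right hwM (norm_nonneg y))
    have e3 := mul_le_mul_of_nonneg_left e2 (norm_nonneg (u₁ x - u₂ x))
    simp only [nsmul_eq_mul, Nat.cast_ofNat, Real.norm_ofNat, norm_mul]
    linarith

theorem IsGasPair.locallyLipschitzOn_min (H : IsGasPair c L M ε ρ₁ u₁ ρ₂ u₂) :
    LocallyLipschitzOn (gasDomain ρ₁ ∩ gasDomain ρ₂) (fun y => min ‖u₁ y - u₂ y‖ 1) :=
  (H.locallyLipschitzOn₁.vec_sub H.locallyLipschitzOn₂).comp_lipschitzWith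
    (lipschitzWith_min_one.comp lipschitzWith_one_norm)

theorem IsGasPair.locallyLipschitzOn_norm_sq (H : IsGasPair c L M ε ρ₁ u₁ ρ₂ u₂) :
    LocallyLipschitzOn (gasDomain ρ₁ ∩ gasDomain ρ₂) (fun y => ‖u₁ y - u₂ y‖ ^ 2) :=
  (H.locallyLipschitzOn₁.vec_sub H.locallyLipschitzOn₂).norm_sq

theorem IsGasPair.ae_norm_fderiv_sub_le (H : IsGasPair c L M ε ρ₁ u₁ ρ₂ u₂) :
    ∀ᵐ x, x ∈ gasDomain ρ₁ ∩ gasDomain ρ₂ → DifferentiableAt ℝ (fun y => ρ₁ y - ρ₂ y) x ∧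
      ‖fderiv ℝ (fun y => ρ₁ y - ρ₂ y) x‖ ≤ ε := by
  filter_upwards [H.lipschitz₁.ae_differentiableAt (μ := volume),
    H.lipschitz₂.ae_differentiableAt (μ := volume)] with x h1 h2 hx
  refine ⟨h1.fun_sub h2, ContinuousLinearMap.opNorm_le_bound _
    ((abs_nonneg _).trans (H.close.1 x)) fun y => ?_⟩
  rw [fderiv_fun_sub h1 h2, sub_apply, fderiv_eq_inner_gradient h1,
    fderiv_eq_inner_gradient h2, ← inner_sub_right]
  refine (norm_inner_le_norm _ _).trans ?_
  rw [mul_comm]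
  have := H.close.2 x ⟨⟨hx.1, h1⟩, hx.2, h2⟩
  gcongr

end FixedTime

/-! ### The three applications of the Hardy inequality. -/

section Hardy

/-- Near the vacuum boundary, where `r₁ + r₂` is small compared with `|r₁ - r₂|`. -/
theorem exists_gasPair_layer_sub (d : ℕ) {c : ℝ} (hc : 0 < c) (L M : ℝ≥0) {N : ℕ} {σ z τ : ℝ}
    (hσ : 0 < σ) (hN : ⌈σ⌉₊ + d + 2 ≤ N) (hz : 0 < z) (hτ : 0 < τ) :
    ∃ ε₀ > 0, ∀ ε ≤ ε₀, ∀ (ρ₁ ρ₂ : Space d → ℝ) (u₁ u₂ : Space d → Space d),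
      IsGasPair c L M ε ρ₁ u₁ ρ₂ u₂ → ∀ A : ℝ, IsGasScale L A ρ₁ ρ₂ →
      ∫ x in gasDomain ρ₁ ∩ gasDomain ρ₂ ∩ {x | ρ₁ x + ρ₂ x < |ρ₁ x - ρ₂ x| / z},
          (ρ₁ x + ρ₂ x) ^ (σ - 1) * (ρ₁ x - ρ₂ x) ^ 2 * gasWeight N A u₁ u₂ x ≤
        τ * ∫ x in gasDomain ρ₁ ∩ gasDomain ρ₂,
          gasDist σ ρ₁ u₁ ρ₂ u₂ x * gasWeight N A u₁ u₂ x := by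
  -- Here k = |s|/(az) and f = s² (with z the given threshold), so the layer μ < ak is μ < |s|/z.
  -- For ε ≤ az both k and its derivative are at most 1, and k|∇f| ≤ 2f, hence the constant K = 2.
  obtain ⟨a, ha, ε₀, hε₀, h⟩ := exists_gasPair_hardy d hc L M N (β := σ - 1) (K := 2) (τ := τ)
    (by linarith) (by norm_num) hτ
  have haz : 0 < a * z := mul_pos ha hz
  refine ⟨min ε₀ (min 1 (a * z)), by positivity, fun ε hε ρ₁ ρ₂ u₁ u₂ H A hA => ?_⟩
  have hε1 : ε ≤ 1 := hε.trans ((min_le_right _ _).trans (min_le_left _ _))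
  have hε2 : ε ≤ a * z := hε.trans ((min_le_right _ _).trans (min_le_right _ _))
  have hsub := H.locallyLipschitzOn_sub
  have hlip : LipschitzWith (Real.toNNReal (a * z)⁻¹) fun y : ℝ => |y| / (a * z) := by
    refine LipschitzWith.of_dist_le_mul fun x y => ?_
    rw [Real.coe_toNNReal _ (inv_nonneg.2 haz.le), Real.dist_eq, Real.dist_eq, ← sub_div, abs_div,
      abs_of_pos haz, div_eq_inv_mul]
    exact mul_le_mul_of_nonneg_left (abs_abs_sub_abs_le x y) (inv_nonneg.2 haz.le)
  have hk := hsub.comp_lipschitzWith hlip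
  have hf : LocallyLipschitzOn (gasDomain ρ₁ ∩ gasDomain ρ₂) fun x => (ρ₁ x - ρ₂ x) ^ 2 :=
    hsub.comp_contDiffAt (H := fun y => y ^ 2) fun _ _ => contDiffAt_id.pow 2
  have hs1 : ∀ x, (ρ₁ x - ρ₂ x) ^ 2 ≤ 1 := fun x => by
    rw [← sq_abs]
    exact pow_le_one₀ (abs_nonneg _) ((H.close.1 x).trans hε1)
  have key := h ε (hε.trans (min_le_left _ _)) ρ₁ ρ₂ u₁ u₂ H A hA.1 a ha.le le_rfl
    (fun x => |ρ₁ x - ρ₂ x| / (a * z)) (fun x => (ρ₁ x - ρ₂ x) ^ 2) hk hf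
    (fun x _ => ⟨by positivity, (div_le_one haz).2 ((H.close.1 x).trans hε2), sq_nonneg _⟩) ?_
    (H.integrableOn_mul_gasWeight hA.1 (by omega) hf.continuousOn fun x _ => ?_)
  · have ek : ∀ x, a * (|ρ₁ x - ρ₂ x| / (a * z)) = |ρ₁ x - ρ₂ x| / z := fun x => by field_simp
    simp only [ek] at key
    have hUm := H.isOpen.measurableSet
    have hm := H.measurableSet_layer (k := fun x => |ρ₁ x - ρ₂ x| / z)
      (hsub.continuousOn.abs.div_const z)
    have hpos : ∀ x ∈ gasDomain ρ₁ ∩ gasDomain ρ₂, 0 < ρ₁ x + ρ₂ x :=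
      fun x hx => add_pos hx.1 hx.2
    refine (integrableOn_and_setIntegral_le hm hUm ?_ (fun x hx => ?_)
      (H.integrableOn_gasDist hε1 hσ hA hN)
      (fun x hx => mul_nonneg (gasDist_nonneg hx) gasWeight_pos.le) hτ.le ?_).2
    · exact ((((H.continuousOn_rpow _).mul (hsub.continuousOn.pow 2)).mul
        H.continuousOn_gasWeight).mono inter_subset_left).aestronglyMeasurable hm
    · have := Real.rpow_nonneg (hpos x hx.1).le (σ - 1)
      have := (gasWeight_pos (N := N) (A := A) (u₁ := u₁) (u₂ := u₂) (x := x)).le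
      positivity
    · calc _ = _ := by
            refine lintegral_congr fun x => ?_
            congr 1
            ring
        _ ≤ _ := key
        _ ≤ _ := by
            refine mul_le_mul_right ((lintegral_mono_set inter_subset_left).trans ?_) _
            refine setLIntegral_mono' hUm fun x hx => ENNReal.ofReal_le_ofReal ?_
            have h1 := Real.rpow_nonneg (hpos x hx).le σ
            have h2 := (gasWeight_pos (N := N) (A := A) (u₁ := u₁) (u₂ := u₂) (x := x)).le
            have h3 : 0 ≤ (ρ₁ x + ρ₂ x) ^ σ * ‖u₁ x - u₂ x‖ ^ 2 * gasWeight N A u₁ u₂ x := by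
              positivity
            rw [gasDist]
            linarith
  · filter_upwards [H.ae_norm_fderiv_sub_le] with x hx hxU
    obtain ⟨hd, hn⟩ := hx hxU
    constructor
    · have h1 := norm_fderiv_le_of_norm_sub_le (f := fun y => |ρ₁ y - ρ₂ y| / (a * z))
        (K := (a * z)⁻¹) (by positivity) hd (.of_forall fun y => by
          have := hlip.dist_le_mul (ρ₁ y - ρ₂ y) (ρ₁ x - ρ₂ x)
          rwa [Real.coe_toNNReal _ (inv_nonneg.2 haz.le)] at this)
      refine h1.trans ?_
      rw [inv_mul_le_iff₀ haz]
      linarith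
    · rw [(hd.hasFDerivAt.pow 2).fderiv]
      have e : |ρ₁ x - ρ₂ x| / (a * z) * ‖fderiv ℝ (fun y => ρ₁ y - ρ₂ y) x‖ ≤ |ρ₁ x - ρ₂ x| := by
        rw [div_mul_eq_mul_div, div_le_iff₀ haz]
        gcongr
        linarith
      rw [norm_smul]
      simp only [Nat.add_one_sub_one, pow_one, nsmul_eq_mul, Nat.cast_ofNat, norm_mul,
        Real.norm_ofNat, Real.norm_eq_abs]
      rw [← sq_abs (ρ₁ x - ρ₂ x)]
      have := mul_le_mul_of_nonneg_left e (abs_nonneg (ρ₁ x - ρ₂ x))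
      linarith
  · rw [abs_of_nonneg (sq_nonneg _)]
    linarith [hs1 x, sq_nonneg ‖u₁ x - u₂ x‖]

/-- Near the vacuum boundary, where `r₁ + r₂` is small compared with `|v₁ - v₂|`. -/
theorem exists_gasPair_layer_velocity (d : ℕ) {c : ℝ} (hc : 0 < c) (L M : ℝ≥0) {N : ℕ} {σ τ : ℝ}
    (hσ : 0 < σ) (hN : ⌈σ⌉₊ + d + 2 ≤ N) (hτ : 0 < τ) :
    ∃ a > 0, ∃ ε₀ > 0, ∀ ε ≤ ε₀, ∀ (ρ₁ ρ₂ : Space d → ℝ) (u₁ u₂ : Space d → Space d),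
      IsGasPair c L M ε ρ₁ u₁ ρ₂ u₂ → ∀ A : ℝ, IsGasScale L A ρ₁ ρ₂ →
      ∫ x in gasDomain ρ₁ ∩ gasDomain ρ₂ ∩ {x | ρ₁ x + ρ₂ x < a * min ‖u₁ x - u₂ x‖ 1},
          (ρ₁ x + ρ₂ x) ^ σ * ‖u₁ x - u₂ x‖ ^ 2 * gasWeight N A u₁ u₂ x ≤
        τ * ∫ x in gasDomain ρ₁ ∩ gasDomain ρ₂,
          gasDist σ ρ₁ u₁ ρ₂ u₂ x * gasWeight N A u₁ u₂ x := by
  -- Here k = min(n, 1) and f = n². The gradient of n² is at most 4Mn, and kn ≤ n² gives the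
  -- constant 4M.
  obtain ⟨a, ha, ε₀, hε₀, h⟩ := exists_gasPair_hardy d hc L M N (β := σ) (K := 4 * M) (τ := τ)
    (by linarith) (by positivity) hτ
  refine ⟨a, ha, min ε₀ 1, by positivity, fun ε hε ρ₁ ρ₂ u₁ u₂ H A hA => ?_⟩
  have hε1 : ε ≤ 1 := hε.trans (min_le_right _ _)
  have hk := H.locallyLipschitzOn_min
  have hf := H.locallyLipschitzOn_norm_sq
  have key := h ε (hε.trans (min_le_left _ _)) ρ₁ ρ₂ u₁ u₂ H A hA.1 a ha.le le_rfl _ _ hk hf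
    (fun x _ => ⟨by positivity, min_le_right _ _, sq_nonneg _⟩) (.of_forall fun x hx => ?_)
    (H.integrableOn_mul_gasWeight hA.1 (by omega) hf.continuousOn fun x _ => ?_)
  · have hUm := H.isOpen.measurableSet
    have hm := H.measurableSet_layer (hk.continuousOn.const_mul a)
    have hpos : ∀ x ∈ gasDomain ρ₁ ∩ gasDomain ρ₂, 0 < ρ₁ x + ρ₂ x :=
      fun x hx => add_pos hx.1 hx.2
    refine (integrableOn_and_setIntegral_le hm hUm ?_ (fun x hx => ?_)
      (H.integrableOn_gasDist hε1 hσ hA hN)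
      (fun x hx => mul_nonneg (gasDist_nonneg hx) gasWeight_pos.le) hτ.le ?_).2
    · exact ((((H.continuousOn_rpow _).mul hf.continuousOn).mul
        H.continuousOn_gasWeight).mono inter_subset_left).aestronglyMeasurable hm
    · have := Real.rpow_nonneg (hpos x hx.1).le σ
      have := (gasWeight_pos (N := N) (A := A) (u₁ := u₁) (u₂ := u₂) (x := x)).le
      positivity
    · calc _ = _ := by
            refine lintegral_congr fun x => ?_
            congr 1
            ring
        _ ≤ _ := key
        _ ≤ _ := by
            refine mul_le_mul_right ((lintegral_mono_set inter_subset_left).trans ?_) _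
            refine setLIntegral_mono' hUm fun x hx => ENNReal.ofReal_le_ofReal ?_
            have h1 := Real.rpow_nonneg (hpos x hx).le (σ - 1)
            have h2 := (gasWeight_pos (N := N) (A := A) (u₁ := u₁) (u₂ := u₂) (x := x)).le
            have h3 : 0 ≤ (ρ₁ x + ρ₂ x) ^ (σ - 1) * (ρ₁ x - ρ₂ x) ^ 2 *
              gasWeight N A u₁ u₂ x := by positivity
            rw [gasDist]
            linarith
  · obtain ⟨h1, h2⟩ := H.norm_fderiv_min_le hx
    refine ⟨h1.trans (by linarith [M.coe_nonneg]), ?_⟩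
    calc _ ≤ ‖u₁ x - u₂ x‖ * (4 * M * ‖u₁ x - u₂ x‖) := by
          gcongr
          exact min_le_left _ _
      _ = _ := by ring
  · rw [abs_of_nonneg (sq_nonneg _)]
    linarith

/-- The cubic velocity terms with a weaker power of `r₁ + r₂`. -/
theorem exists_gasPair_cubic_le (d : ℕ) {c : ℝ} (hc : 0 < c) (L M : ℝ≥0) {N : ℕ} {σ : ℝ}
    (hσ : 0 < σ) (hN : ⌈σ⌉₊ + d + 2 ≤ N) :
    ∃ B > 0, ∃ ε₀ > 0, ∀ ε ≤ ε₀, ∀ (ρ₁ ρ₂ : Space d → ℝ) (u₁ u₂ : Space d → Space d),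
      IsGasPair c L M ε ρ₁ u₁ ρ₂ u₂ → ∀ A : ℝ, IsGasScale L A ρ₁ ρ₂ →
      IntegrableOn (fun x => (ρ₁ x + ρ₂ x) ^ (σ - 1) *
          (‖u₁ x - u₂ x‖ ^ 2 * min ‖u₁ x - u₂ x‖ 1) * gasWeight N A u₁ u₂ x)
          (gasDomain ρ₁ ∩ gasDomain ρ₂) ∧
        ∫ x in gasDomain ρ₁ ∩ gasDomain ρ₂, (ρ₁ x + ρ₂ x) ^ (σ - 1) *
            (‖u₁ x - u₂ x‖ ^ 2 * min ‖u₁ x - u₂ x‖ 1) * gasWeight N A u₁ u₂ x ≤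
          B * ∫ x in gasDomain ρ₁ ∩ gasDomain ρ₂,
            gasDist σ ρ₁ u₁ ρ₂ u₂ x * gasWeight N A u₁ u₂ x := by
  -- With f = n² min(n, 1) and τ = 1 the layer μ < a min(n, 1) holds at most as much of the cubic
  -- term as its complement. On the complement min(n, 1) ≤ μ/a supplies the missing power of μ,
  -- whence the constant 2/a.
  obtain ⟨a, ha, ε₀, hε₀, h⟩ := exists_gasPair_hardy d hc L M N (β := σ - 1) (K := 6 * M) (τ := 1)
    (by linarith) (by positivity) one_pos
  refine ⟨2 / a, by positivity, min ε₀ 1, by positivity, fun ε hε ρ₁ ρ₂ u₁ u₂ H A hA => ?_⟩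
  have hε1 : ε ≤ 1 := hε.trans (min_le_right _ _)
  have hk := H.locallyLipschitzOn_min
  have hq := H.locallyLipschitzOn_norm_sq
  have hf := hq.real_mul hk
  have hUm := H.isOpen.measurableSet
  have hm := H.measurableSet_layer (hk.continuousOn.const_mul a)
  have hpos : ∀ x ∈ gasDomain ρ₁ ∩ gasDomain ρ₂, 0 < ρ₁ x + ρ₂ x :=
    fun x hx => add_pos hx.1 hx.2
  have key := h ε (hε.trans (min_le_left _ _)) ρ₁ ρ₂ u₁ u₂ H A hA.1 a ha.le le_rfl _ _ hk hf
    (fun x _ => ⟨by positivity, min_le_right _ _, by positivity⟩) ?_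
    (H.integrableOn_mul_gasWeight hA.1 (by omega) hf.continuousOn fun x _ => ?_)
  · refine integrableOn_and_setIntegral_le hUm hUm ?_ (fun x hx => ?_)
      (H.integrableOn_gasDist hε1 hσ hA hN)
      (fun x hx => mul_nonneg (gasDist_nonneg hx) gasWeight_pos.le) (by positivity) ?_
    · exact (((H.continuousOn_rpow _).mul hf.continuousOn).mul
        H.continuousOn_gasWeight).aestronglyMeasurable hUm
    · have := Real.rpow_nonneg (hpos x hx).le (σ - 1)
      have := (gasWeight_pos (N := N) (A := A) (u₁ := u₁) (u₂ := u₂) (x := x)).le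
      positivity
    · rw [ENNReal.ofReal_one, one_mul] at key
      set F : Space d → ℝ≥0∞ := fun x => ENNReal.ofReal (‖u₁ x - u₂ x‖ ^ 2 *
        min ‖u₁ x - u₂ x‖ 1 * gasWeight N A u₁ u₂ x * (ρ₁ x + ρ₂ x) ^ (σ - 1))
      have hsplit : gasDomain ρ₁ ∩ gasDomain ρ₂ =
          (gasDomain ρ₁ ∩ gasDomain ρ₂ ∩ {x | ρ₁ x + ρ₂ x < a * min ‖u₁ x - u₂ x‖ 1}) ∪
          (gasDomain ρ₁ ∩ gasDomain ρ₂ ∩ {x | a * min ‖u₁ x - u₂ x‖ 1 ≤ ρ₁ x + ρ₂ x}) := by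
        ext x
        simp only [mem_union, mem_inter_iff, mem_ofPred_eq]
        have := lt_or_ge (ρ₁ x + ρ₂ x) (a * min ‖u₁ x - u₂ x‖ 1)
        tauto
      have hm' : MeasurableSet
          (gasDomain ρ₁ ∩ gasDomain ρ₂ ∩ {x | a * min ‖u₁ x - u₂ x‖ 1 ≤ ρ₁ x + ρ₂ x}) := by
        convert hUm.diff hm using 1
        ext x
        simp only [mem_inter_iff, mem_sdiff, mem_ofPred_eq]
        constructor
        · rintro ⟨h1, h2⟩
          exact ⟨h1, fun h3 => absurd h3.2 h2.not_gt⟩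
        · rintro ⟨h1, h2⟩
          exact ⟨h1, not_lt.1 fun h3 => h2 ⟨h1, h3⟩⟩
      calc _ = ∫⁻ x in gasDomain ρ₁ ∩ gasDomain ρ₂, F x := by
            refine lintegral_congr fun x => ?_
            congr 1
            ring
        _ ≤ (∫⁻ x in gasDomain ρ₁ ∩ gasDomain ρ₂ ∩ {x | ρ₁ x + ρ₂ x < a * min ‖u₁ x - u₂ x‖ 1}, F x)
            + ∫⁻ x in gasDomain ρ₁ ∩ gasDomain ρ₂ ∩ {x | a * min ‖u₁ x - u₂ x‖ 1 ≤ ρ₁ x + ρ₂ x},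
              F x := by
            conv_lhs => rw [hsplit]
            exact lintegral_union_le _ _ _
        _ ≤ 2 * ∫⁻ x in gasDomain ρ₁ ∩ gasDomain ρ₂ ∩
              {x | a * min ‖u₁ x - u₂ x‖ 1 ≤ ρ₁ x + ρ₂ x}, F x := by
            rw [two_mul]
            gcongr
        _ ≤ 2 * ∫⁻ x in gasDomain ρ₁ ∩ gasDomain ρ₂ ∩
              {x | a * min ‖u₁ x - u₂ x‖ 1 ≤ ρ₁ x + ρ₂ x}, ENNReal.ofReal a⁻¹ *
              ENNReal.ofReal (gasDist σ ρ₁ u₁ ρ₂ u₂ x * gasWeight N A u₁ u₂ x) := by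
            gcongr 2 * ?_
            refine setLIntegral_mono' hm' fun x hx => ?_
            rw [← ENNReal.ofReal_mul (by positivity)]
            refine ENNReal.ofReal_le_ofReal ?_
            have h1 := Real.rpow_nonneg (hpos x hx.1).le (σ - 1)
            have h2 := (gasWeight_pos (N := N) (A := A) (u₁ := u₁) (u₂ := u₂) (x := x)).le
            have e : (ρ₁ x + ρ₂ x) ^ σ = (ρ₁ x + ρ₂ x) ^ (σ - 1) * (ρ₁ x + ρ₂ x) := by
              rw [← Real.rpow_add_one (hpos x hx.1).ne']; simp
            have h3 : min ‖u₁ x - u₂ x‖ 1 ≤ a⁻¹ * (ρ₁ x + ρ₂ x) := by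
              rw [le_inv_mul_iff₀ ha]
              exact hx.2
            have h4 : 0 ≤ a⁻¹ * ((ρ₁ x + ρ₂ x) ^ (σ - 1) * (ρ₁ x - ρ₂ x) ^ 2 *
              gasWeight N A u₁ u₂ x) := by positivity
            have h5 := mul_le_mul_of_nonneg_left h3 (mul_nonneg (mul_nonneg h1
              (sq_nonneg ‖u₁ x - u₂ x‖)) h2)
            rw [gasDist, e]
            linarith
        _ ≤ 2 * ∫⁻ x in gasDomain ρ₁ ∩ gasDomain ρ₂, ENNReal.ofReal a⁻¹ *
              ENNReal.ofReal (gasDist σ ρ₁ u₁ ρ₂ u₂ x * gasWeight N A u₁ u₂ x) := by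
            exact mul_le_mul_right (lintegral_mono_set inter_subset_left) _
        _ = _ := by
            rw [lintegral_const_mul' _ _ ENNReal.ofReal_ne_top, ← mul_assoc, div_eq_mul_inv,
              ENNReal.ofReal_mul zero_le_two, ENNReal.ofReal_ofNat]
  · filter_upwards [ae_differentiableAt_of_locallyLipschitzOn (μ := volume) H.isOpen hk]
      with x hxd hx
    obtain ⟨h1, h2⟩ := H.norm_fderiv_min_le hx
    have hM := M.coe_nonneg
    refine ⟨h1.trans (by linarith), ?_⟩
    have hqd : DifferentiableAt ℝ (fun y => ‖u₁ y - u₂ y‖ ^ 2) x :=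
      ((H.differentiableAt₁ hx.1).fun_sub (H.differentiableAt₂ hx.2)).norm_sq ℝ
    rw [fderiv_fun_mul hqd (hxd hx)]
    set n := ‖u₁ x - u₂ x‖
    have hn : 0 ≤ n := norm_nonneg _
    have hmn : min n 1 ≤ n := min_le_left _ _
    have hm0 : 0 ≤ min n 1 := le_min hn zero_le_one
    have h3 := norm_add_le (n ^ 2 • fderiv ℝ (fun y => min ‖u₁ y - u₂ y‖ 1) x)
      (min n 1 • fderiv ℝ (fun y => ‖u₁ y - u₂ y‖ ^ 2) x)
    rw [norm_smul, norm_smul, Real.norm_of_nonneg hm0, Real.norm_of_nonneg (sq_nonneg n)] at h3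
    calc _ ≤ min n 1 * (n ^ 2 * (2 * M) + n * (4 * M * n)) := by
          gcongr
          exact h3.trans (by gcongr)
      _ = _ := by ring
  · rw [abs_of_nonneg (by positivity)]
    have : ‖u₁ x - u₂ x‖ ^ 2 * min ‖u₁ x - u₂ x‖ 1 ≤ ‖u₁ x - u₂ x‖ ^ 2 * 1 := by
      gcongr
      exact min_le_right _ _
    linarith

end Hardy

theorem IsGasPair.integrableOn_gasEnergy {d : ℕ} {c : ℝ} {L M : ℝ≥0} {ε : ℝ} {ρ₁ ρ₂ : Space d → ℝ}
    {u₁ u₂ : Space d → Space d} (H : IsGasPair c L M ε ρ₁ u₁ ρ₂ u₂) (hε : ε ≤ 1) {κ : ℝ}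
    (hκ : 0 < κ) (p : EnergyProfile κ) {CK δ₀ : ℝ} (hCK : 0 ≤ CK) {A : ℝ}
    (hA : IsGasScale L A ρ₁ ρ₂) {N : ℕ} (hN : ⌈1 / κ⌉₊ + d + 2 ≤ N) :
    IntegrableOn (fun x => gasEnergy p CK δ₀ ρ₁ u₁ ρ₂ u₂ x * gasWeight N A u₁ u₂ x)
      (gasDomain ρ₁ ∩ gasDomain ρ₂) := by
  refine ((H.integrableOn_gasDist hε (σ := 1 / κ) (by positivity) hA hN).const_mul
    (p.C + CK)).mono' (((H.continuousOn_gasEnergy p CK δ₀).mul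
      H.continuousOn_gasWeight).aestronglyMeasurable H.isOpen.measurableSet) ?_
  rw [ae_restrict_iff' H.isOpen.measurableSet]
  refine .of_forall fun x hx => ?_
  have hφ := (gasWeight_pos (N := N) (A := A) (u₁ := u₁) (u₂ := u₂) (x := x)).le
  rw [norm_mul, Real.norm_of_nonneg hφ, ← mul_assoc]
  exact mul_le_mul_of_nonneg_right (abs_gasEnergy_le hκ p hCK hx) hφ

/-- The energy controls the distance. -/
theorem exists_gasPair_coercive (d : ℕ) {κ c : ℝ} (hκ : 0 < κ) (hc : 0 < c) (L M : ℝ≥0)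
    (p : EnergyProfile κ) {N : ℕ} (hN : ⌈1 / κ⌉₊ + d + 2 ≤ N) :
    ∃ CK > 0, ∃ δ₀ > 0, ∃ C₁ > 0, ∃ ε₀ > 0, ∀ ε ≤ ε₀, ∀ (ρ₁ ρ₂ : Space d → ℝ)
      (u₁ u₂ : Space d → Space d), IsGasPair c L M ε ρ₁ u₁ ρ₂ u₂ → ∀ A : ℝ, IsGasScale L A ρ₁ ρ₂ →
      ∫ x in gasDomain ρ₁ ∩ gasDomain ρ₂,
          gasDist (1 / κ) ρ₁ u₁ ρ₂ u₂ x * gasWeight N A u₁ u₂ x ≤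
        C₁ * ∫ x in gasDomain ρ₁ ∩ gasDomain ρ₂,
          gasEnergy p CK δ₀ ρ₁ u₁ ρ₂ u₂ x * gasWeight N A u₁ u₂ x := by
  have hσ : 0 < 1 / κ := by positivity
  obtain ⟨CK, hCK, C₁, hC₁, C₂, hC₂, hlayer⟩ := p.exists_le_energy_add_layer hκ
  -- With τ = 1/(4C₂) each of the two layers takes at most a quarter of the distance. Together they
  -- are absorbed into the left side, at the price of doubling C₁.
  obtain ⟨a, ha, ε₁, hε₁, hvel⟩ := exists_gasPair_layer_velocity d hc L M hσ hN
    (τ := (4 * C₂)⁻¹) (by positivity)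
  obtain ⟨ε₂, hε₂, hsub⟩ := exists_gasPair_layer_sub d hc L M hσ hN p.z₀_pos
    (τ := (4 * C₂)⁻¹) (by positivity)
  obtain ⟨ε₃, hε₃, hpt⟩ := hlayer a ha
  refine ⟨CK, hCK, a / 8, by positivity, 2 * C₁, by positivity, min (min ε₁ ε₂) (min ε₃ 1),
    by positivity, fun ε hε ρ₁ ρ₂ u₁ u₂ H A hA => ?_⟩
  have hε1 : ε ≤ 1 := hε.trans ((min_le_right _ _).trans (min_le_right _ _))
  have hv := hvel ε (hε.trans ((min_le_left _ _).trans (min_le_left _ _))) ρ₁ ρ₂ u₁ u₂ H A hA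
  have hs := hsub ε (hε.trans ((min_le_left _ _).trans (min_le_right _ _))) ρ₁ ρ₂ u₁ u₂ H A hA
  have hUm := H.isOpen.measurableSet
  have hms := H.measurableSet_layer (k := fun x => |ρ₁ x - ρ₂ x| / p.z₀)
    (H.locallyLipschitzOn_sub.continuousOn.abs.div_const _)
  have hmv := H.measurableSet_layer (H.locallyLipschitzOn_min.continuousOn.const_mul a)
  have hD := H.integrableOn_gasDist hε1 hσ hA hN
  have hE := H.integrableOn_gasEnergy (δ₀ := a / 8) hε1 hκ p hCK.le hA hN
  have hpos : ∀ x ∈ gasDomain ρ₁ ∩ gasDomain ρ₂, 0 < ρ₁ x + ρ₂ x := fun x hx => add_pos hx.1 hx.2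
  have h0s : ∀ x ∈ gasDomain ρ₁ ∩ gasDomain ρ₂,
      0 ≤ (ρ₁ x + ρ₂ x) ^ (1 / κ - 1) * (ρ₁ x - ρ₂ x) ^ 2 * gasWeight N A u₁ u₂ x := fun x hx => by
    have := Real.rpow_nonneg (hpos x hx).le (1 / κ - 1)
    have := (gasWeight_pos (N := N) (A := A) (u₁ := u₁) (u₂ := u₂) (x := x)).le
    positivity
  have h0v : ∀ x ∈ gasDomain ρ₁ ∩ gasDomain ρ₂,
      0 ≤ (ρ₁ x + ρ₂ x) ^ (1 / κ) * ‖u₁ x - u₂ x‖ ^ 2 * gasWeight N A u₁ u₂ x := fun x hx => by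
    have := Real.rpow_nonneg (hpos x hx).le (1 / κ)
    have := (gasWeight_pos (N := N) (A := A) (u₁ := u₁) (u₂ := u₂) (x := x)).le
    positivity
  have his : IntegrableOn (fun x => (ρ₁ x + ρ₂ x) ^ (1 / κ - 1) * (ρ₁ x - ρ₂ x) ^ 2 *
      gasWeight N A u₁ u₂ x) (gasDomain ρ₁ ∩ gasDomain ρ₂) := by
    refine hD.mono' ((((H.continuousOn_rpow _).mul (H.locallyLipschitzOn_sub.continuousOn.pow 2)).mul
      H.continuousOn_gasWeight).aestronglyMeasurable hUm) ((ae_restrict_iff' hUm).2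
        (.of_forall fun x hx => ?_))
    rw [Real.norm_of_nonneg (h0s x hx), gasDist, add_mul]
    linarith [h0v x hx]
  have hiv : IntegrableOn (fun x => (ρ₁ x + ρ₂ x) ^ (1 / κ) * ‖u₁ x - u₂ x‖ ^ 2 *
      gasWeight N A u₁ u₂ x) (gasDomain ρ₁ ∩ gasDomain ρ₂) := by
    refine hD.mono' ((((H.continuousOn_rpow _).mul (H.continuousOn_norm_sub.pow 2)).mul
      H.continuousOn_gasWeight).aestronglyMeasurable hUm) ((ae_restrict_iff' hUm).2
        (.of_forall fun x hx => ?_))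
    rw [Real.norm_of_nonneg (h0v x hx), gasDist, add_mul]
    linarith [h0s x hx]
  set U := gasDomain ρ₁ ∩ gasDomain ρ₂
  set Fs := fun x => (ρ₁ x + ρ₂ x) ^ (1 / κ - 1) * (ρ₁ x - ρ₂ x) ^ 2 * gasWeight N A u₁ u₂ x
    with hFs
  set Fv := fun x => (ρ₁ x + ρ₂ x) ^ (1 / κ) * ‖u₁ x - u₂ x‖ ^ 2 * gasWeight N A u₁ u₂ x with hFv
  set Ss := U ∩ {x | ρ₁ x + ρ₂ x < |ρ₁ x - ρ₂ x| / p.z₀}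
  set Sv := U ∩ {x | ρ₁ x + ρ₂ x < a * min ‖u₁ x - u₂ x‖ 1}
  have iis : IntegrableOn (Ss.indicator Fs) U := his.indicator hms
  have iiv : IntegrableOn (Sv.indicator Fv) U := hiv.indicator hmv
  have iadd : IntegrableOn (fun x => Ss.indicator Fs x + Sv.indicator Fv x) U := iis.add iiv
  have es : ∫ x in U, Ss.indicator Fs x = ∫ x in Ss, Fs x := by
    rw [setIntegral_indicator hms, inter_eq_self_of_subset_right inter_subset_left]
  have ev : ∫ x in U, Sv.indicator Fv x = ∫ x in Sv, Fv x := by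
    rw [setIntegral_indicator hmv, inter_eq_self_of_subset_right inter_subset_left]
  have hmain : ∫ x in U, gasDist (1 / κ) ρ₁ u₁ ρ₂ u₂ x * gasWeight N A u₁ u₂ x ≤
      ∫ x in U, (C₁ * (gasEnergy p CK (a / 8) ρ₁ u₁ ρ₂ u₂ x * gasWeight N A u₁ u₂ x) +
        C₂ * (Ss.indicator Fs x + Sv.indicator Fv x)) := by
    refine setIntegral_mono_on hD ((hE.const_mul C₁).add (iadd.const_mul C₂)) hUm
      fun x hx => ?_
    have hφ := (gasWeight_pos (N := N) (A := A) (u₁ := u₁) (u₂ := u₂) (x := x)).le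
    have h1 := mul_le_mul_of_nonneg_right (hpt (ρ₁ x) (ρ₂ x) ‖u₁ x - u₂ x‖ _ _ hx.1 hx.2
      (norm_nonneg _) rfl rfl ((H.close.1 x).trans (hε.trans ((min_le_right _ _).trans
        (min_le_left _ _))))) hφ
    have e1 : Ss.indicator Fs x = (if ρ₁ x + ρ₂ x < |ρ₁ x - ρ₂ x| / p.z₀ then
        (ρ₁ x + ρ₂ x) ^ (1 / κ - 1) * (ρ₁ x - ρ₂ x) ^ 2 else 0) * gasWeight N A u₁ u₂ x := by
      by_cases h : ρ₁ x + ρ₂ x < |ρ₁ x - ρ₂ x| / p.z₀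
      · rw [indicator_of_mem (show x ∈ Ss from ⟨hx, h⟩), if_pos h]
      · rw [indicator_of_notMem (fun h' => h h'.2), if_neg h, zero_mul]
    have e2 : Sv.indicator Fv x = (if ρ₁ x + ρ₂ x < a * min ‖u₁ x - u₂ x‖ 1 then
        (ρ₁ x + ρ₂ x) ^ (1 / κ) * ‖u₁ x - u₂ x‖ ^ 2 else 0) * gasWeight N A u₁ u₂ x := by
      by_cases h : ρ₁ x + ρ₂ x < a * min ‖u₁ x - u₂ x‖ 1
      · rw [indicator_of_mem (show x ∈ Sv from ⟨hx, h⟩), if_pos h]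
      · rw [indicator_of_notMem (fun h' => h h'.2), if_neg h, zero_mul]
    rw [e1, e2, gasDist, gasEnergy]
    refine h1.trans (le_of_eq ?_)
    ring
  rw [integral_add (hE.const_mul C₁) (iadd.const_mul C₂), integral_const_mul,
    integral_const_mul, integral_add iis iiv, es, ev] at hmain
  have h4 : C₂ * (∫ x in Ss, Fs x) ≤
      1 / 4 * ∫ x in U, gasDist (1 / κ) ρ₁ u₁ ρ₂ u₂ x * gasWeight N A u₁ u₂ x := by
    refine (mul_le_mul_of_nonneg_left hs hC₂.le).trans (le_of_eq ?_)
    field_simp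
  have h5 : C₂ * (∫ x in Sv, Fv x) ≤
      1 / 4 * ∫ x in U, gasDist (1 / κ) ρ₁ u₁ ρ₂ u₂ x * gasWeight N A u₁ u₂ x := by
    refine (mul_le_mul_of_nonneg_left hv hC₂.le).trans (le_of_eq ?_)
    field_simp
  rw [mul_add] at hmain
  linarith

/-! ### Pairs of solutions: supports of the densities and integrated estimates. -/

section SpaceTime

variable {d : ℕ} {κ T c : ℝ} {L M : ℝ≥0} {ε A : ℝ} {r₁ r₂ : ℝ → Space d → ℝ}
  {v₁ v₂ : ℝ → Space d → Space d}

/-- Two nearby regular solutions, together with the scale of the weights. -/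
structure IsGasFlowPair (κ T c : ℝ) (L M : ℝ≥0) (ε A : ℝ) (r₁ : ℝ → Space d → ℝ)
    (v₁ : ℝ → Space d → Space d) (r₂ : ℝ → Space d → ℝ) (v₂ : ℝ → Space d → Space d) : Prop where
  regular₁ : IsRegularSolution κ T c L M r₁ v₁
  regular₂ : IsRegularSolution κ T c L M r₂ v₂
  close : ∀ t ∈ Icc 0 T, LipschitzClose ε (r₁ t) (r₂ t)
  scale : ∀ t ∈ Icc 0 T, IsGasScale L A (r₁ t) (r₂ t)

theorem IsGasFlowPair.isGasPair (H : IsGasFlowPair κ T c L M ε A r₁ v₁ r₂ v₂) {t : ℝ}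
    (ht : t ∈ Icc 0 T) : IsGasPair c L M ε (r₁ t) (v₁ t) (r₂ t) (v₂ t) :=
  H.regular₁.isGasPair H.regular₂ ht (H.close t ht)

theorem cutoffWeight_weightArg_eq_zero {N : ℕ} {R : ℝ} (hA : 1 ≤ A) (hR : 0 < R)
    {x u₁ u₂ : Space d} (hx : 2 * R * A ^ 2 + 1 < ‖x‖) :
    cutoffWeight N R (weightArg A x u₁ u₂) = 0 := by
  have hA0 : 0 < A ^ 2 := by positivity
  have h1 : 1 ≤ ‖x‖ := by nlinarith
  have h2 : 2 * R ≤ weightArg A x u₁ u₂ := by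
    have h3 : 2 * R ≤ (‖x‖ ^ 2 + ‖u₁‖ ^ 2 + ‖u₂‖ ^ 2) / A ^ 2 := by
      rw [le_div_iff₀ hA0]
      nlinarith [sq_nonneg ‖u₁‖, sq_nonneg ‖u₂‖]
    rw [weightArg]
    linarith
  rw [cutoffWeight, smoothStep_of_two_le ((le_div_iff₀ hR).2 h2), sub_self, mul_zero]

/-- Either μ ≤ h and the cutoff vanishes, or |z| > 1/2 and the profiles vanish: if μ > h and |z| ≤
1/2, both densities are at least μ/4 > h/4. This keeps the density and the flux away from both free
boundaries. -/
theorem energyDensity_energyFlux_eq_zero (p : EnergyProfile κ) {N : ℕ} {R h Λ W ρ₁ ρ₂ : ℝ}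
    (hh : 0 < h) (hρ : ¬(h / 4 ≤ ρ₁ ∧ h / 4 ≤ ρ₂)) :
    energyDensity p N R h Λ W (ρ₁ + ρ₂) (ρ₁ - ρ₂) = 0 ∧
      energyFlux p N R h Λ W (ρ₁ + ρ₂) (ρ₁ - ρ₂) = 0 := by
  rcases le_or_gt (ρ₁ + ρ₂) h with h1 | h1
  · have : smoothStep ((ρ₁ + ρ₂) / h) = 0 := smoothStep_of_le_one ((div_le_one hh).2 h1)
    simp [energyDensity, energyFlux, energyCutoff, this]
  · have hμ : 0 < ρ₁ + ρ₂ := hh.trans h1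
    have h2 : 1 / 2 < |(ρ₁ - ρ₂) / (ρ₁ + ρ₂)| := by
      by_contra! h3
      rw [abs_div, abs_of_pos hμ, div_le_iff₀ hμ, abs_le] at h3
      exact hρ ⟨by linarith, by linarith⟩
    obtain ⟨e1, e2, e3⟩ := p.eq_zero _ h2
    simp [energyDensity, energyFlux, e1, e2, e3]

/-- Only r₁ is cut off. The second density is bounded below through the closeness of the states,
which for r₁ > δ gives r₂ ≥ δ - ε ≥ δ/2. -/
theorem pairVelocity_eq_zero {σ : ℝ} {N : ℕ} {R δ : ℝ} (hδ : 0 < δ) (hε : ε ≤ δ / 2) {t : ℝ}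
    {x : Space d} (hc : |r₁ t x - r₂ t x| ≤ ε) (h : ¬(δ / 2 ≤ r₁ t x ∧ δ / 2 ≤ r₂ t x)) :
    pairVelocity σ N R δ A r₁ v₁ v₂ (t, x) = 0 := by
  have h1 : r₁ t x ≤ δ := by
    by_contra! h2
    rw [abs_le] at hc
    exact h ⟨by linarith, by linarith⟩
  simp [pairVelocity, velocityDensity, cutoffPower_of_le hδ h1]

theorem IsGasFlowPair.locallyLipschitzOn (H : IsGasFlowPair κ T c L M ε A r₁ v₁ r₂ v₂) :
    LocallyLipschitzOn (gasRegion T r₁ ∩ gasRegion T r₂) (pairState A r₁ v₁ r₂ v₂) :=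
  locallyLipschitzOn_pairState (H.regular₁.solution.locallyLipschitz_r.mono inter_subset_left)
    (H.regular₁.solution.locallyLipschitz_v.mono inter_subset_left)
    (H.regular₂.solution.locallyLipschitz_r.mono inter_subset_right)
    (H.regular₂.solution.locallyLipschitz_v.mono inter_subset_right)

theorem IsGasFlowPair.locallyLipschitzOn_pairEnergy (H : IsGasFlowPair κ T c L M ε A r₁ v₁ r₂ v₂)
    (p : EnergyProfile κ) {N : ℕ} {R h : ℝ} :
    LocallyLipschitzOn (gasRegion T r₁ ∩ gasRegion T r₂) (pairEnergy p N R h A r₁ v₁ r₂ v₂) :=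
  ContDiffOn.comp_locallyLipschitzOn (u := pairState A r₁ v₁ r₂ v₂)
    (H := fun y : ℝ × ℝ × ℝ × ℝ => energyDensity p N R h y.1 y.2.1 y.2.2.1 y.2.2.2)
    H.locallyLipschitzOn fun _ hq => contDiffAt_energyDensity p weightArg_pos (add_pos hq.1.2 hq.2.2)

theorem IsGasFlowPair.locallyLipschitzOn_pairFlux (H : IsGasFlowPair κ T c L M ε A r₁ v₁ r₂ v₂)
    (p : EnergyProfile κ) {N : ℕ} {R h : ℝ} :
    LocallyLipschitzOn (gasRegion T r₁ ∩ gasRegion T r₂) (pairFlux p N R h A r₁ v₁ r₂ v₂) :=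
  ContDiffOn.comp_locallyLipschitzOn (u := pairState A r₁ v₁ r₂ v₂)
    (H := fun y : ℝ × ℝ × ℝ × ℝ => energyFlux p N R h y.1 y.2.1 y.2.2.1 y.2.2.2)
    H.locallyLipschitzOn fun _ hq => contDiffAt_energyFlux p weightArg_pos (add_pos hq.1.2 hq.2.2)

/-- The integrated energy estimate, before the right hand side is estimated. -/
theorem IsGasFlowPair.integral_pairEnergy_le_of_le (H : IsGasFlowPair κ T c L M ε A r₁ v₁ r₂ v₂)
    (hε : ε ≤ 1) (hA : 1 ≤ A) (hκ : 0 < κ) (p : EnergyProfile κ) {N : ℕ} {R h C B : ℝ}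
    (hB : IsTransportConstant p d N L M C B) (hR : 0 < R) (hh : 0 < h) {G : ℝ → ℝ}
    (hG : Continuous G)
    (hg : ∀ s ∈ Ioo 0 T, IntegrableOn (fun x => 80 * B ^ 4 * (gasWeight N A (v₁ s) (v₂ s) x *
        ((r₁ s x + r₂ s x) ^ (1 / κ - 1) * (r₁ s x - r₂ s x) ^ 2 +
          (r₁ s x + r₂ s x) ^ (1 / κ) * ‖v₁ s x - v₂ s x‖ ^ 2 +
          (r₁ s x + r₂ s x) ^ (1 / κ - 1) *
            (‖v₁ s x - v₂ s x‖ ^ 2 * min ‖v₁ s x - v₂ s x‖ 1) + (2 * h) ^ (1 / κ))))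
        (gasDomain (r₁ s) ∩ gasDomain (r₂ s)) ∧
      ∫ x in gasDomain (r₁ s) ∩ gasDomain (r₂ s), 80 * B ^ 4 * (gasWeight N A (v₁ s) (v₂ s) x *
        ((r₁ s x + r₂ s x) ^ (1 / κ - 1) * (r₁ s x - r₂ s x) ^ 2 +
          (r₁ s x + r₂ s x) ^ (1 / κ) * ‖v₁ s x - v₂ s x‖ ^ 2 +
          (r₁ s x + r₂ s x) ^ (1 / κ - 1) *
            (‖v₁ s x - v₂ s x‖ ^ 2 * min ‖v₁ s x - v₂ s x‖ 1) + (2 * h) ^ (1 / κ))) ≤ G s)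
    {t : ℝ} (ht : t ∈ Icc 0 T) :
    ∫ x, pairEnergy p N R h A r₁ v₁ r₂ v₂ (t, x) ≤
      (∫ x, pairEnergy p N R h A r₁ v₁ r₂ v₂ (0, x)) + ∫ s in (0 : ℝ)..t, G s := by
  have hv₁ := H.regular₁.solution.locallyLipschitz_v.mono
    (inter_subset_left (t := gasRegion T r₂))
  have hv₂ := H.regular₂.solution.locallyLipschitz_v.mono
    (inter_subset_right (s := gasRegion T r₁))
  have hE := H.locallyLipschitzOn_pairEnergy p (N := N) (R := R) (h := h)
  have hF := H.locallyLipschitzOn_pairFlux p (N := N) (R := R) (h := h)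
  refine integral_le_of_gas_transport (η := h / 4) (R := 2 * R * A ^ 2 + 1)
    (Y := fun q => pairEnergy p N R h A r₁ v₁ r₂ v₂ q •
        ((1 / 2 : ℝ) • (v₁ q.1 q.2 + v₂ q.1 q.2)) +
      pairFlux p N R h A r₁ v₁ r₂ v₂ q • (v₁ q.1 q.2 - v₂ q.1 q.2))
    H.regular₁.solution.continuousOn H.regular₂.solution.continuousOn (by positivity) hE
    ((hE.real_smul ((locallyLipschitzOn_const (1 / 2 : ℝ)).real_smul (hv₁.vec_add hv₂))).vec_add
      (hF.real_smul (hv₁.vec_sub hv₂))) ?_ ?_ hG hg ?_ ht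
  · rintro ⟨s, x⟩ ⟨hs, -⟩ hne
    by_contra hcon
    obtain ⟨e1, e2⟩ := energyDensity_energyFlux_eq_zero p (N := N) (R := R)
      (Λ := weightArg A x (v₁ s x) (v₂ s x)) (W := ‖v₁ s x - v₂ s x‖ ^ 2) hh hcon
    rcases hne with hne | hne
    · exact hne e1
    · exact hne (add_eq_zero_iff_eq_neg.2 ((smul_eq_zero_of_left e1 _).trans
        (neg_eq_zero.2 (smul_eq_zero_of_left e2 _)).symm))
  · intro s x hx
    have e := cutoffWeight_weightArg_eq_zero (N := N) (u₁ := v₁ s x) (u₂ := v₂ s x) hA hR hx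
    simp [pairEnergy, pairFlux, energyDensity, energyFlux, energyCutoff, e]
  · filter_upwards [H.regular₁.solution.ae_isEulerDerivAt, H.regular₂.solution.ae_isEulerDerivAt]
      with s h1 h2 hs
    have hs' := Ioo_subset_Icc_self hs
    filter_upwards [h1 hs, h2 hs] with x h1 h2 hx
    obtain ⟨R₁, A₁, hd₁⟩ := h1 hx.1
    obtain ⟨R₂, A₂, hd₂⟩ := h2 hx.2
    exact energy_transport_at hκ hB hR hh hA hd₁ hd₂ (H.regular₁.differentiableAt hs' hx.1)
      (H.regular₂.differentiableAt hs' hx.2) hx.1 hx.2 (norm_gradient_le (H.regular₁.lipschitz s hs') x)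
      (norm_gradient_le (H.regular₂.lipschitz s hs') x) (H.regular₁.norm_fderiv_le hs' hx.1)
      (H.regular₂.norm_fderiv_le hs' hx.2) (((H.close s hs').1 x).trans hε) ((H.scale s hs').2 x)

theorem IsGasFlowPair.locallyLipschitzOn_pairVelocity
    (H : IsGasFlowPair κ T c L M ε A r₁ v₁ r₂ v₂) {N : ℕ} {R δ σ : ℝ} :
    LocallyLipschitzOn (gasRegion T r₁ ∩ gasRegion T r₂)
      (pairVelocity σ N R δ A r₁ v₁ v₂) := by
  have hv₁ := H.regular₁.solution.locallyLipschitz_v.mono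
    (inter_subset_left (t := gasRegion T r₂))
  have hv₂ := H.regular₂.solution.locallyLipschitz_v.mono
    (inter_subset_right (s := gasRegion T r₁))
  have hr₁ := H.regular₁.solution.locallyLipschitz_r.mono
    (inter_subset_left (t := gasRegion T r₂))
  have hS := (locallyLipschitzOn_weightArg (A := A) hv₁ hv₂).prodMk'
    ((hv₁.vec_sub hv₂).norm_sq.prodMk' hr₁)
  exact ContDiffOn.comp_locallyLipschitzOn
    (u := fun q : ℝ × Space d => (weightArg A q.2 (v₁ q.1 q.2) (v₂ q.1 q.2),
      ‖v₁ q.1 q.2 - v₂ q.1 q.2‖ ^ 2, r₁ q.1 q.2))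
    (H := fun y : ℝ × ℝ × ℝ => velocityDensity σ N R δ y.1 y.2.1 y.2.2) hS
    fun q hq => contDiffAt_velocityDensity weightArg_pos hq.1.2

/-- The integrated estimate for large velocity differences, before the right hand side is
estimated. -/
theorem IsGasFlowPair.integral_pairVelocity_le_of_le (H : IsGasFlowPair κ T c L M ε A r₁ v₁ r₂ v₂)
    {δ : ℝ} (hδ : 0 < δ) (hε : ε ≤ δ / 2) (hA : 1 ≤ A) (hκ : 0 < κ) (p : EnergyProfile κ) {N : ℕ}
    (hN : ⌈1 / κ⌉₊ + d + 2 ≤ N) {R C B : ℝ} (hB : IsTransportConstant p d N L M C B) (hR : 0 < R)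
    {G : ℝ → ℝ} (hG : Continuous G)
    (hg : ∀ s ∈ Ioo 0 T, IntegrableOn (fun x => 8 * B ^ 3 * (gasWeight N A (v₁ s) (v₂ s) x *
          ((r₁ s x + r₂ s x) ^ (1 / κ) * ‖v₁ s x - v₂ s x‖ ^ 2)))
        (gasDomain (r₁ s) ∩ gasDomain (r₂ s)) ∧
      ∫ x in gasDomain (r₁ s) ∩ gasDomain (r₂ s), 8 * B ^ 3 * (gasWeight N A (v₁ s) (v₂ s) x *
          ((r₁ s x + r₂ s x) ^ (1 / κ) * ‖v₁ s x - v₂ s x‖ ^ 2)) ≤ G s)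
    {t : ℝ} (ht : t ∈ Icc 0 T) :
    ∫ x, pairVelocity (1 / κ) N R δ A r₁ v₁ v₂ (t, x) ≤
      (∫ x, pairVelocity (1 / κ) N R δ A r₁ v₁ v₂ (0, x)) + ∫ s in (0 : ℝ)..t, G s := by
  have hv₁ := H.regular₁.solution.locallyLipschitz_v.mono
    (inter_subset_left (t := gasRegion T r₂))
  have hE := H.locallyLipschitzOn_pairVelocity (N := N) (R := R) (δ := δ) (σ := 1 / κ)
  refine integral_le_of_gas_transport (η := δ / 2) (R := 2 * R * A ^ 2 + 1)
    (Y := fun q => pairVelocity (1 / κ) N R δ A r₁ v₁ v₂ q • v₁ q.1 q.2)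
    H.regular₁.solution.continuousOn H.regular₂.solution.continuousOn (by positivity) hE
    (hE.real_smul hv₁) ?_ ?_ hG hg ?_ ht
  · rintro ⟨s, x⟩ ⟨hs, -⟩ hne
    by_contra hcon
    have e := pairVelocity_eq_zero (σ := 1 / κ) (N := N) (R := R) (A := A) (v₁ := v₁) (v₂ := v₂)
      hδ hε ((H.close s hs).1 x) hcon
    rcases hne with hne | hne
    · exact hne e
    · exact hne (smul_eq_zero_of_left e _)
  · intro s x hx
    have e := cutoffWeight_weightArg_eq_zero (N := N) (u₁ := v₁ s x) (u₂ := v₂ s x) hA hR hx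
    simp [pairVelocity, velocityDensity, e]
  · filter_upwards [H.regular₁.solution.ae_isEulerDerivAt, H.regular₂.solution.ae_isEulerDerivAt]
      with s h1 h2 hs
    have hs' := Ioo_subset_Icc_self hs
    filter_upwards [h1 hs, h2 hs] with x h1 h2 hx
    obtain ⟨R₁, A₁, hd₁⟩ := h1 hx.1
    obtain ⟨R₂, A₂, hd₂⟩ := h2 hx.2
    exact velocity_transport_at hκ hB hR hδ hA (by omega)
      ((Nat.le_ceil _).trans (by exact_mod_cast (by omega : ⌈1 / κ⌉₊ ≤ N))) hd₁ hd₂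
      (H.regular₁.differentiableAt hs' hx.1) hx.1 hx.2
      (norm_gradient_le (H.regular₁.lipschitz s hs') x)
      (norm_gradient_le (H.regular₂.lipschitz s hs') x) (H.regular₁.norm_fderiv_le hs' hx.1)
      (H.regular₂.norm_fderiv_le hs' hx.2)

end SpaceTime

theorem tendsto_setIntegral_mul_cutoff {α : Type*} [MeasurableSpace α] {m : Measure α} {U : Set α}
    (hU : MeasurableSet U) {F : α → ℝ} (hF : IntegrableOn F U m) {χ : ℕ → α → ℝ}
    (hχ : ∀ n, ∀ x ∈ U, 0 ≤ χ n x ∧ χ n x ≤ 1)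
    (hm : ∀ n, AEStronglyMeasurable (χ n) (m.restrict U))
    (hlim : ∀ x ∈ U, ∀ᶠ n in Filter.atTop, χ n x = 1) :
    Filter.Tendsto (fun n => ∫ x in U, χ n x * F x ∂m) Filter.atTop (𝓝 (∫ x in U, F x ∂m)) := by
  refine tendsto_integral_of_dominated_convergence (fun x => ‖F x‖)
    (fun n => (hm n).mul hF.aestronglyMeasurable) hF.norm (fun n => ?_) ?_
  · rw [ae_restrict_iff' hU]
    refine .of_forall fun x hx => ?_
    rw [norm_mul, Real.norm_of_nonneg (hχ n x hx).1]
    exact mul_le_of_le_one_left (norm_nonneg _) (hχ n x hx).2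
  · rw [ae_restrict_iff' hU]
    refine .of_forall fun x hx => tendsto_const_nhds.congr' ?_
    filter_upwards [hlim x hx] with n hn
    rw [hn, one_mul]

/-! ### Weighted functionals and bounds for the source terms. -/

section FixedTime

variable {d : ℕ} {c : ℝ} {L M : ℝ≥0} {ε : ℝ} {ρ₁ ρ₂ : Space d → ℝ} {u₁ u₂ : Space d → Space d}

/-- The weighted distance functional. -/
noncomputable def weightedDist (σ : ℝ) (N : ℕ) (A : ℝ) (ρ₁ : Space d → ℝ)
    (u₁ : Space d → Space d) (ρ₂ : Space d → ℝ) (u₂ : Space d → Space d) : ℝ :=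
  ∫ x in gasDomain ρ₁ ∩ gasDomain ρ₂, gasDist σ ρ₁ u₁ ρ₂ u₂ x * gasWeight N A u₁ u₂ x

/-- The weighted energy functional. -/
noncomputable def weightedEnergy {κ : ℝ} (p : EnergyProfile κ) (CK δ : ℝ) (N : ℕ) (A : ℝ)
    (ρ₁ : Space d → ℝ) (u₁ : Space d → Space d) (ρ₂ : Space d → ℝ) (u₂ : Space d → Space d) : ℝ :=
  ∫ x in gasDomain ρ₁ ∩ gasDomain ρ₂, gasEnergy p CK δ ρ₁ u₁ ρ₂ u₂ x * gasWeight N A u₁ u₂ x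

/-- The total mass of the majorant of the weights. -/
noncomputable def weightMass (d : ℕ) (A : ℝ) : ℝ :=
  ∫ x : Space d, A ^ (2 * (d + 1)) * ((1 + ‖x‖ ^ 2) ^ (d + 1))⁻¹

theorem IsGasPair.integral_gasWeight_le (H : IsGasPair c L M ε ρ₁ u₁ ρ₂ u₂) {A : ℝ} (hA : 1 ≤ A)
    {N : ℕ} (hN : d + 1 ≤ N) :
    ∫ x in gasDomain ρ₁ ∩ gasDomain ρ₂, gasWeight N A u₁ u₂ x ≤ weightMass d A := by
  have hi := (integrable_inv_one_add_norm_sq_pow (d := d)).const_mul (A ^ (2 * (d + 1)))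
  refine (setIntegral_mono (H.integrableOn_gasWeight hA hN) hi.integrableOn fun x => ?_).trans
    (setIntegral_le_integral hi (.of_forall fun x => by simp only [Pi.zero_apply]; positivity))
  simpa using pow_mul_gasWeight_le (d := d) (N := N) (k := 0) (u₁ := u₁) (u₂ := u₂) (x := x) hA
    (by omega)

/-- The source terms in the energy estimate. -/
theorem IsGasPair.energy_source_le (H : IsGasPair c L M ε ρ₁ u₁ ρ₂ u₂) (hε : ε ≤ 1) {σ : ℝ}
    (hσ : 0 < σ) {A : ℝ} (hA : IsGasScale L A ρ₁ ρ₂) {N : ℕ} (hN : ⌈σ⌉₊ + d + 2 ≤ N) {B K a : ℝ}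
    (hK : 0 ≤ K) (ha : 0 ≤ a)
    (hi : IntegrableOn (fun x => (ρ₁ x + ρ₂ x) ^ (σ - 1) *
      (‖u₁ x - u₂ x‖ ^ 2 * min ‖u₁ x - u₂ x‖ 1) * gasWeight N A u₁ u₂ x)
      (gasDomain ρ₁ ∩ gasDomain ρ₂))
    (hB : ∫ x in gasDomain ρ₁ ∩ gasDomain ρ₂, (ρ₁ x + ρ₂ x) ^ (σ - 1) *
      (‖u₁ x - u₂ x‖ ^ 2 * min ‖u₁ x - u₂ x‖ 1) * gasWeight N A u₁ u₂ x ≤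
      B * weightedDist σ N A ρ₁ u₁ ρ₂ u₂) :
    IntegrableOn (fun x => K * (gasWeight N A u₁ u₂ x *
        ((ρ₁ x + ρ₂ x) ^ (σ - 1) * (ρ₁ x - ρ₂ x) ^ 2 + (ρ₁ x + ρ₂ x) ^ σ * ‖u₁ x - u₂ x‖ ^ 2 +
          (ρ₁ x + ρ₂ x) ^ (σ - 1) * (‖u₁ x - u₂ x‖ ^ 2 * min ‖u₁ x - u₂ x‖ 1) + a)))
        (gasDomain ρ₁ ∩ gasDomain ρ₂) ∧
      ∫ x in gasDomain ρ₁ ∩ gasDomain ρ₂, K * (gasWeight N A u₁ u₂ x *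
        ((ρ₁ x + ρ₂ x) ^ (σ - 1) * (ρ₁ x - ρ₂ x) ^ 2 + (ρ₁ x + ρ₂ x) ^ σ * ‖u₁ x - u₂ x‖ ^ 2 +
          (ρ₁ x + ρ₂ x) ^ (σ - 1) * (‖u₁ x - u₂ x‖ ^ 2 * min ‖u₁ x - u₂ x‖ 1) + a)) ≤
        K * ((1 + B) * weightedDist σ N A ρ₁ u₁ ρ₂ u₂ + a * weightMass d A) := by
  have hD := H.integrableOn_gasDist hε hσ hA hN
  have hW := H.integrableOn_gasWeight (N := N) hA.1 (by omega)
  have e : (fun x => K * (gasWeight N A u₁ u₂ x *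
      ((ρ₁ x + ρ₂ x) ^ (σ - 1) * (ρ₁ x - ρ₂ x) ^ 2 + (ρ₁ x + ρ₂ x) ^ σ * ‖u₁ x - u₂ x‖ ^ 2 +
        (ρ₁ x + ρ₂ x) ^ (σ - 1) * (‖u₁ x - u₂ x‖ ^ 2 * min ‖u₁ x - u₂ x‖ 1) + a))) =
      fun x => K * (gasDist σ ρ₁ u₁ ρ₂ u₂ x * gasWeight N A u₁ u₂ x + ((ρ₁ x + ρ₂ x) ^ (σ - 1) *
        (‖u₁ x - u₂ x‖ ^ 2 * min ‖u₁ x - u₂ x‖ 1) * gasWeight N A u₁ u₂ x +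
          a * gasWeight N A u₁ u₂ x)) := by
    funext x
    rw [gasDist]
    ring
  have hi2 : IntegrableOn (fun x => (ρ₁ x + ρ₂ x) ^ (σ - 1) *
      (‖u₁ x - u₂ x‖ ^ 2 * min ‖u₁ x - u₂ x‖ 1) * gasWeight N A u₁ u₂ x +
          a * gasWeight N A u₁ u₂ x) (gasDomain ρ₁ ∩ gasDomain ρ₂) := hi.add (hW.const_mul a)
  simp only [e]
  refine ⟨(hD.add hi2).const_mul K, ?_⟩
  rw [integral_const_mul, integral_add hD hi2, integral_add hi (hW.const_mul a),
    integral_const_mul]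
  have h1 := mul_le_mul_of_nonneg_left (H.integral_gasWeight_le (N := N) hA.1 (by omega)) ha
  refine mul_le_mul_of_nonneg_left ?_ hK
  rw [weightedDist] at hB ⊢
  linarith

/-- The source terms in the estimate for large velocity differences. -/
theorem IsGasPair.velocity_source_le (H : IsGasPair c L M ε ρ₁ u₁ ρ₂ u₂) (hε : ε ≤ 1) {σ : ℝ}
    (hσ : 0 < σ) {A : ℝ} (hA : IsGasScale L A ρ₁ ρ₂) {N : ℕ} (hN : ⌈σ⌉₊ + d + 2 ≤ N) {K : ℝ}
    (hK : 0 ≤ K) :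
    IntegrableOn (fun x => K * (gasWeight N A u₁ u₂ x *
        ((ρ₁ x + ρ₂ x) ^ σ * ‖u₁ x - u₂ x‖ ^ 2))) (gasDomain ρ₁ ∩ gasDomain ρ₂) ∧
      ∫ x in gasDomain ρ₁ ∩ gasDomain ρ₂, K * (gasWeight N A u₁ u₂ x *
        ((ρ₁ x + ρ₂ x) ^ σ * ‖u₁ x - u₂ x‖ ^ 2)) ≤ K * weightedDist σ N A ρ₁ u₁ ρ₂ u₂ := by
  have hD := H.integrableOn_gasDist hε hσ hA hN
  have hUm := H.isOpen.measurableSet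
  have hle : ∀ x ∈ gasDomain ρ₁ ∩ gasDomain ρ₂, 0 ≤ gasWeight N A u₁ u₂ x *
      ((ρ₁ x + ρ₂ x) ^ σ * ‖u₁ x - u₂ x‖ ^ 2) ∧ gasWeight N A u₁ u₂ x *
      ((ρ₁ x + ρ₂ x) ^ σ * ‖u₁ x - u₂ x‖ ^ 2) ≤
        gasDist σ ρ₁ u₁ ρ₂ u₂ x * gasWeight N A u₁ u₂ x := fun x hx => by
    have h0 : 0 < ρ₁ x + ρ₂ x := add_pos hx.1 hx.2
    have h1 := Real.rpow_nonneg h0.le (σ - 1)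
    have h2 := Real.rpow_nonneg h0.le σ
    have h3 := (gasWeight_pos (N := N) (A := A) (u₁ := u₁) (u₂ := u₂) (x := x)).le
    have h4 : 0 ≤ (ρ₁ x + ρ₂ x) ^ (σ - 1) * (ρ₁ x - ρ₂ x) ^ 2 * gasWeight N A u₁ u₂ x := by
      positivity
    refine ⟨by positivity, ?_⟩
    rw [gasDist]
    linarith
  have hi : IntegrableOn (fun x => gasWeight N A u₁ u₂ x *
      ((ρ₁ x + ρ₂ x) ^ σ * ‖u₁ x - u₂ x‖ ^ 2)) (gasDomain ρ₁ ∩ gasDomain ρ₂) := by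
    refine hD.mono' ((H.continuousOn_gasWeight.mul ((H.continuousOn_rpow _).mul
      (H.continuousOn_norm_sub.pow 2))).aestronglyMeasurable hUm) ((ae_restrict_iff' hUm).2
        (.of_forall fun x hx => ?_))
    rw [Real.norm_of_nonneg (hle x hx).1]
    exact (hle x hx).2
  refine ⟨hi.const_mul K, ?_⟩
  rw [integral_const_mul]
  exact mul_le_mul_of_nonneg_left (setIntegral_mono_on hi hD hUm fun x hx => (hle x hx).2) hK

theorem weightedDist_nonneg (H : IsGasPair c L M ε ρ₁ u₁ ρ₂ u₂) {σ : ℝ} {N : ℕ} {A : ℝ} :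
    0 ≤ weightedDist σ N A ρ₁ u₁ ρ₂ u₂ :=
  setIntegral_nonneg H.isOpen.measurableSet fun _ hx => mul_nonneg (gasDist_nonneg hx)
    gasWeight_pos.le

/-- An a priori bound for the weighted distance. -/
theorem IsGasPair.weightedDist_le (H : IsGasPair c L M ε ρ₁ u₁ ρ₂ u₂) (hε : ε ≤ 1) {σ : ℝ}
    (hσ : 0 < σ) {A : ℝ} (hA : IsGasScale L A ρ₁ ρ₂) {N : ℕ} (hN : ⌈σ⌉₊ + d + 2 ≤ N) :
    weightedDist σ N A ρ₁ u₁ ρ₂ u₂ ≤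
      (A ^ 2 * (1 + 2 * L)) ^ σ * (3 * A ^ 2) * weightMass d A := by
  have hi := ((integrable_inv_one_add_norm_sq_pow (d := d)).const_mul
    (A ^ (2 * (d + 1)))).const_mul ((A ^ 2 * (1 + 2 * L)) ^ σ * (3 * A ^ 2))
  rw [weightMass, ← integral_const_mul]
  have hA0 := hA.1
  refine (setIntegral_mono_on (H.integrableOn_gasDist hε hσ hA hN) hi.integrableOn
    H.isOpen.measurableSet fun x hx => gasDist_mul_gasWeight_le hσ hA.1 hN hx
      ((H.close.1 x).trans hε) (hA.2 x)).trans
    (setIntegral_le_integral hi (.of_forall fun x => by simp only [Pi.zero_apply]; positivity))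

theorem IsGasPair.abs_weightedEnergy_le (H : IsGasPair c L M ε ρ₁ u₁ ρ₂ u₂) (hε : ε ≤ 1) {κ : ℝ}
    (hκ : 0 < κ) (p : EnergyProfile κ) {CK δ : ℝ} (hCK : 0 ≤ CK) {A : ℝ}
    (hA : IsGasScale L A ρ₁ ρ₂) {N : ℕ} (hN : ⌈1 / κ⌉₊ + d + 2 ≤ N) :
    weightedEnergy p CK δ N A ρ₁ u₁ ρ₂ u₂ ≤
      (p.C + CK) * weightedDist (1 / κ) N A ρ₁ u₁ ρ₂ u₂ := by
  rw [weightedEnergy, weightedDist, ← integral_const_mul]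
  refine setIntegral_mono_on (H.integrableOn_gasEnergy hε hκ p hCK hA hN)
    ((H.integrableOn_gasDist hε (by positivity) hA hN).const_mul _) H.isOpen.measurableSet
    fun x hx => ?_
  rw [← mul_assoc]
  exact mul_le_mul_of_nonneg_right ((le_abs_self _).trans (abs_gasEnergy_le hκ p hCK hx))
    gasWeight_pos.le

end FixedTime

/-! ### Removal of the cutoffs in the weight and near the boundary. -/

section Limit

variable {d : ℕ} {κ T c : ℝ} {L M : ℝ≥0} {ε A : ℝ} {r₁ r₂ : ℝ → Space d → ℝ}
  {v₁ v₂ : ℝ → Space d → Space d}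

theorem IsGasPair.continuousOn_weightArg {ρ₁ ρ₂ : Space d → ℝ} {u₁ u₂ : Space d → Space d}
    (H : IsGasPair c L M ε ρ₁ u₁ ρ₂ u₂) :
    ContinuousOn (fun x => weightArg A x (u₁ x) (u₂ x)) (gasDomain ρ₁ ∩ gasDomain ρ₂) :=
  continuousOn_const.add ((((continuousOn_id.norm.pow 2).add
    (H.locallyLipschitzOn₁.continuousOn.norm.pow 2)).add
    (H.locallyLipschitzOn₂.continuousOn.norm.pow 2)).div_const _)

theorem eventually_smoothStep_div_eq_zero (y : ℝ) :
    ∀ᶠ n : ℕ in Filter.atTop, smoothStep (y / ((n : ℝ) + 1)) = 0 := by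
  filter_upwards [Filter.eventually_ge_atTop ⌈y⌉₊] with n hn
  refine smoothStep_of_le_one ((div_le_one (by positivity)).2 ?_)
  have := (Nat.le_ceil y).trans (Nat.cast_le.2 hn)
  linarith

theorem eventually_smoothStep_div_eq_one {y : ℝ} (hy : 0 < y) :
    ∀ᶠ n : ℕ in Filter.atTop, smoothStep (y / ((n : ℝ) + 1)⁻¹) = 1 := by
  filter_upwards [Filter.eventually_ge_atTop ⌈2 / y⌉₊] with n hn
  refine smoothStep_of_two_le ?_
  have := (Nat.le_ceil (2 / y)).trans (Nat.cast_le.2 hn)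
  rw [div_le_iff₀ hy] at this
  rw [div_inv_eq_mul]
  linarith

/-- The two cutoffs are released together, with R = n + 1 and h = 1/(n + 1), by dominated
convergence. At CK = 0 the complementary energy is absent, so the value of δ plays no role. -/
theorem IsGasFlowPair.tendsto_integral_pairEnergy (H : IsGasFlowPair κ T c L M ε A r₁ v₁ r₂ v₂)
    (hε : ε ≤ 1) (hκ : 0 < κ) (p : EnergyProfile κ) {N : ℕ} (hN : ⌈1 / κ⌉₊ + d + 2 ≤ N) {t : ℝ}
    (ht : t ∈ Icc 0 T) (δ : ℝ) :
    Filter.Tendsto (fun n : ℕ => ∫ x, pairEnergy p N (n + 1) ((n : ℝ) + 1)⁻¹ A r₁ v₁ r₂ v₂ (t, x))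
      Filter.atTop (𝓝 (weightedEnergy p 0 δ N A (r₁ t) (v₁ t) (r₂ t) (v₂ t))) := by
  have HP := H.isGasPair ht
  have hUm := HP.isOpen.measurableSet
  have hS := contDiff_smoothStep.continuous
  refine (tendsto_setIntegral_mul_cutoff hUm (HP.integrableOn_gasEnergy (δ₀ := δ) hε hκ p le_rfl
    (H.scale t ht) hN) (χ := fun n x => (1 - smoothStep (weightArg A x (v₁ t x) (v₂ t x) /
      ((n : ℝ) + 1))) * smoothStep ((r₁ t x + r₂ t x) / ((n : ℝ) + 1)⁻¹)) ?_ ?_ ?_).congr ?_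
  · intro n x _
    have h1 := smoothStep_nonneg (weightArg A x (v₁ t x) (v₂ t x) / ((n : ℝ) + 1))
    have h2 := smoothStep_le_one (weightArg A x (v₁ t x) (v₂ t x) / ((n : ℝ) + 1))
    have h3 := smoothStep_nonneg ((r₁ t x + r₂ t x) / ((n : ℝ) + 1)⁻¹)
    exact ⟨mul_nonneg (by linarith) h3, mul_le_one₀ (by linarith) h3 (smoothStep_le_one _)⟩
  · exact fun n => ((continuousOn_const.sub (hS.comp_continuousOn
      (HP.continuousOn_weightArg.div_const _))).mul (hS.comp_continuousOn
        ((HP.lipschitz₁.continuous.add HP.lipschitz₂.continuous).continuousOn.div_const _))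
        ).aestronglyMeasurable hUm
  · intro x hx
    filter_upwards [eventually_smoothStep_div_eq_zero (weightArg A x (v₁ t x) (v₂ t x)),
      eventually_smoothStep_div_eq_one (add_pos hx.1 hx.2)] with n h1 h2
    rw [h1, h2]
    norm_num
  · intro n
    have hn : (0 : ℝ) < ((n : ℝ) + 1)⁻¹ := by positivity
    refine Eq.trans ?_ (setIntegral_eq_integral_of_forall_compl_eq_zero
      (s := gasDomain (r₁ t) ∩ gasDomain (r₂ t)) ?_)
    · refine setIntegral_congr_fun hUm fun x _ => ?_
      simp only [pairEnergy, energyDensity, energyCutoff, cutoffWeight, gasEnergy, gasWeight]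
      ring
    · intro x hx
      refine (energyDensity_energyFlux_eq_zero p (N := N) (R := n + 1)
        (Λ := weightArg A x (v₁ t x) (v₂ t x)) (W := ‖v₁ t x - v₂ t x‖ ^ 2) hn
        fun h => hx ⟨?_, ?_⟩).1
      · exact (by positivity : 0 < ((n : ℝ) + 1)⁻¹ / 4).trans_le h.1
      · exact (by positivity : 0 < ((n : ℝ) + 1)⁻¹ / 4).trans_le h.2

/-- The weighted energy of large velocity differences. -/
noncomputable def weightedVelocity (σ δ : ℝ) (N : ℕ) (A : ℝ) (ρ₁ : Space d → ℝ)
    (u₁ : Space d → Space d) (ρ₂ : Space d → ℝ) (u₂ : Space d → Space d) : ℝ :=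
  ∫ x in gasDomain ρ₁ ∩ gasDomain ρ₂,
    cutoffPower σ δ (ρ₁ x) * cutoffSquare (‖u₁ x - u₂ x‖ ^ 2) * gasWeight N A u₁ u₂ x

theorem IsGasPair.integrableOn_velocity {ρ₁ ρ₂ : Space d → ℝ} {u₁ u₂ : Space d → Space d}
    (H : IsGasPair c L M ε ρ₁ u₁ ρ₂ u₂) (hε : ε ≤ 1) {κ : ℝ} (hκ : 0 < κ) (p : EnergyProfile κ)
    {δ : ℝ} (hA : IsGasScale L A ρ₁ ρ₂) {N : ℕ} (hN : ⌈1 / κ⌉₊ + d + 2 ≤ N) :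
    IntegrableOn (fun x => cutoffPower (1 / κ) δ (ρ₁ x) * cutoffSquare (‖u₁ x - u₂ x‖ ^ 2) *
      gasWeight N A u₁ u₂ x) (gasDomain ρ₁ ∩ gasDomain ρ₂) := by
  -- The complementary density is the difference of the energy densities with CK = 1 and CK = 0.
  have h := (H.integrableOn_gasEnergy (δ₀ := δ) hε hκ p zero_le_one hA hN).sub
    (H.integrableOn_gasEnergy (δ₀ := δ) hε hκ p le_rfl hA hN)
  refine h.congr (.of_forall fun x => ?_)
  simp only [gasEnergy, Pi.sub_apply]
  ring

theorem IsGasPair.weightedEnergy_eq {ρ₁ ρ₂ : Space d → ℝ} {u₁ u₂ : Space d → Space d}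
    (H : IsGasPair c L M ε ρ₁ u₁ ρ₂ u₂) (hε : ε ≤ 1) {κ : ℝ} (hκ : 0 < κ) (p : EnergyProfile κ)
    {CK δ : ℝ} (hA : IsGasScale L A ρ₁ ρ₂) {N : ℕ} (hN : ⌈1 / κ⌉₊ + d + 2 ≤ N) :
    weightedEnergy p CK δ N A ρ₁ u₁ ρ₂ u₂ = weightedEnergy p 0 δ N A ρ₁ u₁ ρ₂ u₂ +
      CK * weightedVelocity (1 / κ) δ N A ρ₁ u₁ ρ₂ u₂ := by
  rw [weightedEnergy, weightedEnergy, weightedVelocity, ← integral_const_mul,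
    ← integral_add (H.integrableOn_gasEnergy hε hκ p le_rfl hA hN)
      ((H.integrableOn_velocity hε hκ p hA hN).const_mul CK)]
  refine integral_congr_ae (.of_forall fun x => ?_)
  simp only [gasEnergy]
  ring

/-- Only the truncation of the weight is released. The cutoff r₁ ≥ δ stays, since it is part of the
energy and keeps its support inside both gas domains. -/
theorem IsGasFlowPair.tendsto_integral_pairVelocity (H : IsGasFlowPair κ T c L M ε A r₁ v₁ r₂ v₂)
    {δ : ℝ} (hδ : 0 < δ) (hεδ : ε ≤ δ / 2) (hε : ε ≤ 1) (hκ : 0 < κ) (p : EnergyProfile κ) {N : ℕ}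
    (hN : ⌈1 / κ⌉₊ + d + 2 ≤ N) {t : ℝ} (ht : t ∈ Icc 0 T) :
    Filter.Tendsto (fun n : ℕ => ∫ x, pairVelocity (1 / κ) N (n + 1) δ A r₁ v₁ v₂ (t, x))
      Filter.atTop (𝓝 (weightedVelocity (1 / κ) δ N A (r₁ t) (v₁ t) (r₂ t) (v₂ t))) := by
  have HP := H.isGasPair ht
  have hUm := HP.isOpen.measurableSet
  have hS := contDiff_smoothStep.continuous
  refine (tendsto_setIntegral_mul_cutoff hUm (HP.integrableOn_velocity (δ := δ) hε hκ p
    (H.scale t ht) hN) (χ := fun n x => 1 - smoothStep (weightArg A x (v₁ t x) (v₂ t x) /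
      ((n : ℝ) + 1))) ?_ ?_ ?_).congr ?_
  · intro n x _
    have h1 := smoothStep_nonneg (weightArg A x (v₁ t x) (v₂ t x) / ((n : ℝ) + 1))
    have h2 := smoothStep_le_one (weightArg A x (v₁ t x) (v₂ t x) / ((n : ℝ) + 1))
    exact ⟨by linarith, by linarith⟩
  · exact fun n => (continuousOn_const.sub (hS.comp_continuousOn
      (HP.continuousOn_weightArg.div_const _))).aestronglyMeasurable hUm
  · intro x hx
    filter_upwards [eventually_smoothStep_div_eq_zero (weightArg A x (v₁ t x) (v₂ t x))] with n h1
    rw [h1, sub_zero]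
  · intro n
    refine Eq.trans ?_ (setIntegral_eq_integral_of_forall_compl_eq_zero
      (s := gasDomain (r₁ t) ∩ gasDomain (r₂ t)) ?_)
    · refine setIntegral_congr_fun hUm fun x _ => ?_
      simp only [pairVelocity, velocityDensity, cutoffWeight, gasWeight]
      ring
    · intro x hx
      refine pairVelocity_eq_zero hδ hεδ (HP.close.1 x) fun h => hx ⟨?_, ?_⟩
      · exact (half_pos hδ).trans_le h.1
      · exact (half_pos hδ).trans_le h.2

end Limit

/-- A form of Gronwall's inequality for bounded functions which need not be measurable. -/
theorem le_of_forall_integral_bound {I : ℝ → ℝ} {T a b D : ℝ} (hb : 0 < b)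
    (hI : ∀ t ∈ Icc 0 T, 0 ≤ I t) (hD : ∀ t ∈ Icc 0 T, I t ≤ D)
    (h : ∀ P : ℝ → ℝ, Continuous P → (∀ s ∈ Icc 0 T, I s ≤ P s) →
      ∀ t ∈ Icc 0 T, I t ≤ a + b * ∫ s in (0 : ℝ)..t, P s) {t : ℝ} (ht : t ∈ Icc 0 T) :
    I t ≤ 2 * a * Real.exp (2 * b * t) := by
  -- The hypothesis can be tested only with continuous majorants. The natural one is S exp(2bs),
  -- with S the supremum of I(s) exp(-2bs); the exponent 2b makes the integral term contribute half
  -- of S, so that S ≤ a + S/2.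
  set S := sSup ((fun t => I t * Real.exp (-(2 * b * t))) '' Icc 0 T) with hS
  have hbdd : BddAbove ((fun t => I t * Real.exp (-(2 * b * t))) '' Icc 0 T) := by
    refine ⟨D, ?_⟩
    rintro _ ⟨s, hs, rfl⟩
    refine (mul_le_of_le_one_right (hI s hs) (Real.exp_le_one_iff.2 ?_)).trans (hD s hs)
    have := hs.1
    have : 0 ≤ 2 * b * s := by positivity
    linarith
  have hle : ∀ s ∈ Icc 0 T, I s ≤ S * Real.exp (2 * b * s) := fun s hs => by
    have h1 : I s * Real.exp (-(2 * b * s)) ≤ S := le_csSup hbdd ⟨s, hs, rfl⟩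
    rwa [Real.exp_neg, ← div_eq_mul_inv, div_le_iff₀ (Real.exp_pos _)] at h1
  have hS0 : 0 ≤ S := (mul_nonneg (hI t ht) (Real.exp_pos _).le).trans
    (le_csSup hbdd ⟨t, ht, rfl⟩)
  have hint : ∀ s : ℝ, ∫ τ in (0 : ℝ)..s, S * Real.exp (2 * b * τ) =
      S / (2 * b) * Real.exp (2 * b * s) - S / (2 * b) := fun s => by
    rw [intervalIntegral.integral_eq_sub_of_hasDerivAt
      (f := fun τ => S / (2 * b) * Real.exp (2 * b * τ)) (fun τ _ => ?_)
      (Continuous.intervalIntegrable (by fun_prop) _ _)]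
    · simp
    · refine ((((hasDerivAt_id τ).const_mul (2 * b)).exp).const_mul (S / (2 * b))).congr_deriv ?_
      simp only [id_eq, mul_one]
      field_simp
  have hS2 : S ≤ 2 * a := by
    have h1 : S ≤ a + S / 2 := by
      refine csSup_le ⟨_, t, ht, rfl⟩ ?_
      rintro _ ⟨s, hs, rfl⟩
      have h2 := h _ (by fun_prop) hle s hs
      rw [hint] at h2
      have e1 : b * (S / (2 * b) * Real.exp (2 * b * s) - S / (2 * b)) =
          S / 2 * Real.exp (2 * b * s) - S / 2 := by field_simp
      rw [e1] at h2
      have h3 : 1 ≤ Real.exp (2 * b * s) := Real.one_le_exp (by have := hs.1; positivity)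
      simp only
      rw [Real.exp_neg, ← div_eq_mul_inv, div_le_iff₀ (Real.exp_pos _)]
      have ha : 0 ≤ a := by
        have := h _ (by fun_prop) hle 0 ⟨le_rfl, hs.1.trans hs.2⟩
        rw [intervalIntegral.integral_same] at this
        linarith [hI 0 ⟨le_rfl, hs.1.trans hs.2⟩]
      nlinarith
    linarith
  exact (hle t ht).trans (mul_le_mul_of_nonneg_right hS2 (Real.exp_pos _).le)

/-! ### The growth of the weighted energy and the Gronwall argument. -/

section Growth

/-- The integrated energy estimate. -/
theorem exists_weightedEnergy_growth (d : ℕ) {κ c : ℝ} (hκ : 0 < κ) (hc : 0 < c) (L M : ℝ≥0)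
    (p : EnergyProfile κ) {N : ℕ} (hN : ⌈1 / κ⌉₊ + d + 2 ≤ N) {CK δ : ℝ} (hCK : 0 ≤ CK)
    (hδ : 0 < δ) :
    ∃ K > 0, ∃ ε₀ > 0, ∀ ε ≤ ε₀, ∀ (T A : ℝ) (r₁ r₂ : ℝ → Space d → ℝ)
      (v₁ v₂ : ℝ → Space d → Space d), IsGasFlowPair κ T c L M ε A r₁ v₁ r₂ v₂ →
      ∀ P : ℝ → ℝ, Continuous P →
      (∀ s ∈ Icc 0 T, weightedDist (1 / κ) N A (r₁ s) (v₁ s) (r₂ s) (v₂ s) ≤ P s) →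
      ∀ t ∈ Icc 0 T, weightedEnergy p CK δ N A (r₁ t) (v₁ t) (r₂ t) (v₂ t) ≤
        weightedEnergy p CK δ N A (r₁ 0) (v₁ 0) (r₂ 0) (v₂ 0) + K * ∫ s in (0 : ℝ)..t, P s := by
  have hσ : 0 < 1 / κ := by positivity
  obtain ⟨Bc, hBc, ε₁, hε₁, hcub⟩ := exists_gasPair_cubic_le d hc L M hσ hN
  obtain ⟨C, B, hB⟩ := exists_isTransportConstant p hκ d N L M
  have hB0 : 0 < B := one_pos.trans_le hB.one_le
  refine ⟨80 * B ^ 4 * (1 + Bc) + CK * (8 * B ^ 3), by positivity, min ε₁ (min 1 (δ / 2)),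
    by positivity, fun ε hε T A r₁ r₂ v₁ v₂ H P hP hIP t ht => ?_⟩
  have hε1 : ε ≤ 1 := hε.trans ((min_le_right _ _).trans (min_le_left _ _))
  have hεδ : ε ≤ δ / 2 := hε.trans ((min_le_right _ _).trans (min_le_right _ _))
  have h0 : (0 : ℝ) ∈ Icc 0 T := ⟨le_rfl, ht.1.trans ht.2⟩
  have hA := (H.scale t ht).1
  set Q := ∫ s in (0 : ℝ)..t, P s with hQ
  have hE : weightedEnergy p 0 δ N A (r₁ t) (v₁ t) (r₂ t) (v₂ t) ≤
      weightedEnergy p 0 δ N A (r₁ 0) (v₁ 0) (r₂ 0) (v₂ 0) + 80 * B ^ 4 * (1 + Bc) * Q := by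
    have hn : ∀ n : ℕ, ∫ x, pairEnergy p N (n + 1) ((n : ℝ) + 1)⁻¹ A r₁ v₁ r₂ v₂ (t, x) ≤
        (∫ x, pairEnergy p N (n + 1) ((n : ℝ) + 1)⁻¹ A r₁ v₁ r₂ v₂ (0, x)) +
          (80 * B ^ 4 * (1 + Bc) * Q +
            80 * B ^ 4 * (t * ((2 * ((n : ℝ) + 1)⁻¹) ^ (1 / κ) * weightMass d A))) := fun n => by
      refine (H.integral_pairEnergy_le_of_le hε1 hA hκ p hB (by positivity) (by positivity)
        (G := fun s => 80 * B ^ 4 * ((1 + Bc) * P s +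
          (2 * ((n : ℝ) + 1)⁻¹) ^ (1 / κ) * weightMass d A)) (by fun_prop) (fun s hs => ?_)
        ht).trans (le_of_eq ?_)
      · have hs' := Ioo_subset_Icc_self hs
        have HP := H.isGasPair hs'
        obtain ⟨hi, hle⟩ := hcub ε (hε.trans (min_le_left _ _)) _ _ _ _ HP A (H.scale s hs')
        obtain ⟨g1, g2⟩ := HP.energy_source_le hε1 hσ (H.scale s hs') hN (B := Bc)
          (K := 80 * B ^ 4) (a := (2 * ((n : ℝ) + 1)⁻¹) ^ (1 / κ)) (by positivity) (by positivity)
          hi hle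
        refine ⟨g1, g2.trans ?_⟩
        gcongr
        exact hIP s hs'
      · rw [intervalIntegral.integral_const_mul, intervalIntegral.integral_add
          ((hP.const_mul _).intervalIntegrable _ _) (by simp), intervalIntegral.integral_const_mul,
          intervalIntegral.integral_const, smul_eq_mul, sub_zero]
        ring
    -- The error of the cutoff near the boundary is (2h)^σ times the finite mass of the weight, with
    -- the scale A fixed. It vanishes in the limit because σ > 0.
    have hlim : Filter.Tendsto (fun n : ℕ => 80 * B ^ 4 *
        (t * ((2 * ((n : ℝ) + 1)⁻¹) ^ (1 / κ) * weightMass d A))) Filter.atTop (𝓝 0) := by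
      have h1 : Filter.Tendsto (fun n : ℕ => 2 * ((n : ℝ) + 1)⁻¹) Filter.atTop (𝓝 0) := by
        simpa using (tendsto_one_div_add_atTop_nhds_zero_nat (𝕜 := ℝ)).const_mul 2
      have h2 := h1.rpow_const (p := 1 / κ) (Or.inr hσ.le)
      rw [Real.zero_rpow hσ.ne'] at h2
      simpa using ((h2.mul_const (weightMass d A)).const_mul t).const_mul (80 * B ^ 4)
    have h1 := le_of_tendsto_of_tendsto' (H.tendsto_integral_pairEnergy hε1 hκ p hN ht δ)
      ((H.tendsto_integral_pairEnergy hε1 hκ p hN h0 δ).add (hlim.const_add _)) hn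
    simpa using h1
  have hV : weightedVelocity (1 / κ) δ N A (r₁ t) (v₁ t) (r₂ t) (v₂ t) ≤
      weightedVelocity (1 / κ) δ N A (r₁ 0) (v₁ 0) (r₂ 0) (v₂ 0) + 8 * B ^ 3 * Q := by
    refine le_of_tendsto_of_tendsto'
      (H.tendsto_integral_pairVelocity hδ hεδ hε1 hκ p hN ht)
      ((H.tendsto_integral_pairVelocity hδ hεδ hε1 hκ p hN h0).add_const _) fun n => ?_
    refine (H.integral_pairVelocity_le_of_le hδ hεδ hA hκ p hN hB (by positivity)
      (G := fun s => 8 * B ^ 3 * P s) (by fun_prop) (fun s hs => ?_) ht).trans (le_of_eq ?_)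
    · have hs' := Ioo_subset_Icc_self hs
      obtain ⟨g1, g2⟩ := (H.isGasPair hs').velocity_source_le hε1 hσ (H.scale s hs') hN
        (K := 8 * B ^ 3) (by positivity)
      refine ⟨g1, g2.trans ?_⟩
      gcongr
      exact hIP s hs'
    · rw [intervalIntegral.integral_const_mul]
  rw [(H.isGasPair ht).weightedEnergy_eq hε1 hκ p (H.scale t ht) hN,
    (H.isGasPair h0).weightedEnergy_eq hε1 hκ p (H.scale 0 h0) hN]
  have := mul_le_mul_of_nonneg_left hV hCK
  linarith

/-- The difference estimate with weights. -/
theorem exists_weightedDist_le (d : ℕ) {κ c : ℝ} (hκ : 0 < κ) (hc : 0 < c) (L M : ℝ≥0) {N : ℕ}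
    (hN : ⌈1 / κ⌉₊ + d + 2 ≤ N) :
    ∃ ε > 0, ε ≤ 1 ∧ ∀ T : ℝ, 0 < T → ∃ C : ℝ, 0 ≤ C ∧ ∀ (A : ℝ) (r₁ r₂ : ℝ → Space d → ℝ)
      (v₁ v₂ : ℝ → Space d → Space d), IsGasFlowPair κ T c L M ε A r₁ v₁ r₂ v₂ →
      ∀ t ∈ Icc 0 T, weightedDist (1 / κ) N A (r₁ t) (v₁ t) (r₂ t) (v₂ t) ≤
        C * weightedDist (1 / κ) N A (r₁ 0) (v₁ 0) (r₂ 0) (v₂ 0) := by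
  obtain ⟨p⟩ := exists_energyProfile hκ
  obtain ⟨CK, hCK, δ, hδ, C₁, hC₁, ε₁, hε₁, hcoer⟩ := exists_gasPair_coercive d hκ hc L M p hN
  obtain ⟨K, hK, ε₂, hε₂, hgrow⟩ := exists_weightedEnergy_growth d hκ hc L M p hN hCK.le hδ
  have hp := p.C_pos
  -- The smallness of ε is fixed by the coercivity and the growth estimates, before T is given; T
  -- enters only through the exponential.
  refine ⟨min (min ε₁ ε₂) 1, by positivity, min_le_right _ _, fun T hT =>
    ⟨2 * (C₁ * (p.C + CK)) * Real.exp (2 * (C₁ * K) * T), by positivity,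
      fun A r₁ r₂ v₁ v₂ H t ht => ?_⟩⟩
  have hε1 : min (min ε₁ ε₂) 1 ≤ 1 := min_le_right _ _
  have hσ : 0 < 1 / κ := by positivity
  have h0 : (0 : ℝ) ∈ Icc 0 T := ⟨le_rfl, hT.le⟩
  have hI0 : ∀ s ∈ Icc 0 T, 0 ≤ weightedDist (1 / κ) N A (r₁ s) (v₁ s) (r₂ s) (v₂ s) :=
    fun s hs => weightedDist_nonneg (H.isGasPair hs)
  have key := le_of_forall_integral_bound
    (I := fun s => weightedDist (1 / κ) N A (r₁ s) (v₁ s) (r₂ s) (v₂ s))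
    (a := C₁ * (p.C + CK) * weightedDist (1 / κ) N A (r₁ 0) (v₁ 0) (r₂ 0) (v₂ 0))
    (b := C₁ * K) (by positivity) hI0
    (fun s hs => (H.isGasPair hs).weightedDist_le hε1 hσ (H.scale s hs) hN)
    (fun P hP hIP s hs => ?_) ht
  · refine key.trans ?_
    have h2 : Real.exp (2 * (C₁ * K) * t) ≤ Real.exp (2 * (C₁ * K) * T) :=
      Real.exp_le_exp.2 (mul_le_mul_of_nonneg_left ht.2 (by positivity))
    have h3 := mul_le_mul_of_nonneg_left h2 (mul_nonneg (by positivity : 0 ≤ 2 * (C₁ * (p.C + CK)))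
      (hI0 0 h0))
    linarith
  · have h1 := hcoer _ ((min_le_left _ _).trans (min_le_left _ _)) _ _ _ _ (H.isGasPair hs) A
      (H.scale s hs)
    have h2 := hgrow _ ((min_le_left _ _).trans (min_le_right _ _)) T A r₁ r₂ v₁ v₂ H P hP hIP s hs
    have h3 := (H.isGasPair h0).abs_weightedEnergy_le (δ := δ) hε1 hκ p hCK.le (H.scale 0 h0) hN
    have h4 := mul_le_mul_of_nonneg_left (h2.trans (add_le_add_left h3 _)) hC₁.le
    refine (h1.trans h4).trans (le_of_eq ?_)
    ring

end Growth

/-! ### Comparison with the original functional and removal of the weights. -/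

section Conclusion

variable {d : ℕ} {c : ℝ} {L M : ℝ≥0} {ε : ℝ} {ρ₁ ρ₂ : Space d → ℝ} {u₁ u₂ : Space d → Space d}

theorem gasDist_integrand_eq {κ : ℝ} {x : Space d} (hx : x ∈ gasDomain ρ₁ ∩ gasDomain ρ₂) :
    (ρ₁ x + ρ₂ x) ^ (1 / κ - 1) *
        ((ρ₁ x - ρ₂ x) ^ 2 + κ * (ρ₁ x + ρ₂ x) * ‖u₁ x - u₂ x‖ ^ 2) =
      (ρ₁ x + ρ₂ x) ^ (1 / κ - 1) * (ρ₁ x - ρ₂ x) ^ 2 +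
        κ * ((ρ₁ x + ρ₂ x) ^ (1 / κ) * ‖u₁ x - u₂ x‖ ^ 2) := by
  have h : (ρ₁ x + ρ₂ x) ^ (1 / κ) = (ρ₁ x + ρ₂ x) ^ (1 / κ - 1) * (ρ₁ x + ρ₂ x) := by
    rw [← Real.rpow_add_one (add_pos hx.1 hx.2).ne', sub_add_cancel]
  rw [h]
  ring

theorem IsGasPair.distH_le (H : IsGasPair c L M ε ρ₁ u₁ ρ₂ u₂) (κ : ℝ) :
    distH κ ρ₁ u₁ ρ₂ u₂ ≤ ENNReal.ofReal (max 1 κ) *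
      ∫⁻ x in gasDomain ρ₁ ∩ gasDomain ρ₂, ENNReal.ofReal (gasDist (1 / κ) ρ₁ u₁ ρ₂ u₂ x) := by
  rw [distH, ← lintegral_const_mul' _ _ ENNReal.ofReal_ne_top]
  refine setLIntegral_mono' H.isOpen.measurableSet fun x hx => ?_
  rw [← ENNReal.ofReal_mul (by positivity), gasDist_integrand_eq hx, gasDist, mul_add]
  have h0 : 0 ≤ ρ₁ x + ρ₂ x := (add_pos hx.1 hx.2).le
  refine ENNReal.ofReal_le_ofReal (add_le_add ?_ ?_)
  · exact le_mul_of_one_le_left (by positivity) (le_max_left _ _)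
  · exact mul_le_mul_of_nonneg_right (le_max_right _ _) (by positivity)

theorem IsGasPair.lintegral_gasDist_le (H : IsGasPair c L M ε ρ₁ u₁ ρ₂ u₂) {κ : ℝ} (hκ : 0 < κ) :
    ∫⁻ x in gasDomain ρ₁ ∩ gasDomain ρ₂, ENNReal.ofReal (gasDist (1 / κ) ρ₁ u₁ ρ₂ u₂ x) ≤
      ENNReal.ofReal (max 1 κ⁻¹) * distH κ ρ₁ u₁ ρ₂ u₂ := by
  rw [distH, ← lintegral_const_mul' _ _ ENNReal.ofReal_ne_top]
  refine setLIntegral_mono' H.isOpen.measurableSet fun x hx => ?_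
  rw [← ENNReal.ofReal_mul (by positivity), gasDist_integrand_eq hx, gasDist, mul_add]
  have h0 : 0 ≤ ρ₁ x + ρ₂ x := (add_pos hx.1 hx.2).le
  refine ENNReal.ofReal_le_ofReal (add_le_add ?_ ?_)
  · exact le_mul_of_one_le_left (by positivity) (le_max_left _ _)
  · have h1 : 1 ≤ max 1 κ⁻¹ * κ := by
      have := mul_le_mul_of_nonneg_right (le_max_right 1 κ⁻¹) hκ.le
      rwa [inv_mul_cancel₀ hκ.ne'] at this
    rw [← mul_assoc]
    exact le_mul_of_one_le_left (by positivity) h1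

theorem ofReal_weightedDist (H : IsGasPair c L M ε ρ₁ u₁ ρ₂ u₂) (hε : ε ≤ 1) {σ : ℝ}
    (hσ : 0 < σ) {A : ℝ} (hA : IsGasScale L A ρ₁ ρ₂) {N : ℕ} (hN : ⌈σ⌉₊ + d + 2 ≤ N) :
    ENNReal.ofReal (weightedDist σ N A ρ₁ u₁ ρ₂ u₂) = ∫⁻ x in gasDomain ρ₁ ∩ gasDomain ρ₂,
      ENNReal.ofReal (gasDist σ ρ₁ u₁ ρ₂ u₂ x * gasWeight N A u₁ u₂ x) :=
  ofReal_integral_eq_lintegral_ofReal (H.integrableOn_gasDist hε hσ hA hN)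
    ((ae_restrict_iff' H.isOpen.measurableSet).2
      (.of_forall fun _ hx => mul_nonneg (gasDist_nonneg hx) gasWeight_pos.le))

theorem tendsto_gasWeight {N : ℕ} {A : ℕ → ℝ} (hA : Filter.Tendsto A Filter.atTop Filter.atTop)
    (x : Space d) :
    Filter.Tendsto (fun n => gasWeight N (A n) u₁ u₂ x) Filter.atTop (𝓝 1) := by
  have h1 : Filter.Tendsto (fun n => weightArg (A n) x (u₁ x) (u₂ x)) Filter.atTop (𝓝 1) := by
    have h2 : Filter.Tendsto (fun n => A n ^ 2) Filter.atTop Filter.atTop :=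
      (Filter.tendsto_pow_atTop two_ne_zero).comp hA
    simpa [weightArg] using (h2.const_div_atTop (‖x‖ ^ 2 + ‖u₁ x‖ ^ 2 + ‖u₂ x‖ ^ 2)).const_add 1
  simpa [gasWeight] using (h1.pow N).inv₀ (by simp)

/-- Removal of the weights. -/
theorem lintegral_gasDist_le_of_weighted {κ T : ℝ} (hκ : 0 < κ) (hε : ε ≤ 1) {C : ℝ} (hC : 0 ≤ C)
    {N : ℕ} (hN : ⌈1 / κ⌉₊ + d + 2 ≤ N) {A : ℕ → ℝ}
    (hA : Filter.Tendsto A Filter.atTop Filter.atTop) {r₁ r₂ : ℝ → Space d → ℝ}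
    {v₁ v₂ : ℝ → Space d → Space d} (H : ∀ n, IsGasFlowPair κ T c L M ε (A n) r₁ v₁ r₂ v₂) {t : ℝ}
    (ht : t ∈ Icc 0 T)
    (hle : ∀ n, weightedDist (1 / κ) N (A n) (r₁ t) (v₁ t) (r₂ t) (v₂ t) ≤
      C * weightedDist (1 / κ) N (A n) (r₁ 0) (v₁ 0) (r₂ 0) (v₂ 0)) :
    ∫⁻ x in gasDomain (r₁ t) ∩ gasDomain (r₂ t),
        ENNReal.ofReal (gasDist (1 / κ) (r₁ t) (v₁ t) (r₂ t) (v₂ t) x) ≤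
      ENNReal.ofReal C * ∫⁻ x in gasDomain (r₁ 0) ∩ gasDomain (r₂ 0),
        ENNReal.ofReal (gasDist (1 / κ) (r₁ 0) (v₁ 0) (r₂ 0) (v₂ 0) x) := by
  have h0 : (0 : ℝ) ∈ Icc 0 T := ⟨le_rfl, ht.1.trans ht.2⟩
  have hσ : 0 < 1 / κ := by positivity
  have HP := (H 0).isGasPair ht
  have HP0 := (H 0).isGasPair h0
  have hUm := HP.isOpen.measurableSet
  -- The weights tend to 1 at every point as A → ∞. Fatou's lemma handles the left side, which may
  -- be infinite, and on the right side the weights are bounded by 1.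
  calc _ = ∫⁻ x in gasDomain (r₁ t) ∩ gasDomain (r₂ t), Filter.liminf (fun n => ENNReal.ofReal
          (gasDist (1 / κ) (r₁ t) (v₁ t) (r₂ t) (v₂ t) x * gasWeight N (A n) (v₁ t) (v₂ t) x))
          Filter.atTop := by
        refine lintegral_congr fun x => (Filter.Tendsto.liminf_eq ?_).symm
        simpa using ENNReal.tendsto_ofReal ((tendsto_gasWeight (N := N) (u₁ := v₁ t) (u₂ := v₂ t)
          hA x).const_mul (gasDist (1 / κ) (r₁ t) (v₁ t) (r₂ t) (v₂ t) x))
    _ ≤ Filter.liminf (fun n => ∫⁻ x in gasDomain (r₁ t) ∩ gasDomain (r₂ t), ENNReal.ofReal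
          (gasDist (1 / κ) (r₁ t) (v₁ t) (r₂ t) (v₂ t) x * gasWeight N (A n) (v₁ t) (v₂ t) x))
          Filter.atTop :=
        lintegral_liminf_le' fun n => (((HP.continuousOn_gasDist _).mul
          HP.continuousOn_gasWeight).aemeasurable hUm).ennreal_ofReal
    _ ≤ Filter.liminf (fun _ : ℕ => ENNReal.ofReal C *
          ∫⁻ x in gasDomain (r₁ 0) ∩ gasDomain (r₂ 0),
            ENNReal.ofReal (gasDist (1 / κ) (r₁ 0) (v₁ 0) (r₂ 0) (v₂ 0) x)) Filter.atTop := by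
        refine Filter.liminf_le_liminf (.of_forall fun n => ?_)
        rw [← ofReal_weightedDist HP hε hσ ((H n).scale t ht) hN]
        refine (ENNReal.ofReal_le_ofReal (hle n)).trans ?_
        rw [ENNReal.ofReal_mul hC, ofReal_weightedDist HP0 hε hσ ((H n).scale 0 h0) hN]
        refine mul_le_mul_right (setLIntegral_mono' HP0.isOpen.measurableSet fun x hx =>
          ENNReal.ofReal_le_ofReal ?_) _
        exact mul_le_of_le_one_right (gasDist_nonneg hx) gasWeight_le_one
    _ = _ := Filter.liminf_const _

/-- At the origin r₁ + r₂ is bounded on the compact time interval, and the Lipschitz bounds give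
growth at most 2L|x| from there. The threshold depends on the solutions, which is harmless because
the constants of the weighted estimate do not depend on A. -/
theorem exists_forall_isGasScale {T : ℝ} {r₁ r₂ : ℝ → Space d → ℝ}
    (h₁ : ContinuousOn (fun p : ℝ × Space d => r₁ p.1 p.2) (Icc 0 T ×ˢ univ))
    (h₂ : ContinuousOn (fun p : ℝ × Space d => r₂ p.1 p.2) (Icc 0 T ×ˢ univ))
    (hL₁ : ∀ t ∈ Icc 0 T, LipschitzWith L (r₁ t)) (hL₂ : ∀ t ∈ Icc 0 T, LipschitzWith L (r₂ t)) :
    ∃ A₀ : ℝ, ∀ A ≥ A₀, ∀ t ∈ Icc 0 T, IsGasScale L A (r₁ t) (r₂ t) := by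
  have hc : ContinuousOn (fun t => r₁ t 0 + r₂ t 0) (Icc 0 T) :=
    (h₁.comp (f := fun t => (t, (0 : Space d))) (by fun_prop) fun t ht => ⟨ht, mem_univ _⟩).add
      (h₂.comp (f := fun t => (t, (0 : Space d))) (by fun_prop) fun t ht => ⟨ht, mem_univ _⟩)
  obtain ⟨B, hB⟩ := isCompact_Icc.bddAbove_image hc
  refine ⟨max 1 B, fun A hA t ht => ⟨(le_max_left _ _).trans hA, fun x => ?_⟩⟩
  have hA1 : 1 ≤ A := (le_max_left _ _).trans hA
  have h3 : r₁ t 0 + r₂ t 0 ≤ A := (hB ⟨t, ht, rfl⟩).trans ((le_max_right _ _).trans hA)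
  have hlin : ∀ {f : Space d → ℝ}, LipschitzWith L f → f x ≤ f 0 + L * ‖x‖ := fun {f} hf => by
    have := (le_abs_self _).trans (hf.dist_le_mul x 0)
    rw [dist_zero_right] at this
    linarith
  nlinarith [hlin (hL₁ t ht), hlin (hL₂ t ht)]

end Conclusion

theorem theoremt (d : ℕ) (hd : 1 ≤ d) (κ : ℝ) (hκ : 0 < κ) (c : ℝ) (hc : 0 < c) (L M : ℝ≥0) :
    ∃ ε : ℝ, 0 < ε ∧ ∀ T : ℝ, 0 < T → ∃ C : ℝ≥0,
      ∀ (r₁ r₂ : ℝ → Space d → ℝ) (v₁ v₂ : ℝ → Space d → Space d),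
        IsRegularSolution κ T c L M r₁ v₁ →
        IsRegularSolution κ T c L M r₂ v₂ →
        (∀ t ∈ Icc 0 T, LipschitzClose ε (r₁ t) (r₂ t)) →
        (⨆ t ∈ Icc 0 T, distH κ (r₁ t) (v₁ t) (r₂ t) (v₂ t)) ≤
          C * distH κ (r₁ 0) (v₁ 0) (r₂ 0) (v₂ 0) := by
  obtain ⟨ε, hε, hε1, h⟩ := exists_weightedDist_le d hκ hc L M (N := ⌈1 / κ⌉₊ + d + 2) le_rfl
  refine ⟨ε, hε, fun T hT => ?_⟩
  obtain ⟨C, hC, hle⟩ := h T hT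
  refine ⟨Real.toNNReal (max 1 κ) * (Real.toNNReal C * Real.toNNReal (max 1 κ⁻¹)),
    fun r₁ r₂ v₁ v₂ h₁ h₂ hclose => iSup₂_le fun t ht => ?_⟩
  have h0 : (0 : ℝ) ∈ Icc 0 T := ⟨le_rfl, hT.le⟩
  obtain ⟨A₀, hA₀⟩ := exists_forall_isGasScale h₁.solution.continuousOn h₂.solution.continuousOn
    h₁.lipschitz h₂.lipschitz
  -- All scales beyond the threshold are admissible, so a sequence tending to infinity is available
  -- for the removal of the weight.
  have hA : Filter.Tendsto (fun n : ℕ => A₀ + n) Filter.atTop Filter.atTop :=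
    Filter.tendsto_atTop_add_const_left _ _ tendsto_natCast_atTop_atTop
  have H : ∀ n : ℕ, IsGasFlowPair κ T c L M ε (A₀ + n) r₁ v₁ r₂ v₂ := fun n =>
    ⟨h₁, h₂, hclose, hA₀ _ (by simp)⟩
  have hF := lintegral_gasDist_le_of_weighted hκ hε1 hC le_rfl hA H ht
    fun n => hle _ r₁ r₂ v₁ v₂ (H n) t ht
  calc _ ≤ _ := ((H 0).isGasPair ht).distH_le κ
    _ ≤ ENNReal.ofReal (max 1 κ) * (ENNReal.ofReal C * (ENNReal.ofReal (max 1 κ⁻¹) *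
        distH κ (r₁ 0) (v₁ 0) (r₂ 0) (v₂ 0))) :=
      mul_le_mul_right (hF.trans (mul_le_mul_right
        (((H 0).isGasPair h0).lintegral_gasDist_le hκ) _)) _
    _ = _ := by
      simp only [ENNReal.coe_mul, ENNReal.ofReal]
      ring
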